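/- Let $e_1=(1,0)$, $e_2=(0,1)$, and let $$\Delta_d u(x)=u(x+e_1)+u(x-e_1)+u(x+e_2)+u(x-e_2)+u(x+e_1-e_2)+u(x-e_1+e_2)-6u(x)$$ be the 7-point discrete Laplacian of the triangular lattice, $x=(x_1,x_2)\in\mathbb Z^2$. Let $\Omega=\{x\in\mathbb Z^2: x_2\ge 0\}$, $\mathring\Omega=\{x_2>0\}$, $\Gamma=\{x_2=0\}$. Let $k\in(0,3)\setminus\{2\sqrt2\}$, and let $f:\Gamma\to\mathbb C$ have finite support. Problem $\mathcal P_D$ is to find $u:\Omega\to\mathbb C$ with $$(\Delta_d+k^2)u=0 \text{ in } \mathring\Omega,\qquad u=f \text{ on } \Gamma .$$ *Green's functions.* Put $\sigma(\xi;\lambda)=\lambda-6+2\cos\xi_1+2\cos\xi_2+2\cos(\xi_1-\xi_2)$ and $$\mathcal G(x)=\lim_{\varepsilon\to0+}\frac1{4\pi^2}\int_{-\pi}^{\pi}\int_{-\pi}^{\pi}\frac{e^{\iota x\cdot\xi}}{\sigma(\xi;k^2+\iota\varepsilon)}\,d\xi_2\,d\xi_1,\qquad \mathcal G^+(x;y)=\mathcal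 G(x-y)-\mathcal G(\hat x-y),\quad \hat x=(x_1+x_2,-x_2).$$ *Radiation condition.* For $\alpha\in[0,\pi]$ consider the points $\xi\in[-\pi,\pi]^2$ with $\sigma(\xi;k^2)=0$ and $-\nabla_\xi\sigma(\xi;k^2)=c\,(\cos\alpha,\sin\alpha)$ for some $c>0$. If $k^2<8$ there is exactly one such point, $\xi^*(\alpha,k)$. If $k^2>8$ there are exactly two, $\xi^{*,1}(\alpha,k)$ with $\xi_2<\xi_1$ and $\xi^{*,2}(\alpha,k)$ with $\xi_1<\xi_2$. Write $x=|x|(\cos\alpha,\sin\alpha)$ with the Euclidean norm $|x|$. A function $v:\Omega\to\mathbb C$ radiates along a family $\xi(\alpha)$ if, as $|x|\to\infty$ in $\Omega$, uniformly in the direction $x/|x|$, $$v(x)=O(|x|^{-1/2}),\qquad v(x+e_j)=e^{\iota\xi_j(\alpha)}v(x)+O(|x|^{-3/2}),\quad j=1,2.$$ A solution $u$ is called radiating if it radiates along $\xi^*(\cdot,k)$, in the case $k^2<8$; or if $u=u_1+u_2$ with $u_i:\Omega\to\mathbb C$ radiating along $\xi^{*,i}(\cdot,k)$, $i=1,2$,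 in the case $k^2>8$. **Theorem.** The limit defining $\mathcal G(x)$ exists for every $x\in\mathbb Z^2$, Problem $\mathcal P_D$ has exactly one radiating solution $u$, and for all $x\in\Omega$ $$u(x)=\sum_{y\in\Gamma}\bigl(\delta_{x,y}-\mathcal G^+(x;y+e_2)-\mathcal G^+(x;y+e_2-e_1)\bigr)f(y).$$ -/

import Mathlib

open Filter Topology Asymptotics
open scoped Real

namespace TriangularLattice

noncomputable section

/-! ### The lattice, the half-plane and the discrete Helmholtz operator -/

/-- The basis vector `e₁ = (1, 0)` of `ℤ²`. -/
def e₁ : ℤ × ℤ := (1, 0)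

/-- The basis vector `e₂ = (0, 1)` of `ℤ²`. -/
def e₂ : ℤ × ℤ := (0, 1)

/-- The 7-point discrete Laplacian of the triangular lattice in `ℤ²` coordinates. -/
def discreteLaplacian (u : ℤ × ℤ → ℂ) (x : ℤ × ℤ) : ℂ :=
  u (x + e₁) + u (x - e₁) + u (x + e₂) + u (x - e₂) + u (x + e₁ - e₂) + u (x - e₁ + e₂)
    - 6 * u x

/-- The discrete half-plane `Ω = {x : x₂ ≥ 0}`. -/
def halfPlane : Set (ℤ × ℤ) := {x | 0 ≤ x.2}

/-- The interior `{x : x₂ > 0}` of the half-plane. -/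
def halfPlaneInterior : Set (ℤ × ℤ) := {x | 0 < x.2}

/-- The boundary `Γ = {x : x₂ = 0}` of the half-plane. -/
def boundaryLine : Set (ℤ × ℤ) := {x | x.2 = 0}

lemma boundaryLine_subset_halfPlane : boundaryLine ⊆ halfPlane :=
  fun _ hx => le_of_eq (Eq.symm hx)

open Classical in
/-- Extension by zero of a function on `Ω` to `ℤ²`. It only serves to write `u (x ± eⱼ)`; it is
evaluated at points of `Ω` wherever it matters. -/
def extendZero (u : halfPlane → ℂ) (x : ℤ × ℤ) : ℂ :=
  if h : x ∈ halfPlane then u ⟨x, h⟩ else 0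

/-- `u` solves `(Δ_d + k²) u = 0` in the interior of `Ω` (all neighbours of an interior point lie
in `Ω`, so the values of the extension outside of `Ω` are not used). -/
def SolvesHelmholtz (k : ℝ) (u : halfPlane → ℂ) : Prop :=
  ∀ x ∈ halfPlaneInterior,
    discreteLaplacian (extendZero u) x + (k : ℂ) ^ 2 * extendZero u x = 0

/-- The Dirichlet condition `u = f` on `Γ`. -/
def SolvesDirichlet (f : boundaryLine → ℂ) (u : halfPlane → ℂ) : Prop :=
  ∀ y : boundaryLine, u ⟨y, boundaryLine_subset_halfPlane y.2⟩ = f y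

/-! ### The lattice Green's function -/

/-- The symbol `2 cos ξ₁ + 2 cos ξ₂ + 2 cos (ξ₁ - ξ₂) - 6` of the discrete Laplacian, so that
`σ(ξ; λ) = λ + laplaceSymbol ξ`. -/
def laplaceSymbol (ξ : ℝ × ℝ) : ℝ :=
  2 * Real.cos ξ.1 + 2 * Real.cos ξ.2 + 2 * Real.cos (ξ.1 - ξ.2) - 6

/-- The function `x ↦ (4π²)⁻¹ ∫∫ e^{i x·ξ} / σ(ξ; z) dξ` over `[-π, π]²`, for a complex spectral
parameter `z`. -/
def resolventKernel (z : ℂ) (x : ℤ × ℤ) : ℂ :=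
  (1 / (4 * (π : ℂ) ^ 2)) * ∫ ξ₁ in (-π)..π, ∫ ξ₂ in (-π)..π,
    Complex.exp (Complex.I * ((x.1 : ℂ) * ξ₁ + (x.2 : ℂ) * ξ₂)) /
      (z + (laplaceSymbol (ξ₁, ξ₂) : ℂ))

/-- The lattice Green's function `𝒢(x)`: the limit of the resolvent kernel as the spectral
parameter `k² + iε` tends to `k² + i0`. -/
def latticeGreen (k : ℝ) (x : ℤ × ℤ) : ℂ :=
  limUnder (𝓝[>] (0 : ℝ)) fun ε : ℝ => resolventKernel ((k : ℂ) ^ 2 + Complex.I * ε) x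

/-- The reflection `x̂ = (x₁ + x₂, -x₂)`. -/
def reflect (x : ℤ × ℤ) : ℤ × ℤ := (x.1 + x.2, -x.2)

/-- The Dirichlet Green's function of the half-plane, `𝒢⁺(x; y) = 𝒢(x - y) - 𝒢(x̂ - y)`. -/
def halfPlaneGreen (k : ℝ) (x y : ℤ × ℤ) : ℂ :=
  latticeGreen k (x - y) - latticeGreen k (reflect x - y)

/-! ### The radiation condition -/

/-- `x` as a point of the Euclidean plane `ℂ = ℝ²`; its modulus and argument are the polar
coordinates `|x|` and `α` of `x`, i.e. `x₁ = |x| cos α` and `x₂ = |x| sin α`. -/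
def toPlane (x : ℤ × ℤ) : ℂ := ⟨(x.1 : ℝ), (x.2 : ℝ)⟩

/-- `ξ ∈ [-π, π]²` is a far-field point for the direction `α`: it lies on the level curve
`σ(ξ; k²) = 0`, and the gradient there of the dispersion function `-laplaceSymbol` is a positive
multiple of `(cos α, sin α)`. For `0 < k² < 8` there is exactly one such point; for
`8 < k² < 9` there are exactly two, one on each of the two components of the level curve, which are
separated by the diagonal `ξ₁ = ξ₂`. -/
def IsFarFieldPoint (k α : ℝ) (ξ : ℝ × ℝ) : Prop :=
  ξ.1 ∈ Set.Icc (-π) π ∧ ξ.2 ∈ Set.Icc (-π) π ∧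
  k ^ 2 + laplaceSymbol ξ = 0 ∧
  ∃ c : ℝ, 0 < c ∧
    -deriv (fun t => laplaceSymbol (t, ξ.2)) ξ.1 = c * Real.cos α ∧
    -deriv (fun t => laplaceSymbol (ξ.1, t)) ξ.2 = c * Real.sin α

/-- The two estimates of the radiation condition with respect to a family `α ↦ ξ(α)` of points:
`u(x) = O(|x|^{-1/2})` and `u(x + eⱼ) = e^{i ξⱼ(α)} u(x) + O(|x|^{-3/2})`, `j = 1, 2`, as
`|x| → ∞` in `Ω`, uniformly in the direction of `x`. -/
def RadiatesAlong (ξ : ℝ → ℝ × ℝ) (u : halfPlane → ℂ) : Prop :=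
  u =O[cofinite] (fun x : halfPlane => ‖toPlane x‖ ^ (-(1 / 2 : ℝ))) ∧
  (fun x : halfPlane => extendZero u (x + e₁) -
      Complex.exp (Complex.I * ((ξ (toPlane x).arg).1 : ℂ)) * u x)
    =O[cofinite] (fun x : halfPlane => ‖toPlane x‖ ^ (-(3 / 2 : ℝ))) ∧
  (fun x : halfPlane => extendZero u (x + e₂) -
      Complex.exp (Complex.I * ((ξ (toPlane x).arg).2 : ℂ)) * u x)
    =O[cofinite] (fun x : halfPlane => ‖toPlane x‖ ^ (-(3 / 2 : ℝ)))

/-- The radiation condition: one family of far-field points if `k² < 8`; a sum of two functions,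
one for each component of the level curve, if `k² > 8`. -/
def SatisfiesRadiation (k : ℝ) (u : halfPlane → ℂ) : Prop :=
  (k ^ 2 < 8 → ∃ ξ : ℝ → ℝ × ℝ,
    (∀ α ∈ Set.Icc 0 π, IsFarFieldPoint k α (ξ α)) ∧ RadiatesAlong ξ u) ∧
  (8 < k ^ 2 → ∃ ξ η : ℝ → ℝ × ℝ,
    (∀ α ∈ Set.Icc 0 π, IsFarFieldPoint k α (ξ α) ∧ (ξ α).2 < (ξ α).1) ∧
    (∀ α ∈ Set.Icc 0 π, IsFarFieldPoint k α (η α) ∧ (η α).1 < (η α).2) ∧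
    ∃ u₁ u₂ : halfPlane → ℂ, u = u₁ + u₂ ∧ RadiatesAlong ξ u₁ ∧ RadiatesAlong η u₂)

/-- Radiating solutions of the half-plane Dirichlet problem with data `f`. -/
def IsRadiatingSolution (k : ℝ) (f : boundaryLine → ℂ) (u : halfPlane → ℂ) : Prop :=
  SolvesHelmholtz k u ∧ SolvesDirichlet f u ∧ SatisfiesRadiation k u

end

end TriangularLattice

open TriangularLattice

/-!
The lattice Green's function is analysed through a one-dimensional integral. For `x₂ = n ≥ 0` the
residue theorem evaluates the inner integral of the resolvent kernel (`inner_integral`); in the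
half-angle coordinates `ξ₁ = 2p`, `ξ₂ = p + τ` the level curve is `cos p (cos p + cos τ) = K` with
`K = (8 - k²)/4`, and the limit `ε → 0` is, by dominated convergence,
`(4πi)⁻¹ ∫ e^{i(2x₁+n)p} e^{inτ} / (cos p sin τ) dp` over `[-π/2, π/2]`
(`tendsto_resolventKernel_nat`). The invariance of the kernel under `ξ₁ ↔ ξ₂` and under the
reflection `x ↦ x̂` gives all other `x`, and reduces estimates to the sector `-x₂ ≤ x₁ ≤ 0`.

The level curve is real over one interval of `p` if `K > 0` and over two intervals if `K < 0`. Each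
interval is an `Arc`, with a parameter that is regular also at the branch points. The arc is
strictly convex (`wronskian_identity`), so that the phase has one stationary point, with a
nondegeneracy that is uniform in the direction (`Arc.exists_stationary_bound`). A second-derivative
estimate bounds the integral over the arc by `C n^{-1/2}`. If the amplitude vanishes at the
stationary point, one integration by parts brings the integral down to `C n^{-3/2}`; applied to the
amplitude `e^{iξ·a} - e^{iξ*·a}` this shows that the contribution `J` of the arc satisfies the
radiation condition (`Arc.exists_norm_J_translate_le`). The integration by parts continues over the
evanescent parts next to the branch points, so that the boundary terms there cancel. For `K < 0` the
difference operators of the two arcs are applied in succession.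

Existence. The function of the representation formula is a finite combination of translates of the
Green's function, and far-field points depend Lipschitz continuously on the direction
(`exists_char_sub_le`), so the estimates pass to it (`scattered_latticeGreen`). For `K < 0` a
combination of the operators `S_l - e^{iη_l}` with slowly varying coefficients, `S_l` being the
shift by `e_l`, separates the two components (`Scattered.exists_splitting`); the coefficients exist
because the two far-field points of one direction never agree. The Dirichlet condition follows from
`x̂ = x` on the boundary, and the equation holds because the poles `y + e₂` and `y + e₂ - e₁` are
the interior neighbours of `y` (`dirichletKernel_helmholtz`).

Uniqueness. If `ξ` and `η` are far-field points for the same direction, then `e^{i(ξ+η)·e_j} ≠ 1`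
for some `j` (`exists_char_mul_separation`), since the gradient of the symbol is odd. The product of
two outgoing functions is `O(|x|⁻¹)` and oscillates like `e^{i(ξ+η)·x}`; hence it is a discrete
divergence of an `O(|x|⁻¹)` field up to an `O(|x|⁻²)` error (`Radiates.nullFlux_mul`). In Green's
identity for a homogeneous solution `w` and the Dirichlet Green's function, cut off smoothly at the
scale `N`, such products are paired with differences of the cutoff, and a summation by parts shows
that they contribute `O(N⁻¹)` (`exists_cutoff_flux_tendsto_zero`). Therefore `w = 0`.
-/

namespace TriangularLattice

noncomputable section

/-! ### Symmetries of the resolvent kernel -/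

/-- The character `a ↦ e^{i ξ·a}` of the lattice. -/
def char (ξ : ℝ × ℝ) (a : ℤ × ℤ) : ℂ :=
  Complex.exp (Complex.I * ((a.1 : ℂ) * ξ.1 + (a.2 : ℂ) * ξ.2))

lemma char_add (ξ : ℝ × ℝ) (a b : ℤ × ℤ) : char ξ (a + b) = char ξ a * char ξ b := by
  simp only [char, ← Complex.exp_add, Prod.fst_add, Prod.snd_add, Int.cast_add]
  ring_nf

lemma char_zero (ξ : ℝ × ℝ) : char ξ 0 = 1 := by simp [char]

lemma norm_char (ξ : ℝ × ℝ) (a : ℤ × ℤ) : ‖char ξ a‖ = 1 := by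
  have : char ξ a = Complex.exp (((a.1 * ξ.1 + a.2 * ξ.2 : ℝ) : ℂ) * Complex.I) := by
    simp only [char]; push_cast; ring_nf
  rw [this, Complex.norm_exp_ofReal_mul_I]

lemma continuous_char (a : ℤ × ℤ) : Continuous fun ξ : ℝ × ℝ => char ξ a := by
  unfold char; fun_prop

/-- Interchange of the coordinates, the reflection of the triangular lattice in the line through
`e₁ + e₂`. -/
def swapCoord {R : Type*} (x : R × R) : R × R := (x.2, x.1)

/-- The action of the reflection `reflect` on frequencies: `ξ · reflect a = reflectDual ξ · a`. -/
def reflectDual (ξ : ℝ × ℝ) : ℝ × ℝ := (ξ.1, ξ.1 - ξ.2)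

lemma char_reflectDual (ξ : ℝ × ℝ) (a : ℤ × ℤ) :
    char (reflectDual ξ) (reflect a) = char ξ a := by
  simp only [char, reflectDual, reflect]
  push_cast
  ring_nf

lemma char_swapCoord (ξ : ℝ × ℝ) (a : ℤ × ℤ) :
    char (swapCoord ξ) (swapCoord a) = char ξ a := by
  simp only [char, swapCoord]
  ring_nf

lemma laplaceSymbol_reflectDual (ξ : ℝ × ℝ) :
    laplaceSymbol (reflectDual ξ) = laplaceSymbol ξ := by
  simp only [laplaceSymbol, reflectDual, sub_sub_cancel]
  ring

lemma laplaceSymbol_swapCoord (ξ : ℝ × ℝ) :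
    laplaceSymbol (swapCoord ξ) = laplaceSymbol ξ := by
  simp only [laplaceSymbol, swapCoord]
  rw [← Real.cos_neg (ξ.2 - ξ.1), neg_sub]
  ring

lemma continuous_laplaceSymbol : Continuous laplaceSymbol := by
  unfold laplaceSymbol; fun_prop

lemma spectral_ne_zero {z : ℂ} (hz : z.im ≠ 0) (ξ : ℝ × ℝ) : z + (laplaceSymbol ξ : ℂ) ≠ 0 := by
  intro h
  have := congrArg Complex.im h
  simp at this
  exact hz this

/-- The integrand of the resolvent kernel. -/
def resolventIntegrand (z : ℂ) (x : ℤ × ℤ) (ξ : ℝ × ℝ) : ℂ :=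
  char ξ x / (z + (laplaceSymbol ξ : ℂ))

lemma continuous_resolventIntegrand {z : ℂ} (hz : z.im ≠ 0) (x : ℤ × ℤ) :
    Continuous (resolventIntegrand z x) := by
  unfold resolventIntegrand
  exact (continuous_char x).div
    (continuous_const.add (Complex.continuous_ofReal.comp continuous_laplaceSymbol))
    (spectral_ne_zero hz)

/-- Integration over the square `[-π, π]²`. -/
def squareIntegral (F : ℝ × ℝ → ℂ) : ℂ :=
  ∫ ξ₁ in (-π)..π, ∫ ξ₂ in (-π)..π, F (ξ₁, ξ₂)

lemma resolventKernel_eq (z : ℂ) (x : ℤ × ℤ) :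
    resolventKernel z x = (1 / (4 * (π : ℂ) ^ 2)) * squareIntegral (resolventIntegrand z x) := rfl

lemma squareIntegral_add {F G : ℝ × ℝ → ℂ} (hF : Continuous F) (hG : Continuous G) :
    squareIntegral (fun ξ => F ξ + G ξ) = squareIntegral F + squareIntegral G := by
  unfold squareIntegral
  rw [← intervalIntegral.integral_add]
  · refine intervalIntegral.integral_congr fun a _ => ?_
    refine intervalIntegral.integral_add ?_ ?_
    · exact (hF.comp (by fun_prop)).intervalIntegrable _ _
    · exact (hG.comp (by fun_prop)).intervalIntegrable _ _
  · exact (intervalIntegral.continuous_parametric_intervalIntegral_of_continuous'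
      (f := fun a b => F (a, b)) hF _ _).intervalIntegrable _ _
  · exact (intervalIntegral.continuous_parametric_intervalIntegral_of_continuous'
      (f := fun a b => G (a, b)) hG _ _).intervalIntegrable _ _

lemma squareIntegral_const_mul (c : ℂ) (F : ℝ × ℝ → ℂ) :
    squareIntegral (fun ξ => c * F ξ) = c * squareIntegral F := by
  unfold squareIntegral
  simp only [intervalIntegral.integral_const_mul]

lemma squareIntegral_swapCoord {F : ℝ × ℝ → ℂ} (hF : Continuous F) :
    squareIntegral (fun ξ => F (swapCoord ξ)) = squareIntegral F := by
  unfold squareIntegral swapCoord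
  have h0 : (-π : ℝ) ≤ π := by linarith [Real.pi_pos]
  simp only [intervalIntegral.integral_of_le h0]
  rw [MeasureTheory.integral_integral_swap]
  rw [MeasureTheory.Measure.prod_restrict]
  have : Continuous (Function.uncurry fun a b : ℝ => F (b, a)) := by
    show Continuous (fun x : ℝ × ℝ => F (x.2, x.1))
    fun_prop
  exact (this.continuousOn.integrableOn_compact (isCompact_Icc.prod isCompact_Icc)).mono_set
    (Set.prod_mono Set.Ioc_subset_Icc_self Set.Ioc_subset_Icc_self)

lemma squareIntegral_reflectDual {F : ℝ × ℝ → ℂ}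
    (hper : ∀ a, Function.Periodic (fun b => F (a, b)) (2 * π)) :
    squareIntegral (fun ξ => F (reflectDual ξ)) = squareIntegral F := by
  unfold squareIntegral reflectDual
  refine intervalIntegral.integral_congr fun a _ => ?_
  simp only
  rw [intervalIntegral.integral_comp_sub_left (fun b => F (a, b)) a]
  have := (hper a).intervalIntegral_add_eq (a - π) (-π)
  convert this using 2 <;> ring

lemma char_periodic_snd (a : ℝ) (x : ℤ × ℤ) :
    Function.Periodic (fun b => char (a, b) x) (2 * π) := by
  intro b
  simp only [char]
  rw [Complex.exp_eq_exp_iff_exists_int]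
  exact ⟨x.2, by push_cast; ring⟩

lemma laplaceSymbol_periodic_snd (a : ℝ) :
    Function.Periodic (fun b => laplaceSymbol (a, b)) (2 * π) := by
  intro b
  simp only [laplaceSymbol, Real.cos_add_two_pi]
  rw [← sub_sub, Real.cos_sub_two_pi]

lemma resolventIntegrand_periodic_snd (z : ℂ) (x : ℤ × ℤ) (a : ℝ) :
    Function.Periodic (fun b => resolventIntegrand z x (a, b)) (2 * π) := by
  intro b
  have h1 := char_periodic_snd a x b
  have h2 := laplaceSymbol_periodic_snd a b
  simp only at h1 h2
  simp only [resolventIntegrand, h1, h2]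

lemma resolventKernel_swapCoord {z : ℂ} (hz : z.im ≠ 0) (x : ℤ × ℤ) :
    resolventKernel z (swapCoord x) = resolventKernel z x := by
  rw [resolventKernel_eq, resolventKernel_eq,
    ← squareIntegral_swapCoord (continuous_resolventIntegrand hz (swapCoord x))]
  simp only [resolventIntegrand, char_swapCoord, laplaceSymbol_swapCoord]
  rfl

lemma resolventKernel_reflect (z : ℂ) (x : ℤ × ℤ) :
    resolventKernel z (reflect x) = resolventKernel z x := by
  rw [resolventKernel_eq, resolventKernel_eq,
    ← squareIntegral_reflectDual (resolventIntegrand_periodic_snd z (reflect x))]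
  simp only [resolventIntegrand, char_reflectDual, laplaceSymbol_reflectDual]
  rfl

/-! ### The Helmholtz equation for the resolvent kernel -/

lemma integral_exp_int (n : ℤ) :
    ∫ t in (-π)..π, Complex.exp (Complex.I * ((n : ℂ) * t)) = if n = 0 then (2 * π : ℂ) else 0 := by
  split_ifs with h
  · subst h; simp; ring
  · have hc : Complex.I * (n : ℂ) ≠ 0 := mul_ne_zero Complex.I_ne_zero (by exact_mod_cast h)
    simp only [← mul_assoc]
    rw [integral_exp_mul_complex hc]
    rw [div_eq_zero_iff]; left
    rw [sub_eq_zero, Complex.exp_eq_exp_iff_exists_int]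
    exact ⟨n, by push_cast; ring⟩

lemma squareIntegral_char (x : ℤ × ℤ) :
    squareIntegral (fun ξ => char ξ x) = if x = 0 then 4 * (π : ℂ) ^ 2 else 0 := by
  have : squareIntegral (fun ξ => char ξ x) =
      (∫ t in (-π)..π, Complex.exp (Complex.I * ((x.1 : ℂ) * t))) *
        ∫ t in (-π)..π, Complex.exp (Complex.I * ((x.2 : ℂ) * t)) := by
    unfold squareIntegral char
    simp only [mul_add, Complex.exp_add, intervalIntegral.integral_const_mul,
      intervalIntegral.integral_mul_const]
  rw [this, integral_exp_int, integral_exp_int]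
  by_cases h1 : x.1 = 0 <;> by_cases h2 : x.2 = 0 <;> simp [h1, h2, Prod.ext_iff]
  ring

lemma laplaceSymbol_eq_char (ξ : ℝ × ℝ) :
    (laplaceSymbol ξ : ℂ) = char ξ e₁ + char ξ (-e₁) + char ξ e₂ + char ξ (-e₂)
      + char ξ (e₁ - e₂) + char ξ (-e₁ + e₂) - 6 := by
  have h := fun t : ℂ => Complex.two_cos t
  simp only [laplaceSymbol, char, e₁, e₂]
  push_cast
  rw [h, h, h]
  simp
  ring_nf

lemma resolventKernel_helmholtz {z : ℂ} (hz : z.im ≠ 0) (x : ℤ × ℤ) :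
    discreteLaplacian (resolventKernel z) x + z * resolventKernel z x = if x = 0 then 1 else 0 := by
  have key : ∀ ξ, char ξ x = resolventIntegrand z (x + e₁) ξ + resolventIntegrand z (x - e₁) ξ
      + resolventIntegrand z (x + e₂) ξ + resolventIntegrand z (x - e₂) ξ
      + resolventIntegrand z (x + e₁ - e₂) ξ + resolventIntegrand z (x - e₁ + e₂) ξ
      + (z - 6) * resolventIntegrand z x ξ := by
    intro ξ
    have h0 := spectral_ne_zero hz ξ
    have h1 : x + e₁ - e₂ = x + (e₁ - e₂) := by abel
    have h2 : x - e₁ + e₂ = x + (-e₁ + e₂) := by abel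
    rw [h1, h2]
    simp only [resolventIntegrand, sub_eq_add_neg x, char_add ξ x]
    rw [← mul_div_assoc, ← add_div, ← add_div, ← add_div, ← add_div, ← add_div, ← add_div,
      eq_div_iff h0, laplaceSymbol_eq_char]
    ring
  have hc := fun y => continuous_resolventIntegrand hz y
  have h2 := squareIntegral_char x
  simp only [key] at h2
  rw [squareIntegral_add (by fun_prop) (by fun_prop),
    squareIntegral_add (by fun_prop) (by fun_prop),
    squareIntegral_add (by fun_prop) (by fun_prop), squareIntegral_add (by fun_prop) (by fun_prop),
    squareIntegral_add (by fun_prop) (by fun_prop), squareIntegral_add (by fun_prop) (by fun_prop),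
    squareIntegral_const_mul] at h2
  have hpi : (4 * (π : ℂ) ^ 2) ≠ 0 := by simp [Real.pi_ne_zero]
  simp only [discreteLaplacian, resolventKernel_eq]
  have h3 : (if x = 0 then (1 : ℂ) else 0)
      = (1 / (4 * (π : ℂ) ^ 2)) * (if x = 0 then 4 * (π : ℂ) ^ 2 else 0) := by
    split_ifs
    · field_simp
    · simp
  rw [h3, ← h2]
  ring

/-! ### Reduction of the resolvent kernel to a single integral -/

/-- For `a` off the real axis the equation `w + 1/w = 2a` has a root in the open unit disc. -/
lemma exists_joukowski_root {a : ℂ} (ha : a.im ≠ 0) :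
    ∃ w : ℂ, w ≠ 0 ∧ ‖w‖ < 1 ∧ w + w⁻¹ = 2 * a := by
  obtain ⟨s, hs⟩ := IsAlgClosed.exists_pow_nat_eq (a ^ 2 - 1) (n := 2) (by norm_num)
  have hprod : (a + s) * (a - s) = 1 := by linear_combination -hs
  have key : ∀ w v : ℂ, w * v = 1 → w + v = 2 * a → ‖w‖ ≤ 1 →
      ∃ w : ℂ, w ≠ 0 ∧ ‖w‖ < 1 ∧ w + w⁻¹ = 2 * a := by
    intro w v hwv hsum hle
    have hw0 : w ≠ 0 := left_ne_zero_of_mul_eq_one hwv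
    have hv : v = w⁻¹ := eq_inv_of_mul_eq_one_right hwv
    refine ⟨w, hw0, lt_of_le_of_ne hle fun h1 => ha ?_, by rw [← hv, hsum]⟩
    have h3 : (w + w⁻¹).im = (2 * a).im := by rw [← hv, hsum]
    rw [Complex.inv_def, Complex.normSq_eq_norm_sq, h1] at h3
    simp at h3
    exact h3
  rcases le_total ‖a + s‖ 1 with h | h
  · exact key _ _ hprod (by ring) h
  · refine key (a - s) (a + s) (by rw [mul_comm]; exact hprod) (by ring) ?_
    have h4 : ‖a + s‖ * ‖a - s‖ = 1 := by rw [← norm_mul, hprod, norm_one]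
    nlinarith [norm_nonneg (a - s)]

/-- Cauchy's integral formula for the Poisson-type kernel `1 / ((1 - w ζ)(1 - w / ζ))`. -/
lemma integral_exp_div_joukowski {w : ℂ} (hw : ‖w‖ < 1) (n : ℕ) :
    ∫ t in (0 : ℝ)..(2 * π), Complex.exp (Complex.I * (n * t)) /
      ((1 - w * Complex.exp (Complex.I * t)) * (1 - w * Complex.exp (-(Complex.I * t)))) =
      2 * π * w ^ n / (1 - w ^ 2) := by
  have hne : ∀ ζ : ℂ, ‖ζ‖ ≤ 1 → 1 - w * ζ ≠ 0 := by
    intro ζ hζ h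
    have h1 : ‖w * ζ‖ = 1 := by rw [← sub_eq_zero.mp h, norm_one]
    rw [norm_mul] at h1
    nlinarith [norm_nonneg w, norm_nonneg ζ]
  -- With `ζ = e^{it}` the integrand is `ζ ^ n / (1 - w ζ)` over `ζ - w`, times `dζ / i`.
  have hd : DifferentiableOn ℂ (fun ζ : ℂ => ζ ^ n / (1 - w * ζ)) (Metric.closedBall 0 1) := by
    intro ζ hζ
    refine DifferentiableAt.differentiableWithinAt ?_
    refine DifferentiableAt.div (by fun_prop) (by fun_prop) (hne ζ (by simpa using hζ))
  have := hd.circleIntegral_sub_inv_smul (w := w) (by simpa using hw)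
  rw [circleIntegral] at this
  have h2 : ∀ t : ℝ, deriv (circleMap 0 1) t • ((circleMap 0 1 t - w)⁻¹ •
      ((circleMap 0 1 t) ^ n / (1 - w * circleMap 0 1 t))) =
      Complex.I * (Complex.exp (Complex.I * (n * t)) /
      ((1 - w * Complex.exp (Complex.I * t)) * (1 - w * Complex.exp (-(Complex.I * t))))) := by
    intro t
    rw [deriv_circleMap]
    have hz : circleMap 0 1 t = Complex.exp (Complex.I * t) := by
      simp [circleMap, mul_comm]
    have hn : Complex.exp (Complex.I * (n * t)) = Complex.exp (Complex.I * t) ^ n := by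
      rw [← Complex.exp_nat_mul]; ring_nf
    rw [hz, hn, Complex.exp_neg]
    set ζ := Complex.exp (Complex.I * t)
    have hζ0 : ζ ≠ 0 := Complex.exp_ne_zero _
    have hζ1 : ‖ζ‖ = 1 := by
      show ‖Complex.exp (Complex.I * t)‖ = 1
      rw [mul_comm, Complex.norm_exp_ofReal_mul_I]
    have h3 := hne ζ hζ1.le
    have h4 := hne ζ⁻¹ (by rw [norm_inv, hζ1, inv_one])
    have h5 : ζ - w ≠ 0 := by
      intro h; apply h4; rw [← sub_eq_zero.mp h, mul_inv_cancel₀ hζ0, sub_self]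
    have h6 : 1 - w * ζ⁻¹ = (ζ - w) / ζ := by field_simp
    rw [h6, smul_eq_mul, smul_eq_mul]
    field_simp
  simp only [h2] at this
  rw [intervalIntegral.integral_const_mul] at this
  have h7 : 1 - w ^ 2 ≠ 0 := by rw [pow_two]; exact hne w hw.le
  rw [smul_eq_mul] at this
  have h8 := mul_left_cancel₀ Complex.I_ne_zero (this.trans
    (show _ = Complex.I * (2 * π * w ^ n / (1 - w ^ 2)) by field_simp))
  exact h8

/-- The symbol in the coordinates `ξ = (2p, p + τ)`. -/
lemma laplaceSymbol_two_mul (p s : ℝ) :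
    laplaceSymbol (2 * p, s) = 4 * Real.cos p ^ 2 - 8 + 4 * Real.cos p * Real.cos (s - p) := by
  have h1 : Real.cos s + Real.cos (2 * p - s) = 2 * Real.cos p * Real.cos (s - p) := by
    have h2 := Real.cos_add p (s - p)
    have h3 := Real.cos_sub p (s - p)
    rw [show p + (s - p) = s by ring] at h2
    rw [show p - (s - p) = 2 * p - s by ring] at h3
    rw [h2, h3]; ring
  simp only [laplaceSymbol]
  rw [Real.cos_two_mul]
  linear_combination 2 * h1

/-- The inner integral of the resolvent kernel at `ξ₁ = 2p`, in terms of the root `w = e^{iτ}` of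
modulus less than one of the dispersion relation. -/
lemma inner_integral {z : ℂ} {p : ℝ} (hp : 0 < Real.cos p) {w : ℂ} (hw0 : w ≠ 0) (hw : ‖w‖ < 1)
    (hwz : w + w⁻¹ = 2 * (((8 - z) / 4 - (Real.cos p : ℂ) ^ 2) / Real.cos p)) (m : ℤ) (n : ℕ) :
    ∫ s in (-π)..π, resolventIntegrand z (m, n) (2 * p, s) =
      Complex.exp (Complex.I * ((2 * m + n) * p)) *
        (π * w ^ n / (Real.cos p * (w - w⁻¹))) := by
  have hc : (Real.cos p : ℂ) ≠ 0 := by exact_mod_cast hp.ne'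
  set g : ℝ → ℂ := fun t => Complex.exp (Complex.I * (n * t)) /
      ((1 - w * Complex.exp (Complex.I * t)) * (1 - w * Complex.exp (-(Complex.I * t)))) with hg
  -- The denominator factors over the two roots `w` and `w⁻¹` of the dispersion relation.
  have hden : ∀ t : ℝ, z + (4 * (Real.cos p : ℂ) ^ 2 - 8 + 4 * Real.cos p * Real.cos t) =
      -(2 * Real.cos p * w⁻¹) *
        ((1 - w * Complex.exp (Complex.I * t)) * (1 - w * Complex.exp (-(Complex.I * t)))) := by
    intro t
    have h2 := Complex.two_cos (t : ℂ)
    have h3 : Complex.exp (Complex.I * t) * Complex.exp (-(Complex.I * t)) = 1 := by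
      rw [← Complex.exp_add]; simp
    rw [show (t : ℂ) * Complex.I = Complex.I * t by ring,
      show -(t : ℂ) * Complex.I = -(Complex.I * t) by ring] at h2
    have h5 : (Real.cos p : ℂ) * (w + w⁻¹) = 2 * ((8 - z) / 4 - (Real.cos p : ℂ) ^ 2) := by
      rw [hwz]; field_simp
    have h4 : w⁻¹ * w = 1 := inv_mul_cancel₀ hw0
    rw [Complex.ofReal_cos t]
    generalize Complex.exp (Complex.I * t) = ζ at *
    generalize Complex.exp (-(Complex.I * t)) = ζ' at *
    linear_combination (2 * (Real.cos p : ℂ)) * h2 + 2 * h5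
      + (2 * (Real.cos p : ℂ) * w * w⁻¹ * w) * h3
      + (2 * (Real.cos p : ℂ) * (w - ζ - ζ')) * h4
  have hint : ∀ s : ℝ, resolventIntegrand z (m, n) (2 * p, s) =
      Complex.exp (Complex.I * ((2 * m + n) * p)) * (-(2 * Real.cos p * w⁻¹))⁻¹ * g (s - p) := by
    intro s
    simp only [resolventIntegrand, hg]
    rw [laplaceSymbol_two_mul]
    push_cast
    have := hden (s - p)
    push_cast at this
    rw [this]
    simp only [char]
    have h4 : Complex.exp
        (Complex.I * (((m : ℤ) : ℂ) * ((2 * p : ℝ) : ℂ) + (((n : ℕ) : ℤ) : ℂ) * s)) =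
      Complex.exp (Complex.I * ((2 * m + n) * p)) * Complex.exp (Complex.I * (n * (s - p))) := by
      rw [← Complex.exp_add]; push_cast; ring_nf
    rw [h4]
    rw [div_eq_mul_inv, div_eq_mul_inv, mul_inv]
    ring
  -- The substitution `s = p + t` shifts the interval; this is harmless for a periodic integrand.
  have hper : Function.Periodic g (2 * π) := by
    intro t
    simp only [hg]
    have h1 : Complex.exp (Complex.I * (n * ((t + 2 * π : ℝ) : ℂ))) =
        Complex.exp (Complex.I * (n * t)) := by
      rw [Complex.exp_eq_exp_iff_exists_int]; exact ⟨n, by push_cast; ring⟩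
    have h2 : Complex.exp (Complex.I * ((t + 2 * π : ℝ) : ℂ)) = Complex.exp (Complex.I * t) := by
      rw [Complex.exp_eq_exp_iff_exists_int]; exact ⟨1, by push_cast; ring⟩
    rw [h1, Complex.exp_neg, h2, Complex.exp_neg]
  simp only [hint]
  rw [intervalIntegral.integral_const_mul, intervalIntegral.integral_comp_sub_right g]
  have h6 := hper.intervalIntegral_add_eq (-π - p) 0
  rw [show -π - p + 2 * π = π - p by ring, zero_add] at h6
  rw [h6, integral_exp_div_joukowski hw n]
  have h7 : 1 - w ^ 2 ≠ 0 := by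
    intro h
    have h1 : ‖w ^ 2‖ = 1 := by rw [← sub_eq_zero.mp h, norm_one]
    rw [norm_pow] at h1
    nlinarith [norm_nonneg w]
  have h8 : w - w⁻¹ = -(1 - w ^ 2) / w := by field_simp; ring
  rw [h8]
  field_simp

/-! ### The dispersion relation on the real axis -/

/-- With `c = cos p`, the square `c² - (K - c²)²` of `c sin τ` on the level curve
`c (c + cos τ) = K`. -/
def dispY (K p : ℝ) : ℝ := Real.cos p ^ 2 - (K - Real.cos p ^ 2) ^ 2

/-- The value `tan p (K + cos² p)` of `sin p (2 cos p + cos τ)` on the level curve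
`cos p (cos p + cos τ) = K`. -/
def dispT (K p : ℝ) : ℝ := Real.sin p * (K + Real.cos p ^ 2) / Real.cos p

/-- The outgoing branch of `cos p sin τ` on the level curve: positive where `τ` is real, and such
that `|e^{iτ}| < 1` elsewhere. -/
def dispRoot (K p : ℝ) : ℂ :=
  if 0 ≤ dispY K p then (√(dispY K p) : ℂ)
  else Complex.I * ((if 0 < K then 1 else -1 : ℝ) * √(-dispY K p) : ℝ)

/-- The outgoing branch of `e^{iτ}` on the level curve `cos p (cos p + cos τ) = K`. -/
def dispW (K p : ℝ) : ℂ :=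
  ((K - Real.cos p ^ 2 : ℝ) + Complex.I * dispRoot K p) / Real.cos p

lemma dispRoot_sq (K p : ℝ) : dispRoot K p ^ 2 = dispY K p := by
  unfold dispRoot
  split_ifs with h h2
  · rw [← Complex.ofReal_pow, Real.sq_sqrt h]
  · rw [mul_pow, Complex.I_sq, ← Complex.ofReal_pow, mul_pow, Real.sq_sqrt (by linarith)]
    push_cast; ring
  · rw [mul_pow, Complex.I_sq, ← Complex.ofReal_pow, mul_pow, Real.sq_sqrt (by linarith)]
    push_cast; ring

lemma norm_dispRoot (K p : ℝ) : ‖dispRoot K p‖ = √|dispY K p| := by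
  rw [← Real.sqrt_sq (norm_nonneg (dispRoot K p)), ← norm_pow, dispRoot_sq]
  simp

lemma dispW_mul (K : ℝ) {p : ℝ} (hp : 0 < Real.cos p) :
    dispW K p * (((K - Real.cos p ^ 2 : ℝ) - Complex.I * dispRoot K p) / Real.cos p) = 1 := by
  have hc : (Real.cos p : ℂ) ≠ 0 := by exact_mod_cast hp.ne'
  have h := dispRoot_sq K p
  unfold dispW
  rw [div_mul_div_comm, div_eq_one_iff_eq (mul_ne_zero hc hc)]
  unfold dispY at h
  push_cast at h ⊢
  linear_combination h - (dispRoot K p) ^ 2 * Complex.I_sq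

lemma dispW_ne_zero (K : ℝ) {p : ℝ} (hp : 0 < Real.cos p) : dispW K p ≠ 0 :=
  left_ne_zero_of_mul_eq_one (dispW_mul K hp)

lemma dispW_inv (K : ℝ) {p : ℝ} (hp : 0 < Real.cos p) :
    (dispW K p)⁻¹ = ((K - Real.cos p ^ 2 : ℝ) - Complex.I * dispRoot K p) / Real.cos p :=
  (eq_inv_of_mul_eq_one_right (dispW_mul K hp)).symm

lemma dispW_add_inv (K : ℝ) {p : ℝ} (hp : 0 < Real.cos p) :
    dispW K p + (dispW K p)⁻¹ = 2 * (((K : ℂ) - (Real.cos p : ℂ) ^ 2) / Real.cos p) := by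
  rw [dispW_inv K hp]; unfold dispW
  push_cast; ring

lemma dispW_sub_inv (K : ℝ) {p : ℝ} (hp : 0 < Real.cos p) :
    Real.cos p * (dispW K p - (dispW K p)⁻¹) = 2 * Complex.I * dispRoot K p := by
  have hc : (Real.cos p : ℂ) ≠ 0 := by exact_mod_cast hp.ne'
  rw [dispW_inv K hp]; unfold dispW
  field_simp; ring

lemma norm_dispW_of_nonneg {K p : ℝ} (hp : 0 < Real.cos p) (hY : 0 ≤ dispY K p) :
    ‖dispW K p‖ = 1 := by
  have h1 : ‖((K - Real.cos p ^ 2 : ℝ) : ℂ) + Complex.I * dispRoot K p‖ = Real.cos p := by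
    have h2 : dispRoot K p = (√(dispY K p) : ℝ) := by simp [dispRoot, hY]
    rw [h2, mul_comm, Complex.norm_add_mul_I, Real.sq_sqrt hY, dispY]
    rw [add_sub_cancel, Real.sqrt_sq hp.le]
  unfold dispW
  rw [norm_div, h1, Complex.norm_real, Real.norm_of_nonneg hp.le, div_self hp.ne']

/-- In the evanescent region the outgoing root lies inside of the unit disc, quantitatively. -/
lemma one_add_le_norm_dispW_inv {K p : ℝ} (hp : 0 < Real.cos p)
    (hY : dispY K p < 0) : 1 + √(-dispY K p) ≤ ‖(dispW K p)⁻¹‖ := by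
  have hc1 := Real.cos_le_one p
  set c := Real.cos p with hcdef
  have hY' : c ^ 2 < (K - c ^ 2) ^ 2 := by unfold dispY at hY; linarith
  have hs : 0 < √(-dispY K p) := Real.sqrt_pos.mpr (by linarith)
  set s := √(-dispY K p) with hsdef
  rw [dispW_inv K hp]
  have hr : dispRoot K p = Complex.I * ((if 0 < K then 1 else -1 : ℝ) * s : ℝ) := by
    simp [dispRoot, not_le.mpr hY, hsdef]
  have h3 : ((K - c ^ 2 : ℝ) : ℂ) - Complex.I * dispRoot K p =
      ((K - c ^ 2 + (if 0 < K then 1 else -1 : ℝ) * s : ℝ) : ℂ) := by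
    rw [hr, ← mul_assoc, Complex.I_mul_I]; push_cast; ring
  rw [← hcdef, h3, norm_div, Complex.norm_real, Complex.norm_real, Real.norm_of_nonneg hp.le,
    le_div_iff₀ hp]
  have key : c + s ≤ ‖K - c ^ 2 + (if 0 < K then 1 else -1 : ℝ) * s‖ := by
    rw [Real.norm_eq_abs]
    split_ifs with hK0
    · have h4 : c < K - c ^ 2 := by
        by_contra hcon
        push Not at hcon
        have h5 : 0 < K - c ^ 2 + c := by nlinarith
        nlinarith
      rw [abs_of_pos (by linarith)]; linarith
    · have h4 : K - c ^ 2 < -c := by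
        by_contra hcon
        push Not at hcon
        nlinarith
      rw [abs_of_neg (by linarith)]; linarith
  nlinarith

lemma norm_dispW_le {K p : ℝ} (hp : 0 < Real.cos p) : ‖dispW K p‖ ≤ 1 := by
  rcases le_or_gt 0 (dispY K p) with h | h
  · exact (norm_dispW_of_nonneg hp h).le
  · have h1 := one_add_le_norm_dispW_inv hp h
    rw [norm_inv] at h1
    have h2 : 1 ≤ ‖dispW K p‖⁻¹ := by linarith [Real.sqrt_nonneg (-dispY K p)]
    exact (one_le_inv₀ (norm_pos_iff.mpr (dispW_ne_zero K hp))).mp h2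

/-! ### The limiting absorption principle -/

/-- A root of the dispersion relation inside of the unit disc, for a spectral parameter in the
upper half-plane, is close to the outgoing root on the real axis. -/
lemma norm_joukowski_root_sub_le {K p ε : ℝ} (hp : 0 < Real.cos p) (hε : 0 < ε)
    {w : ℂ} (hw0 : w ≠ 0) (hw : ‖w‖ < 1)
    (hwz : w + w⁻¹ = 2 * (((K : ℂ) - Complex.I * ε / 4 - (Real.cos p : ℂ) ^ 2) / Real.cos p)) :
    ‖w - dispW K p‖ * √|dispY K p| ≤ ε / (2 * Real.cos p) := by
  set c := Real.cos p with hcdef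
  have hc : (c : ℂ) ≠ 0 := by exact_mod_cast hp.ne'
  have hc1 : c ≤ 1 := Real.cos_le_one p
  have hW0 := dispW_ne_zero K hp
  -- `w` and `dispW K p` satisfy quadratic equations whose coefficients differ by `O(ε)`.
  have h1 : (w - dispW K p) * (w - (dispW K p)⁻¹) = w * (-(Complex.I * ε / (2 * c))) := by
    have h2 : (w - dispW K p) * (w - (dispW K p)⁻¹) =
        w * ((w + w⁻¹) - (dispW K p + (dispW K p)⁻¹)) := by field_simp; ring
    rw [h2, hwz, dispW_add_inv K hp, ← hcdef]
    field_simp; ring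
  -- Absorption decides the half-plane: the root inside the unit disc lies above the real axis.
  have him : 0 < w.im := by
    have h2 := congrArg Complex.im hwz
    have h3 : (2 * (((K : ℂ) - Complex.I * ε / 4 - (c : ℂ) ^ 2) / c)).im = -(ε / (2 * c)) := by
      have : (2 * (((K : ℂ) - Complex.I * ε / 4 - (c : ℂ) ^ 2) / c)) =
          ((2 * (K - c ^ 2) / c : ℝ) : ℂ) + ((-(ε / (2 * c)) : ℝ) : ℂ) * Complex.I := by
        push_cast; field_simp; ring
      rw [this, Complex.add_im, Complex.ofReal_im, Complex.mul_I_im, Complex.ofReal_re, zero_add]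
    rw [h3, Complex.add_im, Complex.inv_im] at h2
    have hns : 0 < Complex.normSq w := Complex.normSq_pos.mpr hw0
    have hns1 : Complex.normSq w < 1 := by
      rw [Complex.normSq_eq_norm_sq]; nlinarith [norm_nonneg w]
    have h5 : 0 < ε / (2 * c) := by positivity
    by_contra hcon
    push Not at hcon
    have h6 : w.im * Complex.normSq w - w.im = -(ε / (2 * c)) * Complex.normSq w := by
      rw [← h2]; field_simp; ring
    nlinarith [mul_pos h5 hns]
  -- So `w` stays away from the other limit root, which is below the axis or outside the disc.
  have hsep : √|dispY K p| ≤ ‖w - (dispW K p)⁻¹‖ := by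
    rcases le_or_gt 0 (dispY K p) with h | h
    · refine le_trans ?_ (Complex.abs_im_le_norm _)
      have h2 : dispRoot K p = (√(dispY K p) : ℝ) := by simp [dispRoot, h]
      have h3 : ((dispW K p)⁻¹).im = -(√(dispY K p) / c) := by
        rw [dispW_inv K hp, h2, ← hcdef, Complex.div_ofReal_im, Complex.sub_im, Complex.ofReal_im,
          Complex.I_mul_im, Complex.ofReal_re, zero_sub, neg_div]
      rw [Complex.sub_im, h3, abs_of_nonneg h, sub_neg_eq_add]
      have h4 : √(dispY K p) ≤ √(dispY K p) / c := by
        rw [le_div_iff₀ hp]; nlinarith [Real.sqrt_nonneg (dispY K p)]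
      exact le_trans (by linarith) (le_abs_self _)
    · have h2 := one_add_le_norm_dispW_inv hp h
      rw [abs_of_neg h]
      have h3 := norm_sub_norm_le ((dispW K p)⁻¹) w
      rw [norm_sub_rev] at h3
      linarith
  calc ‖w - dispW K p‖ * √|dispY K p| ≤ ‖w - dispW K p‖ * ‖w - (dispW K p)⁻¹‖ := by gcongr
    _ = ‖w‖ * (ε / (2 * c)) := by
        rw [← norm_mul, h1, norm_mul, norm_neg, norm_div, norm_mul, norm_mul]
        simp [abs_of_pos hε, abs_of_pos hp]
    _ ≤ 1 * (ε / (2 * c)) := by gcongr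
    _ = _ := one_mul _

lemma sqrt_abs_dispY_le {K p ε : ℝ} (hp : 0 < Real.cos p)
    {w : ℂ} (hw0 : w ≠ 0)
    (hwz : w + w⁻¹ = 2 * (((K : ℂ) - Complex.I * ε / 4 - (Real.cos p : ℂ) ^ 2) / Real.cos p)) :
    2 * √|dispY K p| ≤ ‖(Real.cos p : ℂ) * (w - w⁻¹)‖ := by
  set c := Real.cos p with hcdef
  have hc : (c : ℂ) ≠ 0 := by exact_mod_cast hp.ne'
  have h1 : ((c : ℂ) * (w - w⁻¹)) ^ 2 = -4 * (((c - K + c ^ 2 : ℝ) + Complex.I * (ε / 4 : ℝ)) *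
      (((c + K - c ^ 2 : ℝ) + Complex.I * (-(ε / 4) : ℝ)))) := by
    have h2 : ((c : ℂ) * (w - w⁻¹)) ^ 2 = (c * (w + w⁻¹)) ^ 2 - 4 * c ^ 2 := by
      field_simp; ring
    rw [h2, hwz]; push_cast; field_simp; ring
  have h3 : ∀ a b : ℝ, |a| ≤ ‖(a : ℂ) + Complex.I * b‖ := by
    intro a b
    refine le_trans (le_of_eq ?_) (Complex.abs_re_le_norm _)
    simp
  have h4 : 4 * |dispY K p| ≤ ‖(c : ℂ) * (w - w⁻¹)‖ ^ 2 := by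
    rw [← norm_pow, h1, norm_mul, norm_mul]
    have h5 : dispY K p = (c - K + c ^ 2) * (c + K - c ^ 2) := by
      unfold dispY; rw [← hcdef]; ring
    rw [h5, abs_mul]
    have : ‖(-4 : ℂ)‖ = 4 := by norm_num
    rw [this]
    gcongr <;> exact h3 _ _
  refine (pow_le_pow_iff_left₀ (by positivity) (norm_nonneg _) two_ne_zero).mp ?_
  rw [mul_pow, Real.sq_sqrt (abs_nonneg _)]
  linarith

lemma measurable_dispY (K : ℝ) : Measurable (dispY K) := by unfold dispY; fun_prop

lemma intervalIntegrable_abs_sub_rpow {r : ℝ} (hr : -1 < r) (s a b : ℝ) :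
    IntervalIntegrable (fun x : ℝ => |x - s| ^ r) MeasureTheory.volume a b := by
  have h0 : ∀ b : ℝ, IntervalIntegrable (fun x : ℝ => |x| ^ r) MeasureTheory.volume 0 b := by
    intro b
    rcases le_total 0 b with hb | hb
    · refine (intervalIntegral.intervalIntegrable_rpow' (a := 0) (b := b) hr).congr ?_
      intro x hx
      rw [Set.uIoc_of_le hb] at hx
      simp [abs_of_pos hx.1]
    · have h1 : IntervalIntegrable (fun x : ℝ => |x| ^ r) MeasureTheory.volume 0 (-b) := by
        refine (intervalIntegral.intervalIntegrable_rpow' (a := 0) (b := -b) hr).congr ?_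
        intro x hx
        rw [Set.uIoc_of_le (by linarith)] at hx
        simp [abs_of_pos hx.1]
      have h2 := (IntervalIntegrable.iff_comp_neg (f := fun x : ℝ => |x| ^ r)).mp h1
      simpa using h2
  have h1 : IntervalIntegrable (fun x : ℝ => |x| ^ r) MeasureTheory.volume (a - s) (b - s) :=
    (h0 _).symm.trans (h0 _)
  have h2 := h1.comp_sub_right s
  simpa using h2

lemma abs_cos_sub_cos_ge {p q : ℝ} (hp : p ∈ Set.Icc 0 (π / 2)) (hq : q ∈ Set.Icc 0 (π / 2)) :
    2 / π ^ 2 * (|p - q| * q) ≤ |Real.cos p - Real.cos q| := by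
  have hpi := Real.pi_pos
  have h1 : Real.cos p - Real.cos q = -2 * Real.sin ((p + q) / 2) * Real.sin ((p - q) / 2) :=
    Real.cos_sub_cos p q
  have h2 := Real.mul_abs_le_abs_sin (x := (p + q) / 2)
    (by rw [abs_of_nonneg (by linarith [hp.1, hq.1])]; linarith [hp.2, hq.2])
  have h3 := Real.mul_abs_le_abs_sin (x := (p - q) / 2)
    (by rw [abs_le]; constructor <;> linarith [hp.1, hq.1, hp.2, hq.2])
  rw [h1, abs_mul, abs_mul]
  have h4 : |(p + q) / 2| = (p + q) / 2 := abs_of_nonneg (by linarith [hp.1, hq.1])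
  have h5 : |(p - q) / 2| = |p - q| / 2 := by rw [abs_div]; norm_num
  rw [h4] at h2
  rw [h5] at h3
  have h6 : |(-2 : ℝ)| = 2 := by norm_num
  rw [h6]
  calc 2 / π ^ 2 * (|p - q| * q) ≤ 2 / π ^ 2 * (|p - q| * (p + q)) := by
        have := hp.1; gcongr
        linarith
    _ = 2 * (2 / π * ((p + q) / 2)) * (2 / π * (|p - q| / 2)) := by field_simp
    _ ≤ _ := by gcongr

/-- `√(1 + 4K)`, which is `√(9 - k²)` for `K = (8 - k²)/4`. -/
def kap (K : ℝ) : ℝ := √(1 + 4 * K)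

/-- The angle at which `cos p = |κ - 1| / 2`. -/
def angA (K : ℝ) : ℝ := Real.arccos (|kap K - 1| / 2)

/-- The angle at which `cos p = (κ + 1) / 2`, for `K < 0`. -/
def angB (K : ℝ) : ℝ := Real.arccos ((kap K + 1) / 2)

/-- The range of `K = (8 - k²)/4` for `0 < k² < 9`, `k² ≠ 8`. -/
structure Admissible (K : ℝ) : Prop where
  lower : -(1 / 4) < K
  upper : K < 2
  ne : K ≠ 0

lemma kap_sq {K : ℝ} (hK : Admissible K) : kap K ^ 2 = 1 + 4 * K :=
  Real.sq_sqrt (by linarith [hK.lower])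

lemma kap_pos {K : ℝ} (hK : Admissible K) : 0 < kap K :=
  Real.sqrt_pos.mpr (by linarith [hK.lower])

lemma kap_lt {K : ℝ} (hK : Admissible K) : kap K < 3 := by
  nlinarith [kap_sq hK, kap_pos hK, hK.upper]

lemma one_lt_kap {K : ℝ} (hK : Admissible K) (h : 0 < K) : 1 < kap K := by
  nlinarith [kap_sq hK, kap_pos hK]

lemma kap_lt_one {K : ℝ} (hK : Admissible K) (h : K < 0) : kap K < 1 := by
  nlinarith [kap_sq hK, kap_pos hK]

lemma kap_ne_one {K : ℝ} (hK : Admissible K) : kap K ≠ 1 := by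
  intro h
  have := kap_sq hK
  rw [h] at this
  exact hK.ne (by linarith)

lemma dispY_eq_mul {K : ℝ} (hK : Admissible K) (p : ℝ) :
    dispY K p = (Real.cos p ^ 2 - (|kap K - 1| / 2) ^ 2) *
      (((kap K + 1) / 2) ^ 2 - Real.cos p ^ 2) := by
  have h := kap_sq hK
  rw [div_pow, sq_abs]
  have hK' : K = (kap K ^ 2 - 1) / 4 := by linarith
  unfold dispY
  rw [show (K - Real.cos p ^ 2) = ((kap K ^ 2 - 1) / 4 - Real.cos p ^ 2) by rw [← hK']]
  ring

lemma abs_kap_sub_one_div_two {K : ℝ} (hK : Admissible K) :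
    0 < |kap K - 1| / 2 ∧ |kap K - 1| / 2 < 1 := by
  refine ⟨?_, ?_⟩
  · have := abs_pos.mpr (sub_ne_zero.mpr (kap_ne_one hK)); positivity
  · have : |kap K - 1| < 2 := abs_lt.mpr ⟨by linarith [kap_pos hK], by linarith [kap_lt hK]⟩
    linarith

lemma cos_angA {K : ℝ} (hK : Admissible K) : Real.cos (angA K) = |kap K - 1| / 2 :=
  Real.cos_arccos (by linarith [abs_kap_sub_one_div_two hK])
    (by linarith [abs_kap_sub_one_div_two hK])

lemma angA_mem {K : ℝ} (hK : Admissible K) : angA K ∈ Set.Ioo 0 (π / 2) :=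
  ⟨Real.arccos_pos.mpr (abs_kap_sub_one_div_two hK).2,
    Real.arccos_lt_pi_div_two.mpr (abs_kap_sub_one_div_two hK).1⟩

lemma cos_angB {K : ℝ} (hK : Admissible K) (h : K < 0) :
    Real.cos (angB K) = (kap K + 1) / 2 :=
  Real.cos_arccos (by linarith [kap_pos hK]) (by linarith [kap_lt_one hK h])

lemma angB_mem {K : ℝ} (hK : Admissible K) (h : K < 0) : angB K ∈ Set.Ioo 0 (angA K) := by
  refine ⟨Real.arccos_pos.mpr (by linarith [kap_lt_one hK h]), ?_⟩
  refine Real.strictAntiOn_arccos ⟨by linarith [abs_kap_sub_one_div_two hK],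
    by linarith [abs_kap_sub_one_div_two hK]⟩ ⟨by linarith [kap_pos hK],
    by linarith [kap_lt_one hK h]⟩ ?_
  have h1 := kap_lt_one hK h
  rw [abs_of_neg (by linarith)]
  linarith [kap_pos hK]

/-- The zeros of `dispY` on `[0, π/2]` are simple. -/
lemma exists_abs_dispY_ge {K : ℝ} (hK : Admissible K) :
    ∃ s t c : ℝ, s ≠ t ∧ 0 < c ∧ ∀ p ∈ Set.Icc 0 (π / 2),
      c * (|p - s| * |p - t|) ≤ |dispY K p| := by
  have hpi := Real.pi_pos
  have hA := angA_mem hK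
  have hA1 := abs_kap_sub_one_div_two hK
  have hfac : ∀ q p : ℝ, q ∈ Set.Icc 0 (π / 2) → p ∈ Set.Icc 0 (π / 2) →
      2 / π ^ 2 * q * Real.cos q * |p - q| ≤ |Real.cos p ^ 2 - Real.cos q ^ 2| := by
    intro q p hq hp
    have h1 := abs_cos_sub_cos_ge hp hq
    have h2 : 0 ≤ Real.cos p := Real.cos_nonneg_of_mem_Icc ⟨by linarith [hp.1], hp.2⟩
    have h3 : 0 ≤ Real.cos q := Real.cos_nonneg_of_mem_Icc ⟨by linarith [hq.1], hq.2⟩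
    rw [sq_sub_sq, abs_mul, abs_of_nonneg (add_nonneg h2 h3)]
    calc 2 / π ^ 2 * q * Real.cos q * |p - q| = Real.cos q * (2 / π ^ 2 * (|p - q| * q)) := by ring
      _ ≤ (Real.cos p + Real.cos q) * |Real.cos p - Real.cos q| := by
          have := hq.1
          gcongr
          linarith
  rcases lt_or_gt_of_ne hK.ne with hneg | hpos
  · have hB := angB_mem hK hneg
    have hB1 : 0 < Real.cos (angB K) := by rw [cos_angB hK hneg]; linarith [kap_pos hK]
    refine ⟨angA K, angB K, (2 / π ^ 2 * angA K * Real.cos (angA K)) *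
      (2 / π ^ 2 * angB K * Real.cos (angB K)), hB.2.ne', ?_, ?_⟩
    · rw [cos_angA hK]
      have := hA.1; have := hB.1; have := hA1.1
      positivity
    · intro p hp
      rw [dispY_eq_mul hK, ← cos_angA hK, ← cos_angB hK hneg, abs_mul]
      have h1 := hfac (angA K) p ⟨hA.1.le, hA.2.le⟩ hp
      have h2 := hfac (angB K) p ⟨hB.1.le, by linarith [hB.2, hA.2]⟩ hp
      rw [abs_sub_comm (Real.cos p ^ 2)] at h2
      calc _ = (2 / π ^ 2 * angA K * Real.cos (angA K) * |p - angA K|) *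
            (2 / π ^ 2 * angB K * Real.cos (angB K) * |p - angB K|) := by ring
        _ ≤ _ := by
            have := hB.1
            gcongr
  · -- For `K > 0` only one factor of `dispY` has a zero; the point `-1` outside the interval takes
    -- the place of the other zero.
    have h1 := one_lt_kap hK hpos
    refine ⟨angA K, -1, (2 / π ^ 2 * angA K * Real.cos (angA K)) *
      (((kap K + 1) / 2) ^ 2 - 1) * (1 / 3), by linarith [hA.1], ?_, ?_⟩
    · rw [cos_angA hK]
      have h2 : 0 < ((kap K + 1) / 2) ^ 2 - 1 := by nlinarith
      have := hA.1; have := hA1.1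
      positivity
    · intro p hp
      rw [dispY_eq_mul hK, ← cos_angA hK, abs_mul]
      have h2 := hfac (angA K) p ⟨hA.1.le, hA.2.le⟩ hp
      have h3 : (((kap K + 1) / 2) ^ 2 - 1) * (1 / 3) * |p - -1| ≤
          |((kap K + 1) / 2) ^ 2 - Real.cos p ^ 2| := by
        have h4 : Real.cos p ^ 2 ≤ 1 := Real.cos_sq_le_one p
        have h5 : 0 < ((kap K + 1) / 2) ^ 2 - 1 := by nlinarith
        have h6 : |p - -1| ≤ 3 := by
          rw [abs_le]; constructor <;> linarith [hp.1, hp.2, Real.pi_lt_four]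
        rw [abs_of_pos (a := ((kap K + 1) / 2) ^ 2 - Real.cos p ^ 2) (by linarith)]
        have h7 : (((kap K + 1) / 2) ^ 2 - 1) * (1 / 3) * |p - -1| ≤
            (((kap K + 1) / 2) ^ 2 - 1) * (1 / 3) * 3 := by gcongr
        linarith
      calc _ = (2 / π ^ 2 * angA K * Real.cos (angA K) * |p - angA K|) *
            ((((kap K + 1) / 2) ^ 2 - 1) * (1 / 3) * |p - -1|) := by ring
        _ ≤ _ := by
            have h5 : 0 < ((kap K + 1) / 2) ^ 2 - 1 := by nlinarith
            gcongr

lemma dispY_neg (K p : ℝ) : dispY K (-p) = dispY K p := by simp [dispY]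

/-- The functions `|Y|^{-r}`, `0 ≤ r < 1`, are integrable. -/
lemma intervalIntegrable_dispY_rpow {K : ℝ} (hK : Admissible K) {r : ℝ} (hr0 : 0 ≤ r) (hr : r < 1) :
    IntervalIntegrable (fun p => |dispY K p| ^ (-r)) MeasureTheory.volume (-(π / 2)) (π / 2) := by
  obtain ⟨s, t, c, hst, hc, hY⟩ := exists_abs_dispY_ge hK
  have hpi := Real.pi_pos
  have hpos : IntervalIntegrable (fun p => |dispY K p| ^ (-r)) MeasureTheory.volume 0 (π / 2) := by
    have hbd : IntervalIntegrable (fun p => (c * (|s - t| / 2)) ^ (-r) *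
        (|p - s| ^ (-r) + |p - t| ^ (-r))) MeasureTheory.volume 0 (π / 2) :=
      ((intervalIntegrable_abs_sub_rpow (by linarith) s _ _).add
        (intervalIntegrable_abs_sub_rpow (by linarith) t _ _)).const_mul _
    refine hbd.mono_fun' ?_ ?_
    · exact ((measurable_dispY K).abs.pow_const _).aestronglyMeasurable
    · have hne : ∀ᵐ p ∂(MeasureTheory.volume.restrict (Set.uIoc 0 (π / 2))), p ∉ ({s, t} : Set ℝ) :=
        MeasureTheory.ae_restrict_of_ae (Set.Countable.ae_notMem (Set.toFinite _).countable _)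
      filter_upwards [hne, MeasureTheory.ae_restrict_mem measurableSet_uIoc] with p hp hp2
      rw [Set.uIoc_of_le (by positivity)] at hp2
      simp only [Set.mem_insert_iff, Set.mem_singleton_iff, not_or] at hp
      have h1 : 0 < |p - s| := abs_pos.mpr (sub_ne_zero.mpr hp.1)
      have h2 : 0 < |p - t| := abs_pos.mpr (sub_ne_zero.mpr hp.2)
      have hd : 0 < |s - t| := abs_pos.mpr (sub_ne_zero.mpr hst)
      have h3 := hY p ⟨hp2.1.le, hp2.2⟩
      have h4 : |s - t| ≤ |p - s| + |p - t| := by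
        rw [abs_sub_comm p s]; exact abs_sub_le s p t
      rw [Real.norm_of_nonneg (by positivity)]
      rw [mul_add, ← Real.mul_rpow (by positivity) h1.le, ← Real.mul_rpow (by positivity) h2.le]
      -- The point is at distance at least `|s - t| / 2` from the farther of the two zeros.
      rcases le_total (|p - s|) (|p - t|) with h5 | h5
      · have h6 : c * (|s - t| / 2) * |p - s| ≤ |dispY K p| := by
          refine le_trans ?_ h3
          nlinarith [mul_pos hc h1]
        have h7 := Real.rpow_le_rpow_of_nonpos (by positivity) h6 (by linarith : -r ≤ 0)
        have h8 : 0 ≤ (c * (|s - t| / 2) * |p - t|) ^ (-r) := by positivity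
        linarith
      · have h6 : c * (|s - t| / 2) * |p - t| ≤ |dispY K p| := by
          refine le_trans ?_ h3
          nlinarith [mul_pos hc h2]
        have h7 := Real.rpow_le_rpow_of_nonpos (by positivity) h6 (by linarith : -r ≤ 0)
        have h8 : 0 ≤ (c * (|s - t| / 2) * |p - s|) ^ (-r) := by positivity
        linarith
  have h2 := (IntervalIntegrable.iff_comp_neg (f := fun p => |dispY K p| ^ (-r))).mp hpos
  simp only [dispY_neg, neg_zero] at h2
  exact h2.symm.trans hpos

/-! ### The one-dimensional representation of the lattice Green's function -/

/-- The function `e^{iXp} w^n` on the level curve. -/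
def mon (K : ℝ) (X n : ℤ) (p : ℝ) : ℂ :=
  Complex.exp (Complex.I * (X * p)) * dispW K p ^ n

lemma dispY_ne_zero_ae {K : ℝ} (hK : Admissible K) :
    ∀ᵐ p : ℝ, p ∈ Set.uIoc (-(π / 2)) (π / 2) → 0 < Real.cos p ∧ dispY K p ≠ 0 := by
  obtain ⟨s, t, c, hst, hc, hY⟩ := exists_abs_dispY_ge hK
  have hpi := Real.pi_pos
  have hne : ∀ᵐ p : ℝ, p ∉ ({s, t, -s, -t, π / 2} : Set ℝ) :=
    Set.Countable.ae_notMem (Set.toFinite _).countable _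
  filter_upwards [hne] with p hp hp2
  simp only [Set.mem_insert_iff, Set.mem_singleton_iff, not_or] at hp
  rw [Set.uIoc_of_le (by linarith)] at hp2
  refine ⟨Real.cos_pos_of_mem_Ioo ⟨hp2.1, lt_of_le_of_ne hp2.2 hp.2.2.2.2⟩, ?_⟩
  rcases le_total 0 p with h | h
  · have h1 := hY p ⟨h, hp2.2⟩
    have h2 : 0 < |p - s| := abs_pos.mpr (sub_ne_zero.mpr hp.1)
    have h3 : 0 < |p - t| := abs_pos.mpr (sub_ne_zero.mpr hp.2.1)
    exact abs_pos.mp (lt_of_lt_of_le (by positivity) h1)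
  · have h1 := hY (-p) ⟨by linarith, by linarith [hp2.1]⟩
    rw [dispY_neg] at h1
    have h2 : 0 < |-p - s| := abs_pos.mpr (fun h => hp.2.2.1 (by linarith))
    have h3 : 0 < |-p - t| := abs_pos.mpr (fun h => hp.2.2.2.1 (by linarith))
    exact abs_pos.mp (lt_of_lt_of_le (by positivity) h1)

lemma resolventKernel_eq_integral {z : ℂ} (m n : ℤ) :
    resolventKernel z (m, n) = (1 / (2 * (π : ℂ) ^ 2)) * ∫ p in (-(π / 2))..(π / 2),
      ∫ s in (-π)..π, resolventIntegrand z (m, n) (2 * p, s) := by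
  rw [resolventKernel_eq, squareIntegral]
  have h := intervalIntegral.integral_comp_mul_left (a := -(π / 2)) (b := π / 2)
    (fun q => ∫ s in (-π)..π, resolventIntegrand z (m, n) (q, s)) (two_ne_zero' ℝ)
  rw [h, show (2 : ℝ) * -(π / 2) = -π by ring, show (2 : ℝ) * (π / 2) = π by ring]
  rw [Complex.real_smul]
  push_cast
  ring

/-- The limiting absorption principle: for `x₂ ≥ 0` the resolvent kernel converges, and the limit
is a single integral over the (real and complex) level curve. -/
theorem tendsto_resolventKernel_nat {K : ℝ} (hK : Admissible K) (m : ℤ) (n : ℕ) :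
    Tendsto (fun ε : ℝ => resolventKernel (8 - 4 * K + Complex.I * ε) (m, n)) (𝓝[>] 0)
      (𝓝 ((1 / (4 * π * Complex.I)) * ∫ p in (-(π / 2))..(π / 2),
        mon K (2 * m + n) n p / dispRoot K p)) := by
  have hpi := Real.pi_pos
  have hlim : Tendsto (fun ε : ℝ => ∫ p in (-(π / 2))..(π / 2),
      ∫ s in (-π)..π, resolventIntegrand (8 - 4 * K + Complex.I * ε) (m, n) (2 * p, s)) (𝓝[>] 0)
      (𝓝 (∫ p in (-(π / 2))..(π / 2),
        (π / (2 * Complex.I)) * (mon K (2 * m + n) n p / dispRoot K p))) := by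
    have hroot : ∀ ε : ℝ, 0 < ε → ∀ p : ℝ, 0 < Real.cos p → ∃ w : ℂ, w ≠ 0 ∧ ‖w‖ < 1 ∧
        w + w⁻¹ = 2 * (((K : ℂ) - Complex.I * ε / 4 - (Real.cos p : ℂ) ^ 2) / Real.cos p) := by
      intro ε hε p hp
      refine exists_joukowski_root ?_
      have : ((K : ℂ) - Complex.I * ε / 4 - (Real.cos p : ℂ) ^ 2) / Real.cos p =
          (((K - Real.cos p ^ 2) / Real.cos p : ℝ) : ℂ) +
            ((-(ε / (4 * Real.cos p)) : ℝ) : ℂ) * Complex.I := by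
        have hc : (Real.cos p : ℂ) ≠ 0 := by exact_mod_cast hp.ne'
        push_cast; field_simp; ring
      rw [this, Complex.add_im, Complex.ofReal_im, Complex.mul_I_im, Complex.ofReal_re, zero_add]
      have : 0 < ε / (4 * Real.cos p) := by positivity
      linarith
    have hinner : ∀ ε : ℝ, ∀ p : ℝ, 0 < Real.cos p → ∀ w : ℂ, w ≠ 0 → ‖w‖ < 1 →
        w + w⁻¹ = 2 * (((K : ℂ) - Complex.I * ε / 4 - (Real.cos p : ℂ) ^ 2) / Real.cos p) →
        ∫ s in (-π)..π, resolventIntegrand (8 - 4 * K + Complex.I * ε) (m, n) (2 * p, s) =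
        Complex.exp (Complex.I * ((2 * m + n) * p)) *
        (π * w ^ n / (Real.cos p * (w - w⁻¹))) := by
      intro ε p hp w hw0 hw1 hwz
      refine inner_integral hp hw0 hw1 ?_ m n
      rw [hwz]; congr 2; ring
    have hexp : ∀ p : ℝ, ‖Complex.exp (Complex.I * ((2 * m + n) * p))‖ = 1 := by
      intro p
      have : Complex.I * ((2 * m + n) * p) = (((2 * m + n) * p : ℝ) : ℂ) * Complex.I := by
        push_cast; ring
      rw [this, Complex.norm_exp_ofReal_mul_I]
    -- Dominated convergence in `p`, with the majorant `|dispY| ^ (-1 / 2)`, singular at the branch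
    -- points.
    refine intervalIntegral.tendsto_integral_filter_of_dominated_convergence
      (fun p => π / 2 * |dispY K p| ^ (-(1 / 2) : ℝ)) ?_ ?_ ?_ ?_
    · filter_upwards [self_mem_nhdsWithin] with ε hε
      have hz : (8 - 4 * (K : ℂ) + Complex.I * ε).im ≠ 0 := by
        have : (8 - 4 * (K : ℂ) + Complex.I * ε).im = ε := by simp
        rw [this]; exact (Set.mem_Ioi.mp hε).ne'
      refine Continuous.aestronglyMeasurable ?_
      refine intervalIntegral.continuous_parametric_intervalIntegral_of_continuous'
        (f := fun p s => resolventIntegrand _ (m, n) (2 * p, s)) ?_ _ _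
      exact (continuous_resolventIntegrand hz (m, n)).comp
        (by fun_prop : Continuous fun q : ℝ × ℝ => (2 * q.1, q.2))
    · filter_upwards [self_mem_nhdsWithin] with ε hε
      filter_upwards [dispY_ne_zero_ae hK] with p hp hp2
      obtain ⟨hc, hY⟩ := hp hp2
      obtain ⟨w, hw0, hw1, hwz⟩ := hroot ε hε p hc
      rw [hinner ε p hc w hw0 hw1 hwz, norm_mul, hexp, one_mul, norm_div, norm_mul, norm_pow]
      have h1 := sqrt_abs_dispY_le hc hw0 hwz
      have hs : 0 < √|dispY K p| := Real.sqrt_pos.mpr (abs_pos.mpr hY)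
      rw [Real.rpow_neg (abs_nonneg _), ← Real.sqrt_eq_rpow]
      have h2 : ‖w‖ ^ n ≤ 1 := pow_le_one₀ (norm_nonneg _) hw1.le
      rw [Complex.norm_real, Real.norm_of_nonneg hpi.le]
      calc π * ‖w‖ ^ n / ‖(Real.cos p : ℂ) * (w - w⁻¹)‖ ≤ π * 1 / (2 * √|dispY K p|) := by gcongr
        _ = _ := by field_simp
    · exact (intervalIntegrable_dispY_rpow hK (by norm_num) (by norm_num)).const_mul _
    · filter_upwards [dispY_ne_zero_ae hK] with p hp hp2
      obtain ⟨hc, hY⟩ := hp hp2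
      have hs : 0 < √|dispY K p| := Real.sqrt_pos.mpr (abs_pos.mpr hY)
      have hr : dispRoot K p ≠ 0 := by
        rw [← norm_pos_iff, norm_dispRoot]; exact hs
      have hcC : (Real.cos p : ℂ) ≠ 0 := by exact_mod_cast hc.ne'
      choose! w hw0 hw1 hwz using fun (ε : ℝ) (hε : 0 < ε) => hroot ε hε p hc
      have hw : Tendsto w (𝓝[>] 0) (𝓝 (dispW K p)) := by
        rw [tendsto_iff_norm_sub_tendsto_zero]
        have hb : Tendsto (fun ε : ℝ => ε / (2 * Real.cos p) / √|dispY K p|) (𝓝[>] 0) (𝓝 0) := by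
          have : Tendsto (fun ε : ℝ => ε / (2 * Real.cos p) / √|dispY K p|) (𝓝 0)
              (𝓝 (0 / (2 * Real.cos p) / √|dispY K p|)) := by
            exact (tendsto_id.div_const _).div_const _
          simp only [zero_div] at this
          exact this.mono_left nhdsWithin_le_nhds
        refine squeeze_zero' (Eventually.of_forall fun _ => norm_nonneg _) ?_ hb
        filter_upwards [self_mem_nhdsWithin] with ε hε
        rw [le_div_iff₀ hs]
        exact norm_joukowski_root_sub_le hc hε (hw0 ε hε) (hw1 ε hε) (hwz ε hε)
      have hW0 := dispW_ne_zero K hc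
      have hden : (Real.cos p : ℂ) * (dispW K p - (dispW K p)⁻¹) ≠ 0 := by
        rw [dispW_sub_inv K hc]
        exact mul_ne_zero (mul_ne_zero two_ne_zero Complex.I_ne_zero) hr
      have h3 : Tendsto (fun ε => Complex.exp (Complex.I * ((2 * m + n) * p)) *
          (π * w ε ^ n / (Real.cos p * (w ε - (w ε)⁻¹)))) (𝓝[>] 0)
          (𝓝 (Complex.exp (Complex.I * ((2 * m + n) * p)) *
          (π * dispW K p ^ n / (Real.cos p * (dispW K p - (dispW K p)⁻¹))))) :=
        (((hw.pow n).const_mul _).div ((hw.sub (hw.inv₀ hW0)).const_mul _) hden).const_mul _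
      have h4 : Complex.exp (Complex.I * ((2 * m + n) * p)) *
          (π * dispW K p ^ n / (Real.cos p * (dispW K p - (dispW K p)⁻¹))) =
          (π / (2 * Complex.I)) * (mon K (2 * m + n) n p / dispRoot K p) := by
        rw [dispW_sub_inv K hc, mon, zpow_natCast]
        push_cast
        field_simp
      rw [← h4]
      refine h3.congr' ?_
      filter_upwards [self_mem_nhdsWithin] with ε hε
      exact (hinner ε p hc (w ε) (hw0 ε hε) (hw1 ε hε) (hwz ε hε)).symm
  have h5 := hlim.const_mul (1 / (2 * (π : ℂ) ^ 2))
  rw [intervalIntegral.integral_const_mul] at h5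
  have h6 : (1 / (2 * (π : ℂ) ^ 2)) * ((π / (2 * Complex.I)) * ∫ p in (-(π / 2))..(π / 2),
      mon K (2 * m + n) n p / dispRoot K p) = (1 / (4 * π * Complex.I)) *
      ∫ p in (-(π / 2))..(π / 2), mon K (2 * m + n) n p / dispRoot K p := by
    have : (π : ℂ) ≠ 0 := by exact_mod_cast hpi.ne'
    field_simp; ring
  rw [h6] at h5
  refine h5.congr fun ε => ?_
  rw [resolventKernel_eq_integral]

/-! ### Oscillatory integrals with one stationary point -/

/-- Bounds for the first two derivatives of a quotient `f / g` of functions with a common simple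
zero `t` of `g`: the first derivative is bounded, the second one is `O(1 / |ψ - t|)`. -/
lemma deriv_quotient_bounds {a b t c M : ℝ} (ht : t ∈ Set.Icc a b) (hc : 0 < c)
    {f f₁ f₂ g g₁ g₂ : ℝ → ℂ}
    (hf : ∀ ψ ∈ Set.Icc a b, HasDerivAt f (f₁ ψ) ψ)
    (hf₁ : ∀ ψ ∈ Set.Icc a b, HasDerivAt f₁ (f₂ ψ) ψ)
    (hg : ∀ ψ ∈ Set.Icc a b, HasDerivAt g (g₁ ψ) ψ)
    (hg₁ : ∀ ψ ∈ Set.Icc a b, HasDerivAt g₁ (g₂ ψ) ψ)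
    (bf₁ : ∀ ψ ∈ Set.Icc a b, ‖f₁ ψ‖ ≤ M) (bf₂ : ∀ ψ ∈ Set.Icc a b, ‖f₂ ψ‖ ≤ M)
    (bg₁ : ∀ ψ ∈ Set.Icc a b, ‖g₁ ψ‖ ≤ M) (bg₂ : ∀ ψ ∈ Set.Icc a b, ‖g₂ ψ‖ ≤ M)
    (hft : f t = 0) (hgt : g t = 0) (hgc : ∀ ψ ∈ Set.Icc a b, c * |ψ - t| ≤ ‖g ψ‖)
    {ψ : ℝ} (hψ : ψ ∈ Set.Icc a b) (hne : ψ ≠ t) :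
    HasDerivAt (fun s => (f₁ s * g s - f s * g₁ s) / g s ^ 2)
      (((f₂ ψ * g ψ - f ψ * g₂ ψ) * g ψ - 2 * g₁ ψ * (f₁ ψ * g ψ - f ψ * g₁ ψ)) / g ψ ^ 3) ψ ∧
    ‖(f₁ ψ * g ψ - f ψ * g₁ ψ) / g ψ ^ 2‖ ≤ 2 * M ^ 2 / c ^ 2 + 4 * M ^ 3 / c ^ 3 ∧
    ‖((f₂ ψ * g ψ - f ψ * g₂ ψ) * g ψ - 2 * g₁ ψ * (f₁ ψ * g ψ - f ψ * g₁ ψ)) / g ψ ^ 3‖ * |ψ - t|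
      ≤ 2 * M ^ 2 / c ^ 2 + 4 * M ^ 3 / c ^ 3 := by
  have hM : 0 ≤ M := (norm_nonneg _).trans (bf₁ t ht)
  have hu : 0 < |ψ - t| := abs_pos.mpr (sub_ne_zero.mpr hne)
  have hgpos : 0 < ‖g ψ‖ := lt_of_lt_of_le (by positivity) (hgc ψ hψ)
  have hg0 : g ψ ≠ 0 := norm_pos_iff.mp hgpos
  have lin : ∀ h h₁ : ℝ → ℂ, (∀ s ∈ Set.Icc a b, HasDerivAt h (h₁ s) s) →
      (∀ s ∈ Set.Icc a b, ‖h₁ s‖ ≤ M) → h t = 0 → ∀ s ∈ Set.Icc a b, ‖h s‖ ≤ M * |s - t| := by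
    intro h h₁ hd hb h0 s hs
    have := (convex_Icc a b).norm_image_sub_le_of_norm_hasDerivWithin_le
      (fun x hx => (hd x hx).hasDerivWithinAt) hb ht hs
    simpa [h0] using this
  have hfl := lin f f₁ hf bf₁ hft
  have hgl := lin g g₁ hg bg₁ hgt
  have hsub : Set.uIcc t ψ ⊆ Set.Icc a b := Set.uIcc_subset_Icc ht hψ
  have hle : ∀ s ∈ Set.uIcc t ψ, |s - t| ≤ |ψ - t| := fun s hs =>
    Set.abs_sub_left_of_mem_uIcc hs
  -- The Wronskian of `f` and `g` vanishes to second order at `t`, like the denominator `g ^ 2`.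
  have hr : ‖f₁ ψ * g ψ - f ψ * g₁ ψ‖ ≤ 2 * M ^ 2 * |ψ - t| * |ψ - t| := by
    have h1 : ∀ s ∈ Set.uIcc t ψ, HasDerivWithinAt (fun s => f₁ s * g s - f s * g₁ s)
        (f₂ s * g s - f s * g₂ s) (Set.uIcc t ψ) s := by
      intro s hs
      have hs' := hsub hs
      have h2 := ((hf₁ s hs').mul (hg s hs')).sub ((hf s hs').mul (hg₁ s hs'))
      refine HasDerivAt.hasDerivWithinAt (h2.congr_deriv ?_)
      ring
    have h2 : ∀ s ∈ Set.uIcc t ψ, ‖f₂ s * g s - f s * g₂ s‖ ≤ 2 * M ^ 2 * |ψ - t| := by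
      intro s hs
      have hs' := hsub hs
      calc ‖f₂ s * g s - f s * g₂ s‖ ≤ ‖f₂ s‖ * ‖g s‖ + ‖f s‖ * ‖g₂ s‖ := by
            rw [← norm_mul, ← norm_mul]; exact norm_sub_le _ _
        _ ≤ M * (M * |ψ - t|) + (M * |ψ - t|) * M := by
            have h3 := hle s hs
            gcongr
            · exact bf₂ s hs'
            · exact (hgl s hs').trans (by gcongr)
            · exact (hfl s hs').trans (by gcongr)
            · exact bg₂ s hs'
        _ = _ := by ring
    have h3 := (convex_uIcc t ψ).norm_image_sub_le_of_norm_hasDerivWithin_le h1 h2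
      Set.left_mem_uIcc Set.right_mem_uIcc
    simpa [hft, hgt] using h3
  have hX : ‖f₂ ψ * g ψ - f ψ * g₂ ψ‖ ≤ 2 * M ^ 2 * |ψ - t| := by
    calc ‖f₂ ψ * g ψ - f ψ * g₂ ψ‖ ≤ ‖f₂ ψ‖ * ‖g ψ‖ + ‖f ψ‖ * ‖g₂ ψ‖ := by
          rw [← norm_mul, ← norm_mul]; exact norm_sub_le _ _
      _ ≤ M * (M * |ψ - t|) + (M * |ψ - t|) * M := by
          gcongr
          · exact bf₂ ψ hψ
          · exact hgl ψ hψ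
          · exact hfl ψ hψ
          · exact bg₂ ψ hψ
      _ = _ := by ring
  have hgc' := hgc ψ hψ
  refine ⟨?_, ?_, ?_⟩
  · have h1 := ((hf₁ ψ hψ).mul (hg ψ hψ)).sub ((hf ψ hψ).mul (hg₁ ψ hψ))
    have h2 := h1.div ((hg ψ hψ).pow 2) (pow_ne_zero 2 hg0)
    refine h2.congr_deriv ?_
    simp only [Pi.mul_apply, Pi.sub_apply, Pi.pow_apply]
    field_simp
    ring
  · rw [norm_div, norm_pow, div_le_iff₀ (by positivity)]
    have h1 : (c * |ψ - t|) ^ 2 ≤ ‖g ψ‖ ^ 2 := by gcongr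
    calc ‖f₁ ψ * g ψ - f ψ * g₁ ψ‖ ≤ 2 * M ^ 2 * |ψ - t| * |ψ - t| := hr
      _ = 2 * M ^ 2 / c ^ 2 * (c * |ψ - t|) ^ 2 := by field_simp
      _ ≤ (2 * M ^ 2 / c ^ 2 + 4 * M ^ 3 / c ^ 3) * ‖g ψ‖ ^ 2 := by
          have : 0 ≤ 4 * M ^ 3 / c ^ 3 := by positivity
          gcongr
          linarith
  · have h4 : ‖((f₂ ψ * g ψ - f ψ * g₂ ψ) * g ψ - 2 * g₁ ψ * (f₁ ψ * g ψ - f ψ * g₁ ψ)) / g ψ ^ 3‖ ≤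
        2 * M ^ 2 * |ψ - t| / ‖g ψ‖ ^ 2 + 2 * M * (2 * M ^ 2 * |ψ - t| * |ψ - t|) / ‖g ψ‖ ^ 3 := by
      rw [sub_div]
      refine (norm_sub_le _ _).trans ?_
      have e1 : (f₂ ψ * g ψ - f ψ * g₂ ψ) * g ψ / g ψ ^ 3 =
          (f₂ ψ * g ψ - f ψ * g₂ ψ) / g ψ ^ 2 := by
        field_simp
      rw [e1, norm_div, norm_pow, norm_div, norm_pow, norm_mul, norm_mul]
      have : ‖(2 : ℂ)‖ = 2 := by norm_num
      rw [this]
      gcongr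
      exact bg₁ ψ hψ
    have h5 : 2 * M ^ 2 * |ψ - t| / ‖g ψ‖ ^ 2 ≤ 2 * M ^ 2 * |ψ - t| / (c * |ψ - t|) ^ 2 := by gcongr
    have h6 : 2 * M * (2 * M ^ 2 * |ψ - t| * |ψ - t|) / ‖g ψ‖ ^ 3 ≤
        2 * M * (2 * M ^ 2 * |ψ - t| * |ψ - t|) / (c * |ψ - t|) ^ 3 := by gcongr
    calc _ ≤ (2 * M ^ 2 * |ψ - t| / (c * |ψ - t|) ^ 2 +
          2 * M * (2 * M ^ 2 * |ψ - t| * |ψ - t|) / (c * |ψ - t|) ^ 3) * |ψ - t| := by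
          gcongr; linarith
      _ = _ := by field_simp; ring

/-- First derivative estimate: an oscillatory integral over an interval at distance `δ` from the
stationary point `t`. -/
lemma norm_integral_le_of_nonstationary {a b t c M Q N δ : ℝ} (hab : a ≤ b) (hc : 0 < c)
    (hδ : 0 < δ) (hN : 0 < N) {E A A' : ℝ → ℂ} {γ γ' : ℝ → ℝ} (hA'm : Measurable A')
    (hγ'm : Measurable γ') (hdist : ∀ ψ ∈ Set.Icc a b, δ ≤ |ψ - t|)
    (hE : ∀ ψ ∈ Set.Icc a b, HasDerivAt E (Complex.I * N * γ ψ * E ψ) ψ)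
    (bE : ∀ ψ ∈ Set.Icc a b, ‖E ψ‖ ≤ 1)
    (hγ : ∀ ψ ∈ Set.Icc a b, HasDerivAt γ (γ' ψ) ψ) (bγ : ∀ ψ ∈ Set.Icc a b, |γ' ψ| ≤ M)
    (hγc : ∀ ψ ∈ Set.Icc a b, c * |ψ - t| ≤ |γ ψ|)
    (hA : ∀ ψ ∈ Set.Icc a b, HasDerivAt A (A' ψ) ψ) (bA : ∀ ψ ∈ Set.Icc a b, ‖A ψ‖ ≤ Q)
    (bA' : ∀ ψ ∈ Set.Icc a b, ‖A' ψ‖ * |ψ - t| ≤ Q) :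
    ‖∫ ψ in a..b, A ψ * E ψ‖ ≤ (1 / N) * ((4 * Q / c + 2 * (Q * M / c ^ 2)) / δ) := by
  have hQ : 0 ≤ Q := (norm_nonneg _).trans (bA a (Set.left_mem_Icc.mpr hab))
  have hM : 0 ≤ M := (abs_nonneg _).trans (bγ a (Set.left_mem_Icc.mpr hab))
  have hupos : ∀ ψ ∈ Set.Icc a b, 0 < |ψ - t| := fun ψ h => hδ.trans_le (hdist ψ h)
  have hγ0 : ∀ ψ ∈ Set.Icc a b, γ ψ ≠ 0 := fun ψ h =>
    abs_pos.mp ((mul_pos hc (hupos ψ h)).trans_le (hγc ψ h))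
  set B' : ℝ → ℂ := fun ψ => A' ψ / γ ψ - A ψ * γ' ψ / (γ ψ : ℂ) ^ 2 with hB'
  have hB : ∀ ψ ∈ Set.Icc a b, HasDerivAt (fun s => A s / γ s) (B' ψ) ψ := by
    intro ψ h
    have h1 : (γ ψ : ℂ) ≠ 0 := by exact_mod_cast hγ0 ψ h
    refine ((hA ψ h).div (hγ ψ h).ofReal_comp h1).congr_deriv ?_
    simp only [hB']
    field_simp
  have bB : ∀ ψ ∈ Set.Icc a b, ‖A ψ / γ ψ‖ ≤ Q / (c * δ) := by
    intro ψ h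
    rw [norm_div, Complex.norm_real, Real.norm_eq_abs]
    have := bA ψ h
    have h2 : c * δ ≤ |γ ψ| := le_trans (by gcongr; exact hdist ψ h) (hγc ψ h)
    gcongr
  have bB' : ∀ ψ ∈ Set.Icc a b, ‖B' ψ‖ ≤ (Q / c + Q * M / c ^ 2) * (1 / (ψ - t) ^ 2) := by
    intro ψ h
    have hu := hupos ψ h
    have h2 := hγc ψ h
    have h3 : ‖A' ψ‖ ≤ Q / |ψ - t| := by rw [le_div_iff₀ hu]; exact bA' ψ h
    rw [← sq_abs (ψ - t)]
    refine (norm_sub_le _ _).trans ?_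
    rw [norm_div, norm_div, norm_mul, norm_pow, Complex.norm_real, Complex.norm_real,
      Real.norm_eq_abs, Real.norm_eq_abs]
    calc ‖A' ψ‖ / |γ ψ| + ‖A ψ‖ * |γ' ψ| / |γ ψ| ^ 2 ≤
          Q / |ψ - t| / (c * |ψ - t|) + Q * M / (c * |ψ - t|) ^ 2 := by
          have := bA ψ h; have := bγ ψ h
          gcongr
      _ = _ := by field_simp
  have hint1 : IntervalIntegrable (fun ψ : ℝ => (Q / c + Q * M / c ^ 2) * (1 / (ψ - t) ^ 2))
      MeasureTheory.volume a b := by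
    refine ContinuousOn.intervalIntegrable ?_
    rw [Set.uIcc_of_le hab]
    refine continuousOn_const.mul (continuousOn_const.div (by fun_prop) ?_)
    intro ψ h
    exact pow_ne_zero 2 (abs_pos.mp (hupos ψ h))
  have hcA : ContinuousOn A (Set.Icc a b) := fun ψ h => (hA ψ h).continuousAt.continuousWithinAt
  have hcγ : ContinuousOn γ (Set.Icc a b) := fun ψ h => (hγ ψ h).continuousAt.continuousWithinAt
  have hcE : ContinuousOn E (Set.Icc a b) := fun ψ h => (hE ψ h).continuousAt.continuousWithinAt
  have hmeas : ∀ f : ℝ → ℂ, ContinuousOn f (Set.Icc a b) → MeasureTheory.AEStronglyMeasurable f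
      (MeasureTheory.volume.restrict (Set.uIoc a b)) := by
    intro f hf
    rw [Set.uIoc_of_le hab]
    exact (hf.mono Set.Ioc_subset_Icc_self).aestronglyMeasurable measurableSet_Ioc
  have hcγC : ContinuousOn (fun ψ => (γ ψ : ℂ)) (Set.Icc a b) :=
    Complex.continuous_ofReal.comp_continuousOn hcγ
  have hB'm : MeasureTheory.AEStronglyMeasurable (fun ψ => E ψ * B' ψ)
      (MeasureTheory.volume.restrict (Set.uIoc a b)) := by
    refine (hmeas E hcE).mul (MeasureTheory.AEStronglyMeasurable.sub ?_ ?_)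
    · exact (hA'm.aestronglyMeasurable.aemeasurable.div
        (hmeas _ hcγC).aemeasurable).aestronglyMeasurable
    · exact (((hmeas _ hcA).aemeasurable.mul
        (Complex.measurable_ofReal.comp hγ'm).aemeasurable).div
        ((hmeas _ hcγC).aemeasurable.pow_const 2)).aestronglyMeasurable
  have hae : ∀ᵐ ψ ∂(MeasureTheory.volume : MeasureTheory.Measure ℝ), ψ ∈ Set.Ioc a b →
      ‖E ψ * B' ψ‖ ≤ (Q / c + Q * M / c ^ 2) * (1 / (ψ - t) ^ 2) := by
    refine Eventually.of_forall fun ψ h => ?_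
    have h' := Set.Ioc_subset_Icc_self h
    rw [norm_mul]
    calc ‖E ψ‖ * ‖B' ψ‖ ≤ 1 * ‖B' ψ‖ := by gcongr; exact bE ψ h'
      _ ≤ _ := by rw [one_mul]; exact bB' ψ h'
  have hint2 : IntervalIntegrable (fun ψ => E ψ * B' ψ) MeasureTheory.volume a b := by
    refine hint1.mono_fun' hB'm ?_
    rw [Set.uIoc_of_le hab]
    exact (MeasureTheory.ae_restrict_iff' measurableSet_Ioc).mpr hae
  have hint3 : IntervalIntegrable (fun ψ => A ψ * E ψ) MeasureTheory.volume a b := by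
    refine ContinuousOn.intervalIntegrable ?_
    rw [Set.uIcc_of_le hab]
    exact hcA.mul hcE
  -- Integration by parts: `E` is the derivative of `E / (i N γ)`, up to a term with `(1 / γ)'`.
  have hftc := intervalIntegral.integral_eq_sub_of_hasDerivAt (a := a) (b := b)
    (f := fun s => E s * (A s / γ s)) (f' := fun ψ => Complex.I * N * (A ψ * E ψ) + E ψ * B' ψ)
    (by
      intro ψ h
      rw [Set.uIcc_of_le hab] at h
      have h1 : (γ ψ : ℂ) ≠ 0 := by exact_mod_cast hγ0 ψ h
      refine ((hE ψ h).mul (hB ψ h)).congr_deriv ?_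
      field_simp)
    ((hint3.const_mul _).add hint2)
  rw [intervalIntegral.integral_add (hint3.const_mul _) hint2,
    intervalIntegral.integral_const_mul] at hftc
  have hI2 : ‖∫ ψ in a..b, E ψ * B' ψ‖ ≤ (Q / c + Q * M / c ^ 2) * (2 / δ) := by
    refine (intervalIntegral.norm_integral_le_of_norm_le hab hae hint1).trans ?_
    rw [intervalIntegral.integral_const_mul]
    have hval : ∫ ψ in a..b, (1 / (ψ - t) ^ 2) = 1 / (a - t) - 1 / (b - t) := by
      rw [intervalIntegral.integral_eq_sub_of_hasDerivAt (f := fun ψ => -(1 / (ψ - t)))]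
      · ring
      · intro ψ h
        rw [Set.uIcc_of_le hab] at h
        have h0 : ψ - t ≠ 0 := abs_pos.mp (hupos ψ h)
        have h1 := (((hasDerivAt_id ψ).sub_const t).inv h0).neg
        simp only [one_div]
        refine h1.congr_deriv ?_
        simp [neg_div]
      · refine ContinuousOn.intervalIntegrable ?_
        rw [Set.uIcc_of_le hab]
        exact continuousOn_const.div (by fun_prop) fun ψ h => pow_ne_zero 2 (abs_pos.mp (hupos ψ h))
    rw [hval]
    have h1 : ∀ ψ ∈ Set.Icc a b, |1 / (ψ - t)| ≤ 1 / δ := by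
      intro ψ h
      rw [abs_div, abs_one]
      exact one_div_le_one_div_of_le hδ (hdist ψ h)
    have h2 := abs_le.mp (h1 a (Set.left_mem_Icc.mpr hab))
    have h3 := abs_le.mp (h1 b (Set.right_mem_Icc.mpr hab))
    have h4 : 1 / (a - t) - 1 / (b - t) ≤ 2 / δ := by
      have : 2 / δ = 1 / δ + 1 / δ := by ring
      linarith [h2.2, h3.1]
    gcongr
  have hbd : ∀ ψ ∈ Set.Icc a b, ‖E ψ * (A ψ / γ ψ)‖ ≤ Q / (c * δ) := by
    intro ψ h
    rw [norm_mul]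
    calc ‖E ψ‖ * ‖A ψ / γ ψ‖ ≤ 1 * (Q / (c * δ)) := by
          have := bB ψ h; have := bE ψ h
          gcongr
      _ = _ := one_mul _
  have hfin : ‖Complex.I * N * ∫ ψ in a..b, A ψ * E ψ‖ ≤
      Q / (c * δ) + Q / (c * δ) + (Q / c + Q * M / c ^ 2) * (2 / δ) := by
    rw [eq_sub_of_add_eq hftc]
    refine (norm_sub_le _ _).trans (add_le_add ((norm_sub_le _ _).trans (add_le_add ?_ ?_)) hI2)
    · exact hbd b (Set.right_mem_Icc.mpr hab)
    · exact hbd a (Set.left_mem_Icc.mpr hab)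
  rw [norm_mul, norm_mul, Complex.norm_I, one_mul, Complex.norm_real, Real.norm_of_nonneg hN.le]
    at hfin
  rw [one_div, inv_mul_eq_div, le_div_iff₀' hN]
  refine hfin.trans (le_of_eq ?_)
  field_simp
  ring

/-- Van der Corput's estimate `O(N^{-1/2})` for a phase with one nondegenerate stationary point `t`.
The amplitude is allowed to be singular at `t`, with a derivative that is `O(1 / |ψ - t|)`. -/
lemma norm_integral_le_of_stationary {a b t c M Q N : ℝ} (ht : t ∈ Set.Icc a b) (hc : 0 < c)
    (hN : 0 < N) {E A A' : ℝ → ℂ} {γ γ' : ℝ → ℝ} (hA'm : Measurable A') (hγ'm : Measurable γ')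
    (hint : IntervalIntegrable (fun ψ => A ψ * E ψ) MeasureTheory.volume a b)
    (hE : ∀ ψ ∈ Set.Icc a b, HasDerivAt E (Complex.I * N * γ ψ * E ψ) ψ)
    (bE : ∀ ψ ∈ Set.Icc a b, ‖E ψ‖ ≤ 1)
    (hγ : ∀ ψ ∈ Set.Icc a b, HasDerivAt γ (γ' ψ) ψ) (bγ : ∀ ψ ∈ Set.Icc a b, |γ' ψ| ≤ M)
    (hγc : ∀ ψ ∈ Set.Icc a b, c * |ψ - t| ≤ |γ ψ|)
    (hA : ∀ ψ ∈ Set.Icc a b, ψ ≠ t → HasDerivAt A (A' ψ) ψ)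
    (bA : ∀ ψ ∈ Set.Icc a b, ψ ≠ t → ‖A ψ‖ ≤ Q)
    (bA' : ∀ ψ ∈ Set.Icc a b, ψ ≠ t → ‖A' ψ‖ * |ψ - t| ≤ Q) (hQ : 0 ≤ Q) :
    ‖∫ ψ in a..b, A ψ * E ψ‖ ≤ (2 * Q + 8 * Q / c + 4 * (Q * M / c ^ 2)) / √N := by
  have hM : 0 ≤ M := (abs_nonneg _).trans (bγ t ht)
  have hs : 0 < √N := Real.sqrt_pos.mpr hN
  -- Within `δ = N ^ (-1 / 2)` of `t` the trivial bound is used, outside the nonstationary one.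
  set δ := 1 / √N with hδdef
  have hδ : 0 < δ := by positivity
  set s₁ := max a (t - δ) with hs₁
  set s₂ := min b (t + δ) with hs₂
  have h1 : a ≤ s₁ := le_max_left _ _
  have h2 : s₁ ≤ t := max_le ht.1 (by linarith)
  have h3 : t ≤ s₂ := le_min ht.2 (by linarith)
  have h4 : s₂ ≤ b := min_le_left _ _
  have hsub : ∀ u v : ℝ, u ∈ Set.Icc a b → v ∈ Set.Icc a b →
      IntervalIntegrable (fun ψ => A ψ * E ψ) MeasureTheory.volume u v := by
    intro u v hu hv
    refine hint.mono_set ?_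
    rw [Set.uIcc_of_le (ht.1.trans ht.2)]
    exact Set.uIcc_subset_Icc hu hv
  have m1 : s₁ ∈ Set.Icc a b := ⟨h1, by linarith [ht.2]⟩
  have m2 : s₂ ∈ Set.Icc a b := ⟨by linarith [ht.1], h4⟩
  have ma : a ∈ Set.Icc a b := ⟨le_rfl, ht.1.trans ht.2⟩
  have mb : b ∈ Set.Icc a b := ⟨ht.1.trans ht.2, le_rfl⟩
  have hsplit : ∫ ψ in a..b, A ψ * E ψ = (∫ ψ in a..s₁, A ψ * E ψ) + (∫ ψ in s₁..s₂, A ψ * E ψ) +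
      ∫ ψ in s₂..b, A ψ * E ψ := by
    rw [intervalIntegral.integral_add_adjacent_intervals (hsub _ _ ma m1) (hsub _ _ m1 m2),
      intervalIntegral.integral_add_adjacent_intervals (hsub _ _ ma m2) (hsub _ _ m2 mb)]
  have outer : ∀ u v : ℝ, u ≤ v → u ∈ Set.Icc a b → v ∈ Set.Icc a b →
      (u = v ∨ ∀ ψ ∈ Set.Icc u v, δ ≤ |ψ - t|) →
      ‖∫ ψ in u..v, A ψ * E ψ‖ ≤ (1 / N) * ((4 * Q / c + 2 * (Q * M / c ^ 2)) / δ) := by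
    intro u v huv hu hv hd
    rcases hd with rfl | hd
    · rw [intervalIntegral.integral_same, norm_zero]; positivity
    have hI : Set.Icc u v ⊆ Set.Icc a b := Set.Icc_subset_Icc hu.1 hv.2
    have hne : ∀ ψ ∈ Set.Icc u v, ψ ≠ t := by
      rintro ψ hψ rfl
      have := hd ψ hψ
      rw [sub_self, abs_zero] at this
      linarith
    exact norm_integral_le_of_nonstationary huv hc hδ hN hA'm hγ'm hd
      (fun ψ h => hE ψ (hI h)) (fun ψ h => bE ψ (hI h)) (fun ψ h => hγ ψ (hI h))
      (fun ψ h => bγ ψ (hI h)) (fun ψ h => hγc ψ (hI h)) (fun ψ h => hA ψ (hI h) (hne ψ h))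
      (fun ψ h => bA ψ (hI h) (hne ψ h)) (fun ψ h => bA' ψ (hI h) (hne ψ h))
  have o1 := outer a s₁ h1 ma m1 (by
    rcases max_choice a (t - δ) with h | h
    · left; rw [hs₁, h]
    · right; intro ψ hψ
      have : ψ ≤ t - δ := by rw [← h]; exact hψ.2
      rw [abs_of_nonpos (by linarith)]; linarith)
  have o2 := outer s₂ b h4 m2 mb (by
    rcases min_choice b (t + δ) with h | h
    · left; rw [hs₂, h]
    · right; intro ψ hψ
      have : t + δ ≤ ψ := by rw [← h]; exact hψ.1
      rw [abs_of_nonneg (by linarith)]; linarith)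
  have inner : ‖∫ ψ in s₁..s₂, A ψ * E ψ‖ ≤ Q * (2 * δ) := by
    have hb : ∀ᵐ ψ ∂(MeasureTheory.volume : MeasureTheory.Measure ℝ), ψ ∈ Set.uIoc s₁ s₂ →
        ‖A ψ * E ψ‖ ≤ Q := by
      have hne : ∀ᵐ p : ℝ, p ∉ ({t} : Set ℝ) :=
        Set.Countable.ae_notMem (Set.toFinite _).countable _
      filter_upwards [hne] with ψ hψt hψ
      rw [Set.uIoc_of_le (h2.trans h3)] at hψ
      have hψ' : ψ ∈ Set.Icc a b := ⟨by linarith [hψ.1], by linarith [hψ.2]⟩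
      rw [norm_mul]
      calc ‖A ψ‖ * ‖E ψ‖ ≤ Q * 1 := by
            have := bA ψ hψ' hψt; have := bE ψ hψ'
            gcongr
        _ = Q := mul_one _
    refine (intervalIntegral.norm_integral_le_of_norm_le_const_ae hb).trans ?_
    rw [abs_of_nonneg (by linarith)]
    have h5 : t - δ ≤ s₁ := le_max_right _ _
    have h6 : s₂ ≤ t + δ := min_le_right _ _
    gcongr
    linarith
  rw [hsplit]
  refine (norm_add₃_le).trans ((add_le_add (add_le_add o1 inner) o2).trans (le_of_eq ?_))
  have e : ∀ X : ℝ, (1 / N) * (X / δ) = X / √N := by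
    intro X
    rw [hδdef, eq_div_iff hs.ne']
    have h5 := Real.mul_self_sqrt hN.le
    calc 1 / N * (X / (1 / √N)) * √N = 1 / N * X * (√N * √N) := by field_simp
      _ = X := by rw [h5]; field_simp
  rw [e, hδdef]
  ring

/-- Integration by parts across the stationary point `t`, for an amplitude `F` that vanishes at
`t`. -/
lemma integral_by_parts_stationary {a b t c M Q N : ℝ} (ht : t ∈ Set.Ioo a b) (hc : 0 < c)
    {E F F₁ D D₁ W : ℝ → ℂ}
    (hF : ∀ ψ ∈ Set.Icc a b, HasDerivAt F (F₁ ψ) ψ) (hD : ∀ ψ ∈ Set.Icc a b, HasDerivAt D (D₁ ψ) ψ)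
    (hE : ∀ ψ ∈ Set.Icc a b, HasDerivAt E (Complex.I * N * (D ψ * W ψ) * E ψ) ψ)
    (bE : ∀ ψ ∈ Set.Icc a b, ‖E ψ‖ ≤ M)
    (hF₁ : Measurable F₁) (hD₁ : Measurable D₁) (hW : ContinuousOn W (Set.Icc a b))
    (hFt : F t = 0) (hDt : D t = 0) (hDc : ∀ ψ ∈ Set.Icc a b, c * |ψ - t| ≤ ‖D ψ‖)
    (hH : ∀ ψ ∈ Set.Icc a b, ψ ≠ t → ‖(F₁ ψ * D ψ - F ψ * D₁ ψ) / D ψ ^ 2‖ ≤ Q) :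
    IntervalIntegrable (fun ψ => (F₁ ψ * D ψ - F ψ * D₁ ψ) / D ψ ^ 2 * E ψ)
      MeasureTheory.volume a b ∧
    Complex.I * N * ∫ ψ in a..b, F ψ * W ψ * E ψ = E b * (F b / D b) - E a * (F a / D a) -
      ∫ ψ in a..b, (F₁ ψ * D ψ - F ψ * D₁ ψ) / D ψ ^ 2 * E ψ := by
  have hab : a ≤ b := (ht.1.trans ht.2).le
  have ht' : t ∈ Set.Icc a b := Set.Ioo_subset_Icc_self ht
  have hcF : ContinuousOn F (Set.Icc a b) := fun ψ h => (hF ψ h).continuousAt.continuousWithinAt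
  have hcD : ContinuousOn D (Set.Icc a b) := fun ψ h => (hD ψ h).continuousAt.continuousWithinAt
  have hcE : ContinuousOn E (Set.Icc a b) := fun ψ h => (hE ψ h).continuousAt.continuousWithinAt
  have hDne : ∀ ψ ∈ Set.Icc a b, ψ ≠ t → D ψ ≠ 0 := by
    intro ψ h hne
    have : 0 < |ψ - t| := abs_pos.mpr (sub_ne_zero.mpr hne)
    exact norm_pos_iff.mp (lt_of_lt_of_le (by positivity) (hDc ψ h))
  have hdsl : ∀ f : ℝ → ℂ, f t = 0 → ∀ ψ, ψ ≠ t → dslope f t ψ = (ψ - t)⁻¹ • f ψ := by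
    intro f hf ψ h
    rw [dslope_of_ne f h, slope_def_module, hf, sub_zero]
  have hcont : ∀ f f₁ : ℝ → ℂ, (∀ ψ ∈ Set.Icc a b, HasDerivAt f (f₁ ψ) ψ) →
      ContinuousOn (dslope f t) (Set.Icc a b) := by
    intro f f₁ hf ψ h
    by_cases hne : ψ = t
    · subst hne
      exact (continuousAt_dslope_same.mpr (hf ψ h).differentiableAt).continuousWithinAt
    · exact ((continuousAt_dslope_of_ne hne).mpr (hf ψ h).continuousAt).continuousWithinAt
  have hDs : ∀ ψ ∈ Set.Icc a b, dslope D t ψ ≠ 0 := by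
    have hge : ∀ ψ ∈ Set.Icc a b, ψ ≠ t → c ≤ ‖dslope D t ψ‖ := by
      intro ψ h hne
      rw [hdsl D hDt ψ hne, norm_smul, norm_inv, Real.norm_eq_abs]
      have : 0 < |ψ - t| := abs_pos.mpr (sub_ne_zero.mpr hne)
      rw [inv_mul_eq_div, le_div_iff₀ this]
      exact hDc ψ h
    intro ψ h
    by_cases hne : ψ = t
    · subst hne
      have hca : ContinuousAt (dslope D ψ) ψ :=
        continuousAt_dslope_same.mpr (hD ψ h).differentiableAt
      have h1 : Tendsto (fun s => ‖dslope D ψ s‖) (𝓝[≠] ψ) (𝓝 ‖dslope D ψ ψ‖) :=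
        (hca.norm).tendsto.mono_left nhdsWithin_le_nhds
      have h2 : c ≤ ‖dslope D ψ ψ‖ := by
        refine ge_of_tendsto h1 ?_
        have : ∀ᶠ s in 𝓝[≠] ψ, s ∈ Set.Icc a b :=
          nhdsWithin_le_nhds (Icc_mem_nhds ht.1 ht.2)
        filter_upwards [this, self_mem_nhdsWithin] with s hs hs2
        exact hge s hs hs2
      exact norm_pos_iff.mp (hc.trans_le h2)
    · exact norm_pos_iff.mp (hc.trans_le (hge ψ h hne))
  -- `F / D` has a removable singularity at `t`: `H` is its continuous extension.
  set H : ℝ → ℂ := fun ψ => dslope F t ψ / dslope D t ψ with hHdef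
  have hHeq : ∀ ψ, ψ ≠ t → H ψ = F ψ / D ψ := by
    intro ψ hne
    simp only [hHdef]
    rw [hdsl F hFt ψ hne, hdsl D hDt ψ hne, Complex.real_smul, Complex.real_smul]
    refine mul_div_mul_left _ _ ?_
    exact_mod_cast inv_ne_zero (sub_ne_zero.mpr hne)
  have hHc : ContinuousOn H (Set.Icc a b) := (hcont F F₁ hF).div (hcont D D₁ hD) hDs
  have hHd : ∀ ψ ∈ Set.Icc a b, ψ ≠ t →
      HasDerivAt H ((F₁ ψ * D ψ - F ψ * D₁ ψ) / D ψ ^ 2) ψ := by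
    intro ψ h hne
    refine ((hF ψ h).div (hD ψ h) (hDne ψ h hne)).congr_of_eventuallyEq ?_
    filter_upwards [isOpen_ne.mem_nhds hne] with s hs
    exact hHeq s hs
  have hmeas : ∀ f : ℝ → ℂ, ContinuousOn f (Set.Icc a b) → AEMeasurable f
      (MeasureTheory.volume.restrict (Set.uIoc a b)) := by
    intro f hf
    rw [Set.uIoc_of_le hab]
    exact ((hf.mono Set.Ioc_subset_Icc_self).aestronglyMeasurable measurableSet_Ioc).aemeasurable
  have hne : ∀ᵐ p : ℝ, p ∉ ({t} : Set ℝ) :=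
    Set.Countable.ae_notMem (Set.toFinite _).countable _
  have hI1 : IntervalIntegrable (fun ψ => (F₁ ψ * D ψ - F ψ * D₁ ψ) / D ψ ^ 2 * E ψ)
      MeasureTheory.volume a b := by
    refine (intervalIntegrable_const (c := Q * M)).mono_fun' ?_ ?_
    · exact ((((hF₁.aemeasurable.mul (hmeas D hcD)).sub
        ((hmeas F hcF).mul hD₁.aemeasurable)).div ((hmeas D hcD).pow_const 2)).mul
        (hmeas E hcE)).aestronglyMeasurable
    · filter_upwards [MeasureTheory.ae_restrict_of_ae hne,
        MeasureTheory.ae_restrict_mem measurableSet_uIoc] with ψ h1 h2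
      rw [Set.uIoc_of_le hab] at h2
      have h2' := Set.Ioc_subset_Icc_self h2
      rw [norm_mul]
      have h3 := hH ψ h2' h1
      have h4 := bE ψ h2'
      have h5 : 0 ≤ Q := (norm_nonneg _).trans h3
      gcongr
  have hI2 : IntervalIntegrable (fun ψ => Complex.I * N * (F ψ * W ψ * E ψ))
      MeasureTheory.volume a b := by
    refine ContinuousOn.intervalIntegrable ?_
    rw [Set.uIcc_of_le hab]
    exact continuousOn_const.mul ((hcF.mul hW).mul hcE)
  refine ⟨hI1, ?_⟩
  -- Only continuity of the primitive is known at `t`; one exceptional point is harmless.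
  have key := MeasureTheory.integral_eq_of_hasDerivAt_off_countable_of_le
    (fun s => E s * H s) (fun ψ => Complex.I * N * (F ψ * W ψ * E ψ) +
      (F₁ ψ * D ψ - F ψ * D₁ ψ) / D ψ ^ 2 * E ψ) hab (s := {t}) (Set.countable_singleton t)
    (hcE.mul hHc) (by
      rintro ψ ⟨h1, h2⟩
      have h1' := Set.Ioo_subset_Icc_self h1
      refine ((hE ψ h1').mul (hHd ψ h1' h2)).congr_deriv ?_
      have hd0 := hDne ψ h1' h2
      rw [hHeq ψ h2]
      field_simp) (hI2.add hI1)
  rw [intervalIntegral.integral_add hI2 hI1, intervalIntegral.integral_const_mul,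
    hHeq a ht.1.ne, hHeq b ht.2.ne'] at key
  rw [← key]; ring

/-! ### Smooth parametrization of an arc of the level curve -/

/-- A maximal interval `[a, b]` on which the level curve `cos p (cos p + cos τ) = K` is real, inside
of a slightly larger interval `[a₀, b₀]`; the ends `a`, `b` are the branch points of `τ`. -/
structure Arc (K : ℝ) where
  a₀ : ℝ
  a : ℝ
  b : ℝ
  b₀ : ℝ
  /-- `dispY` divided by its simple zeros `a` and `b`. -/
  Z : ℝ → ℝ
  lower : -(π / 2) < a₀
  lt_left : a₀ < a
  lt_mid : a < b
  lt_right : b < b₀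
  upper : b₀ < π / 2
  contDiff_Z : ContDiff ℝ 2 Z
  Z_pos : ∀ p ∈ Set.Icc a b, 0 < Z p
  dispY_eq : ∀ p, dispY K p = Real.sin ((p - a) / 2) * Real.sin ((b - p) / 2) * Z p
  dispT_ends : dispT K a * dispT K b < 0
  dispY_left : ∀ p ∈ Set.Ico a₀ a, dispY K p < 0
  dispY_right : ∀ p ∈ Set.Ioc b b₀, dispY K p < 0
  dispT_left : ∀ p ∈ Set.Icc a₀ a, dispT K p ≠ 0
  dispT_right : ∀ p ∈ Set.Icc b b₀, dispT K p ≠ 0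

namespace Arc

variable {K : ℝ} (Γ : Arc K)

/-- The parameter `sin (h / 2)` of the substitution `sin ((p - m) / 2) = sin (h / 2) sin ψ`, where
`h` is half of the length of the interval `[a, b]` and `m` its midpoint. -/
def s : ℝ := Real.sin ((Γ.b - Γ.a) / 4)

/-- The midpoint of `[a, b]`. -/
def m : ℝ := (Γ.a + Γ.b) / 2

/-- The coordinate `p` as a function of the regular parameter `ψ`; the branch points are
`ψ = ± π / 2`. -/
def p (ψ : ℝ) : ℝ := Γ.m + 2 * Real.arcsin (Γ.s * Real.sin ψ)

/-- The function `cos p sin τ` on the arc, in the parameter `ψ`. -/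
def y (ψ : ℝ) : ℝ := Γ.s * Real.cos ψ * √(Γ.Z (Γ.p ψ))

/-- The density of the invariant measure `dp / (cos p sin τ)` in the parameter `ψ`. -/
def ω (ψ : ℝ) : ℝ := 2 / (Real.cos ((Γ.p ψ - Γ.m) / 2) * √(Γ.Z (Γ.p ψ)))

/-- The function `dispT` on the arc, in the parameter `ψ`. -/
def T (ψ : ℝ) : ℝ := dispT K (Γ.p ψ)

/-- The function `e^{iτ}` on the arc, in the parameter `ψ`. -/
def w (ψ : ℝ) : ℂ :=
  ((K - Real.cos (Γ.p ψ) ^ 2 : ℝ) + Complex.I * Γ.y ψ) / Real.cos (Γ.p ψ)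

/-- The function `e^{i(Xp + nτ)}` on the arc, in the parameter `ψ`. -/
def e (X n : ℤ) (ψ : ℝ) : ℂ := Complex.exp (Complex.I * (X * Γ.p ψ)) * Γ.w ψ ^ n

lemma s_pos : 0 < Γ.s :=
  Real.sin_pos_of_pos_of_lt_pi (by linarith [Γ.lt_mid])
    (by linarith [Γ.lower, Γ.lt_left, Γ.upper, Γ.lt_right, Real.pi_pos])

lemma s_lt_one : Γ.s < 1 := by
  have h : Γ.s < Real.sin (π / 2) := Real.sin_lt_sin_of_lt_of_le_pi_div_two
    (by linarith [Γ.lt_mid, Real.pi_pos]) le_rfl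
    (by linarith [Γ.lower, Γ.lt_left, Γ.upper, Γ.lt_right, Real.pi_pos])
  rwa [Real.sin_pi_div_two] at h

lemma abs_s_mul_sin_lt (ψ : ℝ) : |Γ.s * Real.sin ψ| < 1 := by
  rw [abs_mul, abs_of_pos Γ.s_pos]
  have := Real.abs_sin_le_one ψ
  have := Γ.s_lt_one
  nlinarith [Γ.s_pos, abs_nonneg (Real.sin ψ)]

lemma sin_half (ψ : ℝ) : Real.sin ((Γ.p ψ - Γ.m) / 2) = Γ.s * Real.sin ψ := by
  have h := abs_lt.mp (Γ.abs_s_mul_sin_lt ψ)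
  rw [p, add_sub_cancel_left, mul_div_cancel_left₀ _ two_ne_zero, Real.sin_arcsin h.1.le h.2.le]

lemma cos_half_pos (ψ : ℝ) : 0 < Real.cos ((Γ.p ψ - Γ.m) / 2) := by
  have h := abs_lt.mp (Γ.abs_s_mul_sin_lt ψ)
  rw [p, add_sub_cancel_left, mul_div_cancel_left₀ _ two_ne_zero, Real.cos_arcsin]
  exact Real.sqrt_pos.mpr (by nlinarith)

lemma arcsin_s : Real.arcsin Γ.s = (Γ.b - Γ.a) / 4 :=
  Real.arcsin_sin (by linarith [Γ.lt_mid, Real.pi_pos])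
    (by linarith [Γ.lower, Γ.lt_left, Γ.upper, Γ.lt_right, Real.pi_pos])

lemma p_mem (ψ : ℝ) : Γ.p ψ ∈ Set.Icc Γ.a Γ.b := by
  have h1 := Real.sin_le_one ψ
  have h2 := Real.neg_one_le_sin ψ
  have h3 : Real.arcsin (Γ.s * Real.sin ψ) ≤ Real.arcsin Γ.s :=
    Real.monotone_arcsin (by nlinarith [Γ.s_pos])
  have h4 : Real.arcsin (-Γ.s) ≤ Real.arcsin (Γ.s * Real.sin ψ) :=
    Real.monotone_arcsin (by nlinarith [Γ.s_pos])
  rw [Real.arcsin_neg] at h4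
  rw [arcsin_s] at h3 h4
  simp only [p, m]
  constructor <;> linarith

lemma p_right : Γ.p (π / 2) = Γ.b := by
  rw [p, Real.sin_pi_div_two, mul_one, arcsin_s, m]; ring

lemma p_left : Γ.p (-(π / 2)) = Γ.a := by
  rw [p, Real.sin_neg, Real.sin_pi_div_two, mul_neg, mul_one, Real.arcsin_neg, arcsin_s, m]; ring

lemma mem_Ioo {q : ℝ} (hq : q ∈ Set.Icc Γ.a₀ Γ.b₀) : q ∈ Set.Ioo (-(π / 2)) (π / 2) :=
  ⟨Γ.lower.trans_le hq.1, hq.2.trans_lt Γ.upper⟩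

lemma cos_pos {q : ℝ} (hq : q ∈ Set.Icc Γ.a₀ Γ.b₀) : 0 < Real.cos q :=
  Real.cos_pos_of_mem_Ioo (Γ.mem_Ioo hq)

lemma Icc_subset : Set.Icc Γ.a Γ.b ⊆ Set.Icc Γ.a₀ Γ.b₀ :=
  Set.Icc_subset_Icc Γ.lt_left.le Γ.lt_right.le

lemma cos_p_pos (ψ : ℝ) : 0 < Real.cos (Γ.p ψ) := Γ.cos_pos (Γ.Icc_subset (Γ.p_mem ψ))

lemma Z_p_pos (ψ : ℝ) : 0 < Γ.Z (Γ.p ψ) := Γ.Z_pos _ (Γ.p_mem ψ)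

lemma contDiff_p : ContDiff ℝ 2 Γ.p := by
  unfold p
  refine contDiff_const.add (contDiff_const.mul ?_)
  rw [contDiff_iff_contDiffAt]
  intro ψ
  have h := abs_lt.mp (Γ.abs_s_mul_sin_lt ψ)
  exact ContDiffAt.comp (g := Real.arcsin) (f := fun ψ => Γ.s * Real.sin ψ) ψ
    (Real.contDiffAt_arcsin h.1.ne' h.2.ne) (contDiffAt_const.mul Real.contDiff_sin.contDiffAt)

lemma contDiff_sqrt_Z : ContDiff ℝ 2 fun ψ => √(Γ.Z (Γ.p ψ)) :=
  (Γ.contDiff_Z.comp Γ.contDiff_p).sqrt fun ψ => (Γ.Z_p_pos ψ).ne'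

lemma contDiff_y : ContDiff ℝ 2 Γ.y := by
  unfold y
  exact (contDiff_const.mul Real.contDiff_cos).mul Γ.contDiff_sqrt_Z

lemma contDiff_ω : ContDiff ℝ 2 Γ.ω := by
  unfold ω
  refine contDiff_const.div ?_ fun ψ =>
    (mul_pos (Γ.cos_half_pos ψ) (Real.sqrt_pos.mpr (Γ.Z_p_pos ψ))).ne'
  exact (Real.contDiff_cos.comp ((Γ.contDiff_p.sub contDiff_const).div_const 2)).mul
    Γ.contDiff_sqrt_Z

lemma contDiff_T : ContDiff ℝ 2 Γ.T := by
  unfold T dispT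
  have hc := Real.contDiff_cos.comp Γ.contDiff_p
  exact ((Real.contDiff_sin.comp Γ.contDiff_p).mul (contDiff_const.add (hc.pow 2))).div hc
    fun ψ => (Γ.cos_p_pos ψ).ne'

lemma contDiff_ofReal {f : ℝ → ℝ} (hf : ContDiff ℝ 2 f) : ContDiff ℝ 2 fun ψ => (f ψ : ℂ) :=
  Complex.ofRealCLM.contDiff.comp hf

lemma contDiff_w : ContDiff ℝ 2 Γ.w := by
  unfold w
  have hc := Real.contDiff_cos.comp Γ.contDiff_p
  simp only [div_eq_mul_inv]
  refine ContDiff.mul ?_ ((contDiff_ofReal (f := fun ψ => Real.cos (Γ.p ψ)) hc).inv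
    fun ψ => by exact_mod_cast (Γ.cos_p_pos ψ).ne')
  exact (contDiff_ofReal (f := fun ψ => K - Real.cos (Γ.p ψ) ^ 2)
    (contDiff_const.sub (hc.pow 2))).add
    (contDiff_const.mul (contDiff_ofReal Γ.contDiff_y))

lemma ω_pos (ψ : ℝ) : 0 < Γ.ω ψ :=
  div_pos two_pos (mul_pos (Γ.cos_half_pos ψ) (Real.sqrt_pos.mpr (Γ.Z_p_pos ψ)))

lemma y_mul_ω (ψ : ℝ) :
    Γ.y ψ * Γ.ω ψ = 2 * Γ.s * Real.cos ψ / Real.cos ((Γ.p ψ - Γ.m) / 2) := by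
  have h1 := Γ.cos_half_pos ψ
  have h2 := Real.sqrt_pos.mpr (Γ.Z_p_pos ψ)
  unfold y ω
  field_simp

lemma hasDerivAt_p (ψ : ℝ) : HasDerivAt Γ.p (Γ.y ψ * Γ.ω ψ) ψ := by
  have h := abs_lt.mp (Γ.abs_s_mul_sin_lt ψ)
  have h1 := (Real.hasDerivAt_arcsin h.1.ne' h.2.ne).comp ψ
    ((Real.hasDerivAt_sin ψ).const_mul Γ.s)
  refine ((h1.const_mul 2).const_add Γ.m).congr_deriv ?_
  rw [y_mul_ω]
  have h2 : Real.cos ((Γ.p ψ - Γ.m) / 2) = √(1 - (Γ.s * Real.sin ψ) ^ 2) := by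
    rw [p, add_sub_cancel_left, mul_div_cancel_left₀ _ two_ne_zero, Real.cos_arcsin]
  rw [h2]; ring

lemma sin_mul_sin (q : ℝ) : Real.sin ((q - Γ.a) / 2) * Real.sin ((Γ.b - q) / 2) =
    Γ.s ^ 2 - Real.sin ((q - Γ.m) / 2) ^ 2 := by
  have h1 : (q - Γ.a) / 2 = (Γ.b - Γ.a) / 4 + (q - Γ.m) / 2 := by unfold m; ring
  have h2 : (Γ.b - q) / 2 = (Γ.b - Γ.a) / 4 - (q - Γ.m) / 2 := by unfold m; ring
  rw [h1, h2, Real.sin_add, Real.sin_sub, s]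
  have h3 := Real.sin_sq_add_cos_sq ((Γ.b - Γ.a) / 4)
  have h4 := Real.sin_sq_add_cos_sq ((q - Γ.m) / 2)
  generalize Real.sin ((Γ.b - Γ.a) / 4) = u at *
  generalize Real.sin ((q - Γ.m) / 2) = v at *
  generalize Real.cos ((Γ.b - Γ.a) / 4) = u' at *
  generalize Real.cos ((q - Γ.m) / 2) = v' at *
  linear_combination u ^ 2 * h4 - v ^ 2 * h3

lemma y_sq (ψ : ℝ) : Γ.y ψ ^ 2 = dispY K (Γ.p ψ) := by
  rw [Γ.dispY_eq, sin_mul_sin, sin_half, y, mul_pow, mul_pow, Real.sq_sqrt (Γ.Z_p_pos ψ).le]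
  have := Real.sin_sq_add_cos_sq ψ
  linear_combination Γ.s ^ 2 * Γ.Z (Γ.p ψ) * this

lemma y_nonneg {ψ : ℝ} (hψ : ψ ∈ Set.Icc (-(π / 2)) (π / 2)) : 0 ≤ Γ.y ψ :=
  mul_nonneg (mul_nonneg Γ.s_pos.le (Real.cos_nonneg_of_mem_Icc hψ)) (Real.sqrt_nonneg _)

lemma y_pos {ψ : ℝ} (hψ : ψ ∈ Set.Ioo (-(π / 2)) (π / 2)) : 0 < Γ.y ψ :=
  mul_pos (mul_pos Γ.s_pos (Real.cos_pos_of_mem_Ioo hψ)) (Real.sqrt_pos.mpr (Γ.Z_p_pos ψ))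

lemma _root_.TriangularLattice.hasDerivAt_dispY (K q : ℝ) : HasDerivAt (dispY K)
    (-2 * Real.sin q * Real.cos q * (1 + 2 * (K - Real.cos q ^ 2))) q := by
  have h := (Real.hasDerivAt_cos q).pow 2
  refine (h.sub ((h.const_sub K).pow 2)).congr_deriv ?_
  simp only [Pi.pow_apply]
  norm_num
  ring

lemma _root_.TriangularLattice.hasDerivAt_dispT (K : ℝ) {q : ℝ} (hq : Real.cos q ≠ 0) :
    HasDerivAt (dispT K)
      ((K - Real.cos q ^ 2 + 2 * Real.cos q ^ 4) / Real.cos q ^ 2) q := by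
  have h := (Real.hasDerivAt_cos q)
  refine (((Real.hasDerivAt_sin q).mul ((h.pow 2).const_add K)).div h hq).congr_deriv ?_
  have h2 : Real.sin q ^ 2 = 1 - Real.cos q ^ 2 := by rw [Real.sin_sq]
  simp only [Pi.mul_apply, Pi.pow_apply]
  rw [div_eq_div_iff (by positivity) (by positivity)]
  simp only [Nat.cast_ofNat, Nat.reduceSub, pow_one]
  ring_nf
  rw [h2]
  ring

lemma hasDerivAt_y (ψ : ℝ) : HasDerivAt Γ.y
    (-Real.sin (Γ.p ψ) * Real.cos (Γ.p ψ) * (1 + 2 * (K - Real.cos (Γ.p ψ) ^ 2)) * Γ.ω ψ) ψ := by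
  set q := Γ.p ψ with hq
  have hZd : HasDerivAt Γ.Z (deriv Γ.Z q) q :=
    (Γ.contDiff_Z.differentiable (by norm_num) q).hasDerivAt
  have hZ := Γ.Z_p_pos ψ
  have hs := Real.sqrt_pos.mpr hZ
  have h1 : HasDerivAt Γ.y _ ψ := ((Real.hasDerivAt_cos ψ).const_mul Γ.s).mul
    ((hZd.comp ψ (Γ.hasDerivAt_p ψ)).sqrt hZ.ne')
  refine h1.congr_deriv ?_
  have hmul : HasDerivAt (dispY K) (-(Real.sin ((q - Γ.m) / 2) * Real.cos ((q - Γ.m) / 2)) * Γ.Z q +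
      (Γ.s ^ 2 - Real.sin ((q - Γ.m) / 2) ^ 2) * deriv Γ.Z q) q := by
    have h2 : dispY K = fun x => (Γ.s ^ 2 - Real.sin ((x - Γ.m) / 2) ^ 2) * Γ.Z x := by
      funext x; rw [Γ.dispY_eq, sin_mul_sin]
    rw [h2]
    have h3 := (((hasDerivAt_id q).sub_const Γ.m).div_const 2).sin.pow 2
    refine ((h3.const_sub (Γ.s ^ 2)).mul hZd).congr_deriv ?_
    simp only [id, Nat.cast_ofNat, Nat.reduceSub, pow_one, Pi.pow_apply]
    ring
  have h4 := (hasDerivAt_dispY K q).unique hmul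
  rw [hq, sin_half, ← hq] at h4
  have h5 : -Real.sin q * Real.cos q * (1 + 2 * (K - Real.cos q ^ 2)) =
      (-(Γ.s * Real.sin ψ * Real.cos ((q - Γ.m) / 2)) * Γ.Z q +
        (Γ.s ^ 2 - (Γ.s * Real.sin ψ) ^ 2) * deriv Γ.Z q) / 2 := by
    rw [← h4]; ring
  rw [h5, y_mul_ω]
  simp only [ω, ← hq, Function.comp]
  have hch := Γ.cos_half_pos ψ
  rw [← hq] at hch hs hZ
  have h6 : √(Γ.Z q) * √(Γ.Z q) = Γ.Z q := Real.mul_self_sqrt hZ.le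
  generalize √(Γ.Z q) = r at *
  rw [← h6]
  have h7 : Real.sin ψ ^ 2 = 1 - Real.cos ψ ^ 2 := Real.sin_sq ψ
  field_simp
  rw [h7]
  ring

lemma hasDerivAt_w (ψ : ℝ) :
    HasDerivAt Γ.w (-Complex.I * Γ.T ψ * Γ.ω ψ * Γ.w ψ) ψ := by
  have hc := Γ.cos_p_pos ψ
  have hcC : (Real.cos (Γ.p ψ) : ℂ) ≠ 0 := by exact_mod_cast hc.ne'
  have hcos := (Γ.hasDerivAt_p ψ).cos
  have h1 := ((((hcos.pow 2).const_sub K).ofReal_comp).add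
    ((Γ.hasDerivAt_y ψ).ofReal_comp.const_mul Complex.I)).div hcos.ofReal_comp hcC
  refine h1.congr_deriv ?_
  have hy : (Γ.y ψ : ℂ) ^ 2 =
      (Real.cos (Γ.p ψ) : ℂ) ^ 2 - (K - (Real.cos (Γ.p ψ) : ℂ) ^ 2) ^ 2 := by
    have := Γ.y_sq ψ
    rw [dispY] at this
    exact_mod_cast this
  simp only [T, dispT, w, Pi.add_apply, Pi.pow_apply]
  push_cast at hcC hy ⊢
  generalize (Γ.y ψ : ℂ) = Y at *
  generalize Complex.cos (Γ.p ψ : ℂ) = c at *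
  generalize Complex.sin (Γ.p ψ : ℂ) = σ at *
  generalize (Γ.ω ψ : ℂ) = o at *
  field_simp
  linear_combination (σ * o * Complex.I) * hy + (σ * o * Y * (K + c ^ 2)) * Complex.I_sq

lemma w_ne_zero (ψ : ℝ) : Γ.w ψ ≠ 0 := by
  have hc := Γ.cos_p_pos ψ
  have hcC : (Real.cos (Γ.p ψ) : ℂ) ≠ 0 := by exact_mod_cast hc.ne'
  refine div_ne_zero ?_ hcC
  intro h
  have h1 := congrArg Complex.re h
  have h2 := congrArg Complex.im h
  have h3 := Γ.y_sq ψ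
  simp only [Complex.add_re, Complex.add_im, Complex.ofReal_re, Complex.ofReal_im,
    Complex.I_mul_re, Complex.I_mul_im, Complex.zero_re, Complex.zero_im] at h1 h2
  rw [dispY] at h3
  nlinarith

lemma hasDerivAt_e (X n : ℤ) (ψ : ℝ) :
    HasDerivAt (Γ.e X n) (Complex.I * ((X * Γ.y ψ - n * Γ.T ψ) * Γ.ω ψ) * Γ.e X n ψ) ψ := by
  have h1 := (((Γ.hasDerivAt_p ψ).ofReal_comp.const_mul (X : ℂ)).const_mul Complex.I).cexp
  have h2 := (hasDerivAt_zpow n (Γ.w ψ) (Or.inl (Γ.w_ne_zero ψ))).comp ψ (Γ.hasDerivAt_w ψ)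
  refine (h1.mul h2).congr_deriv ?_
  simp only [e, Function.comp]
  rw [zpow_sub_one₀ (Γ.w_ne_zero ψ)]
  have := Γ.w_ne_zero ψ
  push_cast
  field_simp
  ring

lemma contDiff_e (X n : ℤ) : ContDiff ℝ 2 (Γ.e X n) := by
  unfold e
  refine ContDiff.mul ?_ ?_
  · exact (contDiff_const.mul (contDiff_const.mul (contDiff_ofReal Γ.contDiff_p))).cexp
  · obtain ⟨k, rfl | rfl⟩ := n.eq_nat_or_neg
    · simpa using Γ.contDiff_w.pow k
    · simp only [zpow_neg, zpow_natCast]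
      exact (Γ.contDiff_w.pow k).inv fun ψ => pow_ne_zero k (Γ.w_ne_zero ψ)

lemma e_add (X n X' n' : ℤ) (ψ : ℝ) : Γ.e (X + X') (n + n') ψ = Γ.e X n ψ * Γ.e X' n' ψ := by
  simp only [e]
  rw [zpow_add₀ (Γ.w_ne_zero ψ)]
  push_cast
  rw [add_mul, mul_add, Complex.exp_add]
  ring

lemma norm_w (ψ : ℝ) : ‖Γ.w ψ‖ = 1 := by
  have hc := Γ.cos_p_pos ψ
  have h1 : ‖((K - Real.cos (Γ.p ψ) ^ 2 : ℝ) : ℂ) + Complex.I * Γ.y ψ‖ = Real.cos (Γ.p ψ) := by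
    rw [mul_comm, Complex.norm_add_mul_I, y_sq, dispY, add_sub_cancel, Real.sqrt_sq hc.le]
  rw [w, norm_div, h1, Complex.norm_real, Real.norm_of_nonneg hc.le, div_self hc.ne']

lemma norm_e (X n : ℤ) (ψ : ℝ) : ‖Γ.e X n ψ‖ = 1 := by
  rw [e, norm_mul, norm_zpow, norm_w, one_zpow, mul_one]
  have : Complex.I * (X * Γ.p ψ) = ((X * Γ.p ψ : ℝ) : ℂ) * Complex.I := by push_cast; ring
  rw [this, Complex.norm_exp_ofReal_mul_I]

lemma dispRoot_p {ψ : ℝ} (hψ : ψ ∈ Set.Icc (-(π / 2)) (π / 2)) : dispRoot K (Γ.p ψ) = Γ.y ψ := by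
  rw [dispRoot, ← y_sq, if_pos (sq_nonneg _), Real.sqrt_sq (Γ.y_nonneg hψ)]

lemma mon_p {ψ : ℝ} (hψ : ψ ∈ Set.Icc (-(π / 2)) (π / 2)) (X n : ℤ) :
    mon K X n (Γ.p ψ) = Γ.e X n ψ := by
  rw [mon, e, dispW, w, Γ.dispRoot_p hψ]

/-! ### Strict convexity of the arc -/

/-- The curvature of the level curve does not vanish: the Wronskian `y T' - T y'` is a sum of terms
of the sign of `K`. -/
lemma wronskian_identity {c : ℝ} (hc : c ≠ 0) (K : ℝ) :
    (c ^ 2 - (K - c ^ 2) ^ 2) * ((K - c ^ 2 + 2 * c ^ 4) / c ^ 2) +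
      (1 - c ^ 2) * (K + c ^ 2) * (1 + 2 * (K - c ^ 2)) =
    K * ((2 - K) * (1 + 4 * K) / 3 + (4 / 3) * (((3 * c ^ 2 - 1 - K) / 2) ^ 2 +
      (3 / 4) * ((1 - c ^ 2) * (c ^ 2 - (K - c ^ 2) ^ 2) / c ^ 2))) := by
  field_simp
  ring

lemma hasDerivAt_slope {ψ : ℝ} (hψ : ψ ∈ Set.Ioo (-(π / 2)) (π / 2)) :
    HasDerivAt (fun t => K * (Γ.T t / Γ.y t)) (K ^ 2 * ((2 - K) * (1 + 4 * K) / 3 +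
      (4 / 3) * (((3 * Real.cos (Γ.p ψ) ^ 2 - 1 - K) / 2) ^ 2 +
      (3 / 4) * ((1 - Real.cos (Γ.p ψ) ^ 2) * Γ.y ψ ^ 2 / Real.cos (Γ.p ψ) ^ 2))) *
      Γ.ω ψ / Γ.y ψ ^ 2) ψ := by
  have hc := Γ.cos_p_pos ψ
  have hy := Γ.y_pos hψ
  have hT : HasDerivAt Γ.T _ ψ := (hasDerivAt_dispT K hc.ne').comp ψ (Γ.hasDerivAt_p ψ)
  refine ((hT.div (Γ.hasDerivAt_y ψ) hy.ne').const_mul K).congr_deriv ?_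
  have h1 := wronskian_identity hc.ne' K
  have h2 : Γ.y ψ ^ 2 = Real.cos (Γ.p ψ) ^ 2 - (K - Real.cos (Γ.p ψ) ^ 2) ^ 2 := by
    rw [y_sq, dispY]
  rw [← h2] at h1
  rw [pow_two K, mul_assoc K K, ← h1]
  have h3 : Real.sin (Γ.p ψ) ^ 2 = 1 - Real.cos (Γ.p ψ) ^ 2 := Real.sin_sq _
  simp only [T, dispT]
  rw [← h3]
  field_simp
  ring

/-- The stationary points of the phases `μ p + τ` on the arc are uniformly nondegenerate. -/
lemma exists_stationary_bound (hK : Admissible K) : ∃ c : ℝ, 0 < c ∧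
    ∀ μ : ℝ, |μ| ≤ 2 → ∀ t ∈ Set.Ioo (-(π / 2)) (π / 2), μ * Γ.y t = Γ.T t →
      ∀ ψ ∈ Set.Icc (-(π / 2)) (π / 2), c * |ψ - t| ≤ |μ * Γ.y ψ - Γ.T ψ| := by
  have hpi := Real.pi_pos
  set I := Set.Icc (-(π / 2)) (π / 2) with hI
  have hIne : I.Nonempty := Set.nonempty_Icc.mpr (by linarith)
  have hcpt : IsCompact I := isCompact_Icc
  have hyc := Γ.contDiff_y.continuous
  have hTc := Γ.contDiff_T.continuous
  obtain ⟨ψ₀, hψ₀, hmin⟩ := hcpt.exists_isMinOn hIne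
    (f := fun ψ => Γ.y ψ ^ 2 + Γ.T ψ ^ 2) (by fun_prop)
  obtain ⟨ψ₁, hψ₁, hmax⟩ := hcpt.exists_isMaxOn hIne hyc.continuousOn
  obtain ⟨ψ₂, hψ₂, hminω⟩ := hcpt.exists_isMinOn hIne Γ.contDiff_ω.continuous.continuousOn
  set r := Γ.y ψ₀ ^ 2 + Γ.T ψ₀ ^ 2 with hr
  -- `y` and `T` have no common zero: `y` vanishes only at the ends of the arc, where `T ≠ 0`.
  have hrpos : 0 < r := by
    rcases eq_or_lt_of_le hψ₀.1 with h | h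
    · have h1 : Γ.T ψ₀ ≠ 0 := by
        rw [← h, T, p_left]; exact Γ.dispT_left _ (Set.right_mem_Icc.mpr Γ.lt_left.le)
      positivity
    · rcases eq_or_lt_of_le hψ₀.2 with h' | h'
      · have h1 : Γ.T ψ₀ ≠ 0 := by
          rw [h', T, p_right]; exact Γ.dispT_right _ (Set.left_mem_Icc.mpr Γ.lt_right.le)
        positivity
      · have := Γ.y_pos ⟨h, h'⟩
        positivity
  -- The constant `17` makes `|T| ≥ 4 y₁` wherever `y ≤ y₁`, so that `T` dominates `μ y`.
  set y₁ := √(r / 17) with hy₁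
  have hy₁pos : 0 < y₁ := Real.sqrt_pos.mpr (by positivity)
  have hy₁sq : y₁ ^ 2 = r / 17 := Real.sq_sqrt (by positivity)
  have hymax : 0 < Γ.y ψ₁ := lt_of_lt_of_le (Γ.y_pos ⟨by linarith, by linarith⟩)
    (hmax (show (0 : ℝ) ∈ I from ⟨by linarith, by linarith⟩))
  set Ym := Γ.y ψ₁ with hYm
  set κ₀ := K ^ 2 * ((2 - K) * (1 + 4 * K) / 3) * Γ.ω ψ₂ / Ym ^ 2 with hκ₀
  have hA1 : 0 < 2 - K := by linarith [hK.upper]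
  have hA2 : 0 < 1 + 4 * K := by linarith [hK.lower]
  have hA3 : 0 < K ^ 2 := by have := hK.ne; positivity
  have hω₂ := Γ.ω_pos ψ₂
  have hκ₀pos : 0 < κ₀ := by positivity
  -- Strict convexity of the arc: `K T / y` increases with slope at least `κ₀`.
  have hslope : ∀ u ∈ Set.Ioo (-(π / 2)) (π / 2), ∀ v ∈ Set.Ioo (-(π / 2)) (π / 2), u ≤ v →
      κ₀ * (v - u) ≤ K * (Γ.T v / Γ.y v) - K * (Γ.T u / Γ.y u) := by
    refine (convex_Ioo _ _).mul_sub_le_image_sub_of_le_deriv ?_ ?_ ?_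
    · exact fun u hu => (Γ.hasDerivAt_slope hu).continuousAt.continuousWithinAt
    · rw [interior_Ioo]
      exact fun u hu => (Γ.hasDerivAt_slope hu).differentiableAt.differentiableWithinAt
    · rw [interior_Ioo]
      intro u hu
      rw [(Γ.hasDerivAt_slope hu).deriv]
      have hu' : u ∈ I := Set.Ioo_subset_Icc_self hu
      have hyu := Γ.y_pos hu
      have h1 : Γ.y u ≤ Ym := hmax hu'
      have h2 : Γ.ω ψ₂ ≤ Γ.ω u := hminω hu'
      have h3 : 0 ≤ (4 / 3 : ℝ) * (((3 * Real.cos (Γ.p u) ^ 2 - 1 - K) / 2) ^ 2 +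
          (3 / 4) * ((1 - Real.cos (Γ.p u) ^ 2) * Γ.y u ^ 2 / Real.cos (Γ.p u) ^ 2)) := by
        have := Real.cos_sq_le_one (Γ.p u)
        have : 0 ≤ 1 - Real.cos (Γ.p u) ^ 2 := by linarith
        positivity
      have h4 : 0 ≤ (2 - K) * (1 + 4 * K) / 3 := by positivity
      rw [hκ₀]
      have h5 := h4.trans (le_add_of_nonneg_right h3)
      gcongr
      · exact mul_nonneg (mul_nonneg hA3.le h5) (Γ.ω_pos u).le
      · exact le_add_of_nonneg_right h3
  refine ⟨min (κ₀ * y₁ / |K|) (2 * y₁ / π), by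
    have := abs_pos.mpr hK.ne
    positivity, ?_⟩
  intro μ hμ t ht hst ψ hψ
  have htI : t ∈ I := Set.Ioo_subset_Icc_self ht
  have hyψ := Γ.y_nonneg hψ
  rcases le_or_gt (Γ.y ψ) y₁ with hsmall | hbig
  · -- Near the ends of the arc the phase is far from stationary.
    have h1 : r ≤ Γ.y ψ ^ 2 + Γ.T ψ ^ 2 := hmin hψ
    have h2 : 4 * y₁ ≤ |Γ.T ψ| := by
      refine (pow_le_pow_iff_left₀ (by positivity) (abs_nonneg _) two_ne_zero).mp ?_
      rw [sq_abs, mul_pow]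
      nlinarith
    have h3 : |μ * Γ.y ψ| ≤ 2 * y₁ := by
      rw [abs_mul, abs_of_nonneg hyψ]; gcongr
    have h4 : 2 * y₁ ≤ |μ * Γ.y ψ - Γ.T ψ| := by
      have := abs_sub_abs_le_abs_sub (Γ.T ψ) (μ * Γ.y ψ)
      rw [abs_sub_comm (Γ.T ψ)] at this
      linarith
    have h5 : |ψ - t| ≤ π := by
      rw [abs_le]; constructor <;> linarith [hψ.1, hψ.2, ht.1, ht.2]
    calc _ ≤ 2 * y₁ / π * π := by
          gcongr
          exact min_le_right _ _
      _ = 2 * y₁ := by field_simp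
      _ ≤ _ := h4
  · -- Elsewhere `μ = T t / y t`, and the bound is the one on the slope.
    have hyψ' : 0 < Γ.y ψ := hy₁pos.trans hbig
    have hψo : ψ ∈ Set.Ioo (-(π / 2)) (π / 2) := by
      refine ⟨lt_of_le_of_ne hψ.1 ?_, lt_of_le_of_ne hψ.2 ?_⟩
      · rintro rfl; simp [y] at hyψ'
      · rintro rfl; simp [y] at hyψ'
    have hyt := Γ.y_pos ht
    have hμt : μ = Γ.T t / Γ.y t := by rw [eq_div_iff hyt.ne', hst]
    have h1 : κ₀ * |ψ - t| ≤ |K * (Γ.T ψ / Γ.y ψ) - K * (Γ.T t / Γ.y t)| := by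
      rcases le_total t ψ with h | h
      · rw [abs_of_nonneg (by linarith)]
        exact (hslope t ht ψ hψo h).trans (le_abs_self _)
      · rw [abs_of_nonpos (by linarith), abs_sub_comm]
        refine le_trans (le_of_eq (by ring)) ((hslope ψ hψo t ht h).trans (le_abs_self _))
    have h2 : K * (Γ.T ψ / Γ.y ψ) - K * (Γ.T t / Γ.y t) =
        -(K * ((μ * Γ.y ψ - Γ.T ψ) / Γ.y ψ)) := by
      rw [← hμt]; field_simp; ring
    rw [h2, abs_neg, abs_mul, abs_div, abs_of_pos hyψ'] at h1
    have hKa := abs_pos.mpr hK.ne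
    have h3 : κ₀ * |ψ - t| * Γ.y ψ / |K| ≤ |μ * Γ.y ψ - Γ.T ψ| := by
      rw [div_le_iff₀ hKa]
      calc κ₀ * |ψ - t| * Γ.y ψ ≤ |K| * (|μ * Γ.y ψ - Γ.T ψ| / Γ.y ψ) * Γ.y ψ := by gcongr
        _ = _ := by field_simp
    calc _ ≤ κ₀ * y₁ / |K| * |ψ - t| := by
          gcongr
          exact min_le_left _ _
      _ = κ₀ * |ψ - t| * y₁ / |K| := by ring
      _ ≤ κ₀ * |ψ - t| * Γ.y ψ / |K| := by gcongr
      _ ≤ _ := h3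

/-- Every phase `μ p + τ` has a stationary point on the arc. -/
lemma exists_stationary (μ : ℝ) :
    ∃ t ∈ Set.Ioo (-(π / 2)) (π / 2), μ * Γ.y t = Γ.T t := by
  have hpi := Real.pi_pos
  have hle : -(π / 2) ≤ π / 2 := by linarith
  have hc : Continuous fun ψ => μ * Γ.y ψ - Γ.T ψ :=
    (continuous_const.mul Γ.contDiff_y.continuous).sub Γ.contDiff_T.continuous
  have h1 : μ * Γ.y (-(π / 2)) - Γ.T (-(π / 2)) = -dispT K Γ.a := by
    simp [y, T, p_left]
  have h2 : μ * Γ.y (π / 2) - Γ.T (π / 2) = -dispT K Γ.b := by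
    simp [y, T, p_right]
  have h3 := Γ.dispT_ends
  rcases mul_neg_iff.mp h3 with ⟨ha, hb⟩ | ⟨ha, hb⟩
  · obtain ⟨t, ht, h4⟩ := intermediate_value_Ioo hle hc.continuousOn
      (show (0 : ℝ) ∈ Set.Ioo _ _ by rw [h1, h2]; constructor <;> linarith)
    exact ⟨t, ht, sub_eq_zero.mp h4⟩
  · obtain ⟨t, ht, h4⟩ := intermediate_value_Ioo' hle hc.continuousOn
      (show (0 : ℝ) ∈ Set.Ioo _ _ by rw [h1, h2]; constructor <;> linarith)
    exact ⟨t, ht, sub_eq_zero.mp h4⟩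

end Arc

/-! ### Continuity and integrability on the level curve -/

lemma dispRoot_eq (K p : ℝ) : dispRoot K p = (√(dispY K p) : ℂ) +
    Complex.I * ((if 0 < K then 1 else -1 : ℝ) * √(-dispY K p) : ℝ) := by
  unfold dispRoot
  split_ifs with h h2
  · rw [Real.sqrt_eq_zero_of_nonpos (by linarith : -dispY K p ≤ 0)]; simp
  · rw [Real.sqrt_eq_zero_of_nonpos (by linarith : -dispY K p ≤ 0)]; simp
  · rw [Real.sqrt_eq_zero_of_nonpos (by linarith : dispY K p ≤ 0)]; simp
  · rw [Real.sqrt_eq_zero_of_nonpos (by linarith : dispY K p ≤ 0)]; simp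

lemma continuous_dispY (K : ℝ) : Continuous (dispY K) := by unfold dispY; fun_prop

lemma continuous_dispRoot (K : ℝ) : Continuous (dispRoot K) := by
  have h : dispRoot K = fun p => (√(dispY K p) : ℂ) +
    Complex.I * ((if 0 < K then 1 else -1 : ℝ) * √(-dispY K p) : ℝ) := funext (dispRoot_eq K)
  have hY := continuous_dispY K
  rw [h]
  fun_prop

lemma continuousOn_dispW (K : ℝ) : ContinuousOn (dispW K) (Set.Ioo (-(π / 2)) (π / 2)) := by
  unfold dispW
  have h := continuous_dispRoot K
  refine ContinuousOn.div (by fun_prop) (by fun_prop) fun p hp => ?_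
  exact_mod_cast (Real.cos_pos_of_mem_Ioo hp).ne'

lemma continuousOn_dispT (K : ℝ) : ContinuousOn (dispT K) (Set.Ioo (-(π / 2)) (π / 2)) :=
  fun _ hp => (hasDerivAt_dispT K (Real.cos_pos_of_mem_Ioo hp).ne').continuousAt.continuousWithinAt

lemma continuousOn_mon (K : ℝ) (X n : ℤ) :
    ContinuousOn (mon K X n) (Set.Ioo (-(π / 2)) (π / 2)) := by
  unfold mon
  refine ContinuousOn.mul (by fun_prop) ?_
  exact (continuousOn_dispW K).zpow₀ n fun p hp =>
    Or.inl (dispW_ne_zero K (Real.cos_pos_of_mem_Ioo hp))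

lemma mon_add (K : ℝ) {p : ℝ} (hp : 0 < Real.cos p) (X n X' n' : ℤ) :
    mon K (X + X') (n + n') p = mon K X n p * mon K X' n' p := by
  simp only [mon]
  rw [zpow_add₀ (dispW_ne_zero K hp)]
  push_cast
  rw [add_mul, mul_add, Complex.exp_add]
  ring

lemma norm_mon (K : ℝ) (X n : ℤ) (p : ℝ) : ‖mon K X n p‖ = ‖dispW K p‖ ^ n := by
  rw [mon, norm_mul, norm_zpow]
  have : Complex.I * (X * p) = ((X * p : ℝ) : ℂ) * Complex.I := by push_cast; ring
  rw [this, Complex.norm_exp_ofReal_mul_I, one_mul]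

lemma dispRoot_ne_zero {K p : ℝ} (h : dispY K p ≠ 0) : dispRoot K p ≠ 0 := by
  rw [← norm_pos_iff, norm_dispRoot]
  exact Real.sqrt_pos.mpr (abs_pos.mpr h)

lemma measurable_dispRoot (K : ℝ) : Measurable (dispRoot K) := (continuous_dispRoot K).measurable

lemma measurable_mon (K : ℝ) (X n : ℤ) : Measurable (mon K X n) := by
  have hW : Measurable (dispW K) := by
    unfold dispW
    exact ((by fun_prop : Measurable fun p : ℝ => ((K - Real.cos p ^ 2 : ℝ) : ℂ)).add
      (measurable_const.mul (measurable_dispRoot K))).div (by fun_prop)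
  have hpow : Measurable fun z : ℂ => z ^ n := by
    obtain ⟨k, rfl | rfl⟩ := n.eq_nat_or_neg
    · simp only [zpow_natCast]; fun_prop
    · simp only [zpow_neg, zpow_natCast]; exact (measurable_id.pow_const k).inv
  exact (by fun_prop : Measurable fun p : ℝ => Complex.exp (Complex.I * (X * p))).mul (hpow.comp hW)

lemma norm_dispRoot_inv (K p : ℝ) : ‖dispRoot K p‖⁻¹ = |dispY K p| ^ (-(1 / 2) : ℝ) := by
  rw [norm_dispRoot, Real.rpow_neg (abs_nonneg _), ← Real.sqrt_eq_rpow]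

/-- Functions `f / (cos p sin τ)` with `f` bounded are integrable. -/
lemma intervalIntegrable_div_dispRoot {K : ℝ} (hK : Admissible K) {u v M : ℝ} (hu : -(π / 2) ≤ u)
    (huv : u ≤ v) (hv : v ≤ π / 2) {f : ℝ → ℂ}
    (hf : MeasureTheory.AEStronglyMeasurable f (MeasureTheory.volume.restrict (Set.Ioo u v)))
    (hM : ∀ p ∈ Set.Ioo u v, ‖f p‖ ≤ M) :
    IntervalIntegrable (fun p => f p / dispRoot K p) MeasureTheory.volume u v := by
  have h1 : IntervalIntegrable (fun p => M * |dispY K p| ^ (-(1 / 2) : ℝ))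
      MeasureTheory.volume u v := by
    refine ((intervalIntegrable_dispY_rpow hK (r := 1 / 2) (by norm_num) (by norm_num)).const_mul
      M).mono_set ?_
    rw [Set.uIcc_of_le huv, Set.uIcc_of_le (by linarith [Real.pi_pos])]
    exact Set.Icc_subset_Icc hu hv
  have hae : MeasureTheory.volume.restrict (Set.uIoc u v) =
      MeasureTheory.volume.restrict (Set.Ioo u v) := by
    rw [Set.uIoc_of_le huv]
    exact MeasureTheory.Measure.restrict_congr_set MeasureTheory.Ioo_ae_eq_Ioc.symm
  refine h1.mono_fun' ?_ ?_
  · rw [hae]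
    exact (hf.aemeasurable.div (measurable_dispRoot K).aemeasurable).aestronglyMeasurable
  · rw [hae]
    filter_upwards [MeasureTheory.ae_restrict_mem measurableSet_Ioo] with p hp
    rw [norm_div, div_eq_mul_inv, norm_dispRoot_inv]
    have := hM p hp
    gcongr

/-- In the evanescent region the functions `w^n / (cos p sin τ)` are `O(n^{-1/2})` in mean. -/
lemma norm_mon_div_le {K p : ℝ} (hp : 0 < Real.cos p) (hY : dispY K p < 0) (X : ℤ)
    {n : ℕ} (hn : 0 < n) :
    ‖mon K X n p‖ / ‖dispRoot K p‖ ≤ (√n)⁻¹ * |dispY K p| ^ (-(3 / 4) : ℝ) := by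
  have h1 := one_add_le_norm_dispW_inv hp hY
  have hr : √(-dispY K p) = ‖dispRoot K p‖ := by rw [norm_dispRoot, abs_of_neg hY]
  rw [hr] at h1
  have hrpos : 0 < ‖dispRoot K p‖ := norm_pos_iff.mpr (dispRoot_ne_zero hY.ne)
  set r := ‖dispRoot K p‖ with hrdef
  have hnpos : (0 : ℝ) < n := by exact_mod_cast hn
  -- Bernoulli: `(1 + r) ^ n ≥ 1 + n r ≥ √(n r)`. The exponent `1 / 2` keeps the singularity
  -- `r⁻¹ r ^ (-1 / 2)` integrable at the branch points.
  have h2 : √(n * r) ≤ ‖(dispW K p)⁻¹‖ ^ n := by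
    have h3 : 1 + (n : ℝ) * r ≤ (1 + r) ^ n := one_add_mul_le_pow (by linarith) n
    have h4 : √(n * r) ≤ 1 + n * r := by
      rw [Real.sqrt_le_left (by positivity)]
      nlinarith [mul_pos hnpos hrpos]
    exact h4.trans (h3.trans (by gcongr))
  have h5 : ‖mon K X n p‖ ≤ (√(n * r))⁻¹ := by
    rw [norm_mon, zpow_natCast]
    rw [norm_inv, inv_pow] at h2
    exact (le_inv_comm₀ (by positivity)
      (pow_pos (norm_pos_iff.mpr (dispW_ne_zero K hp)) n)).mp h2
  have h6 : |dispY K p| ^ (-(3 / 4) : ℝ) = (√r)⁻¹ * r⁻¹ := by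
    have h7 : |dispY K p| = r ^ (2 : ℝ) := by
      rw [hrdef, norm_dispRoot]; norm_cast; rw [Real.sq_sqrt (abs_nonneg _)]
    rw [h7, ← Real.rpow_mul hrpos.le, Real.sqrt_eq_rpow, ← Real.rpow_neg hrpos.le,
      ← Real.rpow_neg_one r, ← Real.rpow_add hrpos]
    norm_num
  rw [h6, div_eq_mul_inv]
  calc ‖mon K X n p‖ * r⁻¹ ≤ (√(n * r))⁻¹ * r⁻¹ := by gcongr
    _ = _ := by rw [Real.sqrt_mul hnpos.le, mul_inv]; ring

lemma integral_evanescent_le {K : ℝ} (hK : Admissible K) : ∃ C : ℝ, 0 ≤ C ∧ ∀ u v : ℝ,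
    -(π / 2) ≤ u → u ≤ v → v ≤ π / 2 → (∀ p ∈ Set.Ioo u v, dispY K p < 0) →
    ∀ (M : ℝ) (f : ℝ → ℂ), 0 ≤ M → (∀ p ∈ Set.Ioo u v, ‖f p‖ ≤ M) → ∀ (X : ℤ) (n : ℕ), 0 < n →
    ‖∫ p in u..v, mon K X n p * f p / dispRoot K p‖ ≤ M * C / √n := by
  have hint := intervalIntegrable_dispY_rpow hK (r := 3 / 4) (by norm_num) (by norm_num)
  have hpi := Real.pi_pos
  refine ⟨∫ p in (-(π / 2))..(π / 2), |dispY K p| ^ (-(3 / 4) : ℝ),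
    intervalIntegral.integral_nonneg (by linarith) fun p _ => by positivity, ?_⟩
  intro u v hu huv hv hY M f hM hf X n hn
  have hsub : IntervalIntegrable (fun p => |dispY K p| ^ (-(3 / 4) : ℝ))
      MeasureTheory.volume u v := by
    refine hint.mono_set ?_
    rw [Set.uIcc_of_le huv, Set.uIcc_of_le (by linarith)]
    exact Set.Icc_subset_Icc hu hv
  have h1 : ‖∫ p in u..v, mon K X n p * f p / dispRoot K p‖ ≤
      ∫ p in u..v, M * (√n)⁻¹ * |dispY K p| ^ (-(3 / 4) : ℝ) := by
    refine intervalIntegral.norm_integral_le_of_norm_le huv ?_ (hsub.const_mul _)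
    have hne : ∀ᵐ p : ℝ, p ∉ ({v} : Set ℝ) :=
      Set.Countable.ae_notMem (Set.toFinite _).countable _
    filter_upwards [hne] with p hpv hp
    have hp' : p ∈ Set.Ioo u v := ⟨hp.1, lt_of_le_of_ne hp.2 hpv⟩
    have hc : 0 < Real.cos p := Real.cos_pos_of_mem_Ioo ⟨hu.trans_lt hp'.1, hp'.2.trans_le hv⟩
    have h2 := norm_mon_div_le hc (hY p hp') X hn
    rw [norm_div, norm_mul]
    calc ‖mon K X n p‖ * ‖f p‖ / ‖dispRoot K p‖ = ‖mon K X n p‖ / ‖dispRoot K p‖ * ‖f p‖ := by ring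
      _ ≤ ((√n)⁻¹ * |dispY K p| ^ (-(3 / 4) : ℝ)) * M := by
          have := hf p hp'
          gcongr
      _ = _ := by ring
  refine h1.trans ?_
  rw [intervalIntegral.integral_const_mul]
  have h3 : ∫ p in u..v, |dispY K p| ^ (-(3 / 4) : ℝ) ≤
      ∫ p in (-(π / 2))..(π / 2), |dispY K p| ^ (-(3 / 4) : ℝ) :=
    intervalIntegral.integral_mono_interval hu huv hv
      (Eventually.of_forall fun p => by positivity) hint
  have h4 : M * (√n)⁻¹ * (∫ p in u..v, |dispY K p| ^ (-(3 / 4) : ℝ)) ≤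
      M * (√n)⁻¹ * (∫ p in (-(π / 2))..(π / 2), |dispY K p| ^ (-(3 / 4) : ℝ)) := by gcongr
  refine h4.trans (le_of_eq ?_)
  rw [div_eq_mul_inv]
  ring

/-! ### The evanescent parts of the level curve -/

lemma hasDerivAt_dispRoot {K p : ℝ} (hY : dispY K p < 0) : HasDerivAt (dispRoot K)
    (-Real.sin p * Real.cos p * (1 + 2 * (K - Real.cos p ^ 2)) / dispRoot K p) p := by
  have hs : 0 < √(-dispY K p) := Real.sqrt_pos.mpr (by linarith)
  have h1 := ((hasDerivAt_dispY K p).neg.sqrt (by simpa using hY.ne)).const_mul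
    (if 0 < K then 1 else -1 : ℝ)
  have h2 := h1.ofReal_comp.const_mul Complex.I
  have hev : ∀ᶠ q in 𝓝 p, dispY K q < 0 :=
    (continuous_dispY K).continuousAt.eventually_lt continuousAt_const hY
  have hr : ∀ q, dispY K q < 0 → dispRoot K q =
      Complex.I * ((if 0 < K then 1 else -1 : ℝ) * √(-dispY K q) : ℝ) := by
    intro q hq
    rw [dispRoot, if_neg (by linarith)]
  have h3 : HasDerivAt (dispRoot K) _ p := h2.congr_of_eventuallyEq (by
    filter_upwards [hev] with q hq
    rw [hr q hq]; rfl)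
  refine h3.congr_deriv ?_
  rw [hr p hY]
  have hsC : (√(-dispY K p) : ℂ) ≠ 0 := by exact_mod_cast hs.ne'
  simp only [Pi.neg_apply]
  split_ifs
  · push_cast
    field_simp
    linear_combination (Complex.sin p * Complex.cos p * (1 + 2 * (K - Complex.cos p ^ 2))) *
      Complex.I_sq
  · push_cast
    field_simp
    linear_combination (-Complex.sin p * Complex.cos p * (1 + 2 * (K - Complex.cos p ^ 2))) *
      Complex.I_sq

lemma hasDerivAt_dispW {K p : ℝ} (hp : 0 < Real.cos p) (hY : dispY K p < 0) :
    HasDerivAt (dispW K) (-Complex.I * dispT K p / dispRoot K p * dispW K p) p := by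
  have hcC : (Real.cos p : ℂ) ≠ 0 := by exact_mod_cast hp.ne'
  have hr0 := dispRoot_ne_zero hY.ne
  have hcos := Real.hasDerivAt_cos p
  have h1 : HasDerivAt (dispW K) _ p := ((((hcos.pow 2).const_sub K).ofReal_comp).add
    ((hasDerivAt_dispRoot hY).const_mul Complex.I)).div hcos.ofReal_comp hcC
  refine h1.congr_deriv ?_
  have hy := dispRoot_sq K p
  rw [dispY] at hy
  simp only [dispT, dispW, Pi.add_apply, Pi.pow_apply]
  push_cast at hcC hy ⊢
  generalize dispRoot K p = Y at *
  generalize Complex.cos (p : ℂ) = c at *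
  generalize Complex.sin (p : ℂ) = σ at *
  field_simp
  linear_combination (σ * Complex.I) * hy + (σ * Y * (K + c ^ 2)) * Complex.I_sq

lemma hasDerivAt_mon {K p : ℝ} (hp : 0 < Real.cos p) (hY : dispY K p < 0) (X n : ℤ) :
    HasDerivAt (mon K X n)
      (Complex.I * (X * dispRoot K p - n * dispT K p) * mon K X n p / dispRoot K p) p := by
  have hW0 := dispW_ne_zero K hp
  have hr0 := dispRoot_ne_zero hY.ne
  have h1 := (((hasDerivAt_id p).ofReal_comp.const_mul (X : ℂ)).const_mul Complex.I).cexp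
  have h2 := (hasDerivAt_zpow n (dispW K p) (Or.inl hW0)).comp p (hasDerivAt_dispW hp hY)
  refine (h1.mul h2).congr_deriv ?_
  simp only [mon, Function.comp, id]
  rw [zpow_sub_one₀ hW0]
  push_cast
  field_simp
  ring

/-- Integration by parts over an evanescent part of the level curve. -/
lemma integral_by_parts_evanescent {K : ℝ} (hK : Admissible K) {u v : ℝ} (hu : -(π / 2) < u)
    (huv : u ≤ v) (hv : v < π / 2) (hY : ∀ p ∈ Set.Ioo u v, dispY K p < 0)
    (hT : ∀ p ∈ Set.Icc u v, dispT K p ≠ 0) (hYe : ∀ p ∈ Set.Icc u v, dispY K p ≤ 0)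
    (Ax An Bx Bn : ℤ) :
    ∃ C : ℝ, ∀ (X : ℤ) (n : ℕ), 0 < n → |(X : ℝ)| ≤ 2 * n → ∀ z : ℂ, ‖z‖ = 1 →
      ‖Complex.I * n * (∫ p in u..v, mon K X n p *
          (mon K Bx Bn p * (mon K Ax An p - z)) / dispRoot K p) -
        (mon K X n v * (mon K Bx Bn v * (mon K Ax An v - z)) /
            (X / n * dispRoot K v - dispT K v) -
          mon K X n u * (mon K Bx Bn u * (mon K Ax An u - z)) /
            (X / n * dispRoot K u - dispT K u))‖ ≤ C / √n := by
  have hI : Set.Icc u v ⊆ Set.Ioo (-(π / 2)) (π / 2) := fun p hp =>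
    ⟨hu.trans_le hp.1, hp.2.trans_lt hv⟩
  have hcos : ∀ p ∈ Set.Icc u v, 0 < Real.cos p := fun p hp => Real.cos_pos_of_mem_Ioo (hI hp)
  have hne : (Set.Icc u v).Nonempty := Set.nonempty_Icc.mpr huv
  have hcT := (continuousOn_dispT K).mono hI
  have hcR : ContinuousOn (dispRoot K) (Set.Icc u v) := (continuous_dispRoot K).continuousOn
  have hcM := fun X n => (continuousOn_mon K X n).mono hI
  obtain ⟨p₀, hp₀, hmin⟩ := isCompact_Icc.exists_isMinOn hne hcT.norm
  have hc₀ : 0 < ‖dispT K p₀‖ := norm_pos_iff.mpr (hT p₀ hp₀)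
  set c₀ := ‖dispT K p₀‖ with hc₀def
  obtain ⟨MT, hMT⟩ := isCompact_Icc.exists_bound_of_continuousOn hcT
  obtain ⟨MR, hMR⟩ := isCompact_Icc.exists_bound_of_continuousOn hcR
  obtain ⟨MA, hMA⟩ := isCompact_Icc.exists_bound_of_continuousOn (hcM Ax An)
  obtain ⟨MB, hMB⟩ := isCompact_Icc.exists_bound_of_continuousOn (hcM Bx Bn)
  obtain ⟨C, hC, hev⟩ := integral_evanescent_le hK
  have hMT0 := (norm_nonneg _).trans (hMT p₀ hp₀)
  have hMR0 := (norm_nonneg _).trans (hMR p₀ hp₀)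
  have hMA0 := (norm_nonneg _).trans (hMA p₀ hp₀)
  have hMB0 := (norm_nonneg _).trans (hMB p₀ hp₀)
  -- the derivative of `dispT`, and the derivative of `dispRoot` times `dispRoot`, are bounded
  have hcT' : ContinuousOn (fun q : ℝ => (K - Real.cos q ^ 2 + 2 * Real.cos q ^ 4) / Real.cos q ^ 2)
      (Set.Icc u v) := by
    refine ContinuousOn.div (by fun_prop) (by fun_prop) fun q hq => pow_ne_zero 2 (hcos q hq).ne'
  obtain ⟨MT', hMT'⟩ := isCompact_Icc.exists_bound_of_continuousOn hcT'
  obtain ⟨MR', hMR'⟩ := isCompact_Icc.exists_bound_of_continuousOn (f := fun q : ℝ =>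
    (-Real.sin q * Real.cos q * (1 + 2 * (K - Real.cos q ^ 2)) : ℂ)) (s := Set.Icc u v)
    (by fun_prop)
  have hMT'0 := (norm_nonneg _).trans (hMT' p₀ hp₀)
  have hMR'0 := (norm_nonneg _).trans (hMR' p₀ hp₀)
  -- bounds for `F`, `D` and for `dispRoot` times their derivatives
  set bA := |(Ax : ℝ)| * MR + |(An : ℝ)| * MT with hbA
  set bB := |(Bx : ℝ)| * MR + |(Bn : ℝ)| * MT with hbB
  set bF₁ := bB * MB * (MA + 1) + MB * (bA * MA) with hbF₁
  set bD := 2 * MR + MT with hbD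
  set bD₁ := 2 * MR' + MT' * MR with hbD₁
  set Q := (bF₁ * bD + MB * (MA + 1) * bD₁) / c₀ ^ 2 with hQ
  refine ⟨Q * C, ?_⟩
  intro X n hn hX z hz
  have hnpos : (0 : ℝ) < n := by exact_mod_cast hn
  have hnC : (n : ℂ) ≠ 0 := by exact_mod_cast hn.ne'
  set μ : ℝ := X / n with hμ
  have hμ2 : |μ| ≤ 2 := by
    rw [hμ, abs_div, abs_of_pos hnpos, div_le_iff₀ hnpos]; exact hX
  have hμC : (X : ℂ) / n = (μ : ℂ) := by rw [hμ]; push_cast; rfl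
  rw [hμC]
  set D : ℝ → ℂ := fun p => μ * dispRoot K p - dispT K p with hD
  set F : ℝ → ℂ := fun p => mon K Bx Bn p * (mon K Ax An p - z) with hF
  set fF : ℝ → ℂ := fun p => Complex.I * (Bx * dispRoot K p - Bn * dispT K p) * mon K Bx Bn p *
    (mon K Ax An p - z) + mon K Bx Bn p *
      (Complex.I * (Ax * dispRoot K p - An * dispT K p) * mon K Ax An p) with hfF
  set fD : ℝ → ℂ := fun p => μ * (-Real.sin p * Real.cos p * (1 + 2 * (K - Real.cos p ^ 2))) -
    ((K - Real.cos p ^ 2 + 2 * Real.cos p ^ 4) / Real.cos p ^ 2 : ℝ) * dispRoot K p with hfD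
  -- `dispRoot` is purely imaginary here, so that the real part of `D` is `-dispT`.
  have hDge : ∀ p ∈ Set.Icc u v, c₀ ≤ ‖D p‖ := by
    intro p hp
    have h1 : c₀ ≤ ‖dispT K p‖ := hmin hp
    refine h1.trans (le_trans (le_of_eq ?_) (Complex.abs_re_le_norm _))
    have h2 : dispRoot K p = Complex.I * ((if 0 < K then 1 else -1 : ℝ) * √(-dispY K p) : ℝ) := by
      rw [dispRoot_eq, Real.sqrt_eq_zero_of_nonpos (hYe p hp)]; simp
    have h3 : (D p).re = -dispT K p := by
      simp only [hD, h2, Complex.sub_re, Complex.ofReal_re,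
        Complex.re_ofReal_mul, Complex.I_mul_re, Complex.ofReal_im]
      ring
    rw [h3, abs_neg, Real.norm_eq_abs]
  have hD0 : ∀ p ∈ Set.Icc u v, D p ≠ 0 := fun p hp =>
    norm_pos_iff.mp (hc₀.trans_le (hDge p hp))
  have hcD : ContinuousOn D (Set.Icc u v) :=
    (continuousOn_const.mul hcR).sub (Complex.continuous_ofReal.comp_continuousOn hcT)
  have hcF : ContinuousOn F (Set.Icc u v) :=
    (hcM Bx Bn).mul ((hcM Ax An).sub continuousOn_const)
  -- `g / dispRoot` is the derivative of `F / D`.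
  set g : ℝ → ℂ := fun p => (fF p * D p - F p * fD p) / D p ^ 2 with hg
  have hcg : ContinuousOn g (Set.Icc u v) := by
    refine ContinuousOn.div ?_ (hcD.pow 2) fun p hp => pow_ne_zero 2 (hD0 p hp)
    have hcTC := Complex.continuous_ofReal.comp_continuousOn hcT
    have hcTC' := Complex.continuous_ofReal.comp_continuousOn hcT'
    refine ContinuousOn.sub (ContinuousOn.mul ?_ hcD) (hcF.mul ?_)
    · exact (((continuousOn_const.mul ((continuousOn_const.mul hcR).sub
        (continuousOn_const.mul hcTC))).mul (hcM Bx Bn)).mul ((hcM Ax An).sub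
        continuousOn_const)).add ((hcM Bx Bn).mul ((continuousOn_const.mul
        ((continuousOn_const.mul hcR).sub (continuousOn_const.mul hcTC))).mul (hcM Ax An)))
    · exact ContinuousOn.sub (by fun_prop) (hcTC'.mul hcR)
  have hgQ : ∀ p ∈ Set.Icc u v, ‖g p‖ ≤ Q := by
    intro p hp
    have hlin : ∀ x m : ℤ, ‖Complex.I * (x * dispRoot K p - m * dispT K p)‖ ≤
        |(x : ℝ)| * MR + |(m : ℝ)| * MT := by
      intro x m
      rw [norm_mul, Complex.norm_I, one_mul]
      refine (norm_sub_le _ _).trans ?_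
      rw [norm_mul, norm_mul, Complex.norm_intCast, Complex.norm_intCast, Complex.norm_real]
      have := hMR p hp; have := hMT p hp
      gcongr
    have hMAz : ‖mon K Ax An p - z‖ ≤ MA + 1 := by
      refine (norm_sub_le _ _).trans ?_
      rw [hz]; have := hMA p hp; gcongr
    have b1 : ‖F p‖ ≤ MB * (MA + 1) := by
      simp only [hF]; rw [norm_mul]; have := hMB p hp; gcongr
    have b2 : ‖D p‖ ≤ bD := by
      simp only [hD]
      refine (norm_sub_le _ _).trans ?_
      rw [norm_mul, Complex.norm_real, Complex.norm_real, Real.norm_eq_abs μ]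
      have := hMR p hp; have := hMT p hp
      rw [hbD]
      gcongr
    have b3 : ‖fF p‖ ≤ bF₁ := by
      simp only [hfF]
      refine (norm_add_le _ _).trans ?_
      rw [norm_mul, norm_mul, norm_mul (mon K Bx Bn p), norm_mul _ (mon K Ax An p), hbF₁]
      have := hMB p hp; have := hMA p hp
      have := hlin Ax An; have := hlin Bx Bn
      gcongr
    have b4 : ‖fD p‖ ≤ bD₁ := by
      simp only [hfD]
      have h1 := hMR p hp; have h2 := hMT' p hp; have h3 := hMR' p hp
      refine (norm_sub_le _ _).trans (add_le_add ?_ ?_)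
      · rw [norm_mul, Complex.norm_real, Real.norm_eq_abs μ]
        gcongr
      · rw [norm_mul, Complex.norm_real]
        gcongr
    simp only [hg]
    rw [norm_div, norm_pow, hQ]
    have h5 := hDge p hp
    have h6 : ‖fF p * D p - F p * fD p‖ ≤ bF₁ * bD + MB * (MA + 1) * bD₁ := by
      refine (norm_sub_le _ _).trans ?_
      rw [norm_mul, norm_mul]
      have := (norm_nonneg _).trans b3; have := (norm_nonneg _).trans b1
      gcongr
    have h7 := (norm_nonneg _).trans h6
    gcongr
  have hQ0 : 0 ≤ Q := (norm_nonneg _).trans (hgQ p₀ hp₀)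
  have hsub := Set.Ioo_subset_Icc_self (a := u) (b := v)
  have hmon1 : ∀ p ∈ Set.Icc u v, ‖mon K X n p‖ ≤ 1 := by
    intro p hp
    rw [norm_mon, zpow_natCast]
    exact pow_le_one₀ (norm_nonneg _) (norm_dispW_le (hcos p hp))
  have hmeas : ∀ f : ℝ → ℂ, ContinuousOn f (Set.Icc u v) → MeasureTheory.AEStronglyMeasurable f
      (MeasureTheory.volume.restrict (Set.Ioo u v)) := fun f hf =>
    (hf.mono hsub).aestronglyMeasurable measurableSet_Ioo
  have hi1 : IntervalIntegrable (fun p => mon K X n p * F p / dispRoot K p)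
      MeasureTheory.volume u v := by
    obtain ⟨M, hM⟩ := isCompact_Icc.exists_bound_of_continuousOn ((hcM X n).mul hcF)
    exact intervalIntegrable_div_dispRoot hK hu.le huv hv.le (hmeas _ ((hcM X n).mul hcF))
      (fun p hp => hM p (hsub hp))
  have hi2 : IntervalIntegrable (fun p => mon K X n p * g p / dispRoot K p)
      MeasureTheory.volume u v := by
    obtain ⟨M, hM⟩ := isCompact_Icc.exists_bound_of_continuousOn ((hcM X n).mul hcg)
    exact intervalIntegrable_div_dispRoot hK hu.le huv hv.le (hmeas _ ((hcM X n).mul hcg))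
      (fun p hp => hM p (hsub hp))
  have hftc := intervalIntegral.integral_eq_sub_of_hasDerivAt_of_le huv
    (f := fun p => mon K X n p * F p / D p)
    (f' := fun p => Complex.I * n * (mon K X n p * F p / dispRoot K p) +
      mon K X n p * g p / dispRoot K p)
    (((hcM X n).mul hcF).div hcD hD0)
    (by
      intro p hp
      have hp' := hsub hp
      have hc := hcos p hp'
      have hYp := hY p hp
      have hr0 := dispRoot_ne_zero hYp.ne
      have d0 := hD0 p hp'
      have dF : HasDerivAt F (fF p / dispRoot K p) p := by
        refine ((hasDerivAt_mon hc hYp Bx Bn).mul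
          ((hasDerivAt_mon hc hYp Ax An).sub_const z)).congr_deriv ?_
        simp only [hfF]
        field_simp
      have dD : HasDerivAt D (fD p / dispRoot K p) p := by
        refine (((hasDerivAt_dispRoot hYp).const_mul (μ : ℂ)).sub
          (hasDerivAt_dispT K hc.ne').ofReal_comp).congr_deriv ?_
        simp only [hfD]
        field_simp
      refine (((hasDerivAt_mon hc hYp X n).mul dF).div dD d0).congr_deriv ?_
      have hXn : (X : ℂ) * dispRoot K p - ((n : ℤ) : ℂ) * dispT K p = n * D p := by
        simp only [hD, hμ]
        push_cast
        field_simp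
      rw [hXn]
      simp only [hg, Pi.mul_apply]
      field_simp
      ring)
    ((hi1.const_mul _).add hi2)
  rw [intervalIntegral.integral_add (hi1.const_mul _) hi2, intervalIntegral.integral_const_mul]
    at hftc
  have h8 := hev u v hu.le huv hv.le hY Q g hQ0 (fun p hp => hgQ p (hsub hp)) X n hn
  refine le_trans (le_of_eq ?_) h8
  rw [← norm_neg, eq_sub_of_add_eq hftc]
  congr 1
  ring

/-! ### Oscillatory integrals over an arc -/

lemma exists_deriv_bounds {E : Type*} [NormedAddCommGroup E] [NormedSpace ℝ E] {g : ℝ → E}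
    (hg : ContDiff ℝ 2 g) (a b : ℝ) :
    (∀ ψ, HasDerivAt g (deriv g ψ) ψ) ∧ (∀ ψ, HasDerivAt (deriv g) (deriv (deriv g) ψ) ψ) ∧
    Continuous (deriv g) ∧ Continuous (deriv (deriv g)) ∧
    ∃ M : ℝ, 0 ≤ M ∧ ∀ ψ ∈ Set.Icc a b, ‖g ψ‖ ≤ M ∧ ‖deriv g ψ‖ ≤ M ∧
      ‖deriv (deriv g) ψ‖ ≤ M := by
  have h1 : ContDiff ℝ 1 (deriv g) := by
    have := (contDiff_succ_iff_deriv (n := 1) (f := g)).mp (by simpa [one_add_one_eq_two] using hg)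
    exact this.2.2
  have h2 : Continuous (deriv (deriv g)) := h1.continuous_deriv le_rfl
  refine ⟨fun ψ => (hg.differentiable (by norm_num) ψ).hasDerivAt,
    fun ψ => (h1.differentiable (by norm_num) ψ).hasDerivAt, h1.continuous, h2, ?_⟩
  obtain ⟨M₀, hM₀⟩ := isCompact_Icc.exists_bound_of_continuousOn
    (hg.continuous.continuousOn (s := Set.Icc a b))
  obtain ⟨M₁, hM₁⟩ := isCompact_Icc.exists_bound_of_continuousOn
    (h1.continuous.continuousOn (s := Set.Icc a b))
  obtain ⟨M₂, hM₂⟩ := isCompact_Icc.exists_bound_of_continuousOn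
    (h2.continuousOn (s := Set.Icc a b))
  refine ⟨|M₀| + |M₁| + |M₂|, by positivity, fun ψ hψ => ?_⟩
  have := hM₀ ψ hψ; have := hM₁ ψ hψ; have := hM₂ ψ hψ
  have := le_abs_self M₀; have := le_abs_self M₁; have := le_abs_self M₂
  have := abs_nonneg M₀; have := abs_nonneg M₁; have := abs_nonneg M₂
  refine ⟨?_, ?_, ?_⟩ <;> linarith

lemma abs_dispT_le_norm {K p : ℝ} (hY : dispY K p ≤ 0) (μ : ℝ) :
    |dispT K p| ≤ ‖(μ : ℂ) * dispRoot K p - dispT K p‖ := by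
  refine le_trans (le_of_eq ?_) (Complex.abs_re_le_norm _)
  rw [dispRoot_eq, Real.sqrt_eq_zero_of_nonpos hY]
  simp only [Complex.ofReal_zero, zero_add, Complex.sub_re, Complex.ofReal_re,
    Complex.re_ofReal_mul, Complex.I_mul_re, Complex.ofReal_im]
  rw [neg_zero, mul_zero, zero_sub, abs_neg]

namespace Arc

variable {K : ℝ} (Γ : Arc K)

lemma strictMonoOn_p : StrictMonoOn Γ.p (Set.Icc (-(π / 2)) (π / 2)) := by
  refine strictMonoOn_of_deriv_pos (convex_Icc _ _) Γ.contDiff_p.continuous.continuousOn ?_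
  intro ψ hψ
  rw [interior_Icc] at hψ
  rw [(Γ.hasDerivAt_p ψ).deriv]
  exact mul_pos (Γ.y_pos hψ) (Γ.ω_pos ψ)

lemma image_p : Γ.p '' Set.Ioo (-(π / 2)) (π / 2) = Set.Ioo Γ.a Γ.b := by
  have hpi := Real.pi_pos
  have hle : -(π / 2) ≤ π / 2 := by linarith
  apply Set.Subset.antisymm
  · rintro _ ⟨ψ, hψ, rfl⟩
    have hψ' := Set.Ioo_subset_Icc_self hψ
    rw [← p_left, ← p_right]
    exact ⟨Γ.strictMonoOn_p (Set.left_mem_Icc.mpr hle) hψ' hψ.1,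
      Γ.strictMonoOn_p hψ' (Set.right_mem_Icc.mpr hle) hψ.2⟩
  · have := intermediate_value_Ioo hle (Γ.contDiff_p.continuous.continuousOn
      (s := Set.Icc (-(π / 2)) (π / 2)))
    rwa [p_left, p_right] at this

/-- The substitution `p = p(ψ)` removes the singularities at the branch points. -/
lemma integral_comp_p (f : ℝ → ℂ) :
    ∫ q in Γ.a..Γ.b, f q / dispRoot K q = ∫ ψ in (-(π / 2))..(π / 2), f (Γ.p ψ) * Γ.ω ψ := by
  have hpi := Real.pi_pos
  rw [intervalIntegral.integral_of_le Γ.lt_mid.le, intervalIntegral.integral_of_le (by linarith),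
    MeasureTheory.integral_Ioc_eq_integral_Ioo, MeasureTheory.integral_Ioc_eq_integral_Ioo,
    ← image_p, MeasureTheory.integral_image_eq_integral_abs_deriv_smul measurableSet_Ioo
      (fun ψ _ => (Γ.hasDerivAt_p ψ).hasDerivWithinAt)
      (Γ.strictMonoOn_p.injOn.mono Set.Ioo_subset_Icc_self)]
  refine MeasureTheory.setIntegral_congr_fun measurableSet_Ioo fun ψ hψ => ?_
  have hy := Γ.y_pos hψ
  have hyC : (Γ.y ψ : ℂ) ≠ 0 := by exact_mod_cast hy.ne'
  rw [abs_of_pos (mul_pos hy (Γ.ω_pos ψ)), Γ.dispRoot_p (Set.Ioo_subset_Icc_self hψ),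
    Complex.real_smul]
  push_cast
  field_simp

lemma exists_ω_lower : ∃ c : ℝ, 0 < c ∧ ∀ ψ ∈ Set.Icc (-(π / 2)) (π / 2), c ≤ Γ.ω ψ := by
  obtain ⟨ψ₂, _, hmin⟩ := isCompact_Icc.exists_isMinOn
    (Set.nonempty_Icc.mpr (by linarith [Real.pi_pos] : -(π / 2) ≤ π / 2))
    Γ.contDiff_ω.continuous.continuousOn
  exact ⟨Γ.ω ψ₂, Γ.ω_pos _, fun ψ hψ => hmin hψ⟩

/-- The data of the phase `n (μ p + τ)`, `μ = X / n`, used by the estimates below. -/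
lemma exists_phase_bounds (hK : Admissible K) : ∃ c M : ℝ, 0 < c ∧ 0 ≤ M ∧
    ∀ (X : ℤ) (n : ℕ), 0 < n → |(X : ℝ)| ≤ 2 * n → ∀ t ∈ Set.Ioo (-(π / 2)) (π / 2),
      X * Γ.y t = n * Γ.T t →
      (∀ ψ ∈ Set.Icc (-(π / 2)) (π / 2), c * |ψ - t| ≤ |X / n * Γ.y ψ - Γ.T ψ|) ∧
      ∃ γ' : ℝ → ℝ, Measurable γ' ∧
        (∀ ψ, HasDerivAt (fun ψ => (X / n * Γ.y ψ - Γ.T ψ) * Γ.ω ψ) (γ' ψ) ψ) ∧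
        (∀ ψ ∈ Set.Icc (-(π / 2)) (π / 2), |γ' ψ| ≤ M) ∧
        (∀ ψ ∈ Set.Icc (-(π / 2)) (π / 2),
          c * |ψ - t| ≤ |(X / n * Γ.y ψ - Γ.T ψ) * Γ.ω ψ|) ∧
        ∀ ψ, HasDerivAt (Γ.e X n)
          (Complex.I * (n : ℝ) * ((X / n * Γ.y ψ - Γ.T ψ) * Γ.ω ψ : ℝ) * Γ.e X n ψ) ψ := by
  obtain ⟨c, hc, hst⟩ := Γ.exists_stationary_bound hK
  obtain ⟨c', hc', hω⟩ := Γ.exists_ω_lower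
  obtain ⟨h1, -, h1c, -, M₁, hM₁, b₁⟩ :=
    exists_deriv_bounds (Γ.contDiff_y.mul Γ.contDiff_ω) (-(π / 2)) (π / 2)
  obtain ⟨h2, -, h2c, -, M₂, hM₂, b₂⟩ :=
    exists_deriv_bounds (Γ.contDiff_T.mul Γ.contDiff_ω) (-(π / 2)) (π / 2)
  refine ⟨min c (c * c'), 2 * M₁ + M₂, lt_min hc (mul_pos hc hc'), by positivity, ?_⟩
  intro X n hn hX t ht hstat
  have hnpos : (0 : ℝ) < n := by exact_mod_cast hn
  have hμ2 : |(X : ℝ) / n| ≤ 2 := by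
    rw [abs_div, abs_of_pos hnpos, div_le_iff₀ hnpos]; exact hX
  have hst' := hst (X / n) hμ2 t ht (by field_simp; linarith)
  refine ⟨fun ψ hψ => le_trans (by gcongr; exact min_le_left _ _) (hst' ψ hψ),
    fun ψ => X / n * deriv (fun ψ => Γ.y ψ * Γ.ω ψ) ψ - deriv (fun ψ => Γ.T ψ * Γ.ω ψ) ψ, ?_, ?_,
    ?_, ?_, ?_⟩
  · exact ((continuous_const.mul h1c).sub h2c).measurable
  · intro ψ
    exact (((h1 ψ).const_mul ((X : ℝ) / n)).sub (h2 ψ)).congr_of_eventuallyEq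
      (Eventually.of_forall fun ψ => by simp only [Pi.sub_apply]; ring)
  · intro ψ hψ
    refine (abs_sub _ _).trans ?_
    rw [abs_mul]
    have := (b₁ ψ hψ).2.1; have := (b₂ ψ hψ).2.1
    rw [Real.norm_eq_abs] at *
    gcongr
  · intro ψ hψ
    rw [abs_mul, abs_of_pos (Γ.ω_pos ψ)]
    calc min c (c * c') * |ψ - t| ≤ (c * |ψ - t|) * c' := by
          rw [mul_right_comm]; gcongr; exact min_le_right _ _
      _ ≤ _ := by
          have := hst' ψ hψ; have := hω ψ hψ
          gcongr
  · intro ψ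
    refine (Γ.hasDerivAt_e X n ψ).congr_deriv ?_
    have : (n : ℂ) ≠ 0 := by exact_mod_cast hn.ne'
    push_cast
    field_simp

/-- Oscillatory integrals over an arc are `O(n^{-1/2})`. -/
lemma exists_norm_integral_le (hK : Admissible K) (Bx Bn : ℤ) : ∃ C : ℝ, 0 ≤ C ∧
    ∀ (X : ℤ) (n : ℕ), 0 < n → |(X : ℝ)| ≤ 2 * n →
      ‖∫ ψ in (-(π / 2))..(π / 2), Γ.e (X + Bx) (n + Bn) ψ * Γ.ω ψ‖ ≤ C / √n := by
  have hpi := Real.pi_pos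
  obtain ⟨c, M, hc, hM, hph⟩ := Γ.exists_phase_bounds hK
  obtain ⟨h1, -, h1c, -, Q, hQ, b₁⟩ := exists_deriv_bounds
    ((Γ.contDiff_e Bx Bn).mul (contDiff_ofReal Γ.contDiff_ω)) (-(π / 2)) (π / 2)
  set A : ℝ → ℂ := fun ψ => Γ.e Bx Bn ψ * (Γ.ω ψ : ℂ) with hA
  refine ⟨2 * (Q * 4) + 8 * (Q * 4) / c + 4 * (Q * 4 * M / c ^ 2), by positivity, ?_⟩
  intro X n hn hX
  obtain ⟨t, ht, hst⟩ := Γ.exists_stationary (X / n)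
  have hnpos : (0 : ℝ) < n := by exact_mod_cast hn
  obtain ⟨-, γ', hγ'm, hγ, bγ, hγc, hE⟩ := hph X n hn hX t ht (by
    field_simp at hst; linarith)
  have h2 : ∀ ψ, Γ.e (X + Bx) (n + Bn) ψ * Γ.ω ψ = A ψ * Γ.e X n ψ := by
    intro ψ; rw [e_add, hA]; ring
  simp only [h2]
  refine norm_integral_le_of_stationary (Set.Ioo_subset_Icc_self ht) hc hnpos h1c.measurable hγ'm
    ?_ (fun ψ _ => hE ψ) (fun ψ _ => (Γ.norm_e X n ψ).le) (fun ψ _ => hγ ψ) bγ hγc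
    (fun ψ _ _ => h1 ψ) (fun ψ hψ _ => (b₁ ψ hψ).1.trans (by linarith)) (fun ψ hψ _ => ?_)
    (by positivity)
  · refine Continuous.intervalIntegrable ?_ _ _
    exact ((Γ.contDiff_e Bx Bn).continuous.mul (contDiff_ofReal Γ.contDiff_ω).continuous).mul
      (Γ.contDiff_e X n).continuous
  · have h3 : |ψ - t| ≤ 4 := by
      rw [abs_le]
      have := Real.pi_lt_four
      constructor <;> linarith [hψ.1, hψ.2, ht.1, ht.2]
    have := (b₁ ψ hψ).2.1
    gcongr

/-- Integration by parts over an arc, for amplitudes which vanish at the stationary point: the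
remainder is an oscillatory integral again. -/
lemma exists_integral_by_parts (hK : Admissible K) (Ax An Bx Bn : ℤ) : ∃ C : ℝ, 0 ≤ C ∧
    ∀ (X : ℤ) (n : ℕ), 0 < n → |(X : ℝ)| ≤ 2 * n → ∀ t ∈ Set.Ioo (-(π / 2)) (π / 2),
      X * Γ.y t = n * Γ.T t →
      ‖Complex.I * n * (∫ ψ in (-(π / 2))..(π / 2), Γ.e X n ψ *
          (Γ.e Bx Bn ψ * (Γ.e Ax An ψ - Γ.e Ax An t)) * Γ.ω ψ) -
        (Γ.e X n (π / 2) * (Γ.e Bx Bn (π / 2) * (Γ.e Ax An (π / 2) - Γ.e Ax An t)) /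
            (X / n * Γ.y (π / 2) - Γ.T (π / 2)) -
          Γ.e X n (-(π / 2)) * (Γ.e Bx Bn (-(π / 2)) * (Γ.e Ax An (-(π / 2)) - Γ.e Ax An t)) /
            (X / n * Γ.y (-(π / 2)) - Γ.T (-(π / 2))))‖ ≤ C / √n := by
  have hpi := Real.pi_pos
  obtain ⟨c, M, hc, hM, hph⟩ := Γ.exists_phase_bounds hK
  obtain ⟨f1, f2, f1c, f2c, M₁, hM₁, bf⟩ := exists_deriv_bounds
    (Γ.contDiff_e (Bx + Ax) (Bn + An)) (-(π / 2)) (π / 2)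
  obtain ⟨g1, g2, g1c, g2c, M₂, hM₂, bg⟩ := exists_deriv_bounds
    (Γ.contDiff_e Bx Bn) (-(π / 2)) (π / 2)
  obtain ⟨y1, y2, y1c, y2c, M₃, hM₃, b_y⟩ := exists_deriv_bounds
    (contDiff_ofReal Γ.contDiff_y) (-(π / 2)) (π / 2)
  obtain ⟨T1, T2, T1c, T2c, M₄, hM₄, bT⟩ := exists_deriv_bounds
    (contDiff_ofReal Γ.contDiff_T) (-(π / 2)) (π / 2)
  set P := M₁ + M₂ + 2 * M₃ + M₄ with hP
  set Q := 2 * P ^ 2 / c ^ 2 + 4 * P ^ 3 / c ^ 3 with hQ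
  refine ⟨2 * Q + 8 * Q / c + 4 * (Q * M / c ^ 2), by positivity, ?_⟩
  intro X n hn hX t ht hstat
  have hnpos : (0 : ℝ) < n := by exact_mod_cast hn
  obtain ⟨hDc, γ', hγ'm, hγ, bγ, hγc, hE⟩ := hph X n hn hX t ht hstat
  have ht' := Set.Ioo_subset_Icc_self ht
  set z := Γ.e Ax An t with hz
  have hz1 : ‖z‖ = 1 := Γ.norm_e _ _ _
  set μ : ℂ := (X : ℂ) / n with hμ
  have hμ2 : ‖μ‖ ≤ 2 := by
    rw [hμ, norm_div, Complex.norm_intCast, Complex.norm_natCast, div_le_iff₀ hnpos]; exact hX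
  set f : ℝ → ℂ := fun ψ => Γ.e (Bx + Ax) (Bn + An) ψ - z * Γ.e Bx Bn ψ with hf
  set f₁ : ℝ → ℂ := fun ψ => deriv (Γ.e (Bx + Ax) (Bn + An)) ψ - z * deriv (Γ.e Bx Bn) ψ with hf₁
  set f₂ : ℝ → ℂ := fun ψ => deriv (deriv (Γ.e (Bx + Ax) (Bn + An))) ψ -
    z * deriv (deriv (Γ.e Bx Bn)) ψ with hf₂
  set yC : ℝ → ℂ := fun ψ => (Γ.y ψ : ℂ) with hyC
  set TC : ℝ → ℂ := fun ψ => (Γ.T ψ : ℂ) with hTC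
  set g : ℝ → ℂ := fun ψ => μ * yC ψ - TC ψ with hg
  set g₁ : ℝ → ℂ := fun ψ => μ * deriv yC ψ - deriv TC ψ with hg₁
  set g₂ : ℝ → ℂ := fun ψ => μ * deriv (deriv yC) ψ - deriv (deriv TC) ψ with hg₂
  have hgr : ∀ ψ, g ψ = ((X / n * Γ.y ψ - Γ.T ψ : ℝ) : ℂ) := by
    intro ψ; simp only [hg, hμ, hyC, hTC]; push_cast; ring
  have hgt : g t = 0 := by
    rw [hgr]
    have : (X : ℝ) / n * Γ.y t - Γ.T t = 0 := by field_simp; linarith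
    rw [this, Complex.ofReal_zero]
  have hft : f t = 0 := by
    simp only [hf, e_add, hz]; ring
  have hgc : ∀ ψ ∈ Set.Icc (-(π / 2)) (π / 2), c * |ψ - t| ≤ ‖g ψ‖ := by
    intro ψ hψ
    rw [hgr, Complex.norm_real, Real.norm_eq_abs]
    exact hDc ψ hψ
  have hsubz : ∀ u v : ℂ, ‖u‖ ≤ M₁ → ‖v‖ ≤ M₂ → ‖u - z * v‖ ≤ P := by
    intro u v hu hv
    refine (norm_sub_le _ _).trans ?_
    rw [norm_mul, hz1]; linarith
  have hsubμ : ∀ u v : ℂ, ‖u‖ ≤ M₃ → ‖v‖ ≤ M₄ → ‖μ * u - v‖ ≤ P := by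
    intro u v hu hv
    refine (norm_sub_le _ _).trans ?_
    rw [norm_mul]
    have : ‖μ‖ * ‖u‖ ≤ 2 * M₃ := by gcongr
    linarith
  have hF : ∀ ψ, HasDerivAt f (f₁ ψ) ψ := fun ψ => (f1 ψ).sub ((g1 ψ).const_mul z)
  have hG : ∀ ψ, HasDerivAt g (g₁ ψ) ψ := fun ψ => ((y1 ψ).const_mul μ).sub (T1 ψ)
  -- The quotient `f / g` is regular at `t`, uniformly in the frequency.
  have key := fun ψ (hψ : ψ ∈ Set.Icc (-(π / 2)) (π / 2)) (hne : ψ ≠ t) =>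
    deriv_quotient_bounds (f := f) (f₁ := f₁) (f₂ := f₂) (g := g) (g₁ := g₁) (g₂ := g₂) (M := P)
      ht' hc (fun ψ _ => hF ψ)
      (fun ψ _ => (f2 ψ).sub ((g2 ψ).const_mul z)) (fun ψ _ => hG ψ)
      (fun ψ _ => ((y2 ψ).const_mul μ).sub (T2 ψ))
      (fun ψ hψ => hsubz _ _ (bf ψ hψ).2.1 (bg ψ hψ).2.1)
      (fun ψ hψ => hsubz _ _ (bf ψ hψ).2.2 (bg ψ hψ).2.2)
      (fun ψ hψ => hsubμ _ _ (b_y ψ hψ).2.1 (bT ψ hψ).2.1)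
      (fun ψ hψ => hsubμ _ _ (b_y ψ hψ).2.2 (bT ψ hψ).2.2) hft hgt hgc hψ hne
  have mf₁ : Continuous f₁ := f1c.sub (continuous_const.mul g1c)
  have mg₁ : Continuous g₁ := (continuous_const.mul y1c).sub T1c
  have mf₂ : Continuous f₂ := f2c.sub (continuous_const.mul g2c)
  have mg₂ : Continuous g₂ := (continuous_const.mul y2c).sub T2c
  have mf : Continuous f := continuous_iff_continuousAt.mpr fun ψ => (hF ψ).continuousAt
  have mg : Continuous g := continuous_iff_continuousAt.mpr fun ψ => (hG ψ).continuousAt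
  obtain ⟨hint, hparts⟩ := integral_by_parts_stationary (N := (n : ℝ)) (Q := Q) (M := 1)
    (E := Γ.e X n) (F := f) (F₁ := f₁) (D := g) (D₁ := g₁) (W := fun ψ => (Γ.ω ψ : ℂ)) ht hc
    (fun ψ _ => hF ψ) (fun ψ _ => hG ψ)
    (fun ψ _ => (hE ψ).congr_deriv (by rw [hgr]; push_cast; ring))
    (fun ψ _ => (Γ.norm_e X n ψ).le) mf₁.measurable mg₁.measurable
    (contDiff_ofReal Γ.contDiff_ω).continuous.continuousOn hft hgt hgc
    (fun ψ hψ hne => (key ψ hψ hne).2.1)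
  -- The derivative of `f / g` is the amplitude of the remainder, which is estimated once more.
  have hvdc := norm_integral_le_of_stationary (N := (n : ℝ)) (Q := Q) (E := Γ.e X n)
    (A := fun ψ => (f₁ ψ * g ψ - f ψ * g₁ ψ) / g ψ ^ 2)
    (A' := fun ψ => ((f₂ ψ * g ψ - f ψ * g₂ ψ) * g ψ - 2 * g₁ ψ * (f₁ ψ * g ψ - f ψ * g₁ ψ)) /
      g ψ ^ 3) ht' hc hnpos
    (by
      refine Measurable.div (Continuous.measurable ?_) (mg.pow 3).measurable
      fun_prop)
    hγ'm hint (fun ψ _ => hE ψ) (fun ψ _ => (Γ.norm_e X n ψ).le) (fun ψ _ => hγ ψ) bγ hγc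
    (fun ψ hψ hne => (key ψ hψ hne).1) (fun ψ hψ hne => (key ψ hψ hne).2.1)
    (fun ψ hψ hne => (key ψ hψ hne).2.2) (by positivity)
  refine le_trans (le_of_eq ?_) hvdc
  rw [← norm_neg]
  congr 1
  have e1 : ∀ ψ, Γ.e X n ψ * (Γ.e Bx Bn ψ * (Γ.e Ax An ψ - z)) * Γ.ω ψ =
      f ψ * (Γ.ω ψ : ℂ) * Γ.e X n ψ := by
    intro ψ; simp only [hf, e_add]; ring
  simp only [e1]
  rw [show Complex.I * (n : ℂ) = Complex.I * ((n : ℝ) : ℂ) by push_cast; rfl, hparts]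
  have e2 : ∀ ψ, Γ.e X n ψ * (Γ.e Bx Bn ψ * (Γ.e Ax An ψ - z)) / (μ * Γ.y ψ - Γ.T ψ) =
      Γ.e X n ψ * (f ψ / g ψ) := by
    intro ψ; simp only [hf, hg, e_add, hyC, hTC]; ring
  simp only [e2]
  ring

end Arc

namespace Arc

variable {K : ℝ} (Γ : Arc K)

/-- The contribution of an arc, together with evanescent pieces at its ends, to the Green's
function. -/
def J (X n : ℤ) : ℂ := ∫ q in Γ.a₀..Γ.b₀, mon K X n q / dispRoot K q

lemma dispY_a : dispY K Γ.a = 0 := by rw [Γ.dispY_eq]; simp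

lemma dispY_b : dispY K Γ.b = 0 := by rw [Γ.dispY_eq]; simp

lemma intervalIntegrable_div {K : ℝ} (Γ : Arc K) (hK : Admissible K) {u v : ℝ} (hu : Γ.a₀ ≤ u)
    (huv : u ≤ v) (hv : v ≤ Γ.b₀) {f : ℝ → ℂ} (hf : ContinuousOn f (Set.Icc Γ.a₀ Γ.b₀)) :
    IntervalIntegrable (fun q => f q / dispRoot K q) MeasureTheory.volume u v := by
  obtain ⟨M, hM⟩ := isCompact_Icc.exists_bound_of_continuousOn hf
  have hsub : Set.Ioo u v ⊆ Set.Icc Γ.a₀ Γ.b₀ := fun q hq => ⟨hu.trans hq.1.le, hq.2.le.trans hv⟩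
  exact intervalIntegrable_div_dispRoot hK (Γ.lower.le.trans hu) huv (hv.trans Γ.upper.le)
    ((hf.mono hsub).aestronglyMeasurable measurableSet_Ioo) fun q hq => hM q (hsub hq)

lemma continuousOn_mon (X n : ℤ) : ContinuousOn (mon K X n) (Set.Icc Γ.a₀ Γ.b₀) :=
  (TriangularLattice.continuousOn_mon K X n).mono fun _ hq => Γ.mem_Ioo hq

lemma integral_split (hK : Admissible K) {f : ℝ → ℂ} (hf : ContinuousOn f (Set.Icc Γ.a₀ Γ.b₀)) :
    ∫ q in Γ.a₀..Γ.b₀, f q / dispRoot K q = (∫ q in Γ.a₀..Γ.a, f q / dispRoot K q) +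
      (∫ ψ in (-(π / 2))..(π / 2), f (Γ.p ψ) * Γ.ω ψ) + ∫ q in Γ.b..Γ.b₀, f q / dispRoot K q := by
  have h1 := Γ.lt_left; have h2 := Γ.lt_mid; have h3 := Γ.lt_right
  rw [← integral_comp_p, intervalIntegral.integral_add_adjacent_intervals,
    intervalIntegral.integral_add_adjacent_intervals]
  all_goals exact Γ.intervalIntegrable_div hK (by linarith) (by linarith) (by linarith) hf

/-- The contribution of an arc decays as `n^{-1/2}`. -/
lemma exists_norm_J_le (hK : Admissible K) (Bx Bn : ℤ) : ∃ C : ℝ, 0 ≤ C ∧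
    ∀ (X : ℤ) (n : ℕ), 0 < n → |(X : ℝ)| ≤ 2 * n → ‖Γ.J (X + Bx) (n + Bn)‖ ≤ C / √n := by
  obtain ⟨C, hC, hcen⟩ := Γ.exists_norm_integral_le hK Bx Bn
  obtain ⟨C', hC', hev⟩ := integral_evanescent_le hK
  obtain ⟨M, hM⟩ := isCompact_Icc.exists_bound_of_continuousOn (Γ.continuousOn_mon Bx Bn)
  have hM0 : 0 ≤ M := (norm_nonneg _).trans (hM Γ.a (Γ.Icc_subset
    (Set.left_mem_Icc.mpr Γ.lt_mid.le)))
  refine ⟨M * C' + C + M * C', by positivity, ?_⟩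
  intro X n hn hX
  have h1 := Γ.lt_left; have h2 := Γ.lt_mid; have h3 := Γ.lt_right
  have hl := Γ.lower; have hu := Γ.upper
  rw [J, Γ.integral_split hK (Γ.continuousOn_mon _ _)]
  have hev' : ∀ u v : ℝ, Γ.a₀ ≤ u → u ≤ v → v ≤ Γ.b₀ → (∀ q ∈ Set.Ioo u v, dispY K q < 0) →
      ‖∫ q in u..v, mon K (X + Bx) (n + Bn) q / dispRoot K q‖ ≤ M * C' / √n := by
    intro u v hu' huv hv' hY
    have h4 := hev u v (by linarith) huv (by linarith) hY M (mon K Bx Bn) hM0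
      (fun q hq => hM q ⟨hu'.trans hq.1.le, hq.2.le.trans hv'⟩) X n hn
    refine le_trans (le_of_eq ?_) h4
    congr 1
    refine intervalIntegral.integral_congr fun q hq => ?_
    rw [Set.uIcc_of_le huv] at hq
    rw [mon_add K (Γ.cos_pos ⟨hu'.trans hq.1, hq.2.trans hv'⟩)]
  have e1 := hev' Γ.a₀ Γ.a le_rfl h1.le (by linarith) fun q hq => Γ.dispY_left q ⟨hq.1.le, hq.2⟩
  have e2 := hev' Γ.b Γ.b₀ (by linarith) h3.le le_rfl fun q hq => Γ.dispY_right q ⟨hq.1, hq.2.le⟩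
  have e3 : ‖∫ ψ in (-(π / 2))..(π / 2), mon K (X + Bx) (n + Bn) (Γ.p ψ) * Γ.ω ψ‖ ≤ C / √n := by
    refine le_trans (le_of_eq ?_) (hcen X n hn hX)
    congr 1
    refine intervalIntegral.integral_congr fun ψ hψ => ?_
    rw [Set.uIcc_of_le (by linarith [Real.pi_pos])] at hψ
    rw [Γ.mon_p hψ]
  refine (norm_add₃_le).trans ?_
  rw [add_div, add_div]
  linarith

/-- At an evanescent point the boundary terms of the integration by parts are negligible. -/
lemma norm_boundary_le {K q : ℝ} (hq : 0 < Real.cos q) (hY : dispY K q < 0)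
    (hT : dispT K q ≠ 0) {M : ℝ} {G : ℂ} (hG : ‖G‖ ≤ M) (μ : ℝ) (X : ℤ) {n : ℕ} (hn : 0 < n) :
    ‖mon K X n q * G / (μ * dispRoot K q - dispT K q)‖ ≤
      M / (‖dispRoot K q‖ * |dispT K q|) / √n := by
  have h1 := one_add_le_norm_dispW_inv hq hY
  have hr : √(-dispY K q) = ‖dispRoot K q‖ := by rw [norm_dispRoot, abs_of_neg hY]
  rw [hr] at h1
  have hrpos : 0 < ‖dispRoot K q‖ := norm_pos_iff.mpr (dispRoot_ne_zero hY.ne)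
  set r := ‖dispRoot K q‖
  have hnpos : (1 : ℝ) ≤ n := by exact_mod_cast hn
  have hM : 0 ≤ M := (norm_nonneg _).trans hG
  have h2 : √n * r ≤ ‖(dispW K q)⁻¹‖ ^ n := by
    have h3 : 1 + (n : ℝ) * r ≤ (1 + r) ^ n := one_add_mul_le_pow (by linarith) n
    have h4 : √n ≤ n := (Real.sqrt_le_left (by linarith)).mpr (by nlinarith)
    have h5 : √n * r ≤ 1 + n * r := by nlinarith
    exact h5.trans (h3.trans (by gcongr))
  have hsn : 0 < √(n : ℝ) := Real.sqrt_pos.mpr (by linarith)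
  have h5 : ‖mon K X n q‖ ≤ (√n * r)⁻¹ := by
    rw [norm_mon, zpow_natCast]
    rw [norm_inv, inv_pow] at h2
    exact (le_inv_comm₀ (by positivity)
      (pow_pos (norm_pos_iff.mpr (dispW_ne_zero K hq)) n)).mp h2
  have h6 := abs_dispT_le_norm hY.le μ
  have hTp := abs_pos.mpr hT
  rw [norm_div, norm_mul]
  calc ‖mon K X n q‖ * ‖G‖ / ‖(μ : ℂ) * dispRoot K q - dispT K q‖
      ≤ (√n * r)⁻¹ * M / |dispT K q| := by gcongr
    _ = _ := by field_simp

/-- The contribution of an arc is multiplied by a phase under translations, up to an error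
`O(n^{-3/2})`. -/
lemma exists_norm_J_translate_le (hK : Admissible K) (Ax An Bx Bn : ℤ) : ∃ C : ℝ, 0 ≤ C ∧
    ∀ (X : ℤ) (n : ℕ), 0 < n → |(X : ℝ)| ≤ 2 * n → ∀ t ∈ Set.Ioo (-(π / 2)) (π / 2),
      X * Γ.y t = n * Γ.T t →
      ‖Γ.J (X + Bx + Ax) (n + Bn + An) - Γ.e Ax An t * Γ.J (X + Bx) (n + Bn)‖ ≤
        C / (n * √n) := by
  have h1 := Γ.lt_left; have h2 := Γ.lt_mid; have h3 := Γ.lt_right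
  have hl := Γ.lower; have hu := Γ.upper
  have hpi := Real.pi_pos
  obtain ⟨C, hC, hcen⟩ := Γ.exists_integral_by_parts hK Ax An Bx Bn
  have hYl : ∀ q ∈ Set.Icc Γ.a₀ Γ.a, dispY K q ≤ 0 := by
    intro q hq
    rcases eq_or_lt_of_le hq.2 with rfl | h
    · exact Γ.dispY_a.le
    · exact (Γ.dispY_left q ⟨hq.1, h⟩).le
  have hYr : ∀ q ∈ Set.Icc Γ.b Γ.b₀, dispY K q ≤ 0 := by
    intro q hq
    rcases eq_or_lt_of_le hq.1 with rfl | h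
    · exact Γ.dispY_b.le
    · exact (Γ.dispY_right q ⟨h, hq.2⟩).le
  obtain ⟨C₁, hev₁⟩ := integral_by_parts_evanescent hK hl h1.le (by linarith)
    (fun q hq => Γ.dispY_left q ⟨hq.1.le, hq.2⟩) Γ.dispT_left hYl Ax An Bx Bn
  obtain ⟨C₂, hev₂⟩ := integral_by_parts_evanescent hK (by linarith) h3.le hu
    (fun q hq => Γ.dispY_right q ⟨hq.1, hq.2.le⟩) Γ.dispT_right hYr Ax An Bx Bn
  obtain ⟨MA, hMA⟩ := isCompact_Icc.exists_bound_of_continuousOn (Γ.continuousOn_mon Ax An)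
  obtain ⟨MB, hMB⟩ := isCompact_Icc.exists_bound_of_continuousOn (Γ.continuousOn_mon Bx Bn)
  have m₀ : Γ.a₀ ∈ Set.Icc Γ.a₀ Γ.b₀ := ⟨le_rfl, by linarith⟩
  have m₁ : Γ.b₀ ∈ Set.Icc Γ.a₀ Γ.b₀ := ⟨by linarith, le_rfl⟩
  have hMA0 := (norm_nonneg _).trans (hMA _ m₀)
  have hMB0 := (norm_nonneg _).trans (hMB _ m₀)
  set P := MB * (MA + 1) with hP
  set C₃ := P / (‖dispRoot K Γ.a₀‖ * |dispT K Γ.a₀|)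
  set C₄ := P / (‖dispRoot K Γ.b₀‖ * |dispT K Γ.b₀|)
  have hC₃ : 0 ≤ C₃ := by positivity
  have hC₄ : 0 ≤ C₄ := by positivity
  refine ⟨|C₁| + C + |C₂| + C₃ + C₄, by positivity, ?_⟩
  intro X n hn hX t ht hst
  have hnpos : (0 : ℝ) < n := by exact_mod_cast hn
  have hnC : (n : ℂ) ≠ 0 := by exact_mod_cast hn.ne'
  have hsn : 0 < √(n : ℝ) := Real.sqrt_pos.mpr hnpos
  set z := Γ.e Ax An t with hz
  have hz1 : ‖z‖ = 1 := Γ.norm_e _ _ _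
  set F : ℝ → ℂ := fun q => mon K Bx Bn q * (mon K Ax An q - z) with hF
  have hFc : ContinuousOn F (Set.Icc Γ.a₀ Γ.b₀) :=
    (Γ.continuousOn_mon _ _).mul ((Γ.continuousOn_mon _ _).sub continuousOn_const)
  have hFb : ∀ q ∈ Set.Icc Γ.a₀ Γ.b₀, ‖F q‖ ≤ P := by
    intro q hq
    simp only [hF]
    rw [norm_mul, hP]
    have b1 := hMB q hq
    have b2 : ‖mon K Ax An q - z‖ ≤ MA + 1 := by
      refine (norm_sub_le _ _).trans ?_
      rw [hz1]; have := hMA q hq; gcongr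
    gcongr
  -- The difference is an integral over the arc whose amplitude vanishes at the stationary point.
  have hJ : Γ.J (X + Bx + Ax) (n + Bn + An) - z * Γ.J (X + Bx) (n + Bn) =
      ∫ q in Γ.a₀..Γ.b₀, mon K X n q * F q / dispRoot K q := by
    rw [J, J, ← intervalIntegral.integral_const_mul, ← intervalIntegral.integral_sub]
    · refine intervalIntegral.integral_congr fun q hq => ?_
      rw [Set.uIcc_of_le (by linarith)] at hq
      have hc := Γ.cos_pos hq
      simp only [hF]
      rw [mon_add K hc, mon_add K hc]
      ring
    · exact Γ.intervalIntegrable_div hK le_rfl (by linarith) le_rfl (Γ.continuousOn_mon _ _)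
    · exact (Γ.intervalIntegrable_div hK le_rfl (by linarith) le_rfl
        (Γ.continuousOn_mon _ _)).const_mul _
  rw [hJ, Γ.integral_split hK (f := fun q => mon K X n q * F q) ((Γ.continuousOn_mon _ _).mul hFc)]
  have e1 := hev₁ X n hn hX z hz1
  have e2 := hev₂ X n hn hX z hz1
  have e3 := hcen X n hn hX t ht hst
  have g0 : (-(π / 2)) ∈ Set.Icc (-(π / 2)) (π / 2) := ⟨le_rfl, by linarith⟩
  have g1 : π / 2 ∈ Set.Icc (-(π / 2)) (π / 2) := ⟨by linarith, le_rfl⟩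
  rw [← hz, ← Γ.mon_p g0, ← Γ.mon_p g0, ← Γ.mon_p g0, ← Γ.mon_p g1, ← Γ.mon_p g1, ← Γ.mon_p g1,
    ← Γ.dispRoot_p g0, ← Γ.dispRoot_p g1, T, T, p_left, p_right] at e3
  have e3' : ∫ ψ in (-(π / 2))..(π / 2), Γ.e X n ψ * (Γ.e Bx Bn ψ * (Γ.e Ax An ψ - z)) * Γ.ω ψ =
      ∫ ψ in (-(π / 2))..(π / 2), mon K X n (Γ.p ψ) * F (Γ.p ψ) * Γ.ω ψ := by
    refine intervalIntegral.integral_congr fun ψ hψ => ?_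
    rw [Set.uIcc_of_le (by linarith)] at hψ
    simp only [hF]
    rw [Γ.mon_p hψ, Γ.mon_p hψ, Γ.mon_p hψ]
  rw [e3'] at e3
  have b0 := norm_boundary_le (Γ.cos_pos m₀) (Γ.dispY_left _ ⟨le_rfl, h1⟩)
    (Γ.dispT_left _ ⟨le_rfl, h1.le⟩) (hFb _ m₀) (X / n) X hn
  have b1 := norm_boundary_le (Γ.cos_pos m₁) (Γ.dispY_right _ ⟨h3, le_rfl⟩)
    (Γ.dispT_right _ ⟨h3.le, le_rfl⟩) (hFb _ m₁) (X / n) X hn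
  push_cast at b0 b1
  -- The boundary terms at the branch points `a` and `b` cancel between adjacent parts; those at the
  -- outer ends `a₀` and `b₀` are evanescent, hence small.
  have key : ‖Complex.I * n * ((∫ q in Γ.a₀..Γ.a, mon K X n q * F q / dispRoot K q) +
      (∫ ψ in (-(π / 2))..(π / 2), mon K X n (Γ.p ψ) * F (Γ.p ψ) * Γ.ω ψ) +
      ∫ q in Γ.b..Γ.b₀, mon K X n q * F q / dispRoot K q)‖ ≤
      (|C₁| + C + |C₂| + C₃ + C₄) / √n := by
    have s := norm_add_le_of_le (norm_sub_le_of_le (norm_add_le_of_le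
      (norm_add_le_of_le e1 e3) e2) b0) b1
    have hs : C₁ / √n + C / √n + C₂ / √n + C₃ / √n + C₄ / √n ≤
        (|C₁| + C + |C₂| + C₃ + C₄) / √n := by
      rw [← add_div, ← add_div, ← add_div, ← add_div]
      have := le_abs_self C₁; have := le_abs_self C₂
      gcongr
    refine le_trans (le_of_eq ?_) (s.trans hs)
    congr 1
    simp only [hF]
    ring
  rw [norm_mul, norm_mul, Complex.norm_I, one_mul, Complex.norm_natCast] at key
  rw [mul_comm (n : ℝ) √n, ← div_div, le_div_iff₀ hnpos, mul_comm]
  exact key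

end Arc

/-! ### The arcs of the level curve -/

/-- The mirror image of an arc. -/
def Arc.mirror {K : ℝ} (Γ : Arc K) : Arc K where
  a₀ := -Γ.b₀
  a := -Γ.b
  b := -Γ.a
  b₀ := -Γ.a₀
  Z p := Γ.Z (-p)
  lower := neg_lt_neg Γ.upper
  lt_left := neg_lt_neg Γ.lt_right
  lt_mid := neg_lt_neg Γ.lt_mid
  lt_right := neg_lt_neg Γ.lt_left
  upper := by linarith [Γ.lower]
  contDiff_Z := Γ.contDiff_Z.comp contDiff_neg
  Z_pos p hp := Γ.Z_pos _ ⟨by linarith [hp.2], by linarith [hp.1]⟩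
  dispY_eq p := by
    rw [← dispY_neg K p, Γ.dispY_eq (-p)]
    rw [show (p - -Γ.b) / 2 = (Γ.b - -p) / 2 by ring, show (-Γ.a - p) / 2 = (-p - Γ.a) / 2 by ring]
    ring
  dispT_ends := by
    have h : ∀ q, dispT K (-q) = -dispT K q := fun q => by
      simp only [dispT, Real.sin_neg, Real.cos_neg]; ring
    rw [h, h, neg_mul_neg, mul_comm]
    exact Γ.dispT_ends
  dispY_left p hp := by
    rw [← dispY_neg]
    exact Γ.dispY_right _ ⟨by linarith [hp.2], by linarith [hp.1]⟩
  dispY_right p hp := by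
    rw [← dispY_neg]
    exact Γ.dispY_left _ ⟨by linarith [hp.2], by linarith [hp.1]⟩
  dispT_left p hp := by
    have := Γ.dispT_right (-p) ⟨by linarith [hp.2], by linarith [hp.1]⟩
    contrapose! this
    simp only [dispT, Real.sin_neg, Real.cos_neg, neg_mul, neg_div] at this ⊢
    rw [this, neg_zero]
  dispT_right p hp := by
    have := Γ.dispT_left (-p) ⟨by linarith [hp.2], by linarith [hp.1]⟩
    contrapose! this
    simp only [dispT, Real.sin_neg, Real.cos_neg, neg_mul, neg_div] at this ⊢
    rw [this, neg_zero]

lemma cos_lt_cos_of_abs_lt {p q : ℝ} (h : |p| < |q|) (hq : |q| ≤ π / 2) :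
    Real.cos q < Real.cos p := by
  rw [← Real.cos_abs p, ← Real.cos_abs q]
  exact Real.cos_lt_cos_of_nonneg_of_le_pi_div_two (abs_nonneg _) hq h

/-- Beyond `angA` the level curve is evanescent. -/
lemma dispY_neg_of_angA_lt {K : ℝ} (hK : Admissible K) {p : ℝ} (hp : angA K < |p|)
    (hp' : |p| ≤ π / 2) : dispY K p < 0 := by
  have hA := angA_mem hK
  have hpi := Real.pi_pos
  have h1 := abs_kap_sub_one_div_two hK
  have h2 : Real.cos p < |kap K - 1| / 2 := by
    rw [← cos_angA hK]
    exact cos_lt_cos_of_abs_lt (by rwa [abs_of_pos hA.1]) hp'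
  have h3 : 0 ≤ Real.cos p := Real.cos_nonneg_of_mem_Icc (abs_le.mp hp')
  have h4 : |kap K - 1| / 2 < (kap K + 1) / 2 := by
    have : |kap K - 1| < kap K + 1 := abs_lt.mpr ⟨by linarith [kap_pos hK], by linarith⟩
    linarith
  rw [dispY_eq_mul hK]
  exact mul_neg_of_neg_of_pos (by nlinarith) (by nlinarith)

lemma dispY_neg_of_lt_angB {K : ℝ} (hK : Admissible K) (h : K < 0) {p : ℝ} (hp : |p| < angB K) :
    dispY K p < 0 := by
  have hA := angA_mem hK
  have hpi := Real.pi_pos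
  have hB := angB_mem hK h
  have h1 := abs_kap_sub_one_div_two hK
  have h2 : (kap K + 1) / 2 < Real.cos p := by
    rw [← cos_angB hK h]
    exact cos_lt_cos_of_abs_lt (by rwa [abs_of_pos hB.1]) (by
      rw [abs_of_pos hB.1]; linarith [hB.2, hA.2])
  have h4 : |kap K - 1| / 2 < (kap K + 1) / 2 := by
    have : |kap K - 1| < kap K + 1 := abs_lt.mpr ⟨by linarith [kap_pos hK], by linarith⟩
    linarith
  rw [dispY_eq_mul hK]
  exact mul_neg_of_pos_of_neg (by nlinarith) (by nlinarith)

/-- The level curve is a single closed curve if `K > 0`; the half on which `sin τ` is positive is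
an arc. -/
def symmetricArc {K : ℝ} (hK : Admissible K) (h : 0 < K) : Arc K where
  a₀ := -((angA K + π / 2) / 2)
  a := -angA K
  b := angA K
  b₀ := (angA K + π / 2) / 2
  Z p := 2 * (Real.cos p + |kap K - 1| / 2) * (((kap K + 1) / 2) ^ 2 - Real.cos p ^ 2)
  lower := by linarith [(angA_mem hK).2]
  lt_left := by linarith [(angA_mem hK).2]
  lt_mid := by linarith [(angA_mem hK).1]
  lt_right := by linarith [(angA_mem hK).2]
  upper := by linarith [(angA_mem hK).2]
  contDiff_Z := by fun_prop
  Z_pos p hp := by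
    have hA := angA_mem hK
    have hpi := Real.pi_pos
    have h1 := abs_kap_sub_one_div_two hK
    have h2 := one_lt_kap hK h
    have h3 : 0 ≤ Real.cos p := Real.cos_nonneg_of_mem_Icc
      ⟨by linarith [hp.1, hA.2], by linarith [hp.2, hA.2]⟩
    have h4 := Real.cos_le_one p
    exact mul_pos (by linarith) (by nlinarith)
  dispY_eq p := by
    have h1 := Real.cos_sub_cos p (angA K)
    rw [cos_angA hK] at h1
    rw [dispY_eq_mul hK, show (Real.cos p ^ 2 - (|kap K - 1| / 2) ^ 2) =
      (Real.cos p - |kap K - 1| / 2) * (Real.cos p + |kap K - 1| / 2) by ring, h1,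
      show (angA K - p) / 2 = -((p - angA K) / 2) by ring, Real.sin_neg, sub_neg_eq_add]
    ring
  dispT_ends := by
    have hA := angA_mem hK
    have hpi := Real.pi_pos
    have h1 : 0 < Real.cos (angA K) := Real.cos_pos_of_mem_Ioo ⟨by linarith [hA.1], hA.2⟩
    have h2 : 0 < Real.sin (angA K) := Real.sin_pos_of_pos_of_lt_pi hA.1 (by linarith [hA.2])
    simp only [dispT, Real.sin_neg, Real.cos_neg]
    rw [neg_mul, neg_div, neg_mul]
    have : 0 < Real.sin (angA K) * (K + Real.cos (angA K) ^ 2) / Real.cos (angA K) := by positivity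
    nlinarith
  dispY_left p hp := by
    have hA := angA_mem hK
    have hpi := Real.pi_pos
    have h1 : |p| = -p := abs_of_neg (by linarith [hp.2, hA.1])
    exact dispY_neg_of_angA_lt hK (by rw [h1]; linarith [hp.2])
      (by rw [h1]; linarith [hp.1, hA.2])
  dispY_right p hp := by
    have hA := angA_mem hK
    have hpi := Real.pi_pos
    have h1 : |p| = p := abs_of_pos (by linarith [hp.1, hA.1])
    exact dispY_neg_of_angA_lt hK (by rw [h1]; exact hp.1) (by rw [h1]; linarith [hp.2, hA.2])
  dispT_left p hp := by
    have hA := angA_mem hK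
    have hpi := Real.pi_pos
    have h1 : 0 < Real.cos p := Real.cos_pos_of_mem_Ioo
      ⟨by linarith [hp.1, hA.2], by linarith [hp.2, hA.1]⟩
    have h2 : Real.sin p < 0 := Real.sin_neg_of_neg_of_neg_pi_lt (by linarith [hp.2, hA.1])
      (by linarith [hp.1, hA.2])
    exact div_ne_zero (mul_ne_zero h2.ne (by positivity)) h1.ne'
  dispT_right p hp := by
    have hA := angA_mem hK
    have hpi := Real.pi_pos
    have h1 : 0 < Real.cos p := Real.cos_pos_of_mem_Ioo
      ⟨by linarith [hp.1, hA.1], by linarith [hp.2, hA.2]⟩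
    have h2 : 0 < Real.sin p := Real.sin_pos_of_pos_of_lt_pi (by linarith [hp.1, hA.1])
      (by linarith [hp.2, hA.2])
    exact div_ne_zero (mul_ne_zero h2.ne' (by positivity)) h1.ne'

lemma add_cos_sq_pos {K : ℝ} (hK : Admissible K) {c : ℝ} (hc : (kap K + 1) / 2 ≤ c) :
    0 < K + c ^ 2 := by
  nlinarith [kap_sq hK, kap_pos hK]

lemma add_cos_sq_neg {K : ℝ} (hK : Admissible K) (h : K < 0) {c : ℝ} (hc₀ : 0 ≤ c)
    (hc : c ≤ |kap K - 1| / 2) : K + c ^ 2 < 0 := by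
  have h1 := kap_lt_one hK h
  rw [abs_of_neg (by linarith)] at hc
  have h2 := kap_sq hK
  have h3 := kap_pos hK
  have h4 : c ^ 2 ≤ ((1 - kap K) / 2) ^ 2 := by
    have : c ≤ (1 - kap K) / 2 := by linarith
    gcongr
  nlinarith [mul_pos h3 (sub_pos.mpr h1)]

/-- The level curve has two components if `K < 0`; this is the upper half of the one with
`ξ₂ < ξ₁`. -/
def rightArc {K : ℝ} (hK : Admissible K) (h : K < 0) : Arc K where
  a₀ := angB K / 2
  a := angB K
  b := angA K
  b₀ := (angA K + π / 2) / 2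
  Z p := 4 * Real.sin ((angA K + p) / 2) * Real.sin ((p + angB K) / 2) *
    (Real.cos p + |kap K - 1| / 2) * ((kap K + 1) / 2 + Real.cos p)
  lower := by linarith [(angB_mem hK h).1, Real.pi_pos]
  lt_left := by linarith [(angB_mem hK h).1]
  lt_mid := (angB_mem hK h).2
  lt_right := by linarith [(angA_mem hK).2]
  upper := by linarith [(angA_mem hK).2]
  contDiff_Z := by fun_prop
  Z_pos p hp := by
    have hA := angA_mem hK
    have hpi := Real.pi_pos
    have hB := angB_mem hK h
    have h1 := abs_kap_sub_one_div_two hK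
    have h2 := kap_pos hK
    have h3 : 0 ≤ Real.cos p := Real.cos_nonneg_of_mem_Icc
      ⟨by linarith [hp.1, hB.1], by linarith [hp.2, hA.2]⟩
    have h4 : 0 < Real.sin ((angA K + p) / 2) := Real.sin_pos_of_pos_of_lt_pi
      (by linarith [hp.1, hB.1, hA.1]) (by linarith [hp.2, hA.2])
    have h5 : 0 < Real.sin ((p + angB K) / 2) := Real.sin_pos_of_pos_of_lt_pi
      (by linarith [hp.1, hB.1, hA.1]) (by linarith [hp.2, hA.2, hB.2])
    have := h1.1
    positivity
  dispY_eq p := by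
    have h1 := Real.cos_sub_cos p (angA K)
    have h2 := Real.cos_sub_cos (angB K) p
    rw [cos_angA hK] at h1
    rw [cos_angB hK h] at h2
    rw [dispY_eq_mul hK, show (Real.cos p ^ 2 - (|kap K - 1| / 2) ^ 2) =
      (Real.cos p - |kap K - 1| / 2) * (Real.cos p + |kap K - 1| / 2) by ring,
      show ((kap K + 1) / 2) ^ 2 - Real.cos p ^ 2 =
      ((kap K + 1) / 2 - Real.cos p) * ((kap K + 1) / 2 + Real.cos p) by ring, h1, h2,
      show (angA K - p) / 2 = -((p - angA K) / 2) by ring,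
      show (p - angB K) / 2 = -((angB K - p) / 2) by ring, Real.sin_neg, Real.sin_neg,
      add_comm (angA K) p, add_comm (angB K) p]
    ring
  dispT_ends := by
    have hA := angA_mem hK
    have hpi := Real.pi_pos
    have hB := angB_mem hK h
    have h1 : 0 < Real.cos (angA K) := Real.cos_pos_of_mem_Ioo ⟨by linarith [hA.1], hA.2⟩
    have h2 : 0 < Real.sin (angA K) := Real.sin_pos_of_pos_of_lt_pi hA.1 (by linarith [hA.2])
    have h3 : 0 < Real.cos (angB K) :=
      Real.cos_pos_of_mem_Ioo ⟨by linarith [hB.1], by linarith [hA.2, hB.2]⟩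
    have h4 : 0 < Real.sin (angB K) :=
      Real.sin_pos_of_pos_of_lt_pi hB.1 (by linarith [hA.2, hB.2])
    have h5 := add_cos_sq_pos hK (cos_angB hK h).ge
    have h6 := add_cos_sq_neg hK h h1.le (cos_angA hK).le
    exact mul_neg_of_pos_of_neg (div_pos (mul_pos h4 h5) h3)
      (div_neg_of_neg_of_pos (mul_neg_of_pos_of_neg h2 h6) h1)
  dispY_left p hp := by
    have hB := angB_mem hK h
    exact dispY_neg_of_lt_angB hK h (by
      rw [abs_of_pos (by linarith [hp.1, hB.1])]; exact hp.2)
  dispY_right p hp := by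
    have hA := angA_mem hK
    have hpi := Real.pi_pos
    have h1 : |p| = p := abs_of_pos (by linarith [hp.1, hA.1])
    exact dispY_neg_of_angA_lt hK (by rw [h1]; exact hp.1) (by rw [h1]; linarith [hp.2, hA.2])
  dispT_left p hp := by
    have hA := angA_mem hK
    have hpi := Real.pi_pos
    have hB := angB_mem hK h
    have h1 : 0 < Real.cos p := Real.cos_pos_of_mem_Ioo
      ⟨by linarith [hp.1, hB.1], by linarith [hp.2, hA.2, hB.2]⟩
    have h2 : 0 < Real.sin p := Real.sin_pos_of_pos_of_lt_pi (by linarith [hp.1, hB.1])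
      (by linarith [hp.2, hA.2, hB.2])
    have h3 : (kap K + 1) / 2 ≤ Real.cos p := by
      rw [← cos_angB hK h]
      exact Real.cos_le_cos_of_nonneg_of_le_pi (by linarith [hp.1, hB.1])
        (by linarith [hA.2, hB.2]) hp.2
    exact div_ne_zero (mul_ne_zero h2.ne' (add_cos_sq_pos hK h3).ne') h1.ne'
  dispT_right p hp := by
    have hA := angA_mem hK
    have hpi := Real.pi_pos
    have h1 : 0 < Real.cos p := Real.cos_pos_of_mem_Ioo
      ⟨by linarith [hp.1, hA.1], by linarith [hp.2, hA.2]⟩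
    have h2 : 0 < Real.sin p := Real.sin_pos_of_pos_of_lt_pi (by linarith [hp.1, hA.1])
      (by linarith [hp.2, hA.2])
    have h3 : Real.cos p ≤ |kap K - 1| / 2 := by
      rw [← cos_angA hK]
      exact Real.cos_le_cos_of_nonneg_of_le_pi hA.1.le (by linarith [hp.2, hA.2]) hp.1
    exact div_ne_zero (mul_ne_zero h2.ne' (add_cos_sq_neg hK h h1.le h3).ne) h1.ne'

/-- The upper half of the component with `ξ₁ < ξ₂`, for `K < 0`. -/
def leftArc {K : ℝ} (hK : Admissible K) (h : K < 0) : Arc K := (rightArc hK h).mirror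

/-! ### Decomposition of the Green's function -/

/-- Away from the real points of the level curve the contribution to the Green's function is
negligible. -/
lemma exists_norm_integral_le_of_dispY_neg {K u v : ℝ} (hu : -(π / 2) ≤ u) (huv : u ≤ v)
    (hv : v ≤ π / 2) (hY : ∀ p ∈ Set.Icc u v, dispY K p < 0) : ∃ C : ℝ, 0 ≤ C ∧
    ∀ (X : ℤ) (n : ℕ), 0 < n → ‖∫ p in u..v, mon K X n p / dispRoot K p‖ ≤ C / n ^ 2 := by
  obtain ⟨p₀, hp₀, hmin⟩ := isCompact_Icc.exists_isMinOn (Set.nonempty_Icc.mpr huv)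
    (continuous_dispRoot K).norm.continuousOn
  have hr : 0 < ‖dispRoot K p₀‖ := norm_pos_iff.mpr (dispRoot_ne_zero (hY p₀ hp₀).ne)
  set r := ‖dispRoot K p₀‖ with hrdef
  -- `(1 + r) ^ n = (1 + s) ^ (2 n) ≥ (n s) ^ 2` by Bernoulli's inequality.
  set s := √(1 + r) - 1 with hs
  have hs0 : 0 < s := by
    have : 1 < √(1 + r) := by rw [Real.lt_sqrt (by norm_num)]; linarith
    linarith
  have hs2 : (1 + s) ^ 2 = 1 + r := by rw [hs, add_sub_cancel, Real.sq_sqrt (by linarith)]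
  refine ⟨(v - u) / (s ^ 2 * r), div_nonneg (by linarith) (by positivity), ?_⟩
  intro X n hn
  have hnpos : (0 : ℝ) < n := by exact_mod_cast hn
  have hb : ∀ p ∈ Set.uIoc u v, ‖mon K X n p / dispRoot K p‖ ≤ 1 / (n * s) ^ 2 / r := by
    intro p hp
    rw [Set.uIoc_of_le huv] at hp
    have hp' := Set.Ioc_subset_Icc_self hp
    have hYp := hY p hp'
    have hrp : r ≤ ‖dispRoot K p‖ := hmin hp'
    rw [norm_div, norm_mon, zpow_natCast]
    gcongr
    rcases (Real.cos_nonneg_of_mem_Icc (x := p) ⟨by linarith [hp.1], by linarith [hp.2]⟩).eq_or_lt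
      with hc | hc
    · have : dispW K p = 0 := by rw [dispW, ← hc]; simp
      rw [this, norm_zero, zero_pow hn.ne']
      positivity
    · have h1 := one_add_le_norm_dispW_inv hc hYp
      have hr' : √(-dispY K p) = ‖dispRoot K p‖ := by rw [norm_dispRoot, abs_of_neg hYp]
      rw [hr'] at h1
      have h2 : (n * s) ^ 2 ≤ ‖(dispW K p)⁻¹‖ ^ n := by
        have h3 : 1 + (n : ℝ) * s ≤ (1 + s) ^ n := one_add_mul_le_pow (by linarith) n
        calc (n * s) ^ 2 ≤ ((1 + s) ^ n) ^ 2 := by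
              gcongr; linarith
          _ = (1 + r) ^ n := by rw [← hs2, ← pow_mul, ← pow_mul, mul_comm]
          _ ≤ _ := by gcongr; linarith
      rw [norm_inv, inv_pow] at h2
      rw [one_div]
      exact (le_inv_comm₀ (by positivity)
        (pow_pos (norm_pos_iff.mpr (dispW_ne_zero K hc)) n)).mp h2
  refine (intervalIntegral.norm_integral_le_of_norm_le_const hb).trans (le_of_eq ?_)
  rw [abs_of_nonneg (by linarith)]
  field_simp

lemma intervalIntegrable_mon_div {K : ℝ} (hK : Admissible K) (X : ℤ) (n : ℕ) {u v : ℝ}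
    (hu : -(π / 2) ≤ u) (huv : u ≤ v) (hv : v ≤ π / 2) :
    IntervalIntegrable (fun p => mon K X n p / dispRoot K p) MeasureTheory.volume u v := by
  refine intervalIntegrable_div_dispRoot hK hu huv hv (M := 1)
    (measurable_mon K X n).aestronglyMeasurable fun p hp => ?_
  rw [norm_mon, zpow_natCast]
  exact pow_le_one₀ (norm_nonneg _) (norm_dispW_le (Real.cos_pos_of_mem_Ioo
    ⟨hu.trans_lt hp.1, hp.2.trans_le hv⟩))

lemma exists_norm_sub_J_le_of_pos {K : ℝ} (hK : Admissible K) (h : 0 < K) : ∃ C : ℝ, 0 ≤ C ∧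
    ∀ (X : ℤ) (n : ℕ), 0 < n → ‖(∫ p in (-(π / 2))..(π / 2), mon K X n p / dispRoot K p) -
      (symmetricArc hK h).J X n‖ ≤ C / n ^ 2 := by
  have hA := angA_mem hK
  have hpi := Real.pi_pos
  obtain ⟨C₁, hC₁, h₁⟩ := exists_norm_integral_le_of_dispY_neg (K := K) (u := -(π / 2))
    (v := -((angA K + π / 2) / 2)) le_rfl (by linarith [hA.2]) (by linarith [hA.1]) (by
      intro p hp
      have h1 : |p| = -p := abs_of_neg (by linarith [hp.2, hA.1])
      exact dispY_neg_of_angA_lt hK (by rw [h1]; linarith [hp.2, hA.2])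
        (by rw [h1]; linarith [hp.1]))
  obtain ⟨C₂, hC₂, h₂⟩ := exists_norm_integral_le_of_dispY_neg (K := K)
    (u := (angA K + π / 2) / 2) (v := π / 2) (by linarith [hA.1]) (by linarith [hA.2]) le_rfl (by
      intro p hp
      have h1 : |p| = p := abs_of_pos (by linarith [hp.1, hA.1])
      exact dispY_neg_of_angA_lt hK (by rw [h1]; linarith [hp.1, hA.2])
        (by rw [h1]; linarith [hp.2]))
  refine ⟨C₁ + C₂, by positivity, fun X n hn => ?_⟩
  have e : (∫ p in (-(π / 2))..(π / 2), mon K X n p / dispRoot K p) =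
      (∫ p in (-(π / 2))..(-((angA K + π / 2) / 2)), mon K X n p / dispRoot K p) +
      (symmetricArc hK h).J X n + ∫ p in ((angA K + π / 2) / 2)..(π / 2),
        mon K X n p / dispRoot K p := by
    simp only [Arc.J, symmetricArc]
    rw [intervalIntegral.integral_add_adjacent_intervals,
      intervalIntegral.integral_add_adjacent_intervals]
    all_goals
      exact intervalIntegrable_mon_div hK X n (by linarith [hA.1, hA.2])
        (by linarith [hA.1, hA.2]) (by linarith [hA.1, hA.2])
  rw [e, add_sub_right_comm, add_sub_cancel_right, add_div C₁]
  exact norm_add_le_of_le (h₁ X n hn) (h₂ X n hn)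

lemma exists_norm_sub_J_le_of_neg {K : ℝ} (hK : Admissible K) (h : K < 0) : ∃ C : ℝ, 0 ≤ C ∧
    ∀ (X : ℤ) (n : ℕ), 0 < n → ‖(∫ p in (-(π / 2))..(π / 2), mon K X n p / dispRoot K p) -
      ((leftArc hK h).J X n + (rightArc hK h).J X n)‖ ≤ C / n ^ 2 := by
  have hA := angA_mem hK
  have hpi := Real.pi_pos
  have hB := angB_mem hK h
  obtain ⟨C₁, hC₁, h₁⟩ := exists_norm_integral_le_of_dispY_neg (K := K) (u := -(π / 2))
    (v := -((angA K + π / 2) / 2)) le_rfl (by linarith [hA.2]) (by linarith [hA.1]) (by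
      intro p hp
      have h1 : |p| = -p := abs_of_neg (by linarith [hp.2, hA.1])
      exact dispY_neg_of_angA_lt hK (by rw [h1]; linarith [hp.2, hA.2])
        (by rw [h1]; linarith [hp.1]))
  obtain ⟨C₂, hC₂, h₂⟩ := exists_norm_integral_le_of_dispY_neg (K := K)
    (u := (angA K + π / 2) / 2) (v := π / 2) (by linarith [hA.1]) (by linarith [hA.2]) le_rfl (by
      intro p hp
      have h1 : |p| = p := abs_of_pos (by linarith [hp.1, hA.1])
      exact dispY_neg_of_angA_lt hK (by rw [h1]; linarith [hp.1, hA.2])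
        (by rw [h1]; linarith [hp.2]))
  obtain ⟨C₃, hC₃, h₃⟩ := exists_norm_integral_le_of_dispY_neg (K := K)
    (u := -(angB K / 2)) (v := angB K / 2) (by linarith [hA.2, hB.2]) (by linarith [hB.1])
    (by linarith [hA.2, hB.2]) (by
      intro p hp
      have h1 : |p| ≤ angB K / 2 := abs_le.mpr hp
      exact dispY_neg_of_lt_angB hK h (by linarith [hB.1]))
  refine ⟨C₁ + C₃ + C₂, by positivity, fun X n hn => ?_⟩
  have e : (∫ p in (-(π / 2))..(π / 2), mon K X n p / dispRoot K p) =
      (∫ p in (-(π / 2))..(-((angA K + π / 2) / 2)), mon K X n p / dispRoot K p) +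
      (leftArc hK h).J X n + (∫ p in (-(angB K / 2))..(angB K / 2), mon K X n p / dispRoot K p) +
      (rightArc hK h).J X n + ∫ p in ((angA K + π / 2) / 2)..(π / 2),
        mon K X n p / dispRoot K p := by
    simp only [Arc.J, leftArc, Arc.mirror, rightArc]
    rw [intervalIntegral.integral_add_adjacent_intervals,
      intervalIntegral.integral_add_adjacent_intervals,
      intervalIntegral.integral_add_adjacent_intervals,
      intervalIntegral.integral_add_adjacent_intervals]
    all_goals
      exact intervalIntegrable_mon_div hK X n (by linarith [hA.1, hA.2, hB.1, hB.2])
        (by linarith [hA.1, hA.2, hB.1, hB.2]) (by linarith [hA.1, hA.2, hB.1, hB.2])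
  rw [e, add_div (C₁ + C₃), add_div C₁]
  refine le_trans (le_of_eq ?_) (norm_add_le_of_le (norm_add_le_of_le (h₁ X n hn) (h₃ X n hn))
    (h₂ X n hn))
  congr 1
  ring

/-! ### The hexagonal symmetry group -/

/-- The reflection `reflect` of the triangular lattice, with coefficients in any ring. -/
def hexReflect {R : Type*} [Ring R] (x : R × R) : R × R := (x.1 + x.2, -x.2)

/-- The norm of the plane whose unit ball is the hexagon with vertices `± e₁`, `± e₂`,
`± (e₁ - e₂)`; it is invariant under the symmetries of the triangular lattice. -/
def hexNorm {R : Type*} [Ring R] [LinearOrder R] (x : R × R) : R :=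
  max (max |x.1| |x.2|) |x.1 + x.2|

section Hex

lemma hexNorm_swapCoord {R : Type*} [CommRing R] [LinearOrder R] (x : R × R) :
    hexNorm (swapCoord x) = hexNorm x := by
  simp only [hexNorm, swapCoord, max_comm |x.2|, add_comm x.2]

lemma hexNorm_hexReflect {R : Type*} [CommRing R] [LinearOrder R] (x : R × R) :
    hexNorm (hexReflect x) = hexNorm x := by
  simp only [hexNorm, hexReflect, abs_neg, add_neg_cancel_right]
  rw [max_comm, ← max_assoc, max_right_comm]

variable {R : Type*} [CommRing R] [LinearOrder R] [IsStrictOrderedRing R]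

lemma hexNorm_of_sector {x : R × R} (h₁ : -x.2 ≤ x.1) (h₂ : x.1 ≤ 0) : hexNorm x = x.2 := by
  have h : 0 ≤ x.2 := by linarith
  rw [hexNorm, abs_of_nonneg h, abs_of_nonpos h₂, abs_of_nonneg (by linarith),
    max_eq_right (by linarith : -x.1 ≤ x.2), max_eq_left (by linarith)]

/-- The images of the sector `-x₂ ≤ x₁ ≤ 0` under the two reflections cover the plane. -/
lemma sector_induction {P : R × R → Prop} (hs : ∀ x, P x → P (swapCoord x))
    (hr : ∀ x, P x → P (hexReflect x)) (hP : ∀ x : R × R, -x.2 ≤ x.1 → x.1 ≤ 0 → P x)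
    (x : R × R) : P x := by
  have hrr : ∀ x : R × R, hexReflect (hexReflect x) = x := fun x => by
    simp [hexReflect]
  have hss : ∀ x : R × R, swapCoord (swapCoord x) = x := fun x => rfl
  have hup : ∀ x : R × R, 0 ≤ x.2 → P x := by
    intro x hx
    rcases le_or_gt x.1 0 with h1 | h1
    · rcases le_or_gt (-x.2) x.1 with h2 | h2
      · exact hP x h2 h1
      · rw [← hss x, ← hrr (swapCoord x)]
        refine hs _ (hr _ (hP _ ?_ ?_)) <;> simp only [hexReflect, swapCoord] <;> linarith
    · rw [← hrr x, ← hss (hexReflect x)]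
      refine hr _ (hs _ (hP _ ?_ ?_)) <;> simp only [hexReflect, swapCoord] <;> linarith
  rcases le_or_gt 0 x.2 with h | h
  · exact hup x h
  · rw [← hrr x]
    exact hr _ (hup _ (by simp only [hexReflect]; linarith))

end Hex

/-! ### Far-field points -/

/-- `ξ` is a point of the level curve `σ(ξ; 8 - 4K) = 0` at which the outer normal, the gradient of
`-laplaceSymbol`, is a positive multiple of `v`. -/
def FarField (K : ℝ) (v ξ : ℝ × ℝ) : Prop :=
  8 - 4 * K + laplaceSymbol ξ = 0 ∧ ∃ c : ℝ, 0 < c ∧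
    2 * Real.sin ξ.1 + 2 * Real.sin (ξ.1 - ξ.2) = c * v.1 ∧
    2 * Real.sin ξ.2 - 2 * Real.sin (ξ.1 - ξ.2) = c * v.2

/-- For `K < 0` the sign of this function distinguishes the two components of the level curve. -/
def orientation (ξ : ℝ × ℝ) : ℝ := Real.sin ξ.1 - Real.sin ξ.2 - Real.sin (ξ.1 - ξ.2)

lemma FarField.swapCoord {K : ℝ} {v ξ : ℝ × ℝ} (h : FarField K v ξ) :
    FarField K (swapCoord v) (swapCoord ξ) := by
  obtain ⟨h1, c, hc, h2, h3⟩ := h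
  refine ⟨by rw [laplaceSymbol_swapCoord, h1], c, hc, ?_, ?_⟩ <;>
  · simp only [TriangularLattice.swapCoord]
    rw [← neg_sub ξ.1, Real.sin_neg]
    linarith

lemma FarField.hexReflect {K : ℝ} {v ξ : ℝ × ℝ} (h : FarField K v ξ) :
    FarField K (hexReflect v) (reflectDual ξ) := by
  obtain ⟨h1, c, hc, h2, h3⟩ := h
  refine ⟨by rw [laplaceSymbol_reflectDual, h1], c, hc, ?_, ?_⟩ <;>
  · simp only [TriangularLattice.hexReflect, reflectDual, sub_sub_cancel]
    linarith

lemma orientation_swapCoord (ξ : ℝ × ℝ) : orientation (swapCoord ξ) = -orientation ξ := by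
  simp only [orientation, swapCoord]
  rw [← neg_sub ξ.1, Real.sin_neg]
  ring

lemma orientation_reflectDual (ξ : ℝ × ℝ) : orientation (reflectDual ξ) = orientation ξ := by
  simp only [orientation, reflectDual, sub_sub_cancel]
  ring

lemma cos_lt_neg_of_mul_neg {K c d : ℝ} (hK : K < 0) (hc : 0 < c) (h : c * (c + d) = K) :
    d < c := by
  nlinarith

/-- Far-field points in the coordinates `p = ξ₁ / 2`, `τ = ξ₂ - ξ₁ / 2`. -/
lemma FarField.exists_angle {K : ℝ} (hK : Admissible K) {v ξ : ℝ × ℝ} (hv : 0 < v.2)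
    (h : FarField K v ξ) : ∃ p ∈ Set.Ioo (-(π / 2)) (π / 2), 0 < dispY K p ∧
      (2 * v.1 + v.2) * √(dispY K p) = v.2 * dispT K p ∧
      (∀ a : ℤ × ℤ, char ξ a = mon K (2 * a.1 + a.2) a.2 p) ∧
      (K < 0 → 0 < orientation ξ * Real.sin p) := by
  obtain ⟨h1, l, hl, h2, h3⟩ := h
  have hpi := Real.pi_pos
  -- The period `π` in `p` is compensated by a shift of `τ`, so `p` may be normalized.
  obtain ⟨j, hj, -⟩ := existsUnique_sub_zsmul_mem_Ico hpi (ξ.1 / 2) (-(π / 2))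
  simp only [zsmul_eq_mul] at hj
  set p := ξ.1 / 2 - j * π with hp
  set τ := ξ.2 - p with hτ
  have e1 : ξ.1 = 2 * p + j * (2 * π) := by rw [hp]; ring
  have e2 : ξ.2 = p + τ := by rw [hτ]; ring
  have e3 : ξ.1 - ξ.2 = p - τ + j * (2 * π) := by rw [e1, e2]; ring
  clear_value p τ
  have hL : 8 - 4 * K + laplaceSymbol (2 * p, p + τ) = 0 := by
    rw [← h1]
    simp only [laplaceSymbol]
    rw [e3, e1, e2, Real.cos_add_int_mul_two_pi, Real.cos_add_int_mul_two_pi,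
      show 2 * p - (p + τ) = p - τ by ring]
  rw [laplaceSymbol_two_mul, add_sub_cancel_left] at hL
  rw [e3, Real.sin_add_int_mul_two_pi, e2, Real.sin_add, Real.sin_sub] at h3
  rw [e3, e1, Real.sin_add_int_mul_two_pi, Real.sin_add_int_mul_two_pi, Real.sin_sub,
    Real.sin_two_mul] at h2
  have hcK : Real.cos p * (Real.cos p + Real.cos τ) = K := by linarith
  have hc0 : Real.cos p ≠ 0 := by
    intro h0; rw [h0, zero_mul] at hcK; exact hK.ne hcK.symm
  have hc : 0 < Real.cos p := lt_of_le_of_ne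
    (Real.cos_nonneg_of_mem_Icc ⟨hj.1, by linarith [hj.2]⟩) hc0.symm
  have hpm : p ∈ Set.Ioo (-(π / 2)) (π / 2) := by
    refine ⟨lt_of_le_of_ne hj.1 fun h0 => hc0 ?_, by linarith [hj.2]⟩
    rw [← h0, Real.cos_neg, Real.cos_pi_div_two]
  have hy : 0 < Real.cos p * Real.sin τ := by nlinarith
  have hY : dispY K p = (Real.cos p * Real.sin τ) ^ 2 := by
    rw [dispY, ← hcK, mul_pow, Real.sin_sq]; ring
  have hsq : √(dispY K p) = Real.cos p * Real.sin τ := by rw [hY, Real.sqrt_sq hy.le]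
  have hroot : dispRoot K p = (Real.cos p * Real.sin τ : ℝ) := by
    rw [dispRoot, if_pos (by rw [hY]; positivity), hsq]
  have hW : dispW K p = Complex.exp (Complex.I * τ) := by
    rw [dispW, hroot, mul_comm Complex.I (τ : ℂ), Complex.exp_mul_I, ← hcK]
    have : (Complex.cos p : ℂ) ≠ 0 := by exact_mod_cast hc0
    push_cast
    field_simp
    ring
  have hT : dispT K p = Real.sin p * (2 * Real.cos p + Real.cos τ) := by
    rw [dispT, ← hcK]; field_simp; ring
  refine ⟨p, hpm, by rw [hY]; positivity, ?_, ?_, ?_⟩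
  · rw [hsq, hT]
    have : l * ((2 * v.1 + v.2) * (Real.cos p * Real.sin τ)) =
        l * (v.2 * (Real.sin p * (2 * Real.cos p + Real.cos τ))) := by
      linear_combination (-2 * (Real.cos p * Real.sin τ)) * h2 -
        (Real.cos p * Real.sin τ - Real.sin p * (2 * Real.cos p + Real.cos τ)) * h3
    exact mul_left_cancel₀ hl.ne' this
  · intro a
    rw [mon, hW, ← Complex.exp_int_mul, ← Complex.exp_add, char, e1, e2]
    have : Complex.exp (((j * a.1 : ℤ) : ℂ) * (2 * π * Complex.I)) = 1 :=
      Complex.exp_int_mul_two_pi_mul_I _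
    rw [← mul_one (Complex.exp (Complex.I * (_ * _) + _)), ← this, ← Complex.exp_add]
    congr 1
    push_cast
    ring
  · intro hneg
    have h4 : orientation ξ = 2 * Real.sin p * (Real.cos p - Real.cos τ) := by
      rw [orientation, e3, e1, e2, Real.sin_add_int_mul_two_pi, Real.sin_add_int_mul_two_pi,
        Real.sin_add, Real.sin_sub, Real.sin_two_mul]
      ring
    have h5 := cos_lt_neg_of_mul_neg hneg hc hcK
    have h6 : Real.sin p ≠ 0 := by
      intro h0
      have h7 : Real.cos p = 1 := by nlinarith [Real.sin_sq_add_cos_sq p]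
      have := Real.neg_one_le_cos τ
      rw [h7] at hcK
      linarith
    rw [h4]
    have : 0 < Real.sin p ^ 2 := by positivity
    nlinarith

/-- `Γ.Carries v ξ`: the characters of `ξ` are those of the stationary point of the arc in the
direction `v`. -/
def Arc.Carries {K : ℝ} (Γ : Arc K) (v ξ : ℝ × ℝ) : Prop :=
  ∃ t ∈ Set.Ioo (-(π / 2)) (π / 2), (2 * v.1 + v.2) * Γ.y t = v.2 * Γ.T t ∧
    ∀ a : ℤ × ℤ, char ξ a = Γ.e (2 * a.1 + a.2) a.2 t

lemma Arc.carries_of_mem {K : ℝ} (Γ : Arc K) {v ξ : ℝ × ℝ} {p : ℝ} (hp : p ∈ Set.Ioo Γ.a Γ.b)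
    (h : (2 * v.1 + v.2) * √(dispY K p) = v.2 * dispT K p)
    (h' : ∀ a : ℤ × ℤ, char ξ a = mon K (2 * a.1 + a.2) a.2 p) : Γ.Carries v ξ := by
  rw [← Γ.image_p] at hp
  obtain ⟨t, ht, rfl⟩ := hp
  have ht' := Set.Ioo_subset_Icc_self ht
  refine ⟨t, ht, ?_, fun a => by rw [h' a, Γ.mon_p ht']⟩
  rw [← Γ.y_sq, Real.sqrt_sq (Γ.y_nonneg ht')] at h
  exact h

lemma abs_lt_angA {K : ℝ} (hK : Admissible K) {p : ℝ} (hp : p ∈ Set.Ioo (-(π / 2)) (π / 2))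
    (hY : 0 < dispY K p) : |p| < angA K := by
  have hA := angA_mem hK
  by_contra! h
  rcases h.eq_or_lt with h | h
  · have h1 : dispY K p = 0 := by
      rw [dispY_eq_mul hK, ← Real.cos_abs, ← h, cos_angA hK, sub_self, zero_mul]
    linarith
  · exact absurd (dispY_neg_of_angA_lt hK h (abs_lt.mpr hp).le) (by linarith)

lemma angB_lt_abs {K : ℝ} (hK : Admissible K) (hneg : K < 0) {p : ℝ}
    (hY : 0 < dispY K p) : angB K < |p| := by
  by_contra! h
  rcases h.eq_or_lt with h | h
  · have h1 : dispY K p = 0 := by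
      rw [dispY_eq_mul hK, ← Real.cos_abs, h, cos_angB hK hneg, sub_self, mul_zero]
    linarith
  · exact absurd (dispY_neg_of_lt_angB hK hneg h) (by linarith)

lemma FarField.symmetricArc {K : ℝ} (hK : Admissible K) (hpos : 0 < K) {v ξ : ℝ × ℝ} (hv : 0 < v.2)
    (h : FarField K v ξ) : (symmetricArc hK hpos).Carries v ξ := by
  obtain ⟨p, hp, hY, h1, h2, -⟩ := h.exists_angle hK hv
  exact Arc.carries_of_mem _ (abs_lt.mp (abs_lt_angA hK hp hY)) h1 h2

lemma FarField.rightArc {K : ℝ} (hK : Admissible K) (hneg : K < 0) {v ξ : ℝ × ℝ} (hv : 0 < v.2)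
    (h : FarField K v ξ) (ho : 0 < orientation ξ) : (rightArc hK hneg).Carries v ξ := by
  obtain ⟨p, hp, hY, h1, h2, h3⟩ := h.exists_angle hK hv
  have h4 : 0 < p := by
    by_contra! h0
    have := Real.sin_nonpos_of_nonpos_of_neg_pi_le h0 (by linarith [hp.1, Real.pi_pos])
    nlinarith [h3 hneg]
  have h5 := abs_lt_angA hK hp hY
  have h6 := angB_lt_abs hK hneg hY
  rw [abs_of_pos h4] at h5 h6
  exact Arc.carries_of_mem _ ⟨h6, h5⟩ h1 h2

lemma FarField.leftArc {K : ℝ} (hK : Admissible K) (hneg : K < 0) {v ξ : ℝ × ℝ} (hv : 0 < v.2)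
    (h : FarField K v ξ) (ho : orientation ξ < 0) : (leftArc hK hneg).Carries v ξ := by
  obtain ⟨p, hp, hY, h1, h2, h3⟩ := h.exists_angle hK hv
  have h4 : p < 0 := by
    by_contra! h0
    have := Real.sin_nonneg_of_nonneg_of_le_pi h0 (by linarith [hp.2, Real.pi_pos])
    nlinarith [h3 hneg]
  have h5 := abs_lt_angA hK hp hY
  have h6 := angB_lt_abs hK hneg hY
  rw [abs_of_neg h4] at h5 h6
  refine Arc.carries_of_mem _ ?_ h1 h2
  constructor <;> simp only [TriangularLattice.leftArc, Arc.mirror, TriangularLattice.rightArc] <;>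
    linarith

/-- Existence of far-field points, for directions in the upper half-plane. -/
lemma Arc.exists_farField {K : ℝ} (Γ : Arc K) {v : ℝ × ℝ} (hv : 0 < v.2) :
    ∃ ξ, FarField K v ξ ∧ ∃ q ∈ Set.Icc Γ.a Γ.b, ∃ d : ℝ, Real.cos q * (Real.cos q + d) = K ∧
      orientation ξ = 2 * Real.sin q * (Real.cos q - d) := by
  -- The far-field point is the stationary point of the phase `x · ξ` on the arc.
  obtain ⟨t, ht, hst⟩ := Γ.exists_stationary ((2 * v.1 + v.2) / v.2)
  have ht' := Set.Ioo_subset_Icc_self ht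
  have hc := Γ.cos_p_pos t
  have hcC : ((Real.cos (Γ.p t) : ℝ) : ℂ) ≠ 0 := by exact_mod_cast hc.ne'
  set q := Γ.p t with hq
  set τ := (Γ.w t).arg with hτ
  have hwe : Γ.w t = Complex.exp (τ * Complex.I) := by
    have := Complex.norm_mul_exp_arg_mul_I (Γ.w t)
    rw [Γ.norm_w, Complex.ofReal_one, one_mul] at this
    exact this.symm
  rw [Arc.w, Complex.exp_mul_I, ← Complex.ofReal_cos, ← Complex.ofReal_sin, ← hq] at hwe
  have hwe' : ((K - Real.cos q ^ 2 : ℝ) : ℂ) + Complex.I * Γ.y t =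
      (Real.cos q : ℂ) * ((Real.cos τ : ℂ) + Real.sin τ * Complex.I) := by
    rw [← hwe]
    field_simp
  have hre := congrArg Complex.re hwe'
  have him := congrArg Complex.im hwe'
  simp only [Complex.add_re, Complex.add_im, Complex.ofReal_re, Complex.ofReal_im,
    Complex.I_mul_re, Complex.I_mul_im, Complex.re_ofReal_mul, Complex.im_ofReal_mul,
    Complex.mul_I_re, Complex.mul_I_im] at hre him
  have hcK : Real.cos q * (Real.cos q + Real.cos τ) = K := by nlinarith
  have hT : Γ.T t = Real.sin q * (2 * Real.cos q + Real.cos τ) := by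
    rw [Arc.T, dispT, ← hq, ← hcK]; field_simp; ring
  have hy := Γ.y_pos ht
  have hst' : (2 * v.1 + v.2) * Γ.y t = v.2 * Γ.T t := by
    rw [← hst]; field_simp
  refine ⟨(2 * q, q + τ), ⟨?_, 4 * Γ.y t / v.2, by positivity, ?_, ?_⟩,
    q, Γ.p_mem t, Real.cos τ, hcK, ?_⟩
  · rw [laplaceSymbol_two_mul, add_sub_cancel_left]; linarith
  · simp only
    rw [show 2 * q - (q + τ) = q - τ by ring, Real.sin_sub, Real.sin_two_mul]
    rw [hT] at hst'
    field_simp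
    linear_combination (-2 : ℝ) * hst' + 2 * v.2 * him
  · simp only
    rw [show 2 * q - (q + τ) = q - τ by ring, Real.sin_sub, Real.sin_add]
    field_simp
    linear_combination (-4 : ℝ) * him
  · simp only [orientation]
    rw [show 2 * q - (q + τ) = q - τ by ring, Real.sin_sub, Real.sin_add, Real.sin_two_mul]
    ring

lemma ne_zero_of_sector {v : ℝ × ℝ} (h1 : -v.2 ≤ v.1) (h2 : v.1 ≤ 0) (hv : v ≠ 0) : 0 < v.2 := by
  rcases (show 0 ≤ v.2 by linarith).eq_or_lt with h | h
  · exact absurd (Prod.ext (by simp only [Prod.fst_zero]; linarith) h.symm) hv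
  · exact h

lemma swapCoord_ne_zero {v : ℝ × ℝ} (h : swapCoord v ≠ 0) : v ≠ 0 := by
  rintro rfl; exact h rfl

lemma hexReflect_ne_zero {v : ℝ × ℝ} (h : hexReflect v ≠ 0) : v ≠ 0 := by
  rintro rfl; exact h (by simp [hexReflect])

lemma exists_farField {K : ℝ} (hK : Admissible K) (hpos : 0 < K) (v : ℝ × ℝ) (hv : v ≠ 0) :
    ∃ ξ, FarField K v ξ := by
  revert hv
  refine sector_induction (P := fun v => v ≠ 0 → ∃ ξ, FarField K v ξ) ?_ ?_ ?_ v
  · intro v ih hv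
    obtain ⟨ξ, hξ⟩ := ih (swapCoord_ne_zero hv)
    exact ⟨_, hξ.swapCoord⟩
  · intro v ih hv
    obtain ⟨ξ, hξ⟩ := ih (hexReflect_ne_zero hv)
    exact ⟨_, hξ.hexReflect⟩
  · intro v h1 h2 hv
    obtain ⟨ξ, hξ, -⟩ := (symmetricArc hK hpos).exists_farField (ne_zero_of_sector h1 h2 hv)
    exact ⟨ξ, hξ⟩

lemma exists_farField_pair {K : ℝ} (hK : Admissible K) (hneg : K < 0) (v : ℝ × ℝ) (hv : v ≠ 0) :
    ∃ ξ η, FarField K v ξ ∧ FarField K v η ∧ 0 < orientation ξ ∧ orientation η < 0 := by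
  revert hv
  refine sector_induction (P := fun v => v ≠ 0 → ∃ ξ η, FarField K v ξ ∧ FarField K v η ∧
    0 < orientation ξ ∧ orientation η < 0) ?_ ?_ ?_ v
  · intro v ih hv
    obtain ⟨ξ, η, h1, h2, h3, h4⟩ := ih (swapCoord_ne_zero hv)
    refine ⟨_, _, h2.swapCoord, h1.swapCoord, ?_, ?_⟩ <;> rw [orientation_swapCoord] <;> linarith
  · intro v ih hv
    obtain ⟨ξ, η, h1, h2, h3, h4⟩ := ih (hexReflect_ne_zero hv)
    refine ⟨_, _, h1.hexReflect, h2.hexReflect, ?_, ?_⟩ <;> rwa [orientation_reflectDual]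
  · intro v h1 h2 hv
    have hv' := ne_zero_of_sector h1 h2 hv
    have hA := angA_mem hK
    have hB := angB_mem hK hneg
    obtain ⟨ξ, hξ, q, hq, d, hd, ho⟩ := (rightArc hK hneg).exists_farField hv'
    obtain ⟨η, hη, q', hq', d', hd', ho'⟩ := (leftArc hK hneg).exists_farField hv'
    have hc := (rightArc hK hneg).cos_pos ((rightArc hK hneg).Icc_subset hq)
    have hc' := (leftArc hK hneg).cos_pos ((leftArc hK hneg).Icc_subset hq')
    simp only [leftArc, Arc.mirror, rightArc] at hq hq'
    have h5 := cos_lt_neg_of_mul_neg hneg hc hd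
    have h5' := cos_lt_neg_of_mul_neg hneg hc' hd'
    have h6 : 0 < Real.sin q := Real.sin_pos_of_pos_of_lt_pi (by linarith [hq.1, hB.1])
      (by linarith [hq.2, hA.2, Real.pi_pos])
    have h6' : Real.sin q' < 0 := Real.sin_neg_of_neg_of_neg_pi_lt (by linarith [hq'.2, hB.1])
      (by linarith [hq'.1, hA.2, Real.pi_pos])
    refine ⟨ξ, η, hξ, hη, ?_, ?_⟩
    · rw [ho]
      exact mul_pos (by linarith) (by linarith)
    · rw [ho']
      exact mul_neg_of_neg_of_pos (by linarith) (by linarith)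

/-! ### Dependence of the far-field points on the direction -/

/-- The characters of the far-field points are Lipschitz functions of the direction. -/
lemma Arc.exists_char_sub_le {K : ℝ} (hK : Admissible K) (Γ : Arc K) (a : ℤ × ℤ) :
    ∃ C : ℝ, 0 ≤ C ∧ ∀ v v' ξ ξ' : ℝ × ℝ, -v.2 ≤ v.1 → v.1 ≤ 0 → 0 < v.2 →
      hexNorm (v - v') ≤ v.2 / 10 → Γ.Carries v ξ → Γ.Carries v' ξ' →
      ‖char ξ a - char ξ' a‖ ≤ C * (hexNorm (v - v') / v.2) := by
  obtain ⟨c, hc, hst⟩ := Γ.exists_stationary_bound hK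
  obtain ⟨h1, -, -, -, M, hM, b⟩ := exists_deriv_bounds
    (Γ.contDiff_e (2 * a.1 + a.2) a.2) (-(π / 2)) (π / 2)
  obtain ⟨My, hMy⟩ := isCompact_Icc.exists_bound_of_continuousOn
    (Γ.contDiff_y.continuous.continuousOn (s := Set.Icc (-(π / 2)) (π / 2)))
  have hMy0 : 0 ≤ My := (norm_nonneg _).trans (hMy 0 ⟨by linarith [Real.pi_pos],
    by linarith [Real.pi_pos]⟩)
  refine ⟨M * (5 * My / c), by positivity, ?_⟩
  rintro v v' ξ ξ' hv1 hv2 hv hd ⟨t, ht, hs, hξ⟩ ⟨t', ht', hs', hξ'⟩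
  have htI := Set.Ioo_subset_Icc_self ht
  have htI' := Set.Ioo_subset_Icc_self ht'
  set d := hexNorm (v - v') with hddef
  have d1 : |v.1 - v'.1| ≤ d := (le_max_left _ _).trans (le_max_left _ _)
  have d2 : |v.2 - v'.2| ≤ d := (le_max_right _ _).trans (le_max_left _ _)
  have d1' := abs_le.mp d1
  have d2' := abs_le.mp d2
  have hd0 : 0 ≤ d := (abs_nonneg _).trans d1
  have hv' : 9 / 10 * v.2 ≤ v'.2 := by linarith
  have hv'0 : 0 < v'.2 := by linarith
  set μ := (2 * v.1 + v.2) / v.2 with hμ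
  set μ' := (2 * v'.1 + v'.2) / v'.2 with hμ'
  have hμ2 : |μ| ≤ 2 := by
    rw [hμ, abs_div, abs_of_pos hv, div_le_iff₀ hv, abs_le]
    constructor <;> linarith
  have hst1 : μ * Γ.y t = Γ.T t := by rw [hμ]; field_simp; linarith
  have hst2 : μ' * Γ.y t' = Γ.T t' := by rw [hμ']; field_simp; linarith
  -- Nondegeneracy for `μ` bounds the distance of the stationary points `t` and `t'` by `|μ - μ'|`.
  have h3 := hst μ hμ2 t ht hst1 t' htI'
  have h4 : |μ - μ'| ≤ 5 * d / v.2 := by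
    have e : μ - μ' = 2 * (v.1 * (v'.2 - v.2) + v.2 * (v.1 - v'.1)) / (v.2 * v'.2) := by
      rw [hμ, hμ']; field_simp; ring
    rw [e, abs_div, abs_mul, abs_of_pos (mul_pos hv hv'0), abs_two,
      div_le_div_iff₀ (by positivity) hv]
    have e2 : |v.1 * (v'.2 - v.2) + v.2 * (v.1 - v'.1)| ≤ v.2 * d + v.2 * d := by
      refine (abs_add_le _ _).trans (add_le_add ?_ ?_)
      · rw [abs_mul, abs_sub_comm]
        have : |v.1| ≤ v.2 := abs_le.mpr ⟨hv1, by linarith⟩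
        gcongr
      · rw [abs_mul, abs_of_pos hv]; gcongr
    nlinarith [mul_nonneg (mul_nonneg hd0 hv.le) (sub_nonneg.mpr hv'),
      mul_le_mul_of_nonneg_right e2 hv.le, mul_nonneg (mul_nonneg hd0 hv.le) hv.le]
  have h5 : |t' - t| ≤ 5 * My / c * (d / v.2) := by
    rw [← hst2, ← sub_mul, abs_mul] at h3
    have h6 := hMy t' htI'
    rw [Real.norm_eq_abs] at h6
    have h7 : c * |t' - t| ≤ 5 * d / v.2 * My := h3.trans (by
      have : 0 ≤ 5 * d / v.2 := by positivity
      gcongr)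
    rw [mul_comm, ← le_div_iff₀ hc] at h7
    refine h7.trans (le_of_eq ?_)
    field_simp
  rw [hξ, hξ']
  have h8 := (convex_Icc (-(π / 2)) (π / 2)).norm_image_sub_le_of_norm_hasDerivWithin_le
    (fun ψ _ => (h1 ψ).hasDerivWithinAt) (fun ψ hψ => (b ψ hψ).2.1) htI htI'
  rw [norm_sub_rev]
  refine h8.trans ?_
  rw [Real.norm_eq_abs, mul_assoc]
  gcongr

/-! ### Uniformity in the shifts -/

/-- The coordinates of a lattice point as real numbers. -/
def realPoint (x : ℤ × ℤ) : ℝ × ℝ := (x.1, x.2)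

lemma realPoint_hexReflect (x : ℤ × ℤ) : realPoint (hexReflect x) = hexReflect (realPoint x) := by
  simp [realPoint, hexReflect]

lemma hexNorm_realPoint (x : ℤ × ℤ) : hexNorm (realPoint x) = (hexNorm x : ℤ) := by
  simp [realPoint, hexNorm, max_assoc]

lemma realPoint_ne_zero {x : ℤ × ℤ} (hx : x ≠ 0) : realPoint x ≠ 0 := by
  contrapose! hx
  have h1 := congrArg Prod.fst hx
  have h2 := congrArg Prod.snd hx
  simp only [realPoint, Prod.fst_zero, Prod.snd_zero, Int.cast_eq_zero] at h1 h2
  exact Prod.ext h1 h2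

lemma abs_le_hexNorm {R : Type*} [CommRing R] [LinearOrder R] (x : R × R) :
    |x.1| ≤ hexNorm x ∧ |x.2| ≤ hexNorm x :=
  ⟨(le_max_left _ _).trans (le_max_left _ _), (le_max_right _ _).trans (le_max_left _ _)⟩

lemma hexReflect_hexReflect {R : Type*} [Ring R] (x : R × R) : hexReflect (hexReflect x) = x := by
  simp [hexReflect]

lemma hexReflect_sub {R : Type*} [CommRing R] (x y : R × R) :
    hexReflect (x - y) = hexReflect x - hexReflect y := by
  ext <;> simp [hexReflect] <;> ring

lemma hexNorm_reflect (a : ℤ × ℤ) : hexNorm (reflect a) = hexNorm a := hexNorm_hexReflect a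

lemma finite_hexNorm_le (A : ℤ) : {a : ℤ × ℤ | hexNorm a ≤ A}.Finite := by
  refine ((Set.finite_Icc (-A) A).prod (Set.finite_Icc (-A) A)).subset fun a ha => ?_
  have h := abs_le_hexNorm a
  exact ⟨abs_le.mp (h.1.trans ha), abs_le.mp (h.2.trans ha)⟩

lemma exists_uniform {P : ℤ × ℤ → ℝ → Prop} (hmono : ∀ a C C', C ≤ C' → P a C → P a C')
    (h : ∀ a, ∃ C, P a C) (A : ℤ) : ∃ C : ℝ, 0 ≤ C ∧ ∀ a, hexNorm a ≤ A → P a C := by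
  choose C hC using h
  refine ⟨∑ a ∈ (finite_hexNorm_le A).toFinset, |C a|,
    Finset.sum_nonneg fun a _ => abs_nonneg _, fun a ha => hmono a _ _ ?_ (hC a)⟩
  exact (le_abs_self _).trans (Finset.single_le_sum (f := fun a => |C a|)
    (fun a _ => abs_nonneg _) ((finite_hexNorm_le A).mem_toFinset.mpr ha))

lemma hexNorm_nonneg {R : Type*} [CommRing R] [LinearOrder R] [IsStrictOrderedRing R] (x : R × R) :
    0 ≤ hexNorm x := (abs_nonneg _).trans (abs_le_hexNorm x).1

/-- Far-field points on the same component of the level curve are Lipschitz functions of the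
direction, as points of the torus. -/
lemma exists_char_sub_le {K : ℝ} (hK : Admissible K) (A : ℤ) : ∃ C : ℝ, 0 ≤ C ∧
    ∀ a : ℤ × ℤ, hexNorm a ≤ A → ∀ v v' ξ ξ' : ℝ × ℝ, v ≠ 0 → FarField K v ξ → FarField K v' ξ' →
      (K < 0 → 0 < orientation ξ * orientation ξ') →
      ‖char ξ a - char ξ' a‖ ≤ C * (hexNorm (v - v') / hexNorm v) := by
  -- the bound in the sector, for a single shift
  have hloc : ∀ a : ℤ × ℤ, ∃ C : ℝ, ∀ v v' ξ ξ' : ℝ × ℝ, -v.2 ≤ v.1 → v.1 ≤ 0 → 0 < v.2 →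
      FarField K v ξ → FarField K v' ξ' → (K < 0 → 0 < orientation ξ * orientation ξ') →
      ‖char ξ a - char ξ' a‖ ≤ C * (hexNorm (v - v') / v.2) := by
    intro a
    -- If the directions are far apart, the trivial bound `2` suffices.
    have hfar : ∀ v v' ξ ξ' : ℝ × ℝ, 0 < v.2 → v.2 / 10 < hexNorm (v - v') →
        ‖char ξ a - char ξ' a‖ ≤ 20 * (hexNorm (v - v') / v.2) := by
      intro v v' ξ ξ' hv hd
      have h1 : ‖char ξ a - char ξ' a‖ ≤ 2 := by
        refine (norm_sub_le _ _).trans ?_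
        rw [norm_char, norm_char]; norm_num
      refine h1.trans ?_
      rw [← mul_div_assoc, le_div_iff₀ hv]
      linarith
    have hv2 : ∀ v v' : ℝ × ℝ, 0 < v.2 → hexNorm (v - v') ≤ v.2 / 10 → 0 < v'.2 := by
      intro v v' hv hd
      have := abs_le.mp ((abs_le_hexNorm (v - v')).2.trans hd)
      simp only [Prod.snd_sub] at this
      linarith [this.2]
    have hmono : ∀ C C' : ℝ, 0 ≤ C' → ∀ v v' : ℝ × ℝ, 0 < v.2 →
        C * (hexNorm (v - v') / v.2) ≤ (20 + |C| + C') * (hexNorm (v - v') / v.2) := by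
      intro C C' hC' v v' hv
      have h1 := hexNorm_nonneg (v - v')
      have h2 := le_abs_self C
      gcongr
      linarith
    rcases lt_or_gt_of_ne hK.ne with hneg | hpos
    · obtain ⟨C₁, hC₁, h₁⟩ := (rightArc hK hneg).exists_char_sub_le hK a
      obtain ⟨C₂, hC₂, h₂⟩ := (leftArc hK hneg).exists_char_sub_le hK a
      refine ⟨20 + |C₁| + |C₂|, fun v v' ξ ξ' s1 s2 hv hξ hξ' ho => ?_⟩
      rcases le_or_gt (hexNorm (v - v')) (v.2 / 10) with hd | hd
      · have hv' := hv2 v v' hv hd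
        rcases pos_and_pos_or_neg_and_neg_of_mul_pos (ho hneg) with ⟨o, o'⟩ | ⟨o, o'⟩
        · exact (h₁ v v' ξ ξ' s1 s2 hv hd (hξ.rightArc hK hneg hv o)
            (hξ'.rightArc hK hneg hv' o')).trans (hmono C₁ |C₂| (abs_nonneg _) v v' hv)
        · refine (h₂ v v' ξ ξ' s1 s2 hv hd (hξ.leftArc hK hneg hv o)
            (hξ'.leftArc hK hneg hv' o')).trans ((hmono C₂ |C₁| (abs_nonneg _) v v' hv).trans ?_)
          rw [add_right_comm]
      · refine (hfar v v' ξ ξ' hv hd).trans ?_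
        have h1 := hexNorm_nonneg (v - v')
        gcongr
        linarith [abs_nonneg C₁, abs_nonneg C₂]
    · obtain ⟨C₁, hC₁, h₁⟩ := (symmetricArc hK hpos).exists_char_sub_le hK a
      refine ⟨20 + |C₁| + 0, fun v v' ξ ξ' s1 s2 hv hξ hξ' ho => ?_⟩
      rcases le_or_gt (hexNorm (v - v')) (v.2 / 10) with hd | hd
      · have hv' := hv2 v v' hv hd
        exact (h₁ v v' ξ ξ' s1 s2 hv hd (hξ.symmetricArc hK hpos hv)
          (hξ'.symmetricArc hK hpos hv')).trans (hmono C₁ 0 le_rfl v v' hv)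
      · refine (hfar v v' ξ ξ' hv hd).trans ?_
        have h1 := hexNorm_nonneg (v - v')
        gcongr
        linarith [abs_nonneg C₁]
  obtain ⟨C, hC, h⟩ := exists_uniform (P := fun a C => ∀ v v' ξ ξ' : ℝ × ℝ, -v.2 ≤ v.1 →
      v.1 ≤ 0 → 0 < v.2 → FarField K v ξ → FarField K v' ξ' →
      (K < 0 → 0 < orientation ξ * orientation ξ') →
      ‖char ξ a - char ξ' a‖ ≤ C * (hexNorm (v - v') / v.2))
    (fun a C C' hCC hP v v' ξ ξ' s1 s2 hv hξ hξ' ho => (hP v v' ξ ξ' s1 s2 hv hξ hξ' ho).trans (by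
      have := hexNorm_nonneg (v - v')
      gcongr)) hloc A
  refine ⟨C, hC, fun a ha v v' ξ ξ' hv hξ hξ' ho => ?_⟩
  revert a v' ξ ξ' hv
  refine sector_induction (P := fun v => ∀ a : ℤ × ℤ, hexNorm a ≤ A → ∀ v' ξ ξ' : ℝ × ℝ, v ≠ 0 →
    FarField K v ξ → FarField K v' ξ' → (K < 0 → 0 < orientation ξ * orientation ξ') →
      ‖char ξ a - char ξ' a‖ ≤ C * (hexNorm (v - v') / hexNorm v)) ?_ ?_ ?_ v
  · intro v ih a ha v' ξ ξ' hv hξ hξ' ho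
    have := ih (swapCoord a) (by rwa [hexNorm_swapCoord]) (swapCoord v') (swapCoord ξ)
      (swapCoord ξ') (swapCoord_ne_zero hv) hξ.swapCoord hξ'.swapCoord
      (by rw [orientation_swapCoord, orientation_swapCoord, neg_mul_neg]; exact ho)
    rw [char_swapCoord, char_swapCoord] at this
    rw [hexNorm_swapCoord]
    refine this.trans (le_of_eq ?_)
    rw [← hexNorm_swapCoord]
    rfl
  · intro v ih a ha v' ξ ξ' hv hξ hξ' ho
    have h1 := hξ.hexReflect
    rw [hexReflect_hexReflect] at h1
    have := ih (reflect a) (by rwa [hexNorm_reflect]) (hexReflect v') (reflectDual ξ)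
      (reflectDual ξ') (hexReflect_ne_zero hv) h1 hξ'.hexReflect
      (by rw [orientation_reflectDual, orientation_reflectDual]; exact ho)
    rw [char_reflectDual, char_reflectDual] at this
    rw [hexNorm_hexReflect]
    refine this.trans (le_of_eq ?_)
    rw [← hexNorm_hexReflect (v - hexReflect v'), hexReflect_sub, hexReflect_hexReflect]
  · intro v s1 s2 a ha v' ξ ξ' hv hξ hξ' ho
    rw [hexNorm_of_sector s1 s2]
    exact h a ha v v' ξ ξ' s1 s2 (ne_zero_of_sector s1 s2 hv) hξ hξ' ho

/-! ### Far-field asymptotics of the Green's function -/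

/-- The integral over the level curve representing `𝒢(x)`, `x₂ ≥ 0`. -/
def greenIntegral (K : ℝ) (x : ℤ × ℤ) : ℂ :=
  ∫ p in (-(π / 2))..(π / 2), mon K (2 * x.1 + x.2) x.2 p / dispRoot K p

lemma admissible_of_wavenumber {k : ℝ} (hk₀ : 0 < k) (hk₃ : k < 3) (hk : k ≠ 2 * √2) :
    Admissible ((8 - k ^ 2) / 4) := by
  refine ⟨by nlinarith, by nlinarith, fun h => hk ?_⟩
  have h1 : k ^ 2 = (2 * √2) ^ 2 := by
    rw [mul_pow, Real.sq_sqrt (by norm_num)]; linarith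
  exact (pow_left_inj₀ hk₀.le (by positivity) two_ne_zero).mp h1

lemma tendsto_resolventKernel_of_nonneg {k : ℝ} (hK : Admissible ((8 - k ^ 2) / 4)) {x : ℤ × ℤ}
    (hx : 0 ≤ x.2) : Tendsto (fun ε : ℝ => resolventKernel ((k : ℂ) ^ 2 + Complex.I * ε) x)
      (𝓝[>] 0) (𝓝 (1 / (4 * π * Complex.I) *
        greenIntegral ((8 - k ^ 2) / 4) x)) := by
  obtain ⟨m, l⟩ := x
  obtain ⟨n, rfl⟩ := Int.eq_ofNat_of_zero_le hx
  have h := tendsto_resolventKernel_nat hK m n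
  have e : (8 : ℂ) - 4 * (((8 - k ^ 2) / 4 : ℝ) : ℂ) = (k : ℂ) ^ 2 := by push_cast; ring
  simp only [e] at h
  exact h

lemma tendsto_resolventKernel {k : ℝ} (hK : Admissible ((8 - k ^ 2) / 4)) (x : ℤ × ℤ) :
    Tendsto (fun ε : ℝ => resolventKernel ((k : ℂ) ^ 2 + Complex.I * ε) x) (𝓝[>] 0)
      (𝓝 (latticeGreen k x)) := by
  refine tendsto_nhds_limUnder ?_
  rcases le_or_gt 0 x.2 with h | h
  · exact ⟨_, tendsto_resolventKernel_of_nonneg hK h⟩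
  · have h1 := tendsto_resolventKernel_of_nonneg hK (x := reflect x)
      (by simp only [reflect]; linarith)
    simp only [resolventKernel_reflect] at h1
    exact ⟨_, h1⟩

lemma latticeGreen_of_nonneg {k : ℝ} (hK : Admissible ((8 - k ^ 2) / 4)) {x : ℤ × ℤ}
    (hx : 0 ≤ x.2) : latticeGreen k x = 1 / (4 * π * Complex.I) *
      greenIntegral ((8 - k ^ 2) / 4) x :=
  tendsto_nhds_unique (tendsto_resolventKernel hK x) (tendsto_resolventKernel_of_nonneg hK hx)

lemma eventually_im_ne_zero (k : ℝ) :
    ∀ᶠ ε : ℝ in 𝓝[>] 0, ((k : ℂ) ^ 2 + Complex.I * ε).im ≠ 0 := by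
  filter_upwards [self_mem_nhdsWithin] with ε hε
  have : ((k : ℂ) ^ 2 + Complex.I * ε).im = ε := by
    rw [Complex.add_im, ← Complex.ofReal_pow, Complex.ofReal_im, Complex.I_mul_im,
      Complex.ofReal_re, zero_add]
  rw [this]
  exact (ne_of_gt hε)

lemma latticeGreen_reflect {k : ℝ} (hK : Admissible ((8 - k ^ 2) / 4)) (x : ℤ × ℤ) :
    latticeGreen k (reflect x) = latticeGreen k x :=
  tendsto_nhds_unique (tendsto_resolventKernel hK _) ((tendsto_resolventKernel hK x).congr
    fun _ => (resolventKernel_reflect _ x).symm)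

lemma latticeGreen_swapCoord {k : ℝ} (hK : Admissible ((8 - k ^ 2) / 4)) (x : ℤ × ℤ) :
    latticeGreen k (swapCoord x) = latticeGreen k x := by
  refine tendsto_nhds_unique (tendsto_resolventKernel hK _)
    ((tendsto_resolventKernel hK x).congr' ?_)
  filter_upwards [eventually_im_ne_zero k] with ε hε
  exact (resolventKernel_swapCoord hε x).symm

/-- The lattice Green's function is a fundamental solution. -/
lemma latticeGreen_helmholtz {k : ℝ} (hK : Admissible ((8 - k ^ 2) / 4)) (x : ℤ × ℤ) :
    discreteLaplacian (latticeGreen k) x + (k : ℂ) ^ 2 * latticeGreen k x =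
      if x = 0 then 1 else 0 := by
  have hε : Tendsto (fun ε : ℝ => (k : ℂ) ^ 2 + Complex.I * ε) (𝓝[>] 0) (𝓝 ((k : ℂ) ^ 2)) := by
    have : Continuous fun ε : ℝ => (k : ℂ) ^ 2 + Complex.I * ε := by fun_prop
    have h := this.tendsto 0
    simp only [Complex.ofReal_zero, mul_zero, add_zero] at h
    exact h.mono_left nhdsWithin_le_nhds
  have h := tendsto_resolventKernel hK
  refine tendsto_nhds_unique (((((((h _).add (h _)).add (h _)).add (h _)).add (h _)).add
    (h _)).sub ((h x).const_mul 6) |>.add (hε.mul (h x))) (tendsto_const_nhds.congr' ?_)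
  filter_upwards [eventually_im_ne_zero k] with ε hε
  exact (resolventKernel_helmholtz hε x).symm

/-- The contribution of an arc to the Green's function at a lattice point. -/
def Arc.green {K : ℝ} (Γ : Arc K) (x : ℤ × ℤ) : ℂ := Γ.J (2 * x.1 + x.2) x.2

lemma Arc.exists_norm_green_le {K : ℝ} (hK : Admissible K) (Γ : Arc K) : ∃ C : ℝ, 0 ≤ C ∧
    ∀ x : ℤ × ℤ, -x.2 ≤ x.1 → x.1 ≤ 0 → 0 < x.2 → ‖Γ.green x‖ ≤ C / √x.2 := by
  obtain ⟨C, hC, h⟩ := Γ.exists_norm_J_le hK 0 0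
  refine ⟨C, hC, ?_⟩
  rintro ⟨m, l⟩ h1 h2 hx
  obtain ⟨n, rfl⟩ := Int.eq_ofNat_of_zero_le hx.le
  have hn : 0 < n := Int.natCast_pos.mp hx
  have := h (2 * m + n) n hn (by
    have h1' : -(n : ℝ) ≤ m := by exact_mod_cast h1
    have h2' : (m : ℝ) ≤ 0 := by exact_mod_cast h2
    push_cast
    rw [abs_le]; constructor <;> linarith)
  simpa [Arc.green] using this

lemma Arc.exists_norm_green_translate_le {K : ℝ} (hK : Admissible K) (Γ : Arc K) (a b : ℤ × ℤ) :
    ∃ C : ℝ, 0 ≤ C ∧ ∀ x : ℤ × ℤ, -x.2 ≤ x.1 → x.1 ≤ 0 → 0 < x.2 → ∀ ξ,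
      Γ.Carries (realPoint x) ξ →
        ‖Γ.green (x + b + a) - char ξ a * Γ.green (x + b)‖ ≤ C / (x.2 * √x.2) := by
  obtain ⟨C, hC, h⟩ := Γ.exists_norm_J_translate_le hK (2 * a.1 + a.2) a.2 (2 * b.1 + b.2) b.2
  refine ⟨C, hC, ?_⟩
  rintro ⟨m, l⟩ h1 h2 hx ξ ⟨t, ht, hst, hξ⟩
  obtain ⟨n, rfl⟩ := Int.eq_ofNat_of_zero_le hx.le
  have hn : 0 < n := Int.natCast_pos.mp hx
  have := h (2 * m + n) n hn (by
    have h1' : -(n : ℝ) ≤ m := by exact_mod_cast h1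
    have h2' : (m : ℝ) ≤ 0 := by exact_mod_cast h2
    push_cast
    rw [abs_le]; constructor <;> linarith) t ht (by
      simp only [realPoint] at hst
      push_cast at hst ⊢
      exact hst)
  rw [hξ]
  have e1 : 2 * m + n + (2 * b.1 + b.2) = 2 * (m + b.1) + (n + b.2) := by ring
  have e2 : 2 * (m + b.1) + (n + b.2) + (2 * a.1 + a.2) =
    2 * (m + b.1 + a.1) + (n + b.2 + a.2) := by ring
  rw [e1, e2] at this
  simpa [Arc.green] using this

lemma div_shift_le {C : ℝ} (hC : 0 ≤ C) {n a : ℤ} (hn : 0 < n) (h : 2 * |a| ≤ n) :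
    0 < n + a ∧ C / ((n + a : ℤ) : ℝ) ^ 2 ≤ 4 * C / (n * √n) := by
  have h1 := neg_abs_le a
  have h2 : n ≤ 2 * (n + a) := by linarith
  have h3 : (n : ℝ) ≤ 2 * ((n + a : ℤ) : ℝ) := by exact_mod_cast h2
  have hn1 : (1 : ℝ) ≤ n := by exact_mod_cast hn
  have h4 : √(n : ℝ) ≤ n := (Real.sqrt_le_left (by linarith)).mpr (by nlinarith)
  have h5 : 0 < √(n : ℝ) := Real.sqrt_pos.mpr (by linarith)
  refine ⟨by linarith, ?_⟩
  calc C / ((n + a : ℤ) : ℝ) ^ 2 ≤ C / ((n : ℝ) / 2) ^ 2 := by gcongr; linarith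
    _ = 4 * C / (n * n) := by field_simp; norm_num
    _ ≤ _ := by gcongr

lemma exists_norm_greenIntegral_sub_le_of_pos {K : ℝ} (hK : Admissible K) (h : 0 < K) :
    ∃ C : ℝ, 0 ≤ C ∧ ∀ x : ℤ × ℤ, 0 < x.2 →
      ‖greenIntegral K x - (symmetricArc hK h).green x‖ ≤ C / (x.2 : ℝ) ^ 2 := by
  obtain ⟨C, hC, h1⟩ := exists_norm_sub_J_le_of_pos hK h
  refine ⟨C, hC, ?_⟩
  rintro ⟨m, l⟩ hx
  obtain ⟨n, rfl⟩ := Int.eq_ofNat_of_zero_le hx.le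
  simpa [greenIntegral, Arc.green] using h1 (2 * m + n) n (Int.natCast_pos.mp hx)

lemma exists_norm_greenIntegral_sub_le_of_neg {K : ℝ} (hK : Admissible K) (h : K < 0) :
    ∃ C : ℝ, 0 ≤ C ∧ ∀ x : ℤ × ℤ, 0 < x.2 →
      ‖greenIntegral K x - ((leftArc hK h).green x + (rightArc hK h).green x)‖ ≤
        C / (x.2 : ℝ) ^ 2 := by
  obtain ⟨C, hC, h1⟩ := exists_norm_sub_J_le_of_neg hK h
  refine ⟨C, hC, ?_⟩
  rintro ⟨m, l⟩ hx
  obtain ⟨n, rfl⟩ := Int.eq_ofNat_of_zero_le hx.le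
  simpa [greenIntegral, Arc.green] using h1 (2 * m + n) n (Int.natCast_pos.mp hx)

lemma exists_norm_greenIntegral_le {K : ℝ} (hK : Admissible K) : ∃ C : ℝ, 0 ≤ C ∧
    ∀ x : ℤ × ℤ, -x.2 ≤ x.1 → x.1 ≤ 0 → 0 < x.2 → ‖greenIntegral K x‖ ≤ C / √x.2 := by
  have hpow : ∀ (C : ℝ) (n : ℤ), 0 ≤ C → 0 < n → C / (n : ℝ) ^ 2 ≤ C / √n := by
    intro C n hC hn
    have hn1 : (1 : ℝ) ≤ n := by exact_mod_cast hn
    have h5 : 0 < √(n : ℝ) := Real.sqrt_pos.mpr (by linarith)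
    have h6 : √(n : ℝ) ≤ (n : ℝ) ^ 2 := (Real.sqrt_le_left (by positivity)).mpr (by
      nlinarith [pow_le_pow_left₀ zero_le_one hn1 3, sq_nonneg (n : ℝ)])
    gcongr
  rcases lt_or_gt_of_ne hK.ne with hneg | hpos
  · obtain ⟨C, hC, h⟩ := exists_norm_greenIntegral_sub_le_of_neg hK hneg
    obtain ⟨C₁, hC₁, h₁⟩ := (leftArc hK hneg).exists_norm_green_le hK
    obtain ⟨C₂, hC₂, h₂⟩ := (rightArc hK hneg).exists_norm_green_le hK
    refine ⟨C + (C₁ + C₂), by positivity, fun x s1 s2 hx => ?_⟩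
    have e := norm_add_le_of_le ((h x hx).trans (hpow C _ hC hx))
      (norm_add_le_of_le (h₁ x s1 s2 hx) (h₂ x s1 s2 hx))
    rw [sub_add_cancel] at e
    rwa [add_div, add_div]
  · obtain ⟨C, hC, h⟩ := exists_norm_greenIntegral_sub_le_of_pos hK hpos
    obtain ⟨C₁, hC₁, h₁⟩ := (symmetricArc hK hpos).exists_norm_green_le hK
    refine ⟨C + C₁, by positivity, fun x s1 s2 hx => ?_⟩
    have e := norm_add_le_of_le ((h x hx).trans (hpow C _ hC hx)) (h₁ x s1 s2 hx)
    rw [sub_add_cancel] at e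
    rwa [add_div]

lemma exists_norm_greenIntegral_translate_le {K : ℝ} (hK : Admissible K) (hpos : 0 < K)
    (a : ℤ × ℤ) : ∃ C : ℝ, ∀ x : ℤ × ℤ, -x.2 ≤ x.1 → x.1 ≤ 0 → 0 < x.2 → C ≤ x.2 → ∀ ξ,
      FarField K (realPoint x) ξ →
        0 < x.2 + a.2 ∧
        ‖greenIntegral K (x + a) - char ξ a * greenIntegral K x‖ ≤ C / (x.2 * √x.2) := by
  obtain ⟨C₀, hC₀, h₀⟩ := exists_norm_greenIntegral_sub_le_of_pos hK hpos
  obtain ⟨C₁, hC₁, h₁⟩ := (symmetricArc hK hpos).exists_norm_green_translate_le hK a 0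
  refine ⟨4 * C₀ + 4 * C₀ + C₁ + 2 * |(a.2 : ℝ)|, fun x s1 s2 hx hCx ξ hξ => ?_⟩
  have hx' : (0 : ℝ) < x.2 := by exact_mod_cast hx
  have ha : 2 * |a.2| ≤ x.2 := by
    have : 2 * |(a.2 : ℝ)| ≤ x.2 := le_trans (by linarith) hCx
    exact_mod_cast this
  obtain ⟨p1, b1⟩ := div_shift_le hC₀ hx ha
  obtain ⟨p2, b2⟩ := div_shift_le hC₀ hx (a := 0) (by simpa using hx.le)
  rw [add_zero] at b2
  refine ⟨p1, ?_⟩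
  have e1 := (h₀ (x + a) p1).trans b1
  have e2 := (h₀ x hx).trans b2
  have e3 := h₁ x s1 s2 hx ξ (hξ.symmetricArc hK hpos (by simpa [realPoint] using hx))
  rw [add_zero] at e3
  have e2' : ‖char ξ a * (greenIntegral K x - (symmetricArc hK hpos).green x)‖ ≤
      4 * C₀ / (x.2 * √x.2) := by rwa [norm_mul, norm_char, one_mul]
  have e := norm_add_le_of_le (norm_sub_le_of_le e1 e2') e3
  refine le_trans (le_of_eq ?_) (e.trans ?_)
  · congr 1; ring
  · rw [← add_div, ← add_div]
    refine div_le_div_of_nonneg_right ?_ (by positivity)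
    linarith [abs_nonneg (a.2 : ℝ)]

/-- For two components the Green's function is annihilated, up to `O(n^{-3/2})`, by the product of
two translation operators, one for each component. -/
lemma exists_norm_greenIntegral_translate_pair_le {K : ℝ} (hK : Admissible K) (hneg : K < 0)
    (a b : ℤ × ℤ) : ∃ C : ℝ, ∀ x : ℤ × ℤ, -x.2 ≤ x.1 → x.1 ≤ 0 → 0 < x.2 → C ≤ x.2 → ∀ ξ η,
      FarField K (realPoint x) ξ → FarField K (realPoint x) η → 0 < orientation ξ →
      orientation η < 0 → (0 < x.2 + a.2 + b.2 ∧ 0 < x.2 + a.2 ∧ 0 < x.2 + b.2) ∧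
        ‖greenIntegral K (x + a + b) - char ξ a * greenIntegral K (x + b) -
          char η b * greenIntegral K (x + a) + char ξ a * char η b * greenIntegral K x‖ ≤
            C / (x.2 * √x.2) := by
  obtain ⟨C₀, hC₀, h₀⟩ := exists_norm_greenIntegral_sub_le_of_neg hK hneg
  obtain ⟨C₁, hC₁, h₁⟩ := (leftArc hK hneg).exists_norm_green_translate_le hK b a
  obtain ⟨C₂, hC₂, h₂⟩ := (leftArc hK hneg).exists_norm_green_translate_le hK b 0
  obtain ⟨C₃, hC₃, h₃⟩ := (rightArc hK hneg).exists_norm_green_translate_le hK a b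
  obtain ⟨C₄, hC₄, h₄⟩ := (rightArc hK hneg).exists_norm_green_translate_le hK a 0
  refine ⟨4 * (4 * C₀) + (C₁ + C₂ + C₃ + C₄) + 2 * |(a.2 : ℝ)| + 2 * |(b.2 : ℝ)|,
    fun x s1 s2 hx hCx ξ η hξ hη hoξ hoη => ?_⟩
  have hx' : (0 : ℝ) < x.2 := by exact_mod_cast hx
  have hab : 2 * |a.2| + 2 * |b.2| ≤ x.2 := by
    have : 2 * |(a.2 : ℝ)| + 2 * |(b.2 : ℝ)| ≤ x.2 := le_trans (by linarith) hCx
    exact_mod_cast this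
  have ha0 := abs_nonneg a.2
  have hb0 := abs_nonneg b.2
  obtain ⟨p1, b1⟩ := div_shift_le hC₀ hx (a := a.2) (by linarith)
  obtain ⟨p2, b2⟩ := div_shift_le hC₀ hx (a := b.2) (by linarith)
  obtain ⟨p3, b3⟩ := div_shift_le hC₀ hx (a := a.2 + b.2) (by
    have := abs_add_le a.2 b.2
    linarith)
  obtain ⟨p4, b4⟩ := div_shift_le hC₀ hx (a := 0) (by simpa using hx.le)
  rw [add_zero] at b4
  rw [← add_assoc] at p3 b3
  refine ⟨⟨p3, p1, p2⟩, ?_⟩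
  set L := (leftArc hK hneg).green
  set R := (rightArc hK hneg).green
  set G := greenIntegral K
  have hv : 0 < (realPoint x).2 := by simpa [realPoint] using hx
  have cη := hη.leftArc hK hneg hv hoη
  have cξ := hξ.rightArc hK hneg hv hoξ
  have e1 := (h₀ (x + a + b) p3).trans b3
  have e2 := (h₀ (x + b) p2).trans b2
  have e3 := (h₀ (x + a) p1).trans b1
  have e4 := (h₀ x hx).trans b4
  have f1 := h₁ x s1 s2 hx η cη
  have f2 := h₂ x s1 s2 hx η cη
  have f3 := h₃ x s1 s2 hx ξ cξ
  have f4 := h₄ x s1 s2 hx ξ cξ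
  rw [add_zero] at f2 f4
  have n1 := norm_char ξ a
  have n2 := norm_char η b
  -- `G` is replaced by `L + R`. The operator for `η` nearly annihilates `L`, and the one for `ξ`
  -- nearly annihilates `R`.
  have key : G (x + a + b) - char ξ a * G (x + b) - char η b * G (x + a) +
      char ξ a * char η b * G x =
      ((G (x + a + b) - (L (x + a + b) + R (x + a + b))) -
        char ξ a * (G (x + b) - (L (x + b) + R (x + b))) -
        char η b * (G (x + a) - (L (x + a) + R (x + a))) +
        char ξ a * char η b * (G x - (L x + R x))) +
      ((L (x + a + b) - char η b * L (x + a)) - char ξ a * (L (x + b) - char η b * L x) +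
       (R (x + b + a) - char ξ a * R (x + b)) - char η b * (R (x + a) - char ξ a * R x)) := by
    rw [add_right_comm x b a]; ring
  rw [key]
  have g1 := norm_add_le_of_le (norm_sub_le_of_le (norm_sub_le_of_le e1
    ((norm_mul_le_of_le n1.le e2))) (norm_mul_le_of_le n2.le e3))
    (norm_mul_le_of_le (norm_mul_le_of_le n1.le n2.le) e4)
  have g2 := norm_sub_le_of_le (norm_add_le_of_le (norm_sub_le_of_le f1
    ((norm_mul_le_of_le n1.le f2))) f3) (norm_mul_le_of_le n2.le f4)
  refine (norm_add_le_of_le g1 g2).trans ?_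
  simp only [one_mul]
  rw [← add_div, ← add_div, ← add_div, ← add_div, ← add_div, ← add_div, ← add_div]
  refine div_le_div_of_nonneg_right ?_ (by positivity)
  linarith [abs_nonneg (a.2 : ℝ), abs_nonneg (b.2 : ℝ)]

lemma sector_pos {x : ℤ × ℤ} (h1 : -x.2 ≤ x.1) (h2 : x.1 ≤ 0) (hx : x ≠ 0) : 0 < x.2 := by
  rcases (show 0 ≤ x.2 by linarith).eq_or_lt with h | h
  · exact absurd (Prod.ext (by simp only [Prod.fst_zero]; linarith) h.symm) hx
  · exact h

lemma one_le_hexNorm {x : ℤ × ℤ} (hx : x ≠ 0) : 1 ≤ hexNorm x := by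
  by_contra! h
  have h1 := abs_le_hexNorm x
  have h2 : x.1 = 0 := abs_eq_zero.mp (le_antisymm (by linarith) (abs_nonneg _))
  have h3 : x.2 = 0 := abs_eq_zero.mp (le_antisymm (by linarith) (abs_nonneg _))
  exact hx (Prod.ext h2 h3)

lemma reflect_add (x y : ℤ × ℤ) : reflect (x + y) = reflect x + reflect y := by
  ext <;> simp [reflect] <;> ring

lemma reflect_reflect (x : ℤ × ℤ) : reflect (reflect x) = x := by simp [reflect]

lemma hexReflect_eq_reflect (x : ℤ × ℤ) : hexReflect x = reflect x := rfl

/-- The Green's function decays as `|x|^{-1/2}`. -/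
lemma exists_norm_latticeGreen_le {k : ℝ} (hK : Admissible ((8 - k ^ 2) / 4)) :
    ∃ C : ℝ, 0 ≤ C ∧ ∀ x : ℤ × ℤ, x ≠ 0 → ‖latticeGreen k x‖ ≤ C / √(hexNorm x : ℤ) := by
  obtain ⟨C, hC, h⟩ := exists_norm_greenIntegral_le hK
  refine ⟨‖1 / (4 * π * Complex.I)‖ * C, by positivity, fun x => ?_⟩
  refine sector_induction (P := fun x : ℤ × ℤ => x ≠ 0 → ‖latticeGreen k x‖ ≤
    ‖1 / (4 * π * Complex.I)‖ * C / √(hexNorm x : ℤ)) ?_ ?_ ?_ x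
  · intro x ih hx
    rw [latticeGreen_swapCoord hK, hexNorm_swapCoord]
    exact ih (by rintro rfl; exact hx rfl)
  · intro x ih hx
    rw [hexReflect_eq_reflect] at *
    rw [latticeGreen_reflect hK, hexNorm_reflect]
    exact ih (by rintro rfl; exact hx (by simp [reflect]))
  · intro x h1 h2 hx
    have hx2 := sector_pos h1 h2 hx
    rw [latticeGreen_of_nonneg hK hx2.le, hexNorm_of_sector h1 h2, norm_mul, mul_div_assoc]
    have := h x h1 h2 hx2
    gcongr

lemma exists_norm_latticeGreen_le_const {k : ℝ} (hK : Admissible ((8 - k ^ 2) / 4)) :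
    ∃ M : ℝ, 0 ≤ M ∧ ∀ x : ℤ × ℤ, ‖latticeGreen k x‖ ≤ M := by
  obtain ⟨C, hC, h⟩ := exists_norm_latticeGreen_le hK
  refine ⟨C + ‖latticeGreen k 0‖, by positivity, fun x => ?_⟩
  rcases eq_or_ne x 0 with rfl | hx
  · linarith
  · have h1 : (1 : ℝ) ≤ (hexNorm x : ℤ) := by exact_mod_cast one_le_hexNorm hx
    have h2 : 1 ≤ √((hexNorm x : ℤ) : ℝ) := by rwa [Real.one_le_sqrt]
    have h3 : C / √((hexNorm x : ℤ) : ℝ) ≤ C := div_le_self hC h2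
    linarith [h x hx, norm_nonneg (latticeGreen k 0)]

/-- An estimate `≤ C |x|^{-3/2}` for large `x` of a bounded quantity holds for all `x ≠ 0`, with
another constant. -/
lemma exists_le_of_forall_large {ι : Type*} {S : ι → Prop} {g : ι → ℝ} {pt : ι → ℤ × ℤ} {C M : ℝ}
    (hM : ∀ i, S i → g i ≤ M)
    (h : ∀ i, S i → C ≤ (hexNorm (pt i) : ℤ) →
      g i ≤ C / ((hexNorm (pt i) : ℤ) * √(hexNorm (pt i) : ℤ))) :
    ∃ C' : ℝ, 0 ≤ C' ∧ ∀ i, S i → pt i ≠ 0 →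
      g i ≤ C' / ((hexNorm (pt i) : ℤ) * √(hexNorm (pt i) : ℤ)) := by
  refine ⟨|C| + |M| * (|C| * √|C|), by positivity, fun i hi hx => ?_⟩
  have h1 : (1 : ℝ) ≤ (hexNorm (pt i) : ℤ) := by exact_mod_cast one_le_hexNorm hx
  have h0 : 0 < √((hexNorm (pt i) : ℤ) : ℝ) := Real.sqrt_pos.mpr (by linarith)
  rcases le_or_gt C (hexNorm (pt i) : ℤ) with hc | hc
  · refine (h i hi hc).trans ?_
    have := le_abs_self C
    have : 0 ≤ |M| * (|C| * √|C|) := by positivity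
    gcongr
    linarith
  · refine (hM i hi).trans ((le_abs_self M).trans ?_)
    rw [le_div_iff₀ (by positivity)]
    have h2 : ((hexNorm (pt i) : ℤ) : ℝ) ≤ |C| := hc.le.trans (le_abs_self C)
    have h3 : |M| * ((hexNorm (pt i) : ℤ) * √(hexNorm (pt i) : ℤ)) ≤ |M| * (|C| * √|C|) := by
      gcongr
    linarith [abs_nonneg C]

/-- For a connected level curve, translations multiply the Green's function by the character of the
far-field point, up to an error `O(|x|^{-3/2})`. -/
lemma exists_norm_latticeGreen_translate_le {k : ℝ} (hK : Admissible ((8 - k ^ 2) / 4))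
    (hpos : 0 < (8 - k ^ 2) / 4) (A : ℤ) : ∃ C : ℝ, 0 ≤ C ∧ ∀ x : ℤ × ℤ, x ≠ 0 →
      ∀ a, hexNorm a ≤ A → ∀ ξ, FarField ((8 - k ^ 2) / 4) (realPoint x) ξ →
        ‖latticeGreen k (x + a) - char ξ a * latticeGreen k x‖ ≤
          C / ((hexNorm x : ℤ) * √(hexNorm x : ℤ)) := by
  obtain ⟨M, hM, hG⟩ := exists_norm_latticeGreen_le_const hK
  obtain ⟨C, hC, h⟩ := exists_uniform (P := fun a C => ∀ x : ℤ × ℤ, -x.2 ≤ x.1 → x.1 ≤ 0 →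
      0 < x.2 → C ≤ x.2 → ∀ ξ, FarField ((8 - k ^ 2) / 4) (realPoint x) ξ → 0 < x.2 + a.2 ∧
        ‖greenIntegral ((8 - k ^ 2) / 4) (x + a) -
          char ξ a * greenIntegral ((8 - k ^ 2) / 4) x‖ ≤ C / (x.2 * √x.2))
    (fun a C C' hCC hP x h1 h2 h3 h4 ξ hξ => ⟨(hP x h1 h2 h3 (hCC.trans h4) ξ hξ).1,
      (hP x h1 h2 h3 (hCC.trans h4) ξ hξ).2.trans (by
        have : (0 : ℝ) < x.2 := by exact_mod_cast h3
        gcongr)⟩)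
    (exists_norm_greenIntegral_translate_le hK hpos) A
  -- The constant `(1 + ‖κ‖) C` serves both as the bound and as the threshold for `x`, so it has to
  -- be at least `C`.
  set κ : ℂ := 1 / (4 * π * Complex.I)
  have key : ∀ x : ℤ × ℤ, x ≠ 0 → ∀ a, hexNorm a ≤ A → (1 + ‖κ‖) * C ≤ (hexNorm x : ℤ) →
      ∀ ξ, FarField ((8 - k ^ 2) / 4) (realPoint x) ξ →
        ‖latticeGreen k (x + a) - char ξ a * latticeGreen k x‖ ≤
          (1 + ‖κ‖) * C / ((hexNorm x : ℤ) * √(hexNorm x : ℤ)) := by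
    intro x
    refine sector_induction (P := fun x : ℤ × ℤ => x ≠ 0 → ∀ a, hexNorm a ≤ A →
      (1 + ‖κ‖) * C ≤ (hexNorm x : ℤ) →
      ∀ ξ, FarField ((8 - k ^ 2) / 4) (realPoint x) ξ →
        ‖latticeGreen k (x + a) - char ξ a * latticeGreen k x‖ ≤
          (1 + ‖κ‖) * C / ((hexNorm x : ℤ) * √(hexNorm x : ℤ))) ?_ ?_ ?_ x
    · intro x ih hx a ha hl ξ hξ
      rw [hexNorm_swapCoord] at hl ⊢
      have := ih (by rintro rfl; exact hx rfl) (swapCoord a) (by rwa [hexNorm_swapCoord]) hl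
        (swapCoord ξ) hξ.swapCoord
      rw [char_swapCoord, ← latticeGreen_swapCoord hK (x + _),
        ← latticeGreen_swapCoord hK x] at this
      exact this
    · intro x ih hx a ha hl ξ hξ
      have h1 := hξ.hexReflect
      rw [realPoint_hexReflect, hexReflect_hexReflect] at h1
      rw [hexReflect_eq_reflect] at *
      rw [hexNorm_reflect] at hl ⊢
      have := ih (by rintro rfl; exact hx (by simp [reflect])) (reflect a)
        (by rwa [hexNorm_reflect]) hl (reflectDual ξ) h1
      rw [char_reflectDual, ← latticeGreen_reflect hK (x + _), reflect_add, reflect_reflect,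
        ← latticeGreen_reflect hK x] at this
      exact this
    · intro x h1 h2 hx a ha hl ξ hξ
      have hx2 := sector_pos h1 h2 hx
      rw [hexNorm_of_sector h1 h2] at hl ⊢
      obtain ⟨hp, hb⟩ := h a ha x h1 h2 hx2
        (le_trans (by nlinarith [mul_nonneg (norm_nonneg κ) hC]) hl) ξ hξ
      rw [latticeGreen_of_nonneg hK hx2.le, latticeGreen_of_nonneg hK (x := x + a)
        (by simpa using hp.le), mul_left_comm, ← mul_sub, norm_mul]
      have hx2' : (0 : ℝ) < x.2 := by exact_mod_cast hx2
      calc ‖κ‖ * _ ≤ ‖κ‖ * (C / (x.2 * √x.2)) := by gcongr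
        _ ≤ (1 + ‖κ‖) * (C / (x.2 * √x.2)) := by gcongr; linarith
        _ = _ := by ring
  -- The remaining points are finitely many, and the expression is bounded there uniformly in `ξ`.
  obtain ⟨C', hC', h'⟩ := exists_le_of_forall_large (M := M + M)
    (S := fun i : (ℤ × ℤ) × (ℤ × ℤ) × (ℝ × ℝ) => i.1 ≠ 0 ∧ hexNorm i.2.1 ≤ A ∧
      FarField ((8 - k ^ 2) / 4) (realPoint i.1) i.2.2)
    (g := fun i => ‖latticeGreen k (i.1 + i.2.1) - char i.2.2 i.2.1 * latticeGreen k i.1‖)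
    (pt := fun i => i.1) (C := (1 + ‖κ‖) * C)
    (fun i _ => (norm_sub_le _ _).trans (by
      rw [norm_mul, norm_char, one_mul]
      exact add_le_add (hG _) (hG _)))
    (fun i hi hl => key i.1 hi.1 i.2.1 hi.2.1 hl i.2.2 hi.2.2)
  exact ⟨C', hC', fun x hx a ha ξ hξ => h' (x, a, ξ) ⟨hx, ha, hξ⟩ hx⟩

/-- For a level curve with two components, the product of two translation operators, one for each
component, annihilates the Green's function up to an error `O(|x|^{-3/2})`. -/
lemma exists_norm_latticeGreen_translate_pair_le {k : ℝ} (hK : Admissible ((8 - k ^ 2) / 4))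
    (hneg : (8 - k ^ 2) / 4 < 0) (A : ℤ) : ∃ C : ℝ, 0 ≤ C ∧ ∀ x : ℤ × ℤ, x ≠ 0 →
      ∀ a b, hexNorm a ≤ A → hexNorm b ≤ A → ∀ ξ η,
        FarField ((8 - k ^ 2) / 4) (realPoint x) ξ →
        FarField ((8 - k ^ 2) / 4) (realPoint x) η → orientation ξ * orientation η < 0 →
        ‖latticeGreen k (x + a + b) - char ξ a * latticeGreen k (x + b) -
          char η b * latticeGreen k (x + a) + char ξ a * char η b * latticeGreen k x‖ ≤
          C / ((hexNorm x : ℤ) * √(hexNorm x : ℤ)) := by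
  obtain ⟨M, hM, hG⟩ := exists_norm_latticeGreen_le_const hK
  set G := greenIntegral ((8 - k ^ 2) / 4) with hGdef
  have hloc := fun b => exists_uniform (P := fun a C => ∀ x : ℤ × ℤ, -x.2 ≤ x.1 → x.1 ≤ 0 →
      0 < x.2 → C ≤ x.2 → ∀ ξ η, FarField ((8 - k ^ 2) / 4) (realPoint x) ξ →
        FarField ((8 - k ^ 2) / 4) (realPoint x) η → 0 < orientation ξ → orientation η < 0 →
        (0 < x.2 + a.2 + b.2 ∧ 0 < x.2 + a.2 ∧ 0 < x.2 + b.2) ∧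
        ‖G (x + a + b) - char ξ a * G (x + b) - char η b * G (x + a) +
          char ξ a * char η b * G x‖ ≤ C / (x.2 * √x.2))
    (fun a C C' hCC hP x h1 h2 h3 h4 ξ η hξ hη o1 o2 =>
      ⟨(hP x h1 h2 h3 (hCC.trans h4) ξ η hξ hη o1 o2).1,
      (hP x h1 h2 h3 (hCC.trans h4) ξ η hξ hη o1 o2).2.trans (by
        have : (0 : ℝ) < x.2 := by exact_mod_cast h3
        gcongr)⟩)
    (fun a => exists_norm_greenIntegral_translate_pair_le hK hneg a b) A
  obtain ⟨C, hC, h⟩ := exists_uniform (P := fun b C => 0 ≤ C ∧ ∀ a, hexNorm a ≤ A →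
      ∀ x : ℤ × ℤ, -x.2 ≤ x.1 → x.1 ≤ 0 →
      0 < x.2 → C ≤ x.2 → ∀ ξ η, FarField ((8 - k ^ 2) / 4) (realPoint x) ξ →
        FarField ((8 - k ^ 2) / 4) (realPoint x) η → 0 < orientation ξ → orientation η < 0 →
        (0 < x.2 + a.2 + b.2 ∧ 0 < x.2 + a.2 ∧ 0 < x.2 + b.2) ∧
        ‖G (x + a + b) - char ξ a * G (x + b) - char η b * G (x + a) +
          char ξ a * char η b * G x‖ ≤ C / (x.2 * √x.2))
    (fun b C C' hCC hP => ⟨hP.1.trans hCC, fun a ha x h1 h2 h3 h4 ξ η hξ hη o1 o2 =>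
      ⟨(hP.2 a ha x h1 h2 h3 (hCC.trans h4) ξ η hξ hη o1 o2).1,
      (hP.2 a ha x h1 h2 h3 (hCC.trans h4) ξ η hξ hη o1 o2).2.trans (by
        have : (0 : ℝ) < x.2 := by exact_mod_cast h3
        gcongr)⟩⟩)
    hloc A
  -- As for a single translation, `(1 + ‖κ‖) C` is both the bound and the threshold for `x`.
  set κ : ℂ := 1 / (4 * π * Complex.I)
  have key : ∀ x : ℤ × ℤ, x ≠ 0 → ∀ a b, hexNorm a ≤ A → hexNorm b ≤ A →
      (1 + ‖κ‖) * C ≤ (hexNorm x : ℤ) → ∀ ξ η,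
        FarField ((8 - k ^ 2) / 4) (realPoint x) ξ →
        FarField ((8 - k ^ 2) / 4) (realPoint x) η → orientation ξ * orientation η < 0 →
        ‖latticeGreen k (x + a + b) - char ξ a * latticeGreen k (x + b) -
          char η b * latticeGreen k (x + a) + char ξ a * char η b * latticeGreen k x‖ ≤
          (1 + ‖κ‖) * C / ((hexNorm x : ℤ) * √(hexNorm x : ℤ)) := by
    intro x
    refine sector_induction (P := fun x : ℤ × ℤ => x ≠ 0 → ∀ a b, hexNorm a ≤ A → hexNorm b ≤ A →
      (1 + ‖κ‖) * C ≤ (hexNorm x : ℤ) → ∀ ξ η,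
        FarField ((8 - k ^ 2) / 4) (realPoint x) ξ →
        FarField ((8 - k ^ 2) / 4) (realPoint x) η → orientation ξ * orientation η < 0 →
        ‖latticeGreen k (x + a + b) - char ξ a * latticeGreen k (x + b) -
          char η b * latticeGreen k (x + a) + char ξ a * char η b * latticeGreen k x‖ ≤
          (1 + ‖κ‖) * C / ((hexNorm x : ℤ) * √(hexNorm x : ℤ))) ?_ ?_ ?_ x
    · intro x ih hx a b ha hb hl ξ η hξ hη ho
      rw [hexNorm_swapCoord] at hl ⊢
      have := ih (by rintro rfl; exact hx rfl) (swapCoord a) (swapCoord b)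
        (by rwa [hexNorm_swapCoord]) (by rwa [hexNorm_swapCoord]) hl
        (swapCoord ξ) (swapCoord η) hξ.swapCoord hη.swapCoord
        (by rwa [orientation_swapCoord, orientation_swapCoord, neg_mul_neg])
      rw [char_swapCoord, char_swapCoord, ← latticeGreen_swapCoord hK (x + _ + _),
        ← latticeGreen_swapCoord hK (x + swapCoord a),
        ← latticeGreen_swapCoord hK (x + swapCoord b),
        ← latticeGreen_swapCoord hK x] at this
      exact this
    · intro x ih hx a b ha hb hl ξ η hξ hη ho
      have h1 := hξ.hexReflect
      have h2 := hη.hexReflect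
      rw [realPoint_hexReflect, hexReflect_hexReflect] at h1 h2
      rw [hexReflect_eq_reflect] at *
      rw [hexNorm_reflect] at hl ⊢
      have := ih (by rintro rfl; exact hx (by simp [reflect])) (reflect a) (reflect b)
        (by rwa [hexNorm_reflect]) (by rwa [hexNorm_reflect]) hl (reflectDual ξ) (reflectDual η)
        h1 h2 (by rwa [orientation_reflectDual, orientation_reflectDual])
      rw [char_reflectDual, char_reflectDual, ← latticeGreen_reflect hK (x + _ + _),
        ← latticeGreen_reflect hK (x + reflect a), ← latticeGreen_reflect hK (x + reflect b),
        ← latticeGreen_reflect hK x] at this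
      simp only [reflect_add, reflect_reflect] at this
      exact this
    · intro x h1 h2 hx
      have hx2 := sector_pos h1 h2 hx
      -- the claim for `ξ` on the right component
      have hright : ∀ a b, hexNorm a ≤ A → hexNorm b ≤ A →
          (1 + ‖κ‖) * C ≤ (hexNorm x : ℤ) → ∀ ξ η,
          FarField ((8 - k ^ 2) / 4) (realPoint x) ξ →
          FarField ((8 - k ^ 2) / 4) (realPoint x) η → 0 < orientation ξ → orientation η < 0 →
          ‖latticeGreen k (x + a + b) - char ξ a * latticeGreen k (x + b) -
            char η b * latticeGreen k (x + a) + char ξ a * char η b * latticeGreen k x‖ ≤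
            (1 + ‖κ‖) * C / ((hexNorm x : ℤ) * √(hexNorm x : ℤ)) := by
        intro a b ha hb hl ξ η hξ hη o1 o2
        rw [hexNorm_of_sector h1 h2] at hl ⊢
        obtain ⟨⟨p1, p2, p3⟩, hbd⟩ := (h b hb).2 a ha x h1 h2 hx2
          (le_trans (by nlinarith [mul_nonneg (norm_nonneg κ) hC]) hl) ξ η hξ hη o1 o2
        rw [latticeGreen_of_nonneg hK hx2.le, latticeGreen_of_nonneg hK (x := x + a)
          (by simpa using p2.le), latticeGreen_of_nonneg hK (x := x + b) (by simpa using p3.le),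
          latticeGreen_of_nonneg hK (x := x + a + b) (by simpa using p1.le), mul_left_comm,
          mul_left_comm (char η b), mul_left_comm (_ * _), ← mul_sub, ← mul_sub, ← mul_add,
          norm_mul]
        have hx2' : (0 : ℝ) < x.2 := by exact_mod_cast hx2
        calc ‖κ‖ * _ ≤ ‖κ‖ * (C / (x.2 * √x.2)) := by gcongr
          _ ≤ (1 + ‖κ‖) * (C / (x.2 * √x.2)) := by gcongr; linarith
          _ = _ := by ring
      intro a b ha hb hl ξ η hξ hη ho
      rcases mul_neg_iff.mp ho with ⟨o1, o2⟩ | ⟨o1, o2⟩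
      · exact hright a b ha hb hl ξ η hξ hη o1 o2
      · have := hright b a hb ha hl η ξ hη hξ o2 o1
        rw [add_right_comm x b a, sub_right_comm, mul_comm (char η b) (char ξ a)] at this
        exact this
  obtain ⟨C', hC', h'⟩ := exists_le_of_forall_large (M := M + M + M + M)
    (S := fun i : (ℤ × ℤ) × (ℤ × ℤ) × (ℤ × ℤ) × (ℝ × ℝ) × (ℝ × ℝ) => i.1 ≠ 0 ∧
      hexNorm i.2.1 ≤ A ∧ hexNorm i.2.2.1 ≤ A ∧
      FarField ((8 - k ^ 2) / 4) (realPoint i.1) i.2.2.2.1 ∧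
      FarField ((8 - k ^ 2) / 4) (realPoint i.1) i.2.2.2.2 ∧
      orientation i.2.2.2.1 * orientation i.2.2.2.2 < 0)
    (g := fun i => ‖latticeGreen k (i.1 + i.2.1 + i.2.2.1) -
      char i.2.2.2.1 i.2.1 * latticeGreen k (i.1 + i.2.2.1) -
      char i.2.2.2.2 i.2.2.1 * latticeGreen k (i.1 + i.2.1) +
      char i.2.2.2.1 i.2.1 * char i.2.2.2.2 i.2.2.1 * latticeGreen k i.1‖)
    (pt := fun i => i.1) (C := (1 + ‖κ‖) * C)
    (fun i _ => by
      refine norm_add_le_of_le (norm_sub_le_of_le (norm_sub_le_of_le (hG _) ?_) ?_) ?_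
      · rw [norm_mul, norm_char, one_mul]; exact hG _
      · rw [norm_mul, norm_char, one_mul]; exact hG _
      · rw [norm_mul, norm_mul, norm_char, norm_char, one_mul, one_mul]; exact hG _)
    (fun i hi hl => key i.1 hi.1 i.2.1 i.2.2.1 hi.2.1 hi.2.2.1 hl i.2.2.2.1 i.2.2.2.2 hi.2.2.2.1
      hi.2.2.2.2.1 hi.2.2.2.2.2)
  exact ⟨C', hC', fun x hx a b ha hb ξ η hξ hη ho => h' (x, a, b, ξ, η) ⟨hx, ha, hb, hξ, hη, ho⟩ hx⟩

/-! ### Far-field points and directions -/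

lemma isFarFieldPoint_iff {k α : ℝ} {ξ : ℝ × ℝ} : IsFarFieldPoint k α ξ ↔
    ξ.1 ∈ Set.Icc (-π) π ∧ ξ.2 ∈ Set.Icc (-π) π ∧
      FarField ((8 - k ^ 2) / 4) (Real.cos α, Real.sin α) ξ := by
  have d1 : deriv (fun t => laplaceSymbol (t, ξ.2)) ξ.1 =
      -(2 * Real.sin ξ.1 + 2 * Real.sin (ξ.1 - ξ.2)) := by
    refine HasDerivAt.deriv ?_
    simp only [laplaceSymbol]
    have h := ((((Real.hasDerivAt_cos ξ.1).const_mul 2).add_const (2 * Real.cos ξ.2)).add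
      (((hasDerivAt_id ξ.1).sub_const ξ.2).cos.const_mul 2)).sub_const 6
    refine h.congr_deriv ?_
    simp only [id]; ring
  have d2 : deriv (fun t => laplaceSymbol (ξ.1, t)) ξ.2 =
      -(2 * Real.sin ξ.2 - 2 * Real.sin (ξ.1 - ξ.2)) := by
    refine HasDerivAt.deriv ?_
    simp only [laplaceSymbol]
    have h := ((((Real.hasDerivAt_cos ξ.2).const_mul 2).const_add (2 * Real.cos ξ.1)).add
      (((hasDerivAt_id ξ.2).const_sub ξ.1).cos.const_mul 2)).sub_const 6
    refine h.congr_deriv ?_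
    simp only [id]; ring
  rw [IsFarFieldPoint, FarField, d1, d2, neg_neg, neg_neg,
    show 8 - 4 * ((8 - k ^ 2) / 4) = k ^ 2 by ring]

lemma FarField.smul {K r : ℝ} (hr : 0 < r) {v ξ : ℝ × ℝ} (h : FarField K v ξ) :
    FarField K (r * v.1, r * v.2) ξ := by
  obtain ⟨h1, c, hc, h2, h3⟩ := h
  exact ⟨h1, c / r, by positivity, by rw [h2]; field_simp, by rw [h3]; field_simp⟩

lemma toPlane_ne_zero {x : ℤ × ℤ} (hx : x ≠ 0) : toPlane x ≠ 0 := by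
  contrapose! hx
  have h1 := congrArg Complex.re hx
  have h2 := congrArg Complex.im hx
  simp only [toPlane, Complex.zero_re, Complex.zero_im, Int.cast_eq_zero] at h1 h2
  exact Prod.ext h1 h2

lemma farField_of_arg {K : ℝ} {x : ℤ × ℤ} (hx : x ≠ 0) {ξ : ℝ × ℝ}
    (h : FarField K (Real.cos (toPlane x).arg, Real.sin (toPlane x).arg) ξ) :
    FarField K (realPoint x) ξ := by
  have h1 := h.smul (norm_pos_iff.mpr (toPlane_ne_zero hx))
  simp only [Complex.norm_mul_cos_arg, Complex.norm_mul_sin_arg] at h1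
  exact h1

lemma exists_mem_Icc_add_int (t : ℝ) : ∃ s ∈ Set.Icc (-π) π, ∃ j : ℤ, t = s + j * (2 * π) := by
  obtain ⟨j, hj, -⟩ := existsUnique_sub_zsmul_mem_Ico Real.two_pi_pos t (-π)
  simp only [zsmul_eq_mul] at hj
  exact ⟨_, ⟨hj.1, by linarith [hj.2]⟩, j, by ring⟩

lemma FarField.exists_normalized {K : ℝ} {v ξ : ℝ × ℝ} (h : FarField K v ξ) :
    ∃ η : ℝ × ℝ, η.1 ∈ Set.Icc (-π) π ∧ η.2 ∈ Set.Icc (-π) π ∧ FarField K v η ∧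
      orientation η = orientation ξ ∧ ∀ a, char η a = char ξ a := by
  obtain ⟨s, hs, i, hi⟩ := exists_mem_Icc_add_int ξ.1
  obtain ⟨t, ht, j, hj⟩ := exists_mem_Icc_add_int ξ.2
  have e : ξ.1 - ξ.2 = s - t + ((i - j : ℤ) : ℝ) * (2 * π) := by rw [hi, hj]; push_cast; ring
  refine ⟨(s, t), hs, ht, ?_, ?_, fun a => ?_⟩
  · obtain ⟨h1, c, hc, h2, h3⟩ := h
    rw [laplaceSymbol, e, hi, hj, Real.cos_add_int_mul_two_pi, Real.cos_add_int_mul_two_pi,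
      Real.cos_add_int_mul_two_pi] at h1
    rw [e, hi, Real.sin_add_int_mul_two_pi, Real.sin_add_int_mul_two_pi] at h2
    rw [e, hj, Real.sin_add_int_mul_two_pi, Real.sin_add_int_mul_two_pi] at h3
    exact ⟨h1, c, hc, h2, h3⟩
  · rw [orientation, orientation, e, hi, hj, Real.sin_add_int_mul_two_pi,
      Real.sin_add_int_mul_two_pi, Real.sin_add_int_mul_two_pi]
  · rw [char, char, Complex.exp_eq_exp_iff_exists_int]
    refine ⟨-(a.1 * i + a.2 * j), ?_⟩
    rw [hi, hj]
    push_cast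
    ring

/-- In terms of half angles, the level curve is `cos a cos b cos (a - b) = K / 2`. -/
lemma cos_half_mul {K : ℝ} {ξ : ℝ × ℝ} (h : 8 - 4 * K + laplaceSymbol ξ = 0) :
    Real.cos (ξ.1 / 2) * Real.cos (ξ.2 / 2) * Real.cos (ξ.1 / 2 - ξ.2 / 2) = K / 2 := by
  rw [laplaceSymbol, show ξ.1 = 2 * (ξ.1 / 2) by ring, show ξ.2 = 2 * (ξ.2 / 2) by ring,
    ← mul_sub, Real.cos_two_mul, Real.cos_two_mul, Real.cos_two_mul] at h
  have h1 := Real.sin_sq_add_cos_sq (ξ.1 / 2)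
  have h2 := Real.sin_sq_add_cos_sq (ξ.2 / 2)
  have h3 := Real.cos_sub (ξ.1 / 2) (ξ.2 / 2)
  generalize Real.cos (ξ.1 / 2) = a at *
  generalize Real.cos (ξ.2 / 2) = b at *
  generalize Real.sin (ξ.1 / 2) = s at *
  generalize Real.sin (ξ.2 / 2) = t at *
  generalize Real.cos (ξ.1 / 2 - ξ.2 / 2) = D at *
  have h4 : (D - a * b) ^ 2 = (1 - a ^ 2) * (1 - b ^ 2) := by
    rw [h3]; linear_combination t ^ 2 * h1 + (1 - a ^ 2) * h2
  linarith

lemma orientation_eq_mul (ξ : ℝ × ℝ) : orientation ξ =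
    -4 * Real.sin (ξ.1 / 2) * Real.sin (ξ.2 / 2) * Real.sin (ξ.1 / 2 - ξ.2 / 2) := by
  rw [orientation]
  have e1 : Real.sin ξ.1 = 2 * Real.sin (ξ.1 / 2) * Real.cos (ξ.1 / 2) := by
    rw [← Real.sin_two_mul]; ring_nf
  have e2 : Real.sin ξ.2 = 2 * Real.sin (ξ.2 / 2) * Real.cos (ξ.2 / 2) := by
    rw [← Real.sin_two_mul]; ring_nf
  have e3 : Real.sin (ξ.1 - ξ.2) =
      2 * Real.sin (ξ.1 / 2 - ξ.2 / 2) * Real.cos (ξ.1 / 2 - ξ.2 / 2) := by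
    rw [← Real.sin_two_mul]; ring_nf
  rw [e1, e2, e3, Real.sin_sub, Real.cos_sub]
  have h1 := Real.sin_sq_add_cos_sq (ξ.1 / 2)
  have h2 := Real.sin_sq_add_cos_sq (ξ.2 / 2)
  generalize Real.cos (ξ.1 / 2) = a at *
  generalize Real.cos (ξ.2 / 2) = b at *
  generalize Real.sin (ξ.1 / 2) = s at *
  generalize Real.sin (ξ.2 / 2) = t at *
  linear_combination (2 * t * b) * h1 - (2 * s * a) * h2

/-- The two components of the level curve in `[-π, π]²` are separated by the diagonal. -/
lemma orientation_pos_iff {K : ℝ} (hneg : K < 0) {ξ : ℝ × ℝ} (h1 : ξ.1 ∈ Set.Icc (-π) π)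
    (h2 : ξ.2 ∈ Set.Icc (-π) π) (h : 8 - 4 * K + laplaceSymbol ξ = 0) :
    (0 < orientation ξ ↔ ξ.2 < ξ.1) ∧ (orientation ξ < 0 ↔ ξ.1 < ξ.2) := by
  have hpi := Real.pi_pos
  have hP := cos_half_mul h
  have ha : 0 ≤ Real.cos (ξ.1 / 2) := Real.cos_nonneg_of_mem_Icc
    ⟨by linarith [h1.1], by linarith [h1.2]⟩
  have hb : 0 ≤ Real.cos (ξ.2 / 2) := Real.cos_nonneg_of_mem_Icc
    ⟨by linarith [h2.1], by linarith [h2.2]⟩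
  -- On the level curve `cos (ξ₁ / 2) cos (ξ₂ / 2) cos ((ξ₁ - ξ₂) / 2) = K / 2 < 0`.
  have hD : Real.cos (ξ.1 / 2 - ξ.2 / 2) < 0 := by
    by_contra! h0
    have := mul_nonneg (mul_nonneg ha hb) h0
    linarith
  have ha' : Real.cos (ξ.1 / 2) ≠ 0 := by
    intro h0; rw [h0, zero_mul, zero_mul] at hP; linarith
  have hst : Real.sin (ξ.1 / 2) * Real.sin (ξ.2 / 2) < 0 := by
    rw [Real.cos_sub] at hD
    nlinarith [mul_nonneg ha hb]
  have hlt : ∀ s : ℝ, |s| ≤ π → s ≠ π → s ≠ -π → (0 < Real.sin s ↔ 0 < s) ∧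
      (Real.sin s < 0 ↔ s < 0) := by
    intro s hs hs1 hs2
    have hs' := abs_le.mp hs
    rcases lt_trichotomy s 0 with h0 | h0 | h0
    · have := Real.sin_neg_of_neg_of_neg_pi_lt h0 (lt_of_le_of_ne hs'.1 (Ne.symm hs2))
      constructor <;> constructor <;> intro <;> linarith
    · rw [h0, Real.sin_zero]; simp
    · have := Real.sin_pos_of_pos_of_lt_pi h0 (lt_of_le_of_ne hs'.2 hs1)
      constructor <;> constructor <;> intro <;> linarith
  have n1 : ξ.1 / 2 ≠ π / 2 := fun h3 => ha' (by rw [h3, Real.cos_pi_div_two])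
  have n2 : ξ.1 / 2 ≠ -(π / 2) := fun h3 => ha' (by rw [h3, Real.cos_neg, Real.cos_pi_div_two])
  obtain ⟨s1, s2⟩ := hlt (ξ.1 / 2 - ξ.2 / 2)
    (abs_le.mpr ⟨by linarith [h1.1, h2.2], by linarith [h1.2, h2.1]⟩)
    (fun h3 => n1 (by linarith [h1.2, h2.1])) (fun h3 => n2 (by linarith [h1.1, h2.2]))
  rw [orientation_eq_mul]
  have e : -4 * Real.sin (ξ.1 / 2) * Real.sin (ξ.2 / 2) * Real.sin (ξ.1 / 2 - ξ.2 / 2) =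
      (-4 * (Real.sin (ξ.1 / 2) * Real.sin (ξ.2 / 2))) * Real.sin (ξ.1 / 2 - ξ.2 / 2) := by ring
  have hpos : 0 < -4 * (Real.sin (ξ.1 / 2) * Real.sin (ξ.2 / 2)) := by linarith
  have hn : ∀ c t : ℝ, 0 < c → (c * t < 0 ↔ t < 0) := fun c t hc =>
    ⟨fun h => by by_contra! h0; nlinarith [mul_nonneg hc.le h0],
      fun h => mul_neg_of_pos_of_neg hc h⟩
  rw [e, mul_pos_iff_of_pos_left hpos, s1, hn _ _ hpos, s2]
  constructor <;> constructor <;> intro <;> linarith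

/-! ### Separation of the far-field points -/

/-- On a level curve with two components the orientation is bounded away from zero. -/
lemma orientation_sq_ge {K : ℝ} {ξ : ℝ × ℝ} (h : 8 - 4 * K + laplaceSymbol ξ = 0) :
    -(4 * K * (4 + K)) ≤ orientation ξ ^ 2 := by
  have hP := cos_half_mul h
  have h1 := Real.sin_sq_add_cos_sq (ξ.1 / 2)
  have h2 := Real.sin_sq_add_cos_sq (ξ.2 / 2)
  have h3 := Real.cos_sub (ξ.1 / 2) (ξ.2 / 2)
  have h5 := Real.sin_sq_add_cos_sq (ξ.1 / 2 - ξ.2 / 2)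
  rw [orientation_eq_mul]
  generalize Real.cos (ξ.1 / 2) = a at *
  generalize Real.cos (ξ.2 / 2) = b at *
  generalize Real.sin (ξ.1 / 2) = s at *
  generalize Real.sin (ξ.2 / 2) = t at *
  generalize Real.cos (ξ.1 / 2 - ξ.2 / 2) = D at *
  generalize Real.sin (ξ.1 / 2 - ξ.2 / 2) = S at *
  have hs : s ^ 2 = 1 - a ^ 2 := by linarith
  have ht : t ^ 2 = 1 - b ^ 2 := by linarith
  have hS : S ^ 2 = 1 - D ^ 2 := by linarith
  have h4 : (D - a * b) ^ 2 = (1 - a ^ 2) * (1 - b ^ 2) := by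
    rw [h3]; linear_combination t ^ 2 * h1 + (1 - a ^ 2) * h2
  have hsum : a ^ 2 + b ^ 2 + D ^ 2 = 1 + K := by linarith
  have hprod : a ^ 2 * b ^ 2 * D ^ 2 = K ^ 2 / 4 := by
    rw [← mul_pow, ← mul_pow, hP]; ring
  have e : (-4 * s * t * S) ^ 2 = 16 * (s ^ 2 * t ^ 2 * S ^ 2) := by ring
  rw [e, hs, ht, hS]
  have hq : 0 ≤ a ^ 2 * b ^ 2 + b ^ 2 * D ^ 2 + a ^ 2 * D ^ 2 := by positivity
  have e2 : (1 - a ^ 2) * (1 - b ^ 2) * (1 - D ^ 2) = 1 - (a ^ 2 + b ^ 2 + D ^ 2) +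
      (a ^ 2 * b ^ 2 + b ^ 2 * D ^ 2 + a ^ 2 * D ^ 2) - a ^ 2 * b ^ 2 * D ^ 2 := by ring
  rw [e2, hsum, hprod]
  linarith

lemma char_e₁ (ξ : ℝ × ℝ) : char ξ e₁ = Complex.exp (Complex.I * ξ.1) := by
  simp [char, e₁]

lemma char_e₂ (ξ : ℝ × ℝ) : char ξ e₂ = Complex.exp (Complex.I * ξ.2) := by
  simp [char, e₂]

lemma exp_I_mul_im (t : ℝ) : (Complex.exp (Complex.I * t)).im = Real.sin t := by
  rw [mul_comm, Complex.exp_ofReal_mul_I_im]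

lemma char_im (ξ : ℝ × ℝ) : (char ξ e₁).im = Real.sin ξ.1 ∧ (char ξ e₂).im = Real.sin ξ.2 ∧
    (char ξ e₁ * (starRingEnd ℂ) (char ξ e₂)).im = Real.sin (ξ.1 - ξ.2) := by
  rw [char_e₁, char_e₂, ← Complex.exp_conj, ← Complex.exp_add]
  refine ⟨exp_I_mul_im _, exp_I_mul_im _, ?_⟩
  rw [← exp_I_mul_im]
  congr 2
  simp only [map_mul, Complex.conj_I, Complex.conj_ofReal]
  push_cast; ring

lemma norm_mul_conj_sub_le {a b a' b' : ℂ} (ha : ‖a'‖ = 1) (hb : ‖b‖ = 1) :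
    |(a * (starRingEnd ℂ) b).im - (a' * (starRingEnd ℂ) b').im| ≤ ‖a - a'‖ + ‖b - b'‖ := by
  rw [← Complex.sub_im]
  refine (Complex.abs_im_le_norm _).trans ?_
  have e : a * (starRingEnd ℂ) b - a' * (starRingEnd ℂ) b' =
      (a - a') * (starRingEnd ℂ) b + a' * (starRingEnd ℂ) (b - b') := by
    rw [map_sub]; ring
  rw [e]
  refine (norm_add_le _ _).trans (le_of_eq ?_)
  rw [norm_mul, norm_mul, RCLike.norm_conj, RCLike.norm_conj, ha, hb, mul_one, one_mul]

lemma exists_char_separation {K : ℝ} (hK : Admissible K) (hneg : K < 0) : ∃ c : ℝ, 0 < c ∧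
    ∀ v v' ξ η : ℝ × ℝ, FarField K v ξ → FarField K v' η → orientation ξ * orientation η < 0 →
      c ≤ ‖char ξ e₁ - char η e₁‖ ^ 2 + ‖char ξ e₂ - char η e₂‖ ^ 2 := by
  have hl := hK.lower
  have hm : 0 < -(4 * K * (4 + K)) := by nlinarith
  refine ⟨-(4 * K * (4 + K)) / 8, by positivity, ?_⟩
  intro v v' ξ η hξ hη ho
  have h1 := orientation_sq_ge hξ.1
  obtain ⟨x1, x2, x3⟩ := char_im ξ
  obtain ⟨y1, y2, y3⟩ := char_im η
  have a1 := Complex.abs_im_le_norm (char ξ e₁ - char η e₁)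
  have a2 := Complex.abs_im_le_norm (char ξ e₂ - char η e₂)
  have a3 := norm_mul_conj_sub_le (a := char ξ e₁) (b := char ξ e₂) (a' := char η e₁)
    (b' := char η e₂) (norm_char _ _) (norm_char _ _)
  rw [Complex.sub_im, x1, y1] at a1
  rw [Complex.sub_im, x2, y2] at a2
  rw [x3, y3] at a3
  set d₁ := ‖char ξ e₁ - char η e₁‖
  set d₂ := ‖char ξ e₂ - char η e₂‖
  have hdiff : |orientation ξ - orientation η| ≤ 2 * (d₁ + d₂) := by
    rw [orientation, orientation]
    have := abs_le.mp a1; have := abs_le.mp a2; have := abs_le.mp a3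
    rw [abs_le]; constructor <;> linarith
  have hsq : orientation ξ ^ 2 ≤ (orientation ξ - orientation η) ^ 2 := by
    nlinarith [sq_nonneg (orientation η)]
  have hsq2 : (orientation ξ - orientation η) ^ 2 ≤ (2 * (d₁ + d₂)) ^ 2 := sq_le_sq' (by
    linarith [(abs_le.mp hdiff).1]) (abs_le.mp hdiff).2
  nlinarith [sq_nonneg (d₁ - d₂)]

/-- The level curve has no critical points. -/
lemma gradient_ne_zero {K : ℝ} (hK : Admissible K) {ξ : ℝ × ℝ}
    (h : 8 - 4 * K + laplaceSymbol ξ = 0)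
    (h1 : 2 * Real.sin ξ.1 + 2 * Real.sin (ξ.1 - ξ.2) = 0)
    (h2 : 2 * Real.sin ξ.2 - 2 * Real.sin (ξ.1 - ξ.2) = 0) : False := by
  obtain ⟨p, τ, hp, hτ⟩ : ∃ p τ, ξ.1 = 2 * p ∧ ξ.2 = p + τ :=
    ⟨ξ.1 / 2, ξ.2 - ξ.1 / 2, by ring, by ring⟩
  have e : ξ = (2 * p, p + τ) := Prod.ext hp hτ
  rw [e, laplaceSymbol_two_mul, add_sub_cancel_left] at h
  rw [hp, hτ, show 2 * p - (p + τ) = p - τ by ring, Real.sin_sub, Real.sin_two_mul] at h1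
  rw [hp, hτ, show 2 * p - (p + τ) = p - τ by ring, Real.sin_sub, Real.sin_add] at h2
  have hcK : Real.cos p * (Real.cos p + Real.cos τ) = K := by linarith
  have hc0 : Real.cos p ≠ 0 := by
    intro h0; rw [h0, zero_mul] at hcK; exact hK.ne hcK.symm
  have h3 : Real.sin τ = 0 := by
    have : Real.cos p * Real.sin τ = 0 := by linarith
    exact (mul_eq_zero.mp this).resolve_left hc0
  have h4 : Real.sin p * (2 * Real.cos p + Real.cos τ) = 0 := by
    rw [h3] at h1; linarith
  have h5 := Real.sin_sq_add_cos_sq τ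
  have h6 := Real.sin_sq_add_cos_sq p
  rw [h3] at h5
  rcases mul_eq_zero.mp h4 with h7 | h7
  · rw [h7] at h6
    have hp1 : Real.cos p = 1 ∨ Real.cos p = -1 := mul_self_eq_one_iff.mp (by linarith)
    have ht1 : Real.cos τ = 1 ∨ Real.cos τ = -1 := mul_self_eq_one_iff.mp (by linarith)
    have := hK.ne
    have := hK.upper
    rcases hp1 with h | h <;> rcases ht1 with h' | h' <;> rw [h, h'] at hcK <;> norm_num at hcK <;>
      first | linarith | exact hK.ne hcK.symm
  · have h8 : Real.cos τ = -2 * Real.cos p := by linarith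
    rw [h8] at hcK h5
    nlinarith [hK.lower]

/-- Far-field points of the same direction are not opposite to each other. -/
lemma exists_char_mul_separation {K : ℝ} (hK : Admissible K) : ∃ c : ℝ, 0 < c ∧
    ∀ v ξ η : ℝ × ℝ, FarField K v ξ → FarField K v η →
      c ≤ ‖char ξ e₁ * char η e₁ - 1‖ + ‖char ξ e₂ * char η e₂ - 1‖ := by
  set S : Set (ℝ × ℝ) := (Set.Icc (-π) π ×ˢ Set.Icc (-π) π) ∩
    {ξ | 8 - 4 * K + laplaceSymbol ξ = 0} with hS
  have hcpt : IsCompact S := (isCompact_Icc.prod isCompact_Icc).inter_right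
    (isClosed_eq (continuous_const.add continuous_laplaceSymbol) continuous_const)
  set g : ℝ × ℝ → ℝ := fun ξ => |2 * Real.sin ξ.1 + 2 * Real.sin (ξ.1 - ξ.2)| +
    |2 * Real.sin ξ.2 - 2 * Real.sin (ξ.1 - ξ.2)| with hg
  have hgc : Continuous g := by fun_prop
  rcases S.eq_empty_or_nonempty with hem | hne
  · refine ⟨1, one_pos, fun v ξ' η hξ' _ => ?_⟩
    obtain ⟨ξ, h1, h2, hξ, -⟩ := hξ'.exists_normalized
    have : ξ ∈ S := ⟨⟨h1, h2⟩, hξ.1⟩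
    rw [hem] at this
    exact absurd this (Set.notMem_empty _)
  obtain ⟨ξ₀, hξ₀, hmin⟩ := hcpt.exists_isMinOn hne hgc.continuousOn
  have hg0 : 0 < g ξ₀ := by
    refine lt_of_le_of_ne (add_nonneg (abs_nonneg _) (abs_nonneg _)) fun h0 => ?_
    have h1 := abs_nonneg (2 * Real.sin ξ₀.1 + 2 * Real.sin (ξ₀.1 - ξ₀.2))
    have h2 := abs_nonneg (2 * Real.sin ξ₀.2 - 2 * Real.sin (ξ₀.1 - ξ₀.2))
    simp only [hg] at h0
    exact gradient_ne_zero hK hξ₀.2 (abs_eq_zero.mp (by linarith)) (abs_eq_zero.mp (by linarith))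
  refine ⟨g ξ₀ / 6, by positivity, fun v ξ' η hξ' hη => ?_⟩
  obtain ⟨ξ, h1, h2, hξ, -, hch⟩ := hξ'.exists_normalized
  rw [← hch, ← hch]
  have hle : g ξ₀ ≤ g ξ := hmin (show ξ ∈ S from ⟨⟨h1, h2⟩, hξ.1⟩)
  obtain ⟨-, c, hc, c1, c2⟩ := hξ
  obtain ⟨-, d, hd, d1, d2⟩ := hη
  -- If `e^{iξ}` and `e^{-iη}` were close, the gradients at `ξ` and `η` would be nearly opposite;
  -- but they are positive multiples of the same vector, and bounded away from zero.
  have hdist : ∀ a : ℤ × ℤ, ‖char ξ a * char η a - 1‖ =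
      ‖char ξ a - (starRingEnd ℂ) (char η a)‖ := by
    intro a
    have e : char ξ a * char η a - 1 = (char ξ a - (starRingEnd ℂ) (char η a)) * char η a := by
      rw [sub_mul, ← Complex.normSq_eq_conj_mul_self, Complex.normSq_eq_norm_sq, norm_char]
      simp
    rw [e, norm_mul, norm_char, mul_one]
  rw [hdist, hdist]
  obtain ⟨x1, x2, x3⟩ := char_im ξ
  obtain ⟨y1, y2, y3⟩ := char_im η
  have a1 := Complex.abs_im_le_norm (char ξ e₁ - (starRingEnd ℂ) (char η e₁))
  have a2 := Complex.abs_im_le_norm (char ξ e₂ - (starRingEnd ℂ) (char η e₂))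
  have a3 := norm_mul_conj_sub_le (a := char ξ e₁) (b := char ξ e₂)
    (a' := (starRingEnd ℂ) (char η e₁)) (b' := (starRingEnd ℂ) (char η e₂))
    (by rw [RCLike.norm_conj, norm_char]) (norm_char _ _)
  rw [← map_mul, Complex.conj_im, x3, y3] at a3
  rw [Complex.sub_im, Complex.conj_im, x1, y1] at a1
  rw [Complex.sub_im, Complex.conj_im, x2, y2] at a2
  set d₁ := ‖char ξ e₁ - (starRingEnd ℂ) (char η e₁)‖
  set d₂ := ‖char ξ e₂ - (starRingEnd ℂ) (char η e₂)‖
  have hsame : ∀ t : ℝ, |c * t| ≤ |c * t + d * t| := by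
    intro t
    rw [← add_mul, abs_mul, abs_mul, abs_of_pos hc, abs_of_pos (by linarith : 0 < c + d)]
    gcongr
    linarith
  have b1 : |2 * Real.sin ξ.1 + 2 * Real.sin (ξ.1 - ξ.2)| ≤ 2 * d₁ + 2 * (d₁ + d₂) := by
    rw [c1]
    refine (hsame v.1).trans ?_
    rw [← c1, ← d1]
    have := abs_le.mp a1; have := abs_le.mp a3
    rw [abs_le]; constructor <;> linarith
  have b2 : |2 * Real.sin ξ.2 - 2 * Real.sin (ξ.1 - ξ.2)| ≤ 2 * d₂ + 2 * (d₁ + d₂) := by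
    rw [c2]
    refine (hsame v.2).trans ?_
    rw [← c2, ← d2]
    have := abs_le.mp a2; have := abs_le.mp a3
    rw [abs_le]; constructor <;> linarith
  simp only [hg] at hle ⊢
  linarith

/-! ### Growth scales on the lattice -/

/-- The function `|x|^s` on the lattice. -/
def rad (s : ℝ) (x : ℤ × ℤ) : ℝ := ‖toPlane x‖ ^ s

lemma toPlane_add (x y : ℤ × ℤ) : toPlane (x + y) = toPlane x + toPlane y := by
  apply Complex.ext <;> simp [toPlane]

lemma norm_toPlane_le (x : ℤ × ℤ) : ‖toPlane x‖ ≤ 2 * (hexNorm x : ℤ) := by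
  have h := abs_le_hexNorm x
  have h1 : |(x.1 : ℝ)| ≤ (hexNorm x : ℤ) := by exact_mod_cast h.1
  have h2 : |(x.2 : ℝ)| ≤ (hexNorm x : ℤ) := by exact_mod_cast h.2
  refine (Complex.norm_le_abs_re_add_abs_im _).trans ?_
  simp only [toPlane]
  linarith

lemma hexNorm_le (x : ℤ × ℤ) : ((hexNorm x : ℤ) : ℝ) ≤ 2 * ‖toPlane x‖ := by
  have h1 : |(x.1 : ℝ)| ≤ ‖toPlane x‖ := Complex.abs_re_le_norm (toPlane x)
  have h2 : |(x.2 : ℝ)| ≤ ‖toPlane x‖ := Complex.abs_im_le_norm (toPlane x)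
  rw [← hexNorm_realPoint]
  have h3 := abs_add_le (x.1 : ℝ) x.2
  have h4 := norm_nonneg (toPlane x)
  simp only [hexNorm, realPoint]
  refine max_le (max_le ?_ ?_) ?_ <;> linarith

lemma tendsto_norm_toPlane : Tendsto (fun x : ℤ × ℤ => ‖toPlane x‖) cofinite atTop := by
  rw [tendsto_atTop]
  intro b
  rw [eventually_cofinite]
  refine (finite_hexNorm_le ⌈2 * b⌉).subset fun x hx => ?_
  simp only [Set.mem_ofPred_eq, not_le] at hx ⊢
  have h1 := hexNorm_le x
  have h2 : ((hexNorm x : ℤ) : ℝ) ≤ ⌈2 * b⌉ := by linarith [Int.le_ceil (2 * b)]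
  exact_mod_cast h2

lemma norm_toPlane_pos {x : ℤ × ℤ} (hx : x ≠ 0) : 0 < ‖toPlane x‖ :=
  norm_pos_iff.mpr (toPlane_ne_zero hx)

lemma rad_nonneg (s : ℝ) (x : ℤ × ℤ) : 0 ≤ rad s x := Real.rpow_nonneg (norm_nonneg _) _

lemma rad_zero : rad 0 = fun _ => 1 := by
  funext x; simp [rad]

lemma rad_mul_rad (s t : ℝ) {x : ℤ × ℤ} (hx : x ≠ 0) : rad s x * rad t x = rad (s + t) x :=
  (Real.rpow_add (norm_toPlane_pos hx) s t).symm

section Scales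

variable {l : Filter (ℤ × ℤ)} {f g : ℤ × ℤ → ℂ} {s t : ℝ}

lemma IsBigO_mul_rad (hl : l ≤ cofinite) (hf : f =O[l] rad s) (hg : g =O[l] rad t)
    {r : ℝ} (hr : s + t = r) : (fun x => f x * g x) =O[l] rad r := by
  subst hr
  refine (hf.mul hg).congr' EventuallyEq.rfl ?_
  filter_upwards [hl (eventually_cofinite_ne 0)] with x hx
  exact rad_mul_rad s t hx

lemma rad_isBigO_rad (hl : l ≤ cofinite) (hst : s ≤ t) : rad s =O[l] rad t := by
  refine IsBigO.of_bound 1 ?_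
  filter_upwards [hl (tendsto_norm_toPlane.eventually_ge_atTop 1)] with x hx
  rw [Real.norm_of_nonneg (rad_nonneg _ _), Real.norm_of_nonneg (rad_nonneg _ _), one_mul]
  exact Real.rpow_le_rpow_of_exponent_le hx hst

lemma rad_le_of_le {s c : ℝ} {x y : ℤ × ℤ} (hc : 1 ≤ c) (hx : x ≠ 0) (hy : y ≠ 0)
    (h1 : ‖toPlane x‖ ≤ c * ‖toPlane y‖) (h2 : ‖toPlane y‖ ≤ c * ‖toPlane x‖) :
    rad s x ≤ c ^ |s| * rad s y := by
  have hx' := norm_toPlane_pos hx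
  have hy' := norm_toPlane_pos hy
  have hc' : 0 < c := by linarith
  rcases le_total 0 s with h | h
  · rw [abs_of_nonneg h, rad, rad, ← Real.mul_rpow hc'.le hy'.le]
    exact Real.rpow_le_rpow hx'.le h1 h
  · rw [abs_of_nonpos h, rad, rad, Real.rpow_neg hc'.le, ← Real.inv_rpow hc'.le,
      ← Real.mul_rpow (by positivity) hy'.le]
    refine Real.rpow_le_rpow_of_nonpos (by positivity) ?_ h
    rw [inv_mul_le_iff₀ hc']
    exact h2

lemma rad_shift (s : ℝ) (a : ℤ × ℤ) : (fun x => rad s (x + a)) =O[cofinite] rad s := by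
  refine IsBigO.of_bound (2 ^ |s|) ?_
  filter_upwards [tendsto_norm_toPlane.eventually_ge_atTop (2 * ‖toPlane a‖),
    eventually_cofinite_ne 0, eventually_cofinite_ne (-a)] with x hx h0 ha
  rw [Real.norm_of_nonneg (rad_nonneg _ _), Real.norm_of_nonneg (rad_nonneg _ _)]
  have h1 : ‖toPlane (x + a)‖ ≤ ‖toPlane x‖ + ‖toPlane a‖ := by
    rw [toPlane_add]; exact norm_add_le _ _
  have h2 : ‖toPlane x‖ - ‖toPlane a‖ ≤ ‖toPlane (x + a)‖ := by
    rw [toPlane_add]; exact norm_sub_le_norm_add _ _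
  exact rad_le_of_le one_le_two (fun h => ha (eq_neg_of_add_eq_zero_left h)) h0
    (by linarith) (by linarith)

lemma tendsto_add_cofinite (a : ℤ × ℤ) : Tendsto (fun x : ℤ × ℤ => x + a) cofinite cofinite :=
  (add_left_injective a).tendsto_cofinite

lemma IsBigO_shift (hl : l ≤ cofinite) (a : ℤ × ℤ) (ha : Tendsto (fun x : ℤ × ℤ => x + a) l l)
    (hf : f =O[l] rad s) : (fun x => f (x + a)) =O[l] rad s :=
  (hf.comp_tendsto ha).trans ((rad_shift s a).mono hl)

lemma hexNorm_rpow_le {x : ℤ × ℤ} (hx : x ≠ 0) {s : ℝ} (hs : s ≤ 0) :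
    ((hexNorm x : ℤ) : ℝ) ^ s ≤ 2 ^ (-s) * rad s x := by
  have h0 := norm_toPlane_pos hx
  rw [Real.rpow_neg two_pos.le, ← Real.inv_rpow two_pos.le, rad,
    ← Real.mul_rpow (by positivity) h0.le]
  refine Real.rpow_le_rpow_of_nonpos (by positivity) ?_ hs
  have := norm_toPlane_le x
  linarith

lemma div_sqrt_hexNorm (C : ℝ) (x : ℤ × ℤ) :
    C / √(hexNorm x : ℤ) = C * ((hexNorm x : ℤ) : ℝ) ^ (-(1 / 2) : ℝ) := by
  have h : (0 : ℝ) ≤ (hexNorm x : ℤ) := by exact_mod_cast hexNorm_nonneg x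
  rw [Real.rpow_neg h, ← Real.sqrt_eq_rpow, div_eq_mul_inv]

lemma div_mul_sqrt_hexNorm (C : ℝ) {x : ℤ × ℤ} (hx : x ≠ 0) :
    C / ((hexNorm x : ℤ) * √(hexNorm x : ℤ)) = C * ((hexNorm x : ℤ) : ℝ) ^ (-(3 / 2) : ℝ) := by
  have h : (1 : ℝ) ≤ (hexNorm x : ℤ) := by exact_mod_cast one_le_hexNorm hx
  rw [Real.rpow_neg (by linarith), show (3 / 2 : ℝ) = 1 + 1 / 2 by norm_num,
    Real.rpow_add (by linarith), Real.rpow_one, ← Real.sqrt_eq_rpow, div_eq_mul_inv]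

lemma isBigO_rad_of_le_hexNorm (hl : l ≤ cofinite) {C s : ℝ} (hC : 0 ≤ C) (hs : s ≤ 0)
    (h : ∀ᶠ x in l, ‖f x‖ ≤ C * ((hexNorm x : ℤ) : ℝ) ^ s) : f =O[l] rad s := by
  refine IsBigO.of_bound (C * 2 ^ (-s)) ?_
  filter_upwards [h, hl (eventually_cofinite_ne 0)] with x hx h0
  rw [Real.norm_of_nonneg (rad_nonneg _ _), mul_assoc]
  exact hx.trans (mul_le_mul_of_nonneg_left (hexNorm_rpow_le h0 hs) hC)

/-! ### Slowly varying coefficients -/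

/-- Bounded functions whose increment under the shift by `a` is `O(|x|⁻¹)`. -/
def Slow (l : Filter (ℤ × ℤ)) (a : ℤ × ℤ) (f : ℤ × ℤ → ℂ) : Prop :=
  f =O[l] rad 0 ∧ (fun x => f (x + a) - f x) =O[l] rad (-1)

lemma Slow.const (l : Filter (ℤ × ℤ)) (a : ℤ × ℤ) (c : ℂ) : Slow l a fun _ => c := by
  refine ⟨by rw [rad_zero]; exact isBigO_const_const c one_ne_zero l, ?_⟩
  simp only [sub_self]
  exact isBigO_zero _ _

lemma Slow.add {a : ℤ × ℤ} (hf : Slow l a f) (hg : Slow l a g) : Slow l a fun x => f x + g x := by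
  refine ⟨hf.1.add hg.1, (hf.2.add hg.2).congr_left fun x => ?_⟩
  ring

lemma Slow.neg {a : ℤ × ℤ} (hf : Slow l a f) : Slow l a fun x => -f x := by
  refine ⟨hf.1.neg_left, hf.2.neg_left.congr_left fun x => ?_⟩
  ring

lemma Slow.sub {a : ℤ × ℤ} (hf : Slow l a f) (hg : Slow l a g) : Slow l a fun x => f x - g x := by
  simp only [sub_eq_add_neg]
  exact hf.add hg.neg

lemma Slow.shift {a : ℤ × ℤ} (hl : l ≤ cofinite) (hf : Slow l a f) :
    (fun x => f (x + a)) =O[l] rad 0 := by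
  have h := hf.1.add (hf.2.trans (rad_isBigO_rad hl (by norm_num : (-1 : ℝ) ≤ 0)))
  refine h.congr_left fun x => ?_
  ring

lemma Slow.mul {a : ℤ × ℤ} (hl : l ≤ cofinite) (hf : Slow l a f) (hg : Slow l a g) :
    Slow l a fun x => f x * g x := by
  refine ⟨IsBigO_mul_rad hl hf.1 hg.1 (add_zero 0), ?_⟩
  have h1 := IsBigO_mul_rad hl hf.2 (hg.shift hl) (add_zero _)
  have h2 := IsBigO_mul_rad hl hf.1 hg.2 (zero_add _)
  refine (h1.add h2).congr_left fun x => ?_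
  ring

lemma Slow.conj {a : ℤ × ℤ} (hf : Slow l a f) : Slow l a fun x => (starRingEnd ℂ) (f x) := by
  refine ⟨hf.1.norm_left.congr_left (fun x => (RCLike.norm_conj (f x)).symm) |>.of_norm_left,
    hf.2.norm_left.congr_left (fun x => ?_) |>.of_norm_left⟩
  rw [← map_sub, RCLike.norm_conj]

lemma Slow.inv {a : ℤ × ℤ} (hl : l ≤ cofinite) {c : ℝ} (hc : 0 < c) (hf : Slow l a f)
    (h : ∀ᶠ x in l, c ≤ ‖f x‖ ∧ c ≤ ‖f (x + a)‖) : Slow l a fun x => (f x)⁻¹ := by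
  have hinv : (fun x => (f x)⁻¹) =O[l] rad 0 := by
    rw [rad_zero]
    refine IsBigO.of_bound c⁻¹ ?_
    filter_upwards [h] with x hx
    rw [norm_inv, norm_one, mul_one]
    exact inv_anti₀ hc hx.1
  have hinv' : (fun x => (f (x + a))⁻¹) =O[l] rad 0 := by
    rw [rad_zero]
    refine IsBigO.of_bound c⁻¹ ?_
    filter_upwards [h] with x hx
    rw [norm_inv, norm_one, mul_one]
    exact inv_anti₀ hc hx.2
  refine ⟨hinv, ?_⟩
  have h1 := IsBigO_mul_rad hl (IsBigO_mul_rad hl hinv hinv' (add_zero _)) hf.2.neg_left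
    (zero_add _)
  refine h1.congr' ?_ EventuallyEq.rfl
  filter_upwards [h] with x hx
  have h2 : f x ≠ 0 := norm_pos_iff.mp (hc.trans_le hx.1)
  have h3 : f (x + a) ≠ 0 := norm_pos_iff.mp (hc.trans_le hx.2)
  field_simp
  ring

end Scales

/-! ### Families of far-field points -/

/-- `ξ x` is, for the points `x` under consideration, a far-field point for the direction of `x`;
if the level curve has two components, the sign of `σ` selects one of them. -/
def IsFarFamily (K : ℝ) (l : Filter (ℤ × ℤ)) (σ : ℝ) (ξ : ℤ × ℤ → ℝ × ℝ) : Prop :=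
  ∀ᶠ x in l, FarField K (realPoint x) (ξ x) ∧ (K < 0 → 0 < σ * orientation (ξ x))

lemma mul_pos_of_mul_pos {σ a b : ℝ} (ha : 0 < σ * a) (hb : 0 < σ * b) : 0 < a * b := by
  have h := mul_pos ha hb
  by_contra! h0
  nlinarith [mul_nonneg (sq_nonneg σ) (neg_nonneg.mpr h0)]

/-- Far-field points for the directions of `x` and of `x + z` differ by `O(|x|⁻¹)`. -/
lemma IsFarFamily.char_sub {K : ℝ} (hK : Admissible K) {l : Filter (ℤ × ℤ)} (hl : l ≤ cofinite)
    {σ : ℝ} {ξ ξ' : ℤ × ℤ → ℝ × ℝ} (a z : ℤ × ℤ) (h : IsFarFamily K l σ ξ)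
    (h' : ∀ᶠ x in l, FarField K (realPoint (x + z)) (ξ' x) ∧ (K < 0 → 0 < σ * orientation (ξ' x))) :
    (fun x => char (ξ' x) a - char (ξ x) a) =O[l] rad (-1) := by
  obtain ⟨C, hC, hb⟩ := exists_char_sub_le hK (hexNorm a)
  have hz0 : (0 : ℝ) ≤ (hexNorm z : ℤ) := by exact_mod_cast hexNorm_nonneg z
  refine isBigO_rad_of_le_hexNorm hl (C := C * (hexNorm z : ℤ)) (by positivity) (by norm_num) ?_
  filter_upwards [h, h', hl (eventually_cofinite_ne 0)] with x hx hx' h0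
  have h1 := hb a le_rfl (realPoint x) (realPoint (x + z)) (ξ x) (ξ' x) (realPoint_ne_zero h0)
    hx.1 hx'.1 (fun hn => mul_pos_of_mul_pos (hx.2 hn) (hx'.2 hn))
  rw [norm_sub_rev]
  refine h1.trans (le_of_eq ?_)
  have e : realPoint x - realPoint (x + z) = realPoint (-z) := by
    ext <;> simp [realPoint]
  have e2 : hexNorm (-z) = hexNorm z := by
    simp only [hexNorm, Prod.fst_neg, Prod.snd_neg, ← neg_add, abs_neg]
  rw [e, hexNorm_realPoint, hexNorm_realPoint, e2, Real.rpow_neg_one, mul_assoc, div_eq_mul_inv]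

lemma char_isBigO (l : Filter (ℤ × ℤ)) (ξ : ℤ × ℤ → ℝ × ℝ) (a : ℤ × ℤ) :
    (fun x => char (ξ x) a) =O[l] rad 0 := by
  rw [rad_zero]
  exact IsBigO.of_bound 1 (Eventually.of_forall fun x => by simp [norm_char])

lemma IsFarFamily.slow {K : ℝ} (hK : Admissible K) {l : Filter (ℤ × ℤ)} (hl : l ≤ cofinite)
    {σ : ℝ} {ξ : ℤ × ℤ → ℝ × ℝ} (a z : ℤ × ℤ) (hz : Tendsto (fun x : ℤ × ℤ => x + z) l l)
    (h : IsFarFamily K l σ ξ) : Slow l z fun x => char (ξ x) a :=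
  ⟨char_isBigO l ξ a, h.char_sub hK hl a z (hz.eventually h)⟩

/-! ### Outgoing functions -/

section Outgoing

variable {l : Filter (ℤ × ℤ)} {K k : ℝ}

/-- The two estimates of the radiation condition along the family `ξ`, as `x → ∞` along `l`. -/
def Radiates (l : Filter (ℤ × ℤ)) (ξ : ℤ × ℤ → ℝ × ℝ) (v : ℤ × ℤ → ℂ) : Prop :=
  v =O[l] rad (-(1 / 2)) ∧
  (fun x => v (x + e₁) - char (ξ x) e₁ * v x) =O[l] rad (-(3 / 2)) ∧
  (fun x => v (x + e₂) - char (ξ x) e₂ * v x) =O[l] rad (-(3 / 2))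

/-- The asymptotic relations shared by all finite linear combinations of translates of the lattice
Green's function. If `K < 0` the relation says that the operators `S_a - e^{iξ·a}` and
`S_b - e^{iη·b}` (with `S` the shifts) annihilate the two components of the leading term. -/
structure Scattered (K : ℝ) (l : Filter (ℤ × ℤ)) (v : ℤ × ℤ → ℂ) : Prop where
  isBigO : v =O[l] rad (-(1 / 2))
  single : 0 < K → ∀ σ ξ, IsFarFamily K l σ ξ → ∀ a,
    (fun x => v (x + a) - char (ξ x) a * v x) =O[l] rad (-(3 / 2))
  pair : K < 0 → ∀ σ ξ η, σ ≠ 0 → IsFarFamily K l σ ξ → IsFarFamily K l (-σ) η → ∀ a b,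
    (fun x => v (x + a + b) - char (ξ x) a * v (x + b) - char (η x) b * v (x + a)
      + char (ξ x) a * char (η x) b * v x) =O[l] rad (-(3 / 2))

lemma Scattered.add {v w : ℤ × ℤ → ℂ} (hv : Scattered K l v) (hw : Scattered K l w) :
    Scattered K l fun x => v x + w x where
  isBigO := hv.isBigO.add hw.isBigO
  single h σ ξ hξ a := ((hv.single h σ ξ hξ a).add (hw.single h σ ξ hξ a)).congr_left
    fun x => by ring
  pair h σ ξ η h0 hξ hη a b := ((hv.pair h σ ξ η h0 hξ hη a b).add
    (hw.pair h σ ξ η h0 hξ hη a b)).congr_left fun x => by ring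

lemma Scattered.const_mul {v : ℤ × ℤ → ℂ} (c : ℂ) (hv : Scattered K l v) :
    Scattered K l fun x => c * v x where
  isBigO := hv.isBigO.const_mul_left c
  single h σ ξ hξ a := ((hv.single h σ ξ hξ a).const_mul_left c).congr_left fun x => by ring
  pair h σ ξ η h0 hξ hη a b := ((hv.pair h σ ξ η h0 hξ hη a b).const_mul_left c).congr_left
    fun x => by ring

lemma Scattered.of_finite_support (hl : l ≤ cofinite) {v : ℤ × ℤ → ℂ} (hv : v.support.Finite) :
    Scattered K l v := by
  have h (a : ℤ × ℤ) : ∀ᶠ x in l, v (x + a) = 0 := by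
    have h1 : ∀ᶠ x in cofinite, v x = 0 := eventually_cofinite.mpr hv
    exact ((tendsto_add_cofinite a).eventually h1).filter_mono hl
  have h0 : ∀ᶠ x in l, v x = 0 := by simpa using h 0
  refine ⟨?_, fun _ σ ξ _ a => ?_, fun _ σ ξ η _ _ _ a b => ?_⟩
  · refine (isBigO_zero (rad (-(1 / 2))) l).congr' ?_ EventuallyEq.rfl
    filter_upwards [h0] with x hx using hx.symm
  · refine (isBigO_zero (rad (-(3 / 2))) l).congr' ?_ EventuallyEq.rfl
    filter_upwards [h0, h a] with x hx hxa
    simp [hx, hxa]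
  · refine (isBigO_zero (rad (-(3 / 2))) l).congr' ?_ EventuallyEq.rfl
    filter_upwards [h0, h a, h b, h (a + b)] with x hx hxa hxb hxab
    rw [← add_assoc] at hxab
    simp [hx, hxa, hxb, hxab]

lemma Scattered.sum {ι : Type*} (hl : l ≤ cofinite) (s : Finset ι) {v : ι → ℤ × ℤ → ℂ}
    (hv : ∀ i ∈ s, Scattered K l (v i)) : Scattered K l fun x => ∑ i ∈ s, v i x := by
  classical
  induction s using Finset.induction_on with
  | empty => exact .of_finite_support hl (by simp)
  | insert i s hi ih =>
    simp only [Finset.sum_insert hi]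
    exact (hv i (Finset.mem_insert_self i s)).add
      (ih fun j hj => hv j (Finset.mem_insert_of_mem hj))

lemma isBigO_rad_of_le_hexNorm_add (hl : l ≤ cofinite) {f : ℤ × ℤ → ℂ} {C s : ℝ} (hC : 0 ≤ C)
    (hs : s ≤ 0) (z : ℤ × ℤ) (h : ∀ᶠ x in l, ‖f x‖ ≤ C * ((hexNorm (x + z) : ℤ) : ℝ) ^ s) :
    f =O[l] rad s := by
  refine IsBigO.trans (IsBigO.of_bound (C * 2 ^ (-s)) ?_) ((rad_shift s z).mono hl)
  filter_upwards [h,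
    ((tendsto_add_cofinite z).eventually (eventually_cofinite_ne 0)).filter_mono hl]
    with x hx h0
  rw [Real.norm_of_nonneg (rad_nonneg _ _), mul_assoc]
  exact hx.trans (mul_le_mul_of_nonneg_left (hexNorm_rpow_le h0 hs) hC)

lemma latticeGreen_isBigO (hK : Admissible ((8 - k ^ 2) / 4)) (hl : l ≤ cofinite) (z : ℤ × ℤ) :
    (fun x => latticeGreen k (x + z)) =O[l] rad (-(1 / 2)) := by
  obtain ⟨C, hC, h⟩ := exists_norm_latticeGreen_le hK
  refine isBigO_rad_of_le_hexNorm_add hl hC (by norm_num) z ?_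
  filter_upwards [((tendsto_add_cofinite z).eventually (eventually_cofinite_ne 0)).filter_mono hl]
    with x hx
  rw [← div_sqrt_hexNorm]
  exact h _ hx

/-- Translating the Green's function changes the directions of the points by `O(|x|⁻¹)` only, so
that far-field points for the direction of `x` may be used at `x + z`. -/
lemma scattered_latticeGreen (hK : Admissible ((8 - k ^ 2) / 4)) (hl : l ≤ cofinite) (z : ℤ × ℤ) :
    Scattered ((8 - k ^ 2) / 4) l fun x => latticeGreen k (x + z) := by
  have hne : ∀ᶠ x in l, x + z ≠ 0 :=
    hl ((tendsto_add_cofinite z).eventually (eventually_cofinite_ne 0))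
  refine ⟨latticeGreen_isBigO hK hl z, fun hpos σ ξ hξ a => ?_,
    fun hneg σ ξ η h0 hξ hη a b => ?_⟩
  · have hex (x : ℤ × ℤ) : ∃ ζ, x + z ≠ 0 → FarField ((8 - k ^ 2) / 4) (realPoint (x + z)) ζ := by
      by_cases h : x + z = 0
      · exact ⟨0, fun h' => (h' h).elim⟩
      · obtain ⟨ζ, hζ⟩ := exists_farField hK hpos _ (realPoint_ne_zero h)
        exact ⟨ζ, fun _ => hζ⟩
    -- The function `ζ` chooses far-field points at `x + z`, which are compared with those at `x`.
    choose ζ hζ using hex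
    obtain ⟨C, hC, h⟩ := exists_norm_latticeGreen_translate_le hK hpos (hexNorm a)
    have h1 : (fun x => latticeGreen k (x + z + a) - char (ζ x) a * latticeGreen k (x + z))
        =O[l] rad (-(3 / 2)) := by
      refine isBigO_rad_of_le_hexNorm_add hl hC (by norm_num) z ?_
      filter_upwards [hne] with x hx
      rw [← div_mul_sqrt_hexNorm C hx]
      exact h _ hx a le_rfl _ (hζ x hx)
    have h2 : (fun x => char (ζ x) a - char (ξ x) a) =O[l] rad (-1) := by
      refine hξ.char_sub hK hl a z ?_
      filter_upwards [hne] with x hx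
      exact ⟨hζ x hx, fun h => absurd h hpos.not_gt⟩
    refine (h1.add (IsBigO_mul_rad hl h2 (latticeGreen_isBigO hK hl z)
      (by norm_num))).congr_left fun x => ?_
    rw [add_right_comm]
    ring
  · have hex (x : ℤ × ℤ) : ∃ ζ ω, x + z ≠ 0 →
        (FarField ((8 - k ^ 2) / 4) (realPoint (x + z)) ζ ∧ 0 < σ * orientation ζ) ∧
        (FarField ((8 - k ^ 2) / 4) (realPoint (x + z)) ω ∧ 0 < -σ * orientation ω) := by
      by_cases h : x + z = 0
      · exact ⟨0, 0, fun h' => (h' h).elim⟩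
      · obtain ⟨ζ, ω, h1, h2, h3, h4⟩ := exists_farField_pair hK hneg _ (realPoint_ne_zero h)
        rcases lt_or_gt_of_ne h0 with hσ | hσ
        · exact ⟨ω, ζ, fun _ => ⟨⟨h2, mul_pos_of_neg_of_neg hσ h4⟩, h1, mul_pos (by linarith) h3⟩⟩
        · exact ⟨ζ, ω, fun _ => ⟨⟨h1, mul_pos hσ h3⟩, h2,
            mul_pos_of_neg_of_neg (by linarith) h4⟩⟩
    choose ζ ω hζω using hex
    obtain ⟨C, hC, h⟩ := exists_norm_latticeGreen_translate_pair_le hK hneg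
      (max (hexNorm a) (hexNorm b))
    have h1 : (fun x => latticeGreen k (x + z + a + b) - char (ζ x) a * latticeGreen k (x + z + b)
        - char (ω x) b * latticeGreen k (x + z + a)
        + char (ζ x) a * char (ω x) b * latticeGreen k (x + z)) =O[l] rad (-(3 / 2)) := by
      refine isBigO_rad_of_le_hexNorm_add hl hC (by norm_num) z ?_
      filter_upwards [hne] with x hx
      rw [← div_mul_sqrt_hexNorm C hx]
      refine h _ hx a b (le_max_left _ _) (le_max_right _ _) _ _ (hζω x hx).1.1 (hζω x hx).2.1 ?_
      have := mul_pos (hζω x hx).1.2 (hζω x hx).2.2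
      by_contra! h'
      nlinarith [mul_nonneg (sq_nonneg σ) h']
    have h2 : (fun x => char (ζ x) a - char (ξ x) a) =O[l] rad (-1) := by
      refine hξ.char_sub hK hl a z ?_
      filter_upwards [hne] with x hx
      exact ⟨(hζω x hx).1.1, fun _ => (hζω x hx).1.2⟩
    have h3 : (fun x => char (ω x) b - char (η x) b) =O[l] rad (-1) := by
      refine hη.char_sub hK hl b z ?_
      filter_upwards [hne] with x hx
      exact ⟨(hζω x hx).2.1, fun _ => (hζω x hx).2.2⟩
    have hG := latticeGreen_isBigO hK hl
    have h4 := IsBigO_mul_rad hl h2 (hG (z + b)) (by norm_num : -1 + -(1 / 2) = -(3 / 2 : ℝ))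
    have h5 := IsBigO_mul_rad hl h3 (hG (z + a)) (by norm_num : -1 + -(1 / 2) = -(3 / 2 : ℝ))
    have h6 := IsBigO_mul_rad hl (IsBigO_mul_rad hl h2 (char_isBigO l ω b) (add_zero _)) (hG z)
      (by norm_num : -1 + -(1 / 2) = -(3 / 2 : ℝ))
    have h7 := IsBigO_mul_rad hl (IsBigO_mul_rad hl (char_isBigO l ξ a) h3 (zero_add _)) (hG z)
      (by norm_num : -1 + -(1 / 2) = -(3 / 2 : ℝ))
    -- The product is expanded around `(ξ, η)`: every replacement of `ζ` by `ξ` or of `ω` by `η`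
    -- costs `O(|x|⁻¹)`, and the Green's function contributes `O(|x| ^ (-1 / 2))`.
    refine (((h1.add h4).add h5).sub (h6.add h7)).congr_left fun x => ?_
    simp only [← add_assoc]
    rw [add_right_comm x z a, add_right_comm x z b, add_right_comm (x + a) z b]
    ring

/-- If `A₁`, `A₂` vary slowly, then `∑ A_l (S_l - e^{iη_l})`, with `S_l` the shifts by the basis
vectors, projects onto functions radiating along `ξ`. -/
lemma Scattered.radiates_projection (hl : l ≤ cofinite)
    (hs : ∀ a, a = e₁ ∨ a = e₂ → Tendsto (fun x : ℤ × ℤ => x + a) l l)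
    {v A₁ A₂ : ℤ × ℤ → ℂ} {ξ η : ℤ × ℤ → ℝ × ℝ} {σ : ℝ} (hv : Scattered K l v) (hK : Admissible K)
    (hneg : K < 0) (hσ : σ ≠ 0) (hξ : IsFarFamily K l σ ξ) (hη : IsFarFamily K l (-σ) η)
    (h₁ : ∀ a, a = e₁ ∨ a = e₂ → Slow l a A₁) (h₂ : ∀ a, a = e₁ ∨ a = e₂ → Slow l a A₂) :
    Radiates l ξ fun x => A₁ x * (v (x + e₁) - char (η x) e₁ * v x) +
      A₂ x * (v (x + e₂) - char (η x) e₂ * v x) := by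
  have hT (b : ℤ × ℤ) (hb : b = e₁ ∨ b = e₂) :
      (fun x => v (x + b) - char (η x) b * v x) =O[l] rad (-(1 / 2)) :=
    (IsBigO_shift hl b (hs b hb) hv.isBigO).sub
      (IsBigO_mul_rad hl (char_isBigO l η b) hv.isBigO (zero_add _))
  -- The far-field point `η` at `x + a` is replaced by the one at `x`, at the cost of `O(|x|⁻¹)`.
  have hT' (a b : ℤ × ℤ) (ha : a = e₁ ∨ a = e₂) : (fun x => (v (x + a + b) -
      char (η (x + a)) b * v (x + a)) - char (ξ x) a * (v (x + b) - char (η x) b * v x))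
      =O[l] rad (-(3 / 2)) := by
    have h1 := hv.pair hneg σ ξ η hσ hξ hη a b
    have h2 := IsBigO_mul_rad hl (hη.slow hK hl b a (hs a ha)).2
      (IsBigO_shift hl a (hs a ha) hv.isBigO) (by norm_num : -1 + -(1 / 2) = -(3 / 2 : ℝ))
    refine (h1.sub h2).congr_left fun x => ?_
    ring
  have key (a : ℤ × ℤ) (ha : a = e₁ ∨ a = e₂) (b : ℤ × ℤ) (hb : b = e₁ ∨ b = e₂)
      (A : ℤ × ℤ → ℂ) (hA : Slow l a A) : (fun x => A (x + a) * (v (x + a + b) -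
      char (η (x + a)) b * v (x + a)) - char (ξ x) a * (A x * (v (x + b) - char (η x) b * v x)))
      =O[l] rad (-(3 / 2)) := by
    have h1 := IsBigO_mul_rad hl hA.2 (IsBigO_shift hl a (hs a ha) (hT b hb))
      (by norm_num : -1 + -(1 / 2) = -(3 / 2 : ℝ))
    have h2 := IsBigO_mul_rad hl hA.1 (hT' a b ha) (zero_add _)
    refine (h1.add h2).congr_left fun x => ?_
    ring
  refine ⟨(IsBigO_mul_rad hl (h₁ e₁ (.inl rfl)).1 (hT e₁ (.inl rfl)) (zero_add _)).add
    (IsBigO_mul_rad hl (h₂ e₁ (.inl rfl)).1 (hT e₂ (.inr rfl)) (zero_add _)), ?_, ?_⟩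
  · refine ((key e₁ (.inl rfl) e₁ (.inl rfl) A₁ (h₁ e₁ (.inl rfl))).add
      (key e₁ (.inl rfl) e₂ (.inr rfl) A₂ (h₂ e₁ (.inl rfl)))).congr_left fun x => ?_
    ring
  · refine ((key e₂ (.inr rfl) e₁ (.inl rfl) A₁ (h₁ e₂ (.inr rfl))).add
      (key e₂ (.inr rfl) e₂ (.inr rfl) A₂ (h₂ e₂ (.inr rfl)))).congr_left fun x => ?_
    ring

lemma Radiates.congr (hs : ∀ a, a = e₁ ∨ a = e₂ → Tendsto (fun x : ℤ × ℤ => x + a) l l)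
    {v w : ℤ × ℤ → ℂ} {ξ : ℤ × ℤ → ℝ × ℝ} (hv : Radiates l ξ v) (h : v =ᶠ[l] w) :
    Radiates l ξ w := by
  refine ⟨hv.1.congr' h EventuallyEq.rfl, hv.2.1.congr' ?_ EventuallyEq.rfl,
    hv.2.2.congr' ?_ EventuallyEq.rfl⟩
  · filter_upwards [h, (hs e₁ (.inl rfl)).eventually h] with x h1 h2
    rw [h1, h2]
  · filter_upwards [h, (hs e₂ (.inr rfl)).eventually h] with x h1 h2
    rw [h1, h2]

lemma norm_sq_add_norm_sq (z w : ℂ) :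
    ‖z * (starRingEnd ℂ) z + w * (starRingEnd ℂ) w‖ = ‖z‖ ^ 2 + ‖w‖ ^ 2 := by
  rw [Complex.mul_conj, Complex.mul_conj, ← Complex.ofReal_add, Complex.norm_real,
    Complex.normSq_eq_norm_sq, Complex.normSq_eq_norm_sq, Real.norm_of_nonneg (by positivity)]

/-- If `d₁` and `d₂` vary slowly and do not degenerate simultaneously, then slowly varying `A₁`,
`A₂` with `A₁ d₁ + A₂ d₂ = 1` exist. -/
lemma exists_slow_bezout (hl : l ≤ cofinite)
    (hs : ∀ a, a = e₁ ∨ a = e₂ → Tendsto (fun x : ℤ × ℤ => x + a) l l) {d₁ d₂ : ℤ × ℤ → ℂ} {c : ℝ}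
    (hc : 0 < c) (h₁ : ∀ a, a = e₁ ∨ a = e₂ → Slow l a d₁)
    (h₂ : ∀ a, a = e₁ ∨ a = e₂ → Slow l a d₂) (h : ∀ᶠ x in l, c ≤ ‖d₁ x‖ ^ 2 + ‖d₂ x‖ ^ 2) :
    ∃ A₁ A₂ : ℤ × ℤ → ℂ, (∀ a, a = e₁ ∨ a = e₂ → Slow l a A₁) ∧
      (∀ a, a = e₁ ∨ a = e₂ → Slow l a A₂) ∧ ∀ᶠ x in l, A₁ x * d₁ x + A₂ x * d₂ x = 1 := by
  -- `A_l = conj d_l / (|d₁| ^ 2 + |d₂| ^ 2)` is slow since slow functions form a ring with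
  -- conjugation, and inverses of those bounded below.
  set W : ℤ × ℤ → ℂ := fun x =>
    d₁ x * (starRingEnd ℂ) (d₁ x) + d₂ x * (starRingEnd ℂ) (d₂ x) with hW
  have hW' : ∀ᶠ x in l, c ≤ ‖W x‖ := by
    filter_upwards [h] with x hx
    rwa [hW, norm_sq_add_norm_sq]
  have hinv : ∀ a, a = e₁ ∨ a = e₂ → Slow l a fun x => (W x)⁻¹ := fun a ha =>
    (((h₁ a ha).mul hl (h₁ a ha).conj).add ((h₂ a ha).mul hl (h₂ a ha).conj)).inv hl hc
      (hW'.and ((hs a ha).eventually hW'))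
  refine ⟨fun x => (starRingEnd ℂ) (d₁ x) * (W x)⁻¹, fun x => (starRingEnd ℂ) (d₂ x) * (W x)⁻¹,
    fun a ha => (h₁ a ha).conj.mul hl (hinv a ha),
    fun a ha => (h₂ a ha).conj.mul hl (hinv a ha), ?_⟩
  filter_upwards [hW'] with x hx
  have h0 : W x ≠ 0 := norm_pos_iff.mp (hc.trans_le hx)
  rw [mul_right_comm, mul_right_comm _ _ (d₂ x), ← add_mul, mul_comm _ (d₁ x), mul_comm _ (d₂ x)]
  exact mul_inv_cancel₀ h0

/-- If the level curve has two components, a scattered function splits into two functions radiating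
along the two families of far-field points. -/
lemma Scattered.exists_splitting (hl : l ≤ cofinite)
    (hs : ∀ a, a = e₁ ∨ a = e₂ → Tendsto (fun x : ℤ × ℤ => x + a) l l)
    {v : ℤ × ℤ → ℂ} {ξ η : ℤ × ℤ → ℝ × ℝ} (hv : Scattered K l v) (hK : Admissible K)
    (hneg : K < 0) (hξ : IsFarFamily K l 1 ξ) (hη : IsFarFamily K l (-1) η) :
    ∃ v₁ v₂ : ℤ × ℤ → ℂ, v = v₁ + v₂ ∧ Radiates l ξ v₁ ∧ Radiates l η v₂ := by
  obtain ⟨c, hc, hsep⟩ := exists_char_separation hK hneg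
  have hd (b : ℤ × ℤ) : ∀ a, a = e₁ ∨ a = e₂ → Slow l a fun x => char (ξ x) b - char (η x) b :=
    fun a ha => (hξ.slow hK hl b a (hs a ha)).sub (hη.slow hK hl b a (hs a ha))
  obtain ⟨A₁, A₂, h₁, h₂, hA⟩ := exists_slow_bezout hl hs hc (hd e₁) (hd e₂) (by
    filter_upwards [hξ, hη] with x h1 h2
    refine hsep _ _ _ _ h1.1 h2.1 ?_
    nlinarith [h1.2 hneg, h2.2 hneg])
  have hr₁ := hv.radiates_projection hl hs hK hneg one_ne_zero hξ hη h₁ h₂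
  -- Eventually `v - v₁` is the projection with coefficients `-A_l` and the families
  -- exchanged, because `A₁ d₁ + A₂ d₂ = 1`.
  have hr₂ := hv.radiates_projection hl hs hK hneg (neg_ne_zero.mpr one_ne_zero) hη
    (by rwa [neg_neg]) (fun a ha => (h₁ a ha).neg) (fun a ha => (h₂ a ha).neg)
  set v₁ : ℤ × ℤ → ℂ := fun x => A₁ x * (v (x + e₁) - char (η x) e₁ * v x) +
    A₂ x * (v (x + e₂) - char (η x) e₂ * v x) with hv₁
  refine ⟨v₁, v - v₁, (add_sub_cancel v₁ v).symm, hr₁, hr₂.congr hs ?_⟩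
  filter_upwards [hA] with x hx
  rw [Pi.sub_apply, hv₁]
  linear_combination (v x) * hx

end Outgoing

/-! ### Products of outgoing functions -/

section Flux

variable {l : Filter (ℤ × ℤ)} {K : ℝ}

/-- A function that is a discrete divergence of an `O(|x|⁻¹)` field up to `O(|x|⁻²)`. -/
def NullFlux (l : Filter (ℤ × ℤ)) (F : ℤ × ℤ → ℂ) : Prop :=
  ∃ Q₁ Q₂ : ℤ × ℤ → ℂ, Q₁ =O[l] rad (-1) ∧ Q₂ =O[l] rad (-1) ∧
    (fun x => F x - (Q₁ (x + e₁) - Q₁ x) - (Q₂ (x + e₂) - Q₂ x)) =O[l] rad (-2)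

lemma NullFlux.add {F G : ℤ × ℤ → ℂ} (hF : NullFlux l F) (hG : NullFlux l G) :
    NullFlux l fun x => F x + G x := by
  obtain ⟨Q₁, Q₂, h1, h2, h3⟩ := hF
  obtain ⟨P₁, P₂, p1, p2, p3⟩ := hG
  refine ⟨_, _, h1.add p1, h2.add p2, (h3.add p3).congr_left fun x => ?_⟩
  ring

lemma NullFlux.neg {F : ℤ × ℤ → ℂ} (hF : NullFlux l F) : NullFlux l fun x => -F x := by
  obtain ⟨Q₁, Q₂, h1, h2, h3⟩ := hF
  refine ⟨_, _, h1.neg_left, h2.neg_left, h3.neg_left.congr_left fun x => ?_⟩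
  ring

lemma Radiates.shift_isBigO (hl : l ≤ cofinite)
    {ξ : ℤ × ℤ → ℝ × ℝ} {w : ℤ × ℤ → ℂ} (hw : Radiates l ξ w) {a : ℤ × ℤ}
    (ha : a = 0 ∨ a = e₁ ∨ a = e₂) :
    (fun x => w (x + a)) =O[l] rad (-(1 / 2)) ∧
    (fun x => w (x + a) - char (ξ x) a * w x) =O[l] rad (-(3 / 2)) := by
  have h : (fun x => w (x + a) - char (ξ x) a * w x) =O[l] rad (-(3 / 2)) := by
    rcases ha with rfl | rfl | rfl
    · simp only [add_zero, char_zero, one_mul, sub_self]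
      exact isBigO_zero _ _
    · exact hw.2.1
    · exact hw.2.2
  refine ⟨?_, h⟩
  refine ((h.trans (rad_isBigO_rad hl (by norm_num))).add
    (IsBigO_mul_rad hl (char_isBigO l ξ a) hw.1 (zero_add _))).congr_left fun x => ?_
  ring

lemma Radiates.mul_isBigO (hl : l ≤ cofinite)
    {ξ η : ℤ × ℤ → ℝ × ℝ} {w v : ℤ × ℤ → ℂ} (hw : Radiates l ξ w) (hv : Radiates l η v)
    {a b : ℤ × ℤ} (ha : a = 0 ∨ a = e₁ ∨ a = e₂) (hb : b = 0 ∨ b = e₁ ∨ b = e₂) :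
    (fun x => w (x + a) * v (x + b) - char (ξ x) a * char (η x) b * (w x * v x))
      =O[l] rad (-2) := by
  obtain ⟨-, w2⟩ := hw.shift_isBigO hl ha
  obtain ⟨v1, v2⟩ := hv.shift_isBigO hl hb
  have h1 := IsBigO_mul_rad hl w2 v1 (by norm_num : _ + _ = (-2 : ℝ))
  have h2 := IsBigO_mul_rad hl (IsBigO_mul_rad hl (char_isBigO l ξ a) hw.1 (zero_add _)) v2
    (by norm_num : _ + _ = (-2 : ℝ))
  refine (h1.add h2).congr_left fun x => ?_
  ring

/-- The product of two outgoing functions oscillates like `e^{i(ξ+η)·x}`, and `ξ + η` is never a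
period because `ξ` and `η` are far-field points for the same direction. Hence the product is a
discrete divergence up to `O(|x|⁻²)`. -/
lemma Radiates.nullFlux_mul (hK : Admissible K) (hl : l ≤ cofinite)
    (hs : ∀ a, a = e₁ ∨ a = e₂ → Tendsto (fun x : ℤ × ℤ => x + a) l l)
    {ξ η : ℤ × ℤ → ℝ × ℝ} {w v : ℤ × ℤ → ℂ} {σ τ : ℝ} (hξ : IsFarFamily K l σ ξ)
    (hη : IsFarFamily K l τ η) (hw : Radiates l ξ w) (hv : Radiates l η v)
    {a b : ℤ × ℤ} (ha : a = 0 ∨ a = e₁ ∨ a = e₂) (hb : b = 0 ∨ b = e₁ ∨ b = e₂) :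
    NullFlux l fun x => w (x + a) * v (x + b) := by
  obtain ⟨c, hc, hsep⟩ := exists_char_mul_separation hK
  have hC (a b : ℤ × ℤ) : ∀ z, z = e₁ ∨ z = e₂ → Slow l z fun x => char (ξ x) a * char (η x) b :=
    fun z hz => (hξ.slow hK hl a z (hs z hz)).mul hl (hη.slow hK hl b z (hs z hz))
  have hd (b : ℤ × ℤ) : ∀ z, z = e₁ ∨ z = e₂ →
      Slow l z fun x => char (ξ x) b * char (η x) b - 1 :=
    fun z hz => (hC b b z hz).sub (Slow.const l z 1)
  obtain ⟨A₁, A₂, h₁, h₂, hA⟩ := exists_slow_bezout hl hs (c := c ^ 2 / 2) (by positivity)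
    (hd e₁) (hd e₂) (by
      filter_upwards [hξ, hη] with x h1 h2
      have h3 := hsep _ _ _ h1.1 h2.1
      have h4 := mul_self_le_mul_self hc.le h3
      nlinarith [sq_nonneg (‖char (ξ x) e₁ * char (η x) e₁ - 1‖ -
        ‖char (ξ x) e₂ * char (η x) e₂ - 1‖)])
  have hP := IsBigO_mul_rad hl hw.1 hv.1 (by norm_num : _ + _ = (-1 : ℝ))
  -- A difference of `B w v` is `B (e^{i(ξ+η)·m} - 1) w v` up to `O(|x|⁻²)`, for slow `B`.
  have key (m : ℤ × ℤ) (hm : m = e₁ ∨ m = e₂) (B : ℤ × ℤ → ℂ) (hB : Slow l m B) :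
      (fun x => B (x + m) * (w (x + m) * v (x + m)) - B x * (w x * v x) -
        B x * (char (ξ x) m * char (η x) m - 1) * (w x * v x)) =O[l] rad (-2) := by
    have h1 := IsBigO_mul_rad hl hB.2 (IsBigO_shift hl m (hs m hm) hP)
      (by norm_num : _ + _ = (-2 : ℝ))
    have h2 := IsBigO_mul_rad hl hB.1 (hw.mul_isBigO hl hv (.inr hm) (.inr hm)) (zero_add _)
    refine (h1.add h2).congr_left fun x => ?_
    ring
  have hB (A : ℤ × ℤ → ℂ) (hA : ∀ z, z = e₁ ∨ z = e₂ → Slow l z A) (z : ℤ × ℤ)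
      (hz : z = e₁ ∨ z = e₂) : Slow l z fun x => char (ξ x) a * char (η x) b * A x :=
    (hC a b z hz).mul hl (hA z hz)
  refine ⟨fun x => char (ξ x) a * char (η x) b * A₁ x * (w x * v x),
    fun x => char (ξ x) a * char (η x) b * A₂ x * (w x * v x),
    IsBigO_mul_rad hl (hB A₁ h₁ e₁ (.inl rfl)).1 hP (zero_add _),
    IsBigO_mul_rad hl (hB A₂ h₂ e₁ (.inl rfl)).1 hP (zero_add _), ?_⟩
  refine (((hw.mul_isBigO hl hv ha hb).sub (key e₁ (.inl rfl) _ (hB A₁ h₁ e₁ (.inl rfl)))).sub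
    (key e₂ (.inr rfl) _ (hB A₂ h₂ e₂ (.inr rfl)))).congr' ?_ EventuallyEq.rfl
  filter_upwards [hA] with x hx
  linear_combination (char (ξ x) a * char (η x) b * (w x * v x)) * hx

/-- Sums of functions radiating along families of far-field points; if the level curve has two
components, one summand for each of them. -/
def Outgoing (K : ℝ) (l : Filter (ℤ × ℤ)) (w : ℤ × ℤ → ℂ) : Prop :=
  ∃ ξ η w₁ w₂, IsFarFamily K l 1 ξ ∧ IsFarFamily K l (-1) η ∧ w = w₁ + w₂ ∧
    Radiates l ξ w₁ ∧ Radiates l η w₂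

lemma Outgoing.nullFlux_mul (hK : Admissible K) (hl : l ≤ cofinite)
    (hs : ∀ a, a = e₁ ∨ a = e₂ → Tendsto (fun x : ℤ × ℤ => x + a) l l)
    {w v : ℤ × ℤ → ℂ} (hw : Outgoing K l w) (hv : Outgoing K l v)
    {a b : ℤ × ℤ} (ha : a = 0 ∨ a = e₁ ∨ a = e₂) (hb : b = 0 ∨ b = e₁ ∨ b = e₂) :
    NullFlux l fun x => w (x + a) * v (x + b) := by
  obtain ⟨ξ, η, w₁, w₂, hξ, hη, rfl, h1, h2⟩ := hw
  obtain ⟨ξ', η', v₁, v₂, hξ', hη', rfl, h1', h2'⟩ := hv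
  have := ((h1.nullFlux_mul hK hl hs hξ hξ' h1' ha hb).add
    (h1.nullFlux_mul hK hl hs hξ hη' h2' ha hb)).add
    ((h2.nullFlux_mul hK hl hs hη hξ' h1' ha hb).add
    (h2.nullFlux_mul hK hl hs hη hη' h2' ha hb))
  convert this using 2 with x
  simp only [Pi.add_apply]
  ring

end Flux

/-! ### Cutoffs and the flux through large half-circles -/

/-- A smooth cutoff on the plane, with Lipschitz bounds for first and second differences. -/
lemma exists_cutoff : ∃ (φ : ℂ → ℝ) (L : ℝ), 0 ≤ L ∧ (∀ z, ‖z‖ ≤ 1 → φ z = 1) ∧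
    (∀ z, 2 ≤ ‖z‖ → φ z = 0) ∧ (∀ z h, |φ (z + h) - φ z| ≤ L * ‖h‖) ∧
    ∀ z h h', |(φ (z + h + h') - φ (z + h')) - (φ (z + h) - φ z)| ≤ L * ‖h‖ * ‖h'‖ := by
  let φ : ContDiffBump (0 : ℂ) := ⟨1, 2, one_pos, one_lt_two⟩
  have hφ : ContDiff ℝ 2 φ := φ.contDiff
  obtain ⟨L₁, h₁⟩ := hφ.lipschitzWith_of_hasCompactSupport φ.hasCompactSupport (by norm_num)
  obtain ⟨L₂, h₂⟩ := (hφ.fderiv_right (m := 1) (by norm_num)).lipschitzWith_of_hasCompactSupport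
    (φ.hasCompactSupport.fderiv ℝ) (by norm_num)
  have hd : Differentiable ℝ φ := hφ.differentiable (by norm_num)
  refine ⟨φ, max L₁ L₂, le_max_of_le_left L₁.2, fun z hz => ?_, fun z hz => ?_, fun z h => ?_,
    fun z h h' => ?_⟩
  · exact φ.one_of_mem_closedBall (by simpa [φ] using hz)
  · exact φ.zero_of_le_dist (by simpa [φ] using hz)
  · have := h₁.dist_le_mul (z + h) z
    rw [Real.dist_eq, dist_eq_norm, add_sub_cancel_left] at this
    exact this.trans (mul_le_mul_of_nonneg_right (le_max_left _ _) (norm_nonneg _))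
  · have hg (y : ℂ) : HasFDerivAt (fun y => φ (y + h) - φ y)
        (fderiv ℝ φ (y + h) - fderiv ℝ φ y) y :=
      (hasFDerivAt_comp_add_right h |>.mpr (hd (y + h)).hasFDerivAt).sub (hd y).hasFDerivAt
    have hb (y : ℂ) : ‖fderiv ℝ φ (y + h) - fderiv ℝ φ y‖ ≤ max L₁ L₂ * ‖h‖ := by
      have := h₂.dist_le_mul (y + h) y
      rw [dist_eq_norm, dist_eq_norm, add_sub_cancel_left] at this
      exact this.trans (mul_le_mul_of_nonneg_right (le_max_right _ _) (norm_nonneg _))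
    have := Convex.norm_image_sub_le_of_norm_hasFDerivWithin_le (s := Set.univ)
      (fun y _ => (hg y).hasFDerivWithinAt) (fun y _ => hb y) convex_univ (Set.mem_univ z)
      (Set.mem_univ (z + h'))
    rw [add_sub_cancel_left, Real.norm_eq_abs, add_right_comm] at this
    exact this

/-- Cutoffs `χ_N` on the lattice at the scale `N`. -/
lemma exists_lattice_cutoff : ∃ (χ : ℕ → ℤ × ℤ → ℂ) (L : ℝ), 0 ≤ L ∧
    (∀ c, ∀ᶠ N : ℕ in atTop, ∀ x, (‖toPlane x‖ < (N : ℝ) / 2 → χ N (x + c) = 1) ∧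
      (3 * (N : ℝ) < ‖toPlane x‖ → χ N (x + c) = 0)) ∧
    (∀ N, 1 ≤ N → ∀ x a, ‖χ N (x + a) - χ N x‖ ≤ L * ‖toPlane a‖ / N) ∧
    ∀ N, 1 ≤ N → ∀ x a b, ‖(χ N (x + a + b) - χ N (x + b)) - (χ N (x + a) - χ N x)‖ ≤
      L * ‖toPlane a‖ * ‖toPlane b‖ / N ^ 2 := by
  obtain ⟨φ, L, hL, h1, h2, h3, h4⟩ := exists_cutoff
  have hn (N : ℕ) (z : ℂ) : ‖z / (N : ℂ)‖ = ‖z‖ / N := by rw [norm_div, Complex.norm_natCast]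
  refine ⟨fun N x => φ (toPlane x / N), L, hL, fun c => ?_, fun N hN x a => ?_,
    fun N hN x a b => ?_⟩
  · filter_upwards [eventually_ge_atTop 1,
      tendsto_natCast_atTop_atTop.eventually_ge_atTop (2 * ‖toPlane c‖)] with N hN hNc x
    have hN0 : (0 : ℝ) < N := by exact_mod_cast hN
    have hc := norm_nonneg (toPlane c)
    refine ⟨fun hx => ?_, fun hx => ?_⟩
    · rw [h1, Complex.ofReal_one]
      rw [hn, div_le_one hN0, toPlane_add]
      refine (norm_add_le _ _).trans ?_
      linarith
    · rw [h2, Complex.ofReal_zero]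
      rw [hn, le_div_iff₀ hN0, toPlane_add]
      have := norm_sub_le_norm_add (toPlane x) (toPlane c)
      linarith
  · rw [← Complex.ofReal_sub, Complex.norm_real, Real.norm_eq_abs, toPlane_add, add_div]
    refine (h3 _ _).trans (le_of_eq ?_)
    rw [hn, mul_div_assoc]
  · rw [← Complex.ofReal_sub, ← Complex.ofReal_sub, ← Complex.ofReal_sub, Complex.norm_real,
      Real.norm_eq_abs]
    simp only [toPlane_add, add_div]
    refine (h4 _ _ _).trans (le_of_eq ?_)
    rw [hn, hn]
    ring

/-- The filter of neighbourhoods of infinity in the half-plane. -/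
def halfPlaneFilter : Filter (ℤ × ℤ) := cofinite ⊓ 𝓟 halfPlane

lemma halfPlaneFilter_le : halfPlaneFilter ≤ cofinite := inf_le_left

lemma tendsto_shift_halfPlaneFilter (a : ℤ × ℤ) (ha : a = e₁ ∨ a = e₂) :
    Tendsto (fun x : ℤ × ℤ => x + a) halfPlaneFilter halfPlaneFilter := by
  refine tendsto_inf.mpr ⟨(tendsto_add_cofinite a).mono_left inf_le_left, ?_⟩
  refine (tendsto_principal_principal.mpr fun x hx => ?_).mono_left inf_le_right
  have h : 0 ≤ a.2 := by rcases ha with rfl | rfl <;> simp [e₁, e₂]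
  exact add_nonneg (show 0 ≤ x.2 from hx) h

lemma exists_bound_of_isBigO {f : ℤ × ℤ → ℂ} {s : ℝ} (hf : f =O[halfPlaneFilter] rad s) :
    ∃ C R : ℝ, 0 ≤ C ∧ ∀ x ∈ halfPlane, R ≤ ‖toPlane x‖ → ‖f x‖ ≤ C * rad s x := by
  obtain ⟨C, hC, h⟩ := hf.exists_nonneg
  have h1 : ∀ᶠ x in cofinite, x ∈ halfPlane → ‖f x‖ ≤ C * ‖rad s x‖ :=
    eventually_inf_principal.mp h.bound
  obtain ⟨R, hR⟩ := ((eventually_cofinite.mp h1).image fun x => ‖toPlane x‖).bddAbove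
  refine ⟨C, R + 1, hC, fun x hx hxR => ?_⟩
  by_contra h2
  have h3 := hR ⟨x, fun h4 => h2 (by
    have := h4 hx
    rwa [Real.norm_of_nonneg (rad_nonneg s x)] at this), rfl⟩
  linarith

/-- A sum over a region with `O(N^d)` points of size at most `3N` vanishes in the limit if the
weights are `O(N^{-t})` and supported in an annulus of size `N`, the function is `O(|x|^{-s})`, and
`d + 1 = t + s`. -/
lemma tendsto_tsum_annulus {A : Set (ℤ × ℤ)} (hA : A ⊆ halfPlane) {f : ℤ × ℤ → ℂ} {d t s : ℕ}
    (hdts : d + 1 = t + s) (hf : f =O[halfPlaneFilter] rad (-s)) {S : ℕ → Finset (ℤ × ℤ)} {C₀ : ℝ}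
    (hS : ∀ N : ℕ, ∀ x ∈ A, ‖toPlane x‖ ≤ 3 * N → x ∈ S N)
    (hcard : ∀ N : ℕ, 1 ≤ N → ((S N).card : ℝ) ≤ C₀ * N ^ d)
    {D : ℕ → ℤ × ℤ → ℂ} {C₁ : ℝ} (hD : ∀ᶠ N : ℕ in atTop, ∀ x, ‖D N x‖ ≤ C₁ / N ^ t ∧
      (D N x ≠ 0 → (N : ℝ) / 2 ≤ ‖toPlane x‖ ∧ ‖toPlane x‖ ≤ 3 * N)) :
    Tendsto (fun N => ∑' x, D N x * A.indicator f x) atTop (𝓝 0) := by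
  obtain ⟨C, R, hC, hb⟩ := exists_bound_of_isBigO hf
  have hC₀ : 0 ≤ C₀ := by
    have := hcard 1 le_rfl
    rw [Nat.cast_one, one_pow, mul_one] at this
    exact (Nat.cast_nonneg _).trans this
  refine squeeze_zero_norm' (a := fun N : ℕ => C₀ * (C₁ * (C * 2 ^ s)) / N) ?_
    (tendsto_const_div_atTop_nhds_zero_nat _)
  filter_upwards [hD, eventually_ge_atTop 1,
    tendsto_natCast_atTop_atTop.eventually_ge_atTop (2 * R)] with N hN h1 hNR
  have hN0 : (0 : ℝ) < N := by exact_mod_cast h1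
  have hC₁ : 0 ≤ C₁ := by
    have h2 := (norm_nonneg _).trans (hN 0).1
    by_contra! h3
    exact absurd h2 (not_le.mpr (div_neg_of_neg_of_pos h3 (by positivity)))
  -- Each of the `O(N ^ d)` terms is `O(N ^ (-t - s)) = O(N ^ (-d - 1))`.
  have hterm (x : ℤ × ℤ) : ‖D N x * A.indicator f x‖ ≤ C₁ / N ^ t * (C * 2 ^ s / N ^ s) := by
    by_cases hx : D N x = 0
    · rw [hx, zero_mul, norm_zero]
      positivity
    by_cases hxA : x ∈ A
    · rw [norm_mul, Set.indicator_of_mem hxA]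
      refine mul_le_mul (hN x).1 ?_ (norm_nonneg _) (by positivity)
      have h2 := ((hN x).2 hx).1
      refine (hb x (hA hxA) (by linarith)).trans ?_
      rw [mul_div_assoc, rad, Real.rpow_neg (norm_nonneg _), Real.rpow_natCast, ← div_pow]
      refine mul_le_mul_of_nonneg_left ?_ hC
      rw [← inv_pow]
      refine pow_le_pow_left₀ (by positivity) ?_ s
      rw [← inv_div]
      exact inv_anti₀ (by positivity) h2
    · rw [Set.indicator_of_notMem hxA, mul_zero, norm_zero]
      positivity
  rw [tsum_eq_sum (s := S N)]
  · refine (norm_sum_le_of_le _ fun x _ => hterm x).trans ?_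
    rw [Finset.sum_const, nsmul_eq_mul]
    refine (mul_le_mul_of_nonneg_right (hcard N h1) (by positivity)).trans (le_of_eq ?_)
    have e : (N : ℝ) ^ d * N = N ^ t * N ^ s := by rw [← pow_succ, hdts, pow_add]
    field_simp
    linear_combination (C₀ * C₁ * C) * e
  · intro x hx
    by_cases hD0 : D N x = 0
    · rw [hD0, zero_mul]
    · rw [Set.indicator_of_notMem, mul_zero]
      exact fun hxA => hx (hS N x hxA ((hN x).2 hD0).2)

lemma finite_norm_toPlane_le (R : ℝ) : {x : ℤ × ℤ | ‖toPlane x‖ ≤ R}.Finite := by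
  have h := tendsto_norm_toPlane.eventually_gt_atTop R
  rw [eventually_cofinite] at h
  simpa only [not_lt] using h

lemma summable_of_norm_toPlane_le {g : ℤ × ℤ → ℂ} (R : ℝ) (h : ∀ x, g x ≠ 0 → ‖toPlane x‖ ≤ R) :
    Summable g :=
  summable_of_hasFiniteSupport ((finite_norm_toPlane_le R).subset h)

lemma tsum_comp_add (g : ℤ × ℤ → ℂ) (a : ℤ × ℤ) : ∑' x, g (x + a) = ∑' x, g x :=
  (Equiv.addRight a).tsum_eq g

/-- Summation by parts in the half-plane. -/
lemma tsum_indicator_by_parts {D F Q₁ Q₂ : ℤ × ℤ → ℂ} {R : ℝ}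
    (hD : ∀ x, D x ≠ 0 → ‖toPlane x‖ ≤ R) :
    ∑' x, D x * halfPlane.indicator F x =
      ∑' x, D x * halfPlane.indicator
        (fun x => F x - (Q₁ (x + e₁) - Q₁ x) - (Q₂ (x + e₂) - Q₂ x)) x +
      ∑' x, (D (x - e₁) - D x) * halfPlane.indicator Q₁ x +
      ∑' x, (D (x - e₂) - D x) * halfPlane.indicator Q₂ x -
      ∑' x, D (x - e₂) * boundaryLine.indicator Q₂ x := by
  have hsh (a : ℤ × ℤ) (g : ℤ × ℤ → ℂ) : Summable fun x => D (x - a) * g x := by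
    refine summable_of_norm_toPlane_le (R + ‖toPlane a‖) fun x hx => ?_
    have h1 := hD (x - a) (left_ne_zero_of_mul hx)
    have h2 : toPlane x = toPlane (x - a) + toPlane a := by rw [← toPlane_add, sub_add_cancel]
    rw [h2]
    exact (norm_add_le _ _).trans (by linarith)
  have h0 (g : ℤ × ℤ → ℂ) : Summable fun x => D x * g x := by simpa using hsh 0 g
  have hI (a : ℤ × ℤ) (Q : ℤ × ℤ → ℂ) : ∑' x, D x * halfPlane.indicator (fun x => Q (x + a)) x =
      ∑' x, D (x - a) * {x | 0 ≤ (x - a).2}.indicator Q x := by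
    rw [← tsum_comp_add (fun x => D (x - a) * {x : ℤ × ℤ | 0 ≤ (x - a).2}.indicator Q x) a]
    refine tsum_congr fun x => ?_
    rw [add_sub_cancel_right]
    congr 1
    by_cases h : 0 ≤ x.2 <;> simp [Set.indicator, halfPlane, h]
  have k1 : ∑' x, (D (x - e₁) - D x) * halfPlane.indicator Q₁ x =
      ∑' x, D x * halfPlane.indicator (fun x => Q₁ (x + e₁)) x -
      ∑' x, D x * halfPlane.indicator Q₁ x := by
    rw [hI, ← (hsh _ _).tsum_sub (h0 _)]
    refine tsum_congr fun x => ?_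
    have : {x : ℤ × ℤ | 0 ≤ (x - e₁).2} = halfPlane := by ext x; simp [halfPlane, e₁]
    rw [this]
    ring
  -- The shift by `e₂` maps the half-plane to the interior, which produces the boundary term.
  have k2 : ∑' x, (D (x - e₂) - D x) * halfPlane.indicator Q₂ x -
      ∑' x, D (x - e₂) * boundaryLine.indicator Q₂ x =
      ∑' x, D x * halfPlane.indicator (fun x => Q₂ (x + e₂)) x -
      ∑' x, D x * halfPlane.indicator Q₂ x := by
    rw [hI, ← (hsh _ _).tsum_sub (h0 _), ← Summable.tsum_sub ?_ (hsh _ _)]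
    · refine tsum_congr fun x => ?_
      have h : {x : ℤ × ℤ | 0 ≤ (x - e₂).2}.indicator Q₂ x =
          halfPlane.indicator Q₂ x - boundaryLine.indicator Q₂ x := by
        have e : 0 ≤ x.2 - 1 ↔ 0 ≤ x.2 ∧ x.2 ≠ 0 := by omega
        simp only [Set.indicator, halfPlane, boundaryLine, Set.mem_ofPred_eq, e₂, Prod.snd_sub, e]
        by_cases h1 : x.2 = 0 <;> by_cases h2 : 0 ≤ x.2 <;> simp [h1, h2]
      rw [h]
      ring
    · refine ((hsh e₂ (halfPlane.indicator Q₂)).sub (h0 (halfPlane.indicator Q₂))).congr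
        fun x => ?_
      ring
  have k0 := (((h0 (halfPlane.indicator F)).hasSum.sub
    ((h0 (halfPlane.indicator fun x => Q₁ (x + e₁))).hasSum.sub
      (h0 (halfPlane.indicator Q₁)).hasSum)).sub
    ((h0 (halfPlane.indicator fun x => Q₂ (x + e₂))).hasSum.sub
      (h0 (halfPlane.indicator Q₂)).hasSum)).tsum_eq
  have k3 := Eq.trans (a := ∑' x, D x * halfPlane.indicator
      (fun x => F x - (Q₁ (x + e₁) - Q₁ x) - (Q₂ (x + e₂) - Q₂ x)) x) (tsum_congr fun x => by
    by_cases hx : x ∈ halfPlane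
    · simp only [Set.indicator_of_mem hx]
      ring
    · simp only [Set.indicator_of_notMem hx]
      ring) k0
  rw [add_sub_assoc, k1, k2, k3]
  ring

lemma mem_box {x : ℤ × ℤ} {N : ℕ} (hx : ‖toPlane x‖ ≤ 3 * N) :
    x.1 ∈ Finset.Icc (-3 * N : ℤ) (3 * N) ∧ x.2 ∈ Finset.Icc (-3 * N : ℤ) (3 * N) := by
  have h1 : |(x.1 : ℝ)| ≤ 3 * N := (Complex.abs_re_le_norm (toPlane x)).trans hx
  have h2 : |(x.2 : ℝ)| ≤ 3 * N := (Complex.abs_im_le_norm (toPlane x)).trans hx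
  have h3 : |x.1| ≤ 3 * (N : ℤ) := by exact_mod_cast h1
  have h4 : |x.2| ≤ 3 * (N : ℤ) := by exact_mod_cast h2
  rw [abs_le] at h3 h4
  rw [Finset.mem_Icc, Finset.mem_Icc]
  omega

lemma card_box {N : ℕ} (hN : 1 ≤ N) : ((Finset.Icc (-3 * N : ℤ) (3 * N)).card : ℝ) ≤ 7 * N := by
  have h : (Finset.Icc (-3 * N : ℤ) (3 * N)).card ≤ 7 * N := by
    rw [Int.card_Icc]
    omega
  exact_mod_cast h

/-- Through large half-circles, a function that is a discrete divergence up to `O(|x|⁻²)` has no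
flux: the differences of the cutoffs are `O(N⁻¹)` on an annulus of `O(N²)` points, and summation by
parts gains the missing factor `N⁻¹`. -/
lemma exists_cutoff_flux_tendsto_zero : ∃ χ : ℕ → ℤ × ℤ → ℂ,
    (∀ c, ∀ᶠ N : ℕ in atTop, ∀ x, (‖toPlane x‖ < (N : ℝ) / 2 → χ N (x + c) = 1) ∧
      (3 * (N : ℝ) < ‖toPlane x‖ → χ N (x + c) = 0)) ∧
    ∀ F, NullFlux halfPlaneFilter F → ∀ a b, Tendsto
      (fun N => ∑' x, (χ N (x + b) - χ N (x + a)) * halfPlane.indicator F x) atTop (𝓝 0) := by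
  obtain ⟨χ, L, hL, h1, h2, h3⟩ := exists_lattice_cutoff
  refine ⟨χ, h1, fun F hF a b => ?_⟩
  obtain ⟨Q₁, Q₂, hQ₁, hQ₂, hR⟩ := hF
  set D : ℕ → ℤ × ℤ → ℂ := fun N x => χ N (x + b) - χ N (x + a) with hDdef
  -- away from the annulus the cutoffs are locally constant
  have hsupp (c d : ℤ × ℤ) : ∀ᶠ N : ℕ in atTop, ∀ x, χ N (x + c) - χ N (x + d) ≠ 0 →
      (N : ℝ) / 2 ≤ ‖toPlane x‖ ∧ ‖toPlane x‖ ≤ 3 * N := by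
    filter_upwards [h1 c, h1 d] with N hc hd x hx
    refine ⟨?_, ?_⟩ <;> by_contra! h
    · exact hx (by rw [(hc x).1 h, (hd x).1 h, sub_self])
    · exact hx (by rw [(hc x).2 h, (hd x).2 h, sub_self])
  have hD1 (z : ℤ × ℤ) : ∀ᶠ N : ℕ in atTop, ∀ x,
      ‖D N (x - z)‖ ≤ L * ‖toPlane (b - a)‖ / (N : ℝ) ^ 1 ∧
      (D N (x - z) ≠ 0 → (N : ℝ) / 2 ≤ ‖toPlane x‖ ∧ ‖toPlane x‖ ≤ 3 * N) := by
    filter_upwards [hsupp (b - z) (a - z), eventually_ge_atTop 1] with N hs hN x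
    refine ⟨?_, fun h => hs x ?_⟩
    · have := h2 N hN (x - z + a) (b - a)
      rwa [add_assoc, add_sub_cancel, ← pow_one (N : ℝ)] at this
    · simpa only [hDdef, ← add_sub_assoc, sub_add_eq_add_sub] using h
  have hD2 (z : ℤ × ℤ) : ∀ᶠ N : ℕ in atTop, ∀ x,
      ‖D N (x - z) - D N x‖ ≤ L * ‖toPlane (b - a)‖ * ‖toPlane (-z)‖ / (N : ℝ) ^ 2 ∧
      (D N (x - z) - D N x ≠ 0 → (N : ℝ) / 2 ≤ ‖toPlane x‖ ∧ ‖toPlane x‖ ≤ 3 * N) := by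
    filter_upwards [hD1 z, hD1 0, eventually_ge_atTop 1] with N hs hs0 hN x
    refine ⟨?_, fun h => ?_⟩
    · have := h3 N hN (x + a) (b - a) (-z)
      have e1 : x + a + (b - a) + -z = x - z + b := by abel
      have e2 : x + a + -z = x - z + a := by abel
      have e3 : x + a + (b - a) = x + b := by abel
      rwa [e1, e2, e3] at this
    · by_cases h0 : D N x = 0
      · exact (hs x).2 (by simpa [h0] using h)
      · exact (by simpa using (hs0 x).2 : D N x ≠ 0 → _) h0
  have hbox (N : ℕ) : ∀ x ∈ halfPlane, ‖toPlane x‖ ≤ 3 * N →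
      x ∈ Finset.Icc (-3 * N : ℤ) (3 * N) ×ˢ Finset.Icc (-3 * N : ℤ) (3 * N) :=
    fun x _ hx => Finset.mem_product.mpr (mem_box hx)
  have hboxcard (N : ℕ) (hN : 1 ≤ N) : ((Finset.Icc (-3 * N : ℤ) (3 * N) ×ˢ
      Finset.Icc (-3 * N : ℤ) (3 * N)).card : ℝ) ≤ 49 * (N : ℝ) ^ 2 := by
    rw [Finset.card_product, Nat.cast_mul]
    have := mul_le_mul (card_box hN) (card_box hN) (Nat.cast_nonneg _) (by positivity)
    linarith
  have hrow (N : ℕ) : ∀ x ∈ boundaryLine, ‖toPlane x‖ ≤ 3 * N →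
      x ∈ Finset.Icc (-3 * N : ℤ) (3 * N) ×ˢ {(0 : ℤ)} :=
    fun x hx hxN => Finset.mem_product.mpr ⟨(mem_box hxN).1, Finset.mem_singleton.mpr hx⟩
  have hrowcard (N : ℕ) (hN : 1 ≤ N) :
      ((Finset.Icc (-3 * N : ℤ) (3 * N) ×ˢ {(0 : ℤ)}).card : ℝ) ≤ 7 * (N : ℝ) ^ 1 := by
    rw [Finset.card_product, Finset.card_singleton, mul_one, pow_one]
    exact card_box hN
  have hD0 := hD1 0
  simp only [sub_zero] at hD0
  -- The four sums of the summation by parts: the remainder, the two components of the field, and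
  -- the boundary.
  have t0 := tendsto_tsum_annulus subset_rfl (d := 2) (t := 1) (s := 2) (by norm_num)
    (by exact_mod_cast hR) hbox hboxcard hD0
  have t1 := tendsto_tsum_annulus subset_rfl (d := 2) (t := 2) (s := 1) (by norm_num)
    (by exact_mod_cast hQ₁) hbox hboxcard (hD2 e₁)
  have t2 := tendsto_tsum_annulus subset_rfl (d := 2) (t := 2) (s := 1) (by norm_num)
    (by exact_mod_cast hQ₂) hbox hboxcard (hD2 e₂)
  have t3 := tendsto_tsum_annulus boundaryLine_subset_halfPlane (d := 1) (t := 1) (s := 1)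
    (by norm_num) (by exact_mod_cast hQ₂) hrow hrowcard (hD1 e₂)
  have t := ((t0.add t1).add t2).sub t3
  rw [add_zero, add_zero, sub_zero] at t
  refine t.congr' ?_
  filter_upwards [hD0] with N hN
  exact (tsum_indicator_by_parts fun x hx => ((hN x).2 hx).2).symm

/-! ### Green's identity and uniqueness -/

lemma tsum_flux_eq {χ w v : ℤ × ℤ → ℂ} {R : ℝ} (hχ : ∀ x, χ x ≠ 0 → ‖toPlane x‖ ≤ R) (a b : ℤ × ℤ) :
    ∑' x, (χ (x + a) - χ (x + b)) * (w (x + a) * v (x + b) - w (x + b) * v (x + a)) =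
      ∑' x, χ x * (w x * (v (x + (b - a)) + v (x - (b - a))) -
        v x * (w (x + (b - a)) + w (x - (b - a)))) := by
  have hsum (g : ℤ × ℤ → ℂ) : Summable fun x => χ x * g x :=
    summable_of_norm_toPlane_le R fun x hx => hχ x (left_ne_zero_of_mul hx)
  have hshift (c : ℤ × ℤ) (g : ℤ × ℤ → ℂ) :
      HasSum (fun x => χ (x + c) * g x) (∑' x, χ x * g (x - c)) := by
    have h := (Equiv.addRight c).hasSum_iff.mpr (hsum fun x => g (x - c)).hasSum
    convert h using 2 with x
    simp
  have h := ((hshift a fun x => w (x + a) * v (x + b) - w (x + b) * v (x + a)).sub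
    (hshift b fun x => w (x + a) * v (x + b) - w (x + b) * v (x + a))).tsum_eq
  simp only [← sub_mul] at h
  rw [h, ← (hsum _).tsum_sub (hsum _)]
  refine tsum_congr fun x => ?_
  have e1 : x - a + b = x + (b - a) := by abel
  have e2 : x - b + a = x - (b - a) := by abel
  rw [sub_add_cancel, sub_add_cancel, e1, e2]
  ring

/-- Green's identity with a cutoff, for functions that vanish outside of the open half-plane; the
three terms belong to the three directions of bonds. -/
lemma green_identity {k : ℝ} {χ w v : ℤ × ℤ → ℂ} {R : ℝ} (hχ : ∀ x, χ x ≠ 0 → ‖toPlane x‖ ≤ R)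
    (y : ℤ × ℤ) (hw : ∀ x : ℤ × ℤ, 0 < x.2 → discreteLaplacian w x + (k : ℂ) ^ 2 * w x = 0)
    (hw0 : ∀ x : ℤ × ℤ, x.2 ≤ 0 → w x = 0) (hv : ∀ x : ℤ × ℤ, 0 < x.2 →
      discreteLaplacian v x + (k : ℂ) ^ 2 * v x = if x = y then 1 else 0)
    (hv0 : ∀ x : ℤ × ℤ, x.2 ≤ 0 → v x = 0) :
    χ y * w y =
      ∑' x, (χ (x + 0) - χ (x + e₁)) * (w (x + 0) * v (x + e₁) - w (x + e₁) * v (x + 0)) +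
      ∑' x, (χ (x + 0) - χ (x + e₂)) * (w (x + 0) * v (x + e₂) - w (x + e₂) * v (x + 0)) +
      ∑' x, (χ (x + e₁) - χ (x + e₂)) * (w (x + e₁) * v (x + e₂) - w (x + e₂) * v (x + e₁)) := by
  have hsum (g : ℤ × ℤ → ℂ) : Summable fun x => χ x * g x :=
    summable_of_norm_toPlane_le R fun x hx => hχ x (left_ne_zero_of_mul hx)
  rw [tsum_flux_eq hχ, tsum_flux_eq hχ, tsum_flux_eq hχ, ← (hsum _).tsum_add (hsum _),
    ← ((hsum _).add (hsum _)).tsum_add (hsum _), ← tsum_ite_eq y fun x => χ x * w x]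
  refine tsum_congr fun x => ?_
  rcases le_or_gt x.2 0 with hx | hx
  · rw [hw0 x hx, hv0 x hx]
    simp
  · have h1 := hw x hx
    have h2 := hv x hx
    rw [discreteLaplacian] at h1 h2
    have e1 : x + (e₂ - e₁) = x - e₁ + e₂ := by abel
    have e2 : x - (e₂ - e₁) = x + e₁ - e₂ := by abel
    rw [sub_zero, sub_zero, e1, e2]
    split_ifs with h
    · rw [if_pos h] at h2
      linear_combination χ x * v x * h1 - χ x * w x * h2
    · rw [if_neg h] at h2
      linear_combination χ x * v x * h1 - χ x * w x * h2

/-- The difference of two outgoing functions that solves the homogeneous problem vanishes, provided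
that there is an outgoing Dirichlet Green's function `v` with pole at `y`. -/
lemma eq_zero_of_outgoing {k : ℝ} (hK : Admissible ((8 - k ^ 2) / 4)) {u u' v : ℤ × ℤ → ℂ}
    (hu : Outgoing ((8 - k ^ 2) / 4) halfPlaneFilter u)
    (hu' : Outgoing ((8 - k ^ 2) / 4) halfPlaneFilter u')
    (hv : Outgoing ((8 - k ^ 2) / 4) halfPlaneFilter v) (y : ℤ × ℤ)
    (hw : ∀ x : ℤ × ℤ, 0 < x.2 → discreteLaplacian (u - u') x + (k : ℂ) ^ 2 * (u - u') x = 0)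
    (hw0 : ∀ x : ℤ × ℤ, x.2 ≤ 0 → (u - u') x = 0) (hv' : ∀ x : ℤ × ℤ, 0 < x.2 →
      discreteLaplacian v x + (k : ℂ) ^ 2 * v x = if x = y then 1 else 0)
    (hv0 : ∀ x : ℤ × ℤ, x.2 ≤ 0 → v x = 0) : (u - u') y = 0 := by
  obtain ⟨χ, hχ, hflux⟩ := exists_cutoff_flux_tendsto_zero
  set w := u - u' with hwdef
  have hT (a b : ℤ × ℤ) (ha : a = 0 ∨ a = e₁ ∨ a = e₂) (hb : b = 0 ∨ b = e₁ ∨ b = e₂) :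
      Tendsto (fun N => ∑' x, (χ N (x + a) - χ N (x + b)) *
        (w (x + a) * v (x + b) - w (x + b) * v (x + a))) atTop (𝓝 0) := by
    have hnull (a b : ℤ × ℤ) (ha : a = 0 ∨ a = e₁ ∨ a = e₂) (hb : b = 0 ∨ b = e₁ ∨ b = e₂) :
        NullFlux halfPlaneFilter fun x => w (x + a) * v (x + b) := by
      have := (hu.nullFlux_mul hK halfPlaneFilter_le tendsto_shift_halfPlaneFilter hv ha hb).add
        (hu'.nullFlux_mul hK halfPlaneFilter_le tendsto_shift_halfPlaneFilter hv ha hb).neg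
      convert this using 2 with x
      rw [hwdef, Pi.sub_apply]
      ring
    refine (hflux _ ((hnull a b ha hb).add (hnull b a hb ha).neg) b a).congr fun N => ?_
    refine tsum_congr fun x => ?_
    by_cases hx : x ∈ halfPlane
    · rw [Set.indicator_of_mem hx]
      ring
    · -- Below the half-plane both shifted points are in the region where `w` vanishes.
      have hle (c : ℤ × ℤ) (hc : c = 0 ∨ c = e₁ ∨ c = e₂) : w (x + c) = 0 := by
        have hx' : x.2 < 0 := not_le.mp hx
        have : c.2 ≤ 1 := by rcases hc with rfl | rfl | rfl <;> simp [e₁, e₂]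
        exact hw0 _ (by rw [Prod.snd_add]; omega)
      rw [Set.indicator_of_notMem hx, hle a ha, hle b hb]
      ring
  have h1 := ((hT 0 e₁ (.inl rfl) (.inr (.inl rfl))).add
    (hT 0 e₂ (.inl rfl) (.inr (.inr rfl)))).add (hT e₁ e₂ (.inr (.inl rfl)) (.inr (.inr rfl)))
  rw [add_zero, add_zero] at h1
  refine tendsto_nhds_unique (Tendsto.congr' ?_ (tendsto_const_nhds (x := w y))) h1
  filter_upwards [hχ 0, tendsto_natCast_atTop_atTop.eventually_gt_atTop (2 * ‖toPlane y‖)]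
    with N hN hNy
  simp only [add_zero] at hN
  have h2 := green_identity (k := k) (χ := χ N) (R := 3 * N)
    (fun x hx => not_lt.mp fun h => hx ((hN x).2 h)) y hw hw0 hv' hv0
  rwa [(hN y).1 (by linarith), one_mul] at h2

/-! ### The radiation condition on the half-plane -/

lemma map_val_cofinite : map ((↑) : halfPlane → ℤ × ℤ) cofinite = halfPlaneFilter := by
  rw [← Subtype.val_injective.comap_cofinite_eq, map_comap, Subtype.range_coe]
  rfl

lemma extendZero_coe (u : halfPlane → ℂ) (x : halfPlane) : extendZero u x = u x := by
  rw [extendZero, dif_pos x.2]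

lemma extendZero_of_notMem (u : halfPlane → ℂ) {x : ℤ × ℤ} (hx : x ∉ halfPlane) :
    extendZero u x = 0 := by
  rw [extendZero, dif_neg hx]

lemma extendZero_add (u v : halfPlane → ℂ) : extendZero (u + v) = extendZero u + extendZero v := by
  funext x
  by_cases hx : x ∈ halfPlane <;> simp [extendZero, hx]

lemma radiatesAlong_iff (Ξ : ℝ → ℝ × ℝ) (u : halfPlane → ℂ) : RadiatesAlong Ξ u ↔
    Radiates halfPlaneFilter (fun x => Ξ (toPlane x).arg) (extendZero u) := by
  rw [RadiatesAlong, Radiates, ← map_val_cofinite, isBigO_map, isBigO_map, isBigO_map]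
  simp only [Function.comp_def, extendZero_coe, char_e₁, char_e₂]
  rfl

lemma isFarFamily_of_arg {k σ : ℝ} {Ξ : ℝ → ℝ × ℝ} (h : ∀ α ∈ Set.Icc 0 π,
    IsFarFieldPoint k α (Ξ α) ∧ ((8 - k ^ 2) / 4 < 0 → 0 < σ * orientation (Ξ α))) :
    IsFarFamily ((8 - k ^ 2) / 4) halfPlaneFilter σ fun x => Ξ (toPlane x).arg := by
  filter_upwards [halfPlaneFilter_le (eventually_cofinite_ne 0),
    (inf_le_right : halfPlaneFilter ≤ 𝓟 halfPlane) (mem_principal_self _)] with x h0 hx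
  have hα : (toPlane x).arg ∈ Set.Icc 0 π := by
    refine ⟨Complex.arg_nonneg_iff.mpr ?_, Complex.arg_le_pi _⟩
    have : (0 : ℤ) ≤ x.2 := hx
    simpa [toPlane] using this
  obtain ⟨h1, h2⟩ := h _ hα
  exact ⟨farField_of_arg h0 (isFarFieldPoint_iff.mp h1).2.2, h2⟩

lemma IsFarFieldPoint.orientation_iff {k α : ℝ} {ξ : ℝ × ℝ} (hneg : (8 - k ^ 2) / 4 < 0)
    (h : IsFarFieldPoint k α ξ) :
    (0 < orientation ξ ↔ ξ.2 < ξ.1) ∧ (orientation ξ < 0 ↔ ξ.1 < ξ.2) := by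
  obtain ⟨h1, h2, h3⟩ := isFarFieldPoint_iff.mp h
  exact orientation_pos_iff hneg h1 h2 h3.1

lemma Radiates.zero (l : Filter (ℤ × ℤ)) (ξ : ℤ × ℤ → ℝ × ℝ) : Radiates l ξ 0 := by
  refine ⟨isBigO_zero _ _, ?_, ?_⟩ <;>
  · simp only [Pi.zero_apply, mul_zero, sub_zero]
    exact isBigO_zero _ _

lemma SatisfiesRadiation.outgoing {k : ℝ} (hK : Admissible ((8 - k ^ 2) / 4)) {u : halfPlane → ℂ}
    (hu : SatisfiesRadiation k u) :
    Outgoing ((8 - k ^ 2) / 4) halfPlaneFilter (extendZero u) := by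
  rcases lt_or_gt_of_ne hK.ne with hneg | hpos
  · obtain ⟨Ξ, Η, hΞ, hΗ, u₁, u₂, rfl, h1, h2⟩ := hu.2 (by linarith)
    refine ⟨_, _, _, _, isFarFamily_of_arg fun α hα => ⟨(hΞ α hα).1, fun _ => ?_⟩,
      isFarFamily_of_arg fun α hα => ⟨(hΗ α hα).1, fun _ => ?_⟩, extendZero_add u₁ u₂,
      (radiatesAlong_iff Ξ u₁).mp h1, (radiatesAlong_iff Η u₂).mp h2⟩
    · rw [one_mul]
      exact ((hΞ α hα).1.orientation_iff hneg).1.mpr (hΞ α hα).2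
    · rw [neg_one_mul, neg_pos]
      exact ((hΗ α hα).1.orientation_iff hneg).2.mpr (hΗ α hα).2
  · obtain ⟨Ξ, hΞ, h1⟩ := hu.1 (by linarith)
    exact ⟨_, _, _, 0, isFarFamily_of_arg fun α hα => ⟨hΞ α hα, fun h => absurd h hpos.not_gt⟩,
      isFarFamily_of_arg fun α hα => ⟨hΞ α hα, fun h => absurd h hpos.not_gt⟩, (add_zero _).symm,
      (radiatesAlong_iff Ξ u).mp h1, Radiates.zero _ _⟩

lemma cos_sin_ne_zero (α : ℝ) : ((Real.cos α, Real.sin α) : ℝ × ℝ) ≠ 0 := by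
  intro h
  rw [Prod.ext_iff] at h
  have h1 : Real.cos α = 0 := h.1
  have h2 : Real.sin α = 0 := h.2
  have := Real.sin_sq_add_cos_sq α
  rw [h1, h2] at this
  norm_num at this

lemma exists_farFieldPoints {k : ℝ} (hK : Admissible ((8 - k ^ 2) / 4))
    (hpos : 0 < (8 - k ^ 2) / 4) : ∃ Ξ : ℝ → ℝ × ℝ, ∀ α, IsFarFieldPoint k α (Ξ α) := by
  have h (α : ℝ) : ∃ ξ, IsFarFieldPoint k α ξ := by
    obtain ⟨ξ, hξ⟩ := exists_farField hK hpos _ (cos_sin_ne_zero α)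
    obtain ⟨η, h1, h2, h3, -⟩ := hξ.exists_normalized
    exact ⟨η, isFarFieldPoint_iff.mpr ⟨h1, h2, h3⟩⟩
  choose Ξ hΞ using h
  exact ⟨Ξ, hΞ⟩

lemma exists_farFieldPoints_pair {k : ℝ} (hK : Admissible ((8 - k ^ 2) / 4))
    (hneg : (8 - k ^ 2) / 4 < 0) : ∃ Ξ Η : ℝ → ℝ × ℝ,
      (∀ α, IsFarFieldPoint k α (Ξ α) ∧ (Ξ α).2 < (Ξ α).1) ∧
      ∀ α, IsFarFieldPoint k α (Η α) ∧ (Η α).1 < (Η α).2 := by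
  have h (α : ℝ) : ∃ ξ η, (IsFarFieldPoint k α ξ ∧ ξ.2 < ξ.1) ∧
      IsFarFieldPoint k α η ∧ η.1 < η.2 := by
    obtain ⟨ξ, η, hξ, hη, o1, o2⟩ := exists_farField_pair hK hneg _ (cos_sin_ne_zero α)
    obtain ⟨ξ', h1, h2, h3, h4, -⟩ := hξ.exists_normalized
    obtain ⟨η', h1', h2', h3', h4', -⟩ := hη.exists_normalized
    rw [← h4] at o1
    rw [← h4'] at o2
    exact ⟨ξ', η', ⟨isFarFieldPoint_iff.mpr ⟨h1, h2, h3⟩,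
      (orientation_pos_iff hneg h1 h2 h3.1).1.mp o1⟩, isFarFieldPoint_iff.mpr ⟨h1', h2', h3'⟩,
      (orientation_pos_iff hneg h1' h2' h3'.1).2.mp o2⟩
  choose Ξ Η hΞ hΗ using h
  exact ⟨Ξ, Η, hΞ, hΗ⟩

lemma extendZero_eventuallyEq (v : ℤ × ℤ → ℂ) :
    v =ᶠ[halfPlaneFilter] extendZero fun x : halfPlane => v x := by
  filter_upwards [(inf_le_right : halfPlaneFilter ≤ 𝓟 halfPlane) (mem_principal_self _)] with x hx
  rw [extendZero, dif_pos hx]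

lemma Scattered.satisfiesRadiation {k : ℝ} (hK : Admissible ((8 - k ^ 2) / 4)) {v : ℤ × ℤ → ℂ}
    (hv : Scattered ((8 - k ^ 2) / 4) halfPlaneFilter v) :
    SatisfiesRadiation k fun x : halfPlane => v x := by
  have hs := tendsto_shift_halfPlaneFilter
  refine ⟨fun h => ?_, fun h => ?_⟩
  · have hpos : 0 < (8 - k ^ 2) / 4 := by linarith
    obtain ⟨Ξ, hΞ⟩ := exists_farFieldPoints hK hpos
    have hfam := isFarFamily_of_arg (σ := 1) fun α _ => ⟨hΞ α, fun h => absurd h hpos.not_gt⟩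
    refine ⟨Ξ, fun α _ => hΞ α, (radiatesAlong_iff _ _).mpr (Radiates.congr hs
      ⟨hv.isBigO, hv.single hpos 1 _ hfam e₁, hv.single hpos 1 _ hfam e₂⟩
      (extendZero_eventuallyEq v))⟩
  · have hneg : (8 - k ^ 2) / 4 < 0 := by linarith
    obtain ⟨Ξ, Η, hΞ, hΗ⟩ := exists_farFieldPoints_pair hK hneg
    obtain ⟨v₁, v₂, rfl, h1, h2⟩ := hv.exists_splitting halfPlaneFilter_le hs hK hneg
      (isFarFamily_of_arg fun α _ => ⟨(hΞ α).1, fun _ => by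
        rw [one_mul]
        exact ((hΞ α).1.orientation_iff hneg).1.mpr (hΞ α).2⟩)
      (isFarFamily_of_arg fun α _ => ⟨(hΗ α).1, fun _ => by
        rw [neg_one_mul, neg_pos]
        exact ((hΗ α).1.orientation_iff hneg).2.mpr (hΗ α).2⟩)
    exact ⟨Ξ, Η, fun α _ => hΞ α, fun α _ => hΗ α, fun x => v₁ x, fun x => v₂ x, rfl,
      (radiatesAlong_iff _ _).mpr (h1.congr hs (extendZero_eventuallyEq v₁)),
      (radiatesAlong_iff _ _).mpr (h2.congr hs (extendZero_eventuallyEq v₂))⟩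

/-! ### The Dirichlet problem -/

section Dirichlet

variable {k : ℝ}

lemma halfPlaneGreen_eq (hK : Admissible ((8 - k ^ 2) / 4)) (x y : ℤ × ℤ) :
    halfPlaneGreen k x y = latticeGreen k (x - y) - latticeGreen k (x - reflect y) := by
  have e : reflect x - y = reflect (x - reflect y) := by
    ext
    · simp only [reflect, Prod.fst_sub, Prod.snd_sub]
      ring
    · simp only [reflect, Prod.snd_sub]
      ring
  rw [halfPlaneGreen, e, latticeGreen_reflect hK]

lemma halfPlaneGreen_of_boundary {x : ℤ × ℤ} (hx : x.2 = 0) (y : ℤ × ℤ) :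
    halfPlaneGreen k x y = 0 := by
  have e : reflect x = x := by ext <;> simp [reflect, hx]
  rw [halfPlaneGreen, e, sub_self]

lemma scattered_halfPlaneGreen (hK : Admissible ((8 - k ^ 2) / 4)) {l : Filter (ℤ × ℤ)}
    (hl : l ≤ cofinite) (y : ℤ × ℤ) :
    Scattered ((8 - k ^ 2) / 4) l fun x => halfPlaneGreen k x y := by
  have := (scattered_latticeGreen hK hl (-y)).add
    ((scattered_latticeGreen hK hl (-reflect y)).const_mul (-1))
  convert this using 2 with x
  rw [halfPlaneGreen_eq hK, sub_eq_add_neg, sub_eq_add_neg, sub_eq_add_neg, neg_one_mul]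

/-- Only the pole `y` lies in the open half-plane; the other one is its mirror image. -/
lemma halfPlaneGreen_helmholtz (hK : Admissible ((8 - k ^ 2) / 4)) {x y : ℤ × ℤ} (hx : 0 < x.2)
    (hy : 0 < y.2) : discreteLaplacian (fun x => halfPlaneGreen k x y) x +
      (k : ℂ) ^ 2 * halfPlaneGreen k x y = if x = y then 1 else 0 := by
  have h1 := latticeGreen_helmholtz hK (x - y)
  have h2 := latticeGreen_helmholtz hK (x - reflect y)
  have hne : x - reflect y ≠ 0 := by
    intro h
    have := congrArg Prod.snd h
    simp only [reflect, Prod.snd_sub, Prod.snd_zero] at this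
    omega
  rw [if_neg hne] at h2
  simp only [sub_eq_zero] at h1
  rw [← h1, discreteLaplacian]
  rw [discreteLaplacian] at h2 ⊢
  simp only [halfPlaneGreen_eq hK]
  have e (a b : ℤ × ℤ) : x + a - b = x - b + a := by abel
  have e' (a b : ℤ × ℤ) : x - a - b = x - b - a := by abel
  simp only [sub_eq_add_neg, add_right_comm _ _ (-y), add_right_comm _ _ (-reflect y)] at h2 ⊢
  linear_combination -h2

/-- The kernel of the solution operator of the Dirichlet problem. -/
def dirichletKernel (k : ℝ) (y x : ℤ × ℤ) : ℂ :=
  (if x = y then 1 else 0) - halfPlaneGreen k x (y + e₂) - halfPlaneGreen k x (y + e₂ - e₁)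

lemma scattered_dirichletKernel (hK : Admissible ((8 - k ^ 2) / 4)) {l : Filter (ℤ × ℤ)}
    (hl : l ≤ cofinite) (y : ℤ × ℤ) : Scattered ((8 - k ^ 2) / 4) l (dirichletKernel k y) := by
  have hfin : (fun x : ℤ × ℤ => if x = y then (1 : ℂ) else 0).support.Finite := by
    refine (Set.finite_singleton y).subset fun x hx => ?_
    by_contra h
    exact hx (if_neg h)
  have := ((Scattered.of_finite_support hl hfin).add
    ((scattered_halfPlaneGreen hK hl (y + e₂)).const_mul (-1))).add
    ((scattered_halfPlaneGreen hK hl (y + e₂ - e₁)).const_mul (-1))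
  convert this using 2 with x
  rw [dirichletKernel]
  ring

lemma dirichletKernel_of_boundary {x : ℤ × ℤ} (hx : x.2 = 0) (y : ℤ × ℤ) :
    dirichletKernel k y x = if x = y then 1 else 0 := by
  rw [dirichletKernel, halfPlaneGreen_of_boundary hx, halfPlaneGreen_of_boundary hx, sub_zero,
    sub_zero]

/-- The two interior neighbours of a boundary point `y` are `y + e₂` and `y + e₂ - e₁`: there the
Laplacian of the indicator function of `y` is cancelled by the poles of the Green's functions. -/
lemma dirichletKernel_helmholtz (hK : Admissible ((8 - k ^ 2) / 4)) {x y : ℤ × ℤ} (hx : 0 < x.2)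
    (hy : y.2 = 0) : discreteLaplacian (dirichletKernel k y) x +
      (k : ℂ) ^ 2 * dirichletKernel k y x = 0 := by
  have h1 := halfPlaneGreen_helmholtz hK (y := y + e₂) hx (by simp [e₂, hy])
  have h2 := halfPlaneGreen_helmholtz hK (y := y + e₂ - e₁) hx (by simp [e₁, e₂, hy])
  have h3 : discreteLaplacian (fun x => if x = y then 1 else 0) x =
      (if x = y + e₂ then 1 else 0) + if x = y + e₂ - e₁ then 1 else 0 := by
    have n1 : x + e₁ ≠ y := fun h => by
      have := congrArg Prod.snd h; simp only [e₁, Prod.snd_add] at this; omega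
    have n2 : x - e₁ ≠ y := fun h => by
      have := congrArg Prod.snd h; simp only [e₁, Prod.snd_sub] at this; omega
    have n3 : x + e₂ ≠ y := fun h => by
      have := congrArg Prod.snd h; simp only [e₂, Prod.snd_add] at this; omega
    have n4 : x - e₁ + e₂ ≠ y := fun h => by
      have := congrArg Prod.snd h; simp only [e₁, e₂, Prod.snd_add, Prod.snd_sub] at this; omega
    have n5 : x ≠ y := fun h => by
      have := congrArg Prod.snd h; omega
    have i1 : x - e₂ = y ↔ x = y + e₂ := sub_eq_iff_eq_add
    have i2 : x + e₁ - e₂ = y ↔ x = y + e₂ - e₁ := by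
      rw [sub_eq_iff_eq_add, eq_sub_iff_add_eq]
    simp only [discreteLaplacian, if_neg n1, if_neg n2, if_neg n3, if_neg n4, if_neg n5, i1, i2]
    ring
  have h4 : (if x = y then (1 : ℂ) else 0) = 0 := if_neg fun h => by
    have := congrArg Prod.snd h; omega
  rw [discreteLaplacian] at h1 h2 h3 ⊢
  simp only [dirichletKernel]
  linear_combination h3 - h1 - h2 + (k : ℂ) ^ 2 * h4

lemma discreteLaplacian_sum {ι : Type*} (s : Finset ι) (g : ι → ℤ × ℤ → ℂ) (x : ℤ × ℤ) :
    discreteLaplacian (fun x => ∑ i ∈ s, g i x) x = ∑ i ∈ s, discreteLaplacian (g i) x := by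
  simp only [discreteLaplacian, Finset.sum_add_distrib, Finset.sum_sub_distrib, Finset.mul_sum]

lemma discreteLaplacian_congr {u v : ℤ × ℤ → ℂ} {x : ℤ × ℤ} (hx : 0 < x.2)
    (h : ∀ z : ℤ × ℤ, 0 ≤ z.2 → u z = v z) : discreteLaplacian u x = discreteLaplacian v x := by
  rw [discreteLaplacian, discreteLaplacian, h, h, h, h, h, h, h]
  all_goals
    first
      | omega
      | simp only [e₁, e₂, Prod.snd_add, Prod.snd_sub]
        omega

/-- The function given by the representation formula, on all of `ℤ²`. -/
def dirichletSolution (k : ℝ) (f : boundaryLine → ℂ) (x : ℤ × ℤ) : ℂ :=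
  ∑ᶠ y : boundaryLine, dirichletKernel k y x * f y

lemma dirichletSolution_eq_sum {f : boundaryLine → ℂ} (hf : f.support.Finite) (x : ℤ × ℤ) :
    dirichletSolution k f x = ∑ y ∈ hf.toFinset, f y * dirichletKernel k y x := by
  rw [dirichletSolution, finsum_eq_sum_of_support_subset (s := hf.toFinset)]
  · exact Finset.sum_congr rfl fun y _ => mul_comm _ _
  · intro y hy
    rw [Set.Finite.coe_toFinset]
    exact right_ne_zero_of_mul hy

lemma isRadiatingSolution_dirichletSolution (hK : Admissible ((8 - k ^ 2) / 4))
    {f : boundaryLine → ℂ} (hf : f.support.Finite) :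
    IsRadiatingSolution k f fun x => dirichletSolution k f x := by
  have heq (z : ℤ × ℤ) (hz : 0 ≤ z.2) :
      extendZero (fun x : halfPlane => dirichletSolution k f x) z =
        ∑ y ∈ hf.toFinset, f y * dirichletKernel k y z := by
    rw [← dirichletSolution_eq_sum hf]
    exact extendZero_coe _ ⟨z, hz⟩
  refine ⟨fun x hx => ?_, fun y => ?_, Scattered.satisfiesRadiation hK ?_⟩
  · rw [discreteLaplacian_congr hx heq, heq x (le_of_lt hx), discreteLaplacian_sum,
      Finset.mul_sum, ← Finset.sum_add_distrib]
    refine Finset.sum_eq_zero fun y _ => ?_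
    have h := dirichletKernel_helmholtz hK (y := y) hx y.2
    rw [discreteLaplacian] at h ⊢
    linear_combination f y * h
  · change dirichletSolution k f y = f y
    rw [dirichletSolution, finsum_eq_single _ y]
    · rw [dirichletKernel_of_boundary y.2, if_pos rfl, one_mul]
    · intro z hz
      rw [dirichletKernel_of_boundary y.2, if_neg (fun h => hz (Subtype.ext h.symm)), zero_mul]
  · have : dirichletSolution k f = fun x => ∑ y ∈ hf.toFinset, f y * dirichletKernel k y x :=
      funext fun x => dirichletSolution_eq_sum hf x
    rw [this]
    exact Scattered.sum halfPlaneFilter_le _ fun y _ =>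
      (scattered_dirichletKernel hK halfPlaneFilter_le y).const_mul (f y)

lemma IsRadiatingSolution.unique (hK : Admissible ((8 - k ^ 2) / 4)) {f : boundaryLine → ℂ}
    {u u' : halfPlane → ℂ} (hu : IsRadiatingSolution k f u) (hu' : IsRadiatingSolution k f u') :
    u = u' := by
  obtain ⟨h1, h2, h3⟩ := hu
  obtain ⟨h1', h2', h3'⟩ := hu'
  funext y
  have hzero (x : ℤ × ℤ) (hx : x.2 ≤ 0) : (extendZero u - extendZero u') x = 0 := by
    rw [Pi.sub_apply]
    rcases hx.lt_or_eq with hx | hx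
    · rw [extendZero_of_notMem u (not_le.mpr hx), extendZero_of_notMem u' (not_le.mpr hx), sub_self]
    · rw [extendZero_coe u ⟨x, hx.ge⟩, extendZero_coe u' ⟨x, hx.ge⟩, sub_eq_zero]
      exact (h2 ⟨x, hx⟩).trans (h2' ⟨x, hx⟩).symm
  suffices h : (extendZero u - extendZero u') y = 0 by
    rwa [Pi.sub_apply, extendZero_coe, extendZero_coe, sub_eq_zero] at h
  rcases le_or_gt (y : ℤ × ℤ).2 0 with hy | hy
  · exact hzero y hy
  -- At an interior point `y` the Green's function with pole `y` represents the difference.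
  set v : halfPlane → ℂ := fun x => halfPlaneGreen k x y with hv
  have hveq (z : ℤ × ℤ) (hz : 0 ≤ z.2) : extendZero v z = halfPlaneGreen k z y :=
    extendZero_coe v ⟨z, hz⟩
  refine eq_zero_of_outgoing hK (h3.outgoing hK) (h3'.outgoing hK)
    (((scattered_halfPlaneGreen hK halfPlaneFilter_le y).satisfiesRadiation hK).outgoing hK) y
    (fun x hx => ?_) hzero (fun x hx => ?_) fun x hx => ?_
  · have e := h1 x hx
    have e' := h1' x hx
    rw [discreteLaplacian] at e e' ⊢
    simp only [Pi.sub_apply]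
    linear_combination e - e'
  · rw [discreteLaplacian_congr hx hveq, hveq x hx.le]
    exact halfPlaneGreen_helmholtz hK hx hy
  · rcases hx.lt_or_eq with hx | hx
    · exact extendZero_of_notMem _ (not_le.mpr hx)
    · rw [hveq x hx.ge]
      exact halfPlaneGreen_of_boundary hx y

end Dirichlet

end

end TriangularLattice

open TriangularLattice
theorem mainTheorem2 (k : ℝ) (hk₀ : 0 < k) (hk₃ : k < 3) (hk : k ≠ 2 * Real.sqrt 2)
    (f : boundaryLine → ℂ) (hf : f.support.Finite) :
    (∀ x : ℤ × ℤ, Tendsto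
      (fun ε : ℝ => resolventKernel ((k : ℂ) ^ 2 + Complex.I * ε) x)
      (𝓝[>] 0) (𝓝 (latticeGreen k x))) ∧
    (∃! u : halfPlane → ℂ, IsRadiatingSolution k f u) ∧
    ∀ u : halfPlane → ℂ, IsRadiatingSolution k f u → ∀ x : halfPlane,
      u x = ∑ᶠ y : boundaryLine,
        ((if (x : ℤ × ℤ) = y then 1 else 0)
          - halfPlaneGreen k x (y + e₂) - halfPlaneGreen k x (y + e₂ - e₁)) * f y := by
  have hK := admissible_of_wavenumber hk₀ hk₃ hk
  have hsol := isRadiatingSolution_dirichletSolution hK hf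
  exact ⟨tendsto_resolventKernel hK, ⟨_, hsol, fun u hu => hu.unique hK hsol⟩,
    fun u hu x => congrFun (hu.unique hK hsol) x⟩
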